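/- Let $p_0,p_1\in\mathbb C^*$ with $p_0^2\ne1$, $p_1^2\ne1$. For $n\ge0$ let $H^B_n$ be the affine Hecke algebra of type $B_n$: the $\mathbb C$-algebra generated by $T_i$ ($0\le i<n$) and invertible elements $X_i$ ($1\le i\le n$), subject to the relations: the $X_i$ commute; $T_0T_1T_0T_1=T_1T_0T_1T_0$, $T_iT_{i+1}T_i=T_{i+1}T_iT_{i+1}$ ($1\le i<n-1$), $T_iT_j=T_jT_i$ ($|i-j|>1$); $(T_0-p_0)(T_0+p_0^{-1})=0$, $(T_i-p_1)(T_i+p_1^{-1})=0$ ($1\le i<n$); $T_0X_1^{-1}T_0=X_1$, $T_iX_iT_i=X_{i+1}$ ($1\le i<n$), $T_iX_j=X_jT_i$ ($j\ne i,i+1$). Let $H^A_n\subset H^B_n$ be the subalgebra generated by $T_i$ ($1\le i<n$) and $X_i^{\pm1}$ ($1\le i\le n$). For $I\subset\mathbb C^*$, a module is of type $I$ if it is finite-dimensional and all eigenvalues of all the $X_i$ lie in $I$. The group $\mathbb Z$ acts on $\mathbb C^*$ by $k\colon a\mapsto ap_1^{2k}$, and the semidirect product $\mathbb Z_2\times\mathbb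 Z=\{\pm1\}\times\mathbb Z$ acts by $(\epsilon,k)\colon a\mapsto a^{\epsilon}p_1^{2k}$. For $n,m\ge0$ put $F_r=\mathbb C[X_1^{\pm1},\dots,X_r^{\pm1}]$ and $\mathcal F=F_{n+m}[D^{-1}]$, where $$D=\prod_{1\le i\le n<j\le n+m}(X_i-p_1^2X_j)(X_i-p_1^{-2}X_j)(X_i-p_1^2X_j^{-1})(X_i-p_1^{-2}X_j^{-1})(X_i-X_j)(X_i-X_j^{-1}).$$ In $\mathrm{Frac}(F_{n+m})\otimes_{F_{n+m}}H^B_{n+m}$ let $$\tilde\varphi_i=(p_1^{-1}-p_1X_iX_{i+1}^{-1})^{-1}\bigl((1-X_iX_{i+1}^{-1})T_i-(p_1-p_1^{-1})\bigr)\qquad(1\le i<n+m).$$ Then $H^B_{n+m}\otimes_{F_{n+m}}\mathcal F$ is a right module over $(H^B_n\otimes H^B_m)\otimes_{F_{n+m}}\mathcal F$, where $H^B_n$ acts through $T_i\mapsto T_i$, $X_i\mapsto X_i$, and $H^B_m$ through $T_0\mapsto\tilde\varphi_n\cdots\tilde\varphi_1T_0\tilde\varphi_1\cdots\tilde\varphi_n$,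 $T_i\mapsto T_{i+n}$ ($1\le i<m$), $X_i\mapsto X_{i+n}$ ($1\le i\le m$). Let $I,J\subset\mathbb C^*$ be disjoint and $(\mathbb Z_2\times\mathbb Z)$-invariant. For an $H^B_n$-module $N$ of type $I$ and an $H^B_m$-module $M$ of type $J$, the action of $F_{n+m}$ on $N\otimes M$ extends to $\mathcal F$, and one sets $$N\diamond M=(H^B_{n+m}\otimes_{F_{n+m}}\mathcal F)\otimes_{(H^B_n\otimes H^B_m)\otimes_{F_{n+m}}\mathcal F}(N\otimes M).$$ Then the following hold. (i) If $N$ is an irreducible $H^B_n$-module of type $I$ and $M$ an irreducible $H^B_m$-module of type $J$, then $N\diamond M$ is an irreducible $H^B_{n+m}$-module of type $I\cup J$. (ii) If $L$ is an irreducible $H^B_n$-module of type $I\cup J$, then there are an integer $m$ with $0\le m\le n$, an irreducible $H^B_m$-module $N$ of type $I$ and an irreducible $H^B_{n-m}$-module $M$ of type $J$ such that $L\simeq N\diamond M$. (iii) Let now $I$ be a $(\mathbb Z_2\times\mathbb Z)$-orbit that decomposes as $I=I_+\sqcup I_-$ with $I_\pm$ being $\mathbb Z$-orbits and $I_-=(I_+)^{-1}$,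 and assume $\pm1,\pm p_0\notin I$. Then for any irreducible $H^B_n$-module $L$ of type $I$ there is a (finite-dimensional) irreducible $H^A_n$-module $M$ such that $L\simeq \mathrm{Ind}_{H^A_n}^{H^B_n}M=H^B_n\otimes_{H^A_n}M$. -/

import Mathlib

open scoped TensorProduct

noncomputable section

/-! ### The affine Hecke algebra of type B -/

/-- Generators of the affine Hecke algebra of type B. Indices start at zero: `T i` is the
generator `T_i` for `0 ≤ i < n`, while `X i` is the generator `X_{i+1}` and `Xinv i` its
inverse, so that `X 0, …, X (n-1)` are `X_1, …, X_n`. -/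
inductive HeckeGen (n : ℕ) : Type
  | T (i : Fin n)
  | X (i : Fin n)
  | Xinv (i : Fin n)

namespace HeckeB

/-- The free generators. -/
abbrev freeT {n : ℕ} (i : ℕ) (h : i < n) : FreeAlgebra ℂ (HeckeGen n) :=
  FreeAlgebra.ι ℂ (HeckeGen.T ⟨i, h⟩)

abbrev freeX {n : ℕ} (i : ℕ) (h : i < n) : FreeAlgebra ℂ (HeckeGen n) :=
  FreeAlgebra.ι ℂ (HeckeGen.X ⟨i, h⟩)

abbrev freeXinv {n : ℕ} (i : ℕ) (h : i < n) : FreeAlgebra ℂ (HeckeGen n) :=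
  FreeAlgebra.ι ℂ (HeckeGen.Xinv ⟨i, h⟩)

/-- The defining relations of the affine Hecke algebra of type `B_n` with parameters
`p₀`, `p₁`. -/
inductive Rel (p₀ p₁ : ℂˣ) (n : ℕ) :
    FreeAlgebra ℂ (HeckeGen n) → FreeAlgebra ℂ (HeckeGen n) → Prop
  | X_mul_Xinv (i : ℕ) (h : i < n) : Rel p₀ p₁ n (freeX i h * freeXinv i h) 1
  | Xinv_mul_X (i : ℕ) (h : i < n) : Rel p₀ p₁ n (freeXinv i h * freeX i h) 1
  | X_comm (i j : ℕ) (hi : i < n) (hj : j < n) :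
      Rel p₀ p₁ n (freeX i hi * freeX j hj) (freeX j hj * freeX i hi)
  | braid_zero (h0 : 0 < n) (h1 : 1 < n) :
      Rel p₀ p₁ n (freeT 0 h0 * freeT 1 h1 * freeT 0 h0 * freeT 1 h1)
        (freeT 1 h1 * freeT 0 h0 * freeT 1 h1 * freeT 0 h0)
  | braid (i : ℕ) (hi : 1 ≤ i) (h : i < n) (h' : i + 1 < n) :
      Rel p₀ p₁ n (freeT i h * freeT (i + 1) h' * freeT i h)
        (freeT (i + 1) h' * freeT i h * freeT (i + 1) h')
  | T_comm (i j : ℕ) (hi : i < n) (hj : j < n) (hij : i + 1 < j) :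
      Rel p₀ p₁ n (freeT i hi * freeT j hj) (freeT j hj * freeT i hi)
  | quadratic_zero (h : 0 < n) :
      Rel p₀ p₁ n
        ((freeT 0 h - algebraMap ℂ _ (p₀ : ℂ)) * (freeT 0 h + algebraMap ℂ _ (p₀ : ℂ)⁻¹)) 0
  | quadratic (i : ℕ) (hi : 1 ≤ i) (h : i < n) :
      Rel p₀ p₁ n
        ((freeT i h - algebraMap ℂ _ (p₁ : ℂ)) * (freeT i h + algebraMap ℂ _ (p₁ : ℂ)⁻¹)) 0
  | T_zero_X (h : 0 < n) :
      Rel p₀ p₁ n (freeT 0 h * freeXinv 0 h * freeT 0 h) (freeX 0 h)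
  -- The relation `T_i X_i T_i = X_{i+1}` for `1 ≤ i < n`, with `i = k + 1`.
  | T_X (k : ℕ) (h : k < n) (h' : k + 1 < n) :
      Rel p₀ p₁ n (freeT (k + 1) h' * freeX k h * freeT (k + 1) h') (freeX (k + 1) h')
  -- The relation `T_i X_j = X_j T_i` for `j ≠ i, i+1`, with `j = k + 1`.
  | T_X_comm (i k : ℕ) (hi : i < n) (hk : k < n) (h₁ : k + 1 ≠ i) (h₂ : k ≠ i) :
      Rel p₀ p₁ n (freeT i hi * freeX k hk) (freeX k hk * freeT i hi)

end HeckeB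

/-- The affine Hecke algebra of type `B_n` over `ℂ`. -/
def HeckeB (p₀ p₁ : ℂˣ) (n : ℕ) : Type := RingQuot (HeckeB.Rel p₀ p₁ n)

namespace HeckeB

variable (p₀ p₁ : ℂˣ) (n : ℕ)

instance : Ring (HeckeB p₀ p₁ n) := inferInstanceAs (Ring (RingQuot (HeckeB.Rel p₀ p₁ n)))

instance : Algebra ℂ (HeckeB p₀ p₁ n) :=
  inferInstanceAs (Algebra ℂ (RingQuot (HeckeB.Rel p₀ p₁ n)))

/-- The quotient map from the free algebra. -/
def mk : FreeAlgebra ℂ (HeckeGen n) →ₐ[ℂ] HeckeB p₀ p₁ n :=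
  RingQuot.mkAlgHom ℂ (HeckeB.Rel p₀ p₁ n)

/-- The image of a generator. -/
def gen (g : HeckeGen n) : HeckeB p₀ p₁ n := mk p₀ p₁ n (FreeAlgebra.ι ℂ g)

variable {n}

theorem X_mul_Xinv (i : Fin n) :
    gen p₀ p₁ n (.X i) * gen p₀ p₁ n (.Xinv i) = 1 := by
  have h := RingQuot.mkAlgHom_rel ℂ (Rel.X_mul_Xinv (p₀ := p₀) (p₁ := p₁) i.1 i.2)
  rw [map_mul, map_one] at h
  exact h

theorem Xinv_mul_X (i : Fin n) :
    gen p₀ p₁ n (.Xinv i) * gen p₀ p₁ n (.X i) = 1 := by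
  have h := RingQuot.mkAlgHom_rel ℂ (Rel.Xinv_mul_X (p₀ := p₀) (p₁ := p₁) i.1 i.2)
  rw [map_mul, map_one] at h
  exact h

/-- `X_{i+1}` as a unit. -/
def unitX (i : Fin n) : (HeckeB p₀ p₁ n)ˣ where
  val := gen p₀ p₁ n (.X i)
  inv := gen p₀ p₁ n (.Xinv i)
  val_inv := X_mul_Xinv p₀ p₁ i
  inv_val := Xinv_mul_X p₀ p₁ i

/-- The Laurent monomial `X_1 ^ a_1 ⋯ X_n ^ a_n`. -/
def monomial (a : Fin n → ℤ) : HeckeB p₀ p₁ n :=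
  (((List.ofFn fun i => unitX p₀ p₁ i ^ a i).prod : (HeckeB p₀ p₁ n)ˣ) : HeckeB p₀ p₁ n)

/-- The Laurent polynomial in `X_1, …, X_n` with the given coefficients, as an element of the
affine Hecke algebra. -/
def laurent (f : (Fin n → ℤ) →₀ ℂ) : HeckeB p₀ p₁ n :=
  f.sum fun a c => c • monomial p₀ p₁ a

variable (n)

/-- The affine Hecke algebra of type A: the subalgebra generated by `T_i` (`1 ≤ i < n`) and
`X_i^{±1}` (`1 ≤ i ≤ n`). -/
def typeA : Subalgebra ℂ (HeckeB p₀ p₁ n) :=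
  Algebra.adjoin ℂ
    ({x | ∃ i : Fin n, 1 ≤ (i : ℕ) ∧ x = gen p₀ p₁ n (.T i)} ∪
      {x | ∃ i : Fin n, x = gen p₀ p₁ n (.X i) ∨ x = gen p₀ p₁ n (.Xinv i)})

variable {n}

/-- A module over the affine Hecke algebra of type B is of type `I ⊆ ℂ^*` if it is
finite-dimensional and all the eigenvalues of all `X_i` belong to `I`. -/
def IsOfType (I : Set ℂˣ) (M : Type*) [AddCommGroup M] [Module ℂ M]
    [Module (HeckeB p₀ p₁ n) M] [IsScalarTower ℂ (HeckeB p₀ p₁ n) M] : Prop :=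
  FiniteDimensional ℂ M ∧
    ∀ (i : Fin n) (a : ℂ),
      Module.End.HasEigenvalue (Algebra.lsmul ℂ ℂ M (gen p₀ p₁ n (.X i))) a →
        ∃ u ∈ I, (u : ℂ) = a

/-! ### Induction from type A to type B -/

/-- The elements `b a ⊗ u - b ⊗ a u` by which one divides to pass from the tensor product over
`ℂ` to the one over the type A subalgebra. -/
def indRel (M : Type*) [AddCommGroup M] [Module ℂ M] [Module (typeA p₀ p₁ n) M] :
    Set (HeckeB p₀ p₁ n ⊗[ℂ] M) :=
  {z | ∃ (b : HeckeB p₀ p₁ n) (a : typeA p₀ p₁ n) (u : M),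
    z = (b * (a : HeckeB p₀ p₁ n)) ⊗ₜ[ℂ] u - b ⊗ₜ[ℂ] (a • u)}

/-- The induced module `H^B_n ⊗_{H^A_n} M`. -/
abbrev Ind (M : Type*) [AddCommGroup M] [Module ℂ M] [Module (typeA p₀ p₁ n) M] :=
  (HeckeB p₀ p₁ n ⊗[ℂ] M) ⧸ Submodule.span (HeckeB p₀ p₁ n) (indRel p₀ p₁ M)

end HeckeB

/-! ### Formally inverting elements of a non-commutative algebra -/

namespace UnivLoc

/-- Relations for the algebra obtained from `A` by adjoining inverses of all elements of `S`. -/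
inductive Rel {A : Type*} [Ring A] [Algebra ℂ A] (S : Set A) :
    FreeAlgebra ℂ (A ⊕ S) → FreeAlgebra ℂ (A ⊕ S) → Prop
  | add (a b : A) : Rel S (FreeAlgebra.ι ℂ (.inl (a + b)))
      (FreeAlgebra.ι ℂ (.inl a) + FreeAlgebra.ι ℂ (.inl b))
  | mul (a b : A) : Rel S (FreeAlgebra.ι ℂ (.inl (a * b)))
      (FreeAlgebra.ι ℂ (.inl a) * FreeAlgebra.ι ℂ (.inl b))
  | scalar (c : ℂ) : Rel S (FreeAlgebra.ι ℂ (.inl (algebraMap ℂ A c))) (algebraMap ℂ _ c)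
  | mul_inv (s : S) : Rel S (FreeAlgebra.ι ℂ (.inl (s : A)) * FreeAlgebra.ι ℂ (.inr s)) 1
  | inv_mul (s : S) : Rel S (FreeAlgebra.ι ℂ (.inr s) * FreeAlgebra.ι ℂ (.inl (s : A))) 1

end UnivLoc

/-- The universal `ℂ`-algebra under `A` in which all elements of `S` become invertible. -/
def UnivLoc {A : Type*} [Ring A] [Algebra ℂ A] (S : Set A) : Type _ :=
  RingQuot (UnivLoc.Rel S)

namespace UnivLoc

variable {A : Type*} [Ring A] [Algebra ℂ A] (S : Set A)

instance : Ring (UnivLoc S) := inferInstanceAs (Ring (RingQuot (UnivLoc.Rel S)))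

instance : Algebra ℂ (UnivLoc S) := inferInstanceAs (Algebra ℂ (RingQuot (UnivLoc.Rel S)))

/-- The canonical map. -/
def of : A →ₐ[ℂ] UnivLoc S where
  toFun a := RingQuot.mkAlgHom ℂ (UnivLoc.Rel S) (FreeAlgebra.ι ℂ (.inl a))
  map_add' a b := by
    rw [RingQuot.mkAlgHom_rel ℂ (Rel.add a b), map_add]; rfl
  map_mul' a b := by
    rw [RingQuot.mkAlgHom_rel ℂ (Rel.mul a b), map_mul]; rfl
  commutes' c := by
    rw [RingQuot.mkAlgHom_rel ℂ (Rel.scalar c), AlgHom.commutes]; rfl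
  map_zero' := by
    have h := RingQuot.mkAlgHom_rel ℂ (Rel.scalar (S := S) 0)
    rw [map_zero, map_zero, map_zero] at h
    exact h
  map_one' := by
    have h := RingQuot.mkAlgHom_rel ℂ (Rel.scalar (S := S) 1)
    rw [map_one, map_one, map_one] at h
    exact h

/-- The elements of `S` do become invertible. -/
theorem isUnit_of (s : S) : IsUnit (of S (s : A)) := by
  refine ⟨⟨of S (s : A), RingQuot.mkAlgHom ℂ (UnivLoc.Rel S) (FreeAlgebra.ι ℂ (.inr s)),
    ?_, ?_⟩, rfl⟩
  · have h := RingQuot.mkAlgHom_rel ℂ (Rel.mul_inv s)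
    rw [map_mul, map_one] at h
    exact h
  · have h := RingQuot.mkAlgHom_rel ℂ (Rel.inv_mul s)
    rw [map_mul, map_one] at h
    exact h

end UnivLoc

namespace HeckeB

/-! ### The operation `N ◇ M` -/

/-- The algebra `ℂ(X_1, …, X_r) ⊗_{ℂ[X^{±1}]} H^B_r`, that is, `H^B_r` with all nonzero Laurent
polynomials in the `X_i` inverted. -/
abbrev Loc (p₀ p₁ : ℂˣ) (r : ℕ) : Type :=
  UnivLoc {x : HeckeB p₀ p₁ r | ∃ f : (Fin r → ℤ) →₀ ℂ, f ≠ 0 ∧ x = laurent p₀ p₁ f}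

variable (p₀ p₁ : ℂˣ)

/-- The canonical map from `H^B_r` to its localization. -/
def toLoc (r : ℕ) : HeckeB p₀ p₁ r →ₐ[ℂ] Loc p₀ p₁ r := UnivLoc.of _

/-- `H^B_r` acts on its localization by multiplication on the left. -/
instance (r : ℕ) : Module (HeckeB p₀ p₁ r) (Loc p₀ p₁ r) :=
  Module.compHom _ (toLoc p₀ p₁ r).toRingHom

instance (r : ℕ) : IsScalarTower ℂ (HeckeB p₀ p₁ r) (Loc p₀ p₁ r) where
  smul_assoc c a x := by
    change toLoc p₀ p₁ r (c • a) * x = c • (toLoc p₀ p₁ r a * x)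
    rw [map_smul, smul_mul_assoc]

/-- The image of `X_{i+1}` in the localization. -/
abbrev locX {r : ℕ} (i : Fin r) : Loc p₀ p₁ r := toLoc p₀ p₁ r (gen p₀ p₁ r (.X i))

/-- The image of `X_{i+1}⁻¹` in the localization. -/
abbrev locXinv {r : ℕ} (i : Fin r) : Loc p₀ p₁ r := toLoc p₀ p₁ r (gen p₀ p₁ r (.Xinv i))

/-- The image of `T_i` in the localization. -/
abbrev locT {r : ℕ} (i : Fin r) : Loc p₀ p₁ r := toLoc p₀ p₁ r (gen p₀ p₁ r (.T i))

/-- The normalized intertwiner for `1 ≤ i < r`, with `i = k + 1`: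
`(p₁⁻¹ - p₁ Y)⁻¹ ((1 - Y) T_i - (p₁ - p₁⁻¹))` where `Y = X_i X_{i+1}⁻¹`. The element inverted
is a nonzero Laurent polynomial, hence a unit. -/
def intertwiner {r : ℕ} (k : ℕ) (h : k + 1 < r) : Loc p₀ p₁ r :=
  let Y : Loc p₀ p₁ r := locX p₀ p₁ ⟨k, by omega⟩ * locXinv p₀ p₁ ⟨k + 1, h⟩
  Ring.inverse ((p₁ : ℂ)⁻¹ • 1 - (p₁ : ℂ) • Y) *
    ((1 - Y) * locT p₀ p₁ ⟨k + 1, h⟩ - ((p₁ : ℂ) - (p₁ : ℂ)⁻¹) • 1)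

/-- The Laurent polynomials whose inverses are adjoined; their product over all
`1 ≤ i ≤ n < j ≤ n + m` is the denominator `D`. -/
def denominators (n m r : ℕ) (hr : n + m = r) : Set (Loc p₀ p₁ r) :=
  {d | ∃ (i : Fin n) (j : Fin m),
    let x := locX p₀ p₁ (⟨i, by omega⟩ : Fin r)
    let y := locX p₀ p₁ (⟨n + j, by omega⟩ : Fin r)
    let y' := locXinv p₀ p₁ (⟨n + j, by omega⟩ : Fin r)
    d = x - (p₁ : ℂ) ^ 2 • y ∨ d = x - ((p₁ : ℂ)⁻¹) ^ 2 • y ∨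
    d = x - (p₁ : ℂ) ^ 2 • y' ∨ d = x - ((p₁ : ℂ)⁻¹) ^ 2 • y' ∨
    d = x - y ∨ d = x - y'}

/-- The ring `ℂ[X_1^{±1}, …, X_{n+m}^{±1}, D⁻¹]` inside the localization. -/
def coeffRing (n m r : ℕ) (hr : n + m = r) : Subalgebra ℂ (Loc p₀ p₁ r) :=
  Algebra.adjoin ℂ
    ({x | ∃ i : Fin r, x = locX p₀ p₁ i ∨ x = locXinv p₀ p₁ i} ∪
      {x | ∃ d ∈ denominators p₀ p₁ n m r hr, x = Ring.inverse d})

/-- The left module `H^B_{n+m} ⊗ ℂ[X_1^{±1}, …, X_{n+m}^{±1}, D⁻¹]`, realized as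
`H^B_{n+m} · ℂ[X_1^{±1}, …, X_{n+m}^{±1}, D⁻¹]` inside the localization. -/
def bimod (n m r : ℕ) (hr : n + m = r) : Submodule (HeckeB p₀ p₁ r) (Loc p₀ p₁ r) :=
  Submodule.span (HeckeB p₀ p₁ r) (coeffRing p₀ p₁ n m r hr : Set (Loc p₀ p₁ r))

/-- The previous submodule as a type. -/
def Bimod (n m r : ℕ) (hr : n + m = r) : Type := bimod p₀ p₁ n m r hr

section

variable (n m r : ℕ) (hr : n + m = r)

instance : AddCommGroup (Bimod p₀ p₁ n m r hr) :=
  inferInstanceAs (AddCommGroup (bimod p₀ p₁ n m r hr))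

instance : Module (HeckeB p₀ p₁ r) (Bimod p₀ p₁ n m r hr) :=
  inferInstanceAs (Module (HeckeB p₀ p₁ r) (bimod p₀ p₁ n m r hr))

instance : Module ℂ (Bimod p₀ p₁ n m r hr) :=
  inferInstanceAs (Module ℂ (bimod p₀ p₁ n m r hr))

instance : IsScalarTower ℂ (HeckeB p₀ p₁ r) (Bimod p₀ p₁ n m r hr) :=
  inferInstanceAs (IsScalarTower ℂ (HeckeB p₀ p₁ r) (bimod p₀ p₁ n m r hr))

/-- The inclusion into the localization. -/
def Bimod.val {p₀ p₁ : ℂˣ} {n m r : ℕ} {hr : n + m = r} (x : Bimod p₀ p₁ n m r hr) : Loc p₀ p₁ r :=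
  (show bimod p₀ p₁ n m r hr from x : Loc p₀ p₁ r)

end

/-- The images of the generators of `H^B_n` in the localization of `H^B_{n+m}`. -/
def leftGen (n m r : ℕ) (hr : n + m = r) : HeckeGen n → Loc p₀ p₁ r
  | .T i => locT p₀ p₁ ⟨i, by omega⟩
  | .X i => locX p₀ p₁ ⟨i, by omega⟩
  | .Xinv i => locXinv p₀ p₁ ⟨i, by omega⟩

/-- The images of the generators of `H^B_m` in the localization of `H^B_{n+m}`:
`T_0 ↦ φ_n ⋯ φ_1 T_0 φ_1 ⋯ φ_n` with `φ_i` the normalized intertwiners, `T_i ↦ T_{i+n}` for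
`1 ≤ i < m`, and `X_i ↦ X_{i+n}`. -/
def rightGen (n m r : ℕ) (hr : n + m = r) : HeckeGen m → Loc p₀ p₁ r
  | .T i =>
      if (i : ℕ) = 0 then
        (List.ofFn fun k : Fin n => intertwiner p₀ p₁ (r := r) k (by have := i.2; omega)).reverse.prod *
          locT p₀ p₁ ⟨0, by have := i.2; omega⟩ *
          (List.ofFn fun k : Fin n => intertwiner p₀ p₁ (r := r) k (by have := i.2; omega)).prod
      else locT p₀ p₁ ⟨n + i, by omega⟩
  | .X i => locX p₀ p₁ ⟨n + i, by omega⟩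
  | .Xinv i => locXinv p₀ p₁ ⟨n + i, by omega⟩

section Diamond

variable {n m : ℕ} (r : ℕ) (hr : n + m = r)
  (N : Type*) [AddCommGroup N] [Module ℂ N] [Module (HeckeB p₀ p₁ n) N]
  (M : Type*) [AddCommGroup M] [Module ℂ M] [Module (HeckeB p₀ p₁ m) M]

/-- The elements `x b ⊗ u - x ⊗ b u` by which one divides to pass from the tensor product over
`ℂ` to the one over `(H^B_n ⊗ H^B_m) ⊗ ℂ[X^{±1}, D⁻¹]`, with `b` a generator of `H^B_n` or of
`H^B_m`. When `D` acts invertibly on `N ⊗ M`, balancing over `D⁻¹` follows from balancing over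
the `X_i`. -/
def diamondRel : Set (Bimod p₀ p₁ n m r hr ⊗[ℂ] (N ⊗[ℂ] M)) :=
  {z | ∃ (x y : Bimod p₀ p₁ n m r hr) (g : HeckeGen n) (u : N) (v : M),
      y.val = x.val * leftGen p₀ p₁ n m r hr g ∧
      z = y ⊗ₜ[ℂ] (u ⊗ₜ[ℂ] v) - x ⊗ₜ[ℂ] ((gen p₀ p₁ n g • u) ⊗ₜ[ℂ] v)} ∪
  {z | ∃ (x y : Bimod p₀ p₁ n m r hr) (g : HeckeGen m) (u : N) (v : M),
      y.val = x.val * rightGen p₀ p₁ n m r hr g ∧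
      z = y ⊗ₜ[ℂ] (u ⊗ₜ[ℂ] v) - x ⊗ₜ[ℂ] (u ⊗ₜ[ℂ] (gen p₀ p₁ m g • v))}

/-- The `H^B_{n+m}`-module `N ◇ M`. -/
abbrev Diamond :=
  (Bimod p₀ p₁ n m r hr ⊗[ℂ] (N ⊗[ℂ] M)) ⧸
    Submodule.span (HeckeB p₀ p₁ r) (diamondRel p₀ p₁ r hr N M)

end Diamond

/-! ### The action of `ℤ₂ × ℤ` on `ℂ^*` -/

/-- The orbit of `a` under the action `(ε, k) : a ↦ a ^ ε * p₁ ^ (2 k)` of the semidirect product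
of `{1, -1}` and `ℤ`. -/
def orbitB (a : ℂˣ) : Set ℂˣ := {b | ∃ (ε : ℤˣ) (k : ℤ), b = a ^ (ε : ℤ) * p₁ ^ (2 * k)}

/-- The orbit of `a` under the action `k : a ↦ a * p₁ ^ (2 k)` of `ℤ`. -/
def orbitA (a : ℂˣ) : Set ℂˣ := {b | ∃ k : ℤ, b = a * p₁ ^ (2 * k)}

/-- Invariance of a subset of `ℂ^*` under the semidirect product of `{1, -1}` and `ℤ`. -/
def IsInvariant (I : Set ℂˣ) : Prop := ∀ a ∈ I, orbitB p₁ a ⊆ I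

end HeckeB

end

universe u v

/-!
The affine Hecke algebra acts on rational functions in `X_1, …, X_r` by Demazure–Lusztig operators,
combinations of the identity and a reflection. This representation is faithful: by the Bernstein
relation, Laurent monomials times words in the finite Hecke algebra span the algebra
(`span_monomial_mul_typeBWords`), the number of words is the order of the Weyl group, and the
automorphisms in the Weyl group are linearly independent over the rational functions by Dedekind.
The same holds for `H^B_n ⊗ H^B_m` (`tensorRep_injective`) and for the localizations
(`locRep_injective`), so all identities in the bimodule that defines `N ◇ M` may be checked on
operators. There the normalized intertwiners are the adjacent transpositions
(`locRep_intertwiner`), and the twisted `T_0` of `H^B_m` is the operator of `T_0` in the variable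
`X_{n+1}` (`locRep_rightGen`).

Hence `N ◇ M` is spanned by components `w ⊗ (N ⊗ M)`, one for each shuffle `w`
(`span_diamondMk_eq_top`). Variables act on the component of `w` as permuted by `w`; as `I` and `J`
are disjoint, eigenvalues separate the components. No class `1 ⊗ z` with `z ≠ 0` vanishes, because
the projection of operators onto block-preserving ones detects `z` (`diamondMk_ne_zero`). A
nonzero submodule therefore meets some component (`exists_componentPreimage_ne_bot`). The
unnormalized intertwiners lead from one component to another and act invertibly, since `I` and `J`
are stable under `p₁²`, so the submodule meets all components in the same subspace of `N ⊗ M`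
(`componentPreimage_eq`). That subspace is stable under `H^B_n ⊗ H^B_m`, hence everything, by the
density theorem.

Conversely, the weights of a simple module `L` of type `I ∪ J` may be rearranged by intertwiners
until the eigenvalues in `I` come first (`exists_sorted_weight`). A suitable polynomial `E` in the
variables, symmetric under both Weyl groups of the blocks, has as its image the part of `L` with
such weights. The localized bimodule maps `im E` into `L`, which makes `im E` a module over
`H^B_n ⊗ H^B_m` (`exists_block_action`). It contains an image of some `N ⊗ M` with `N` and `M`
simple (`exists_tensor_map`), and the resulting nonzero map `N ◇ M → L` of simple modules is an
isomorphism (`exists_equiv_diamond`).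

For an orbit that splits as `I ⊔ I⁻¹`, the weights of a module over `n` variables have `2 ^ n`
possible sign patterns. Since `±p₀` do not occur, all intertwiners, including that of `T_0`, act
invertibly between the subspaces of adjacent patterns, so these all have the same dimension
(`finrank_signSpace`), and they are independent (`sum_finrank_signSpace_le`). The one in which all
eigenvalues lie in `I` is stable under the type A subalgebra. For a simple submodule `M` of it,
`Ind M → L` is nonzero, hence onto, and it is injective because `dim Ind M ≤ 2 ^ n dim M`
(`finrank_ind_le`).
-/

noncomputable section

namespace HeckeB

/-! ### The field of rational functions and the group acting on it -/

/-- The field `ℂ(X_1, …, X_r)`, as the fraction field of the group algebra of `ℤ^r`. -/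
def RatFun (r : ℕ) : Type := FractionRing (AddMonoidAlgebra ℂ (Fin r → ℤ))

instance (r : ℕ) : Field (RatFun r) :=
  inferInstanceAs (Field (FractionRing (AddMonoidAlgebra ℂ (Fin r → ℤ))))

instance (r : ℕ) : Algebra ℂ (RatFun r) :=
  inferInstanceAs (Algebra ℂ (FractionRing (AddMonoidAlgebra ℂ (Fin r → ℤ))))

instance (r : ℕ) : CharZero (RatFun r) := charZero_of_injective_algebraMap
  (algebraMap ℂ (RatFun r)).injective

/-- The embedding of Laurent polynomials into rational functions. -/
def toRat (r : ℕ) : AddMonoidAlgebra ℂ (Fin r → ℤ) →ₐ[ℂ] RatFun r :=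
  IsScalarTower.toAlgHom ℂ (AddMonoidAlgebra ℂ (Fin r → ℤ))
    (FractionRing (AddMonoidAlgebra ℂ (Fin r → ℤ)))

variable {r : ℕ}

theorem toRat_injective : Function.Injective (toRat r) :=
  IsFractionRing.injective (AddMonoidAlgebra ℂ (Fin r → ℤ))
    (FractionRing (AddMonoidAlgebra ℂ (Fin r → ℤ)))

theorem exists_toRat_mul_eq (k : RatFun r) : ∃ f g, g ≠ 0 ∧ toRat r g * k = toRat r f := by
  obtain ⟨⟨f, g⟩, h⟩ := IsLocalization.surj (nonZeroDivisors (AddMonoidAlgebra ℂ (Fin r → ℤ)))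
    (S := FractionRing (AddMonoidAlgebra ℂ (Fin r → ℤ))) k
  exact ⟨f, g, nonZeroDivisors.ne_zero g.2, (mul_comm _ _).trans h⟩

/-- The monomial `X^a` as a rational function. -/
def mono (a : Fin r → ℤ) : RatFun r := toRat r (AddMonoidAlgebra.single a 1)

theorem mono_add (a b : Fin r → ℤ) : mono (a + b) = mono a * mono b := by
  simp [mono, ← map_mul, AddMonoidAlgebra.single_mul_single]

@[simp] theorem mono_zero : mono (0 : Fin r → ℤ) = 1 := by
  rw [mono, ← AddMonoidAlgebra.one_def, map_one]

theorem mono_ne_zero (a : Fin r → ℤ) : mono a ≠ 0 := by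
  intro h
  have := mono_add a (-a)
  simp [h] at this

theorem mono_neg (a : Fin r → ℤ) : mono (-a) = (mono a)⁻¹ := by
  refine eq_inv_of_mul_eq_one_left ?_
  rw [← mono_add, neg_add_cancel, mono_zero]

theorem toRat_eq_sum (f : AddMonoidAlgebra ℂ (Fin r → ℤ)) :
    toRat r f = f.coeff.sum fun a c => c • mono a := by
  conv_lhs => rw [← AddMonoidAlgebra.sum_coeff_single f]
  simp only [Finsupp.sum, map_sum]
  refine Finset.sum_congr rfl fun a _ => ?_
  rw [mono, ← map_smul, AddMonoidAlgebra.smul_single, smul_eq_mul, mul_one]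

theorem linearIndependent_mono : LinearIndependent ℂ (mono : (Fin r → ℤ) → RatFun r) := by
  rw [linearIndependent_iff]
  intro l hl
  have : toRat r (AddMonoidAlgebra.ofCoeff l) = 0 := by
    rw [toRat_eq_sum]; exact hl
  have h2 := toRat_injective (this.trans (map_zero _).symm)
  exact congrArg AddMonoidAlgebra.coeff h2

theorem mono_injective : Function.Injective (mono : (Fin r → ℤ) → RatFun r) :=
  linearIndependent_mono.injective

theorem algHom_ext_mono {F : Type*} [Field F] [Algebra ℂ F] {f g : RatFun r →ₐ[ℂ] F}
    (h : ∀ a, f (mono a) = g (mono a)) : f = g := by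
  have h1 : f.comp (toRat r) = g.comp (toRat r) := by
    ext a
    exact h _
  ext k
  obtain ⟨x, y, hy, hk⟩ := exists_toRat_mul_eq k
  have hx := DFunLike.congr_fun h1 x
  have hy' := DFunLike.congr_fun h1 y
  simp only [AlgHom.comp_apply] at hx hy'
  have hne : g (toRat r y) ≠ 0 := by
    rw [map_ne_zero, Ne, ← map_zero (toRat r)]
    exact fun h => hy (toRat_injective h)
  refine mul_left_cancel₀ hne ?_
  rw [← map_mul, hk, ← hx, ← hk, map_mul, hy']

/-- The group of automorphisms of the lattice of exponents. It contains the Weyl group of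
type `B_r` as the group of signed permutations. -/
abbrev LatAut (r : ℕ) : Type := (Fin r → ℤ) ≃ₗ[ℤ] (Fin r → ℤ)

/-- The automorphism of the field of rational functions given by a lattice automorphism. -/
def autEquiv (g : LatAut r) : RatFun r ≃ₐ[ℂ] RatFun r :=
  IsFractionRing.algEquivOfAlgEquiv (R := ℂ)
    (K := FractionRing (AddMonoidAlgebra ℂ (Fin r → ℤ)))
    (L := FractionRing (AddMonoidAlgebra ℂ (Fin r → ℤ)))
    (AddMonoidAlgebra.domCongr ℂ ℂ g.toAddEquiv)

theorem autEquiv_mono (g : LatAut r) (a : Fin r → ℤ) : autEquiv g (mono a) = mono (g a) := by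
  refine (IsFractionRing.algEquivOfAlgEquiv_algebraMap (R := ℂ)
    (K := FractionRing (AddMonoidAlgebra ℂ (Fin r → ℤ)))
    (L := FractionRing (AddMonoidAlgebra ℂ (Fin r → ℤ)))
    (AddMonoidAlgebra.domCongr ℂ ℂ g.toAddEquiv) _).trans ?_
  rw [AddMonoidAlgebra.domCongr_single]; rfl

/-- The action of lattice automorphisms on rational functions. -/
def aut : LatAut r →* (RatFun r ≃ₐ[ℂ] RatFun r) where
  toFun := autEquiv
  map_one' := by
    refine AlgEquiv.coe_toAlgHom_injective (algHom_ext_mono fun a => ?_)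
    exact autEquiv_mono _ _
  map_mul' g h := by
    refine AlgEquiv.coe_toAlgHom_injective (algHom_ext_mono fun a => ?_)
    change autEquiv (g * h) (mono a) = autEquiv g (autEquiv h (mono a))
    rw [autEquiv_mono, autEquiv_mono, autEquiv_mono]; rfl

theorem aut_mono (g : LatAut r) (a : Fin r → ℤ) : aut g (mono a) = mono (g a) :=
  autEquiv_mono g a

theorem aut_mul_apply (g h : LatAut r) (k : RatFun r) : aut (g * h) k = aut g (aut h k) := by
  rw [map_mul]; rfl

theorem aut_injective : Function.Injective (aut : LatAut r → _) := by
  intro g h hgh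
  ext1 a
  refine mono_injective ?_
  rw [← aut_mono, ← aut_mono, hgh]

/-- The variable `X_{i+1}` as a rational function. -/
def ratX (i : Fin r) : RatFun r := mono (Pi.single i 1)

theorem ratX_ne_zero (i : Fin r) : ratX i ≠ 0 := mono_ne_zero _

/-- The permutation of the coordinates of the lattice. -/
def permAut : Equiv.Perm (Fin r) →* LatAut r where
  toFun σ := LinearEquiv.funCongrLeft ℤ ℤ σ.symm
  map_one' := rfl
  map_mul' _ _ := rfl

/-- The change of signs of coordinates of the lattice. -/
def signAut : (Fin r → ℤˣ) →* LatAut r where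
  toFun ε := LinearEquiv.piCongrRight fun i => LinearEquiv.smulOfUnit (ε i)
  map_one' := by ext1 a; ext i; exact one_smul ℤˣ (a i)
  map_mul' ε δ := by ext1 a; ext i; exact mul_smul (ε i) (δ i) (a i)

/-- The change of sign of one coordinate. -/
def flipAut (i : Fin r) : LatAut r := signAut (Pi.mulSingle i (-1))

@[simp] theorem permAut_apply (σ : Equiv.Perm (Fin r)) (a : Fin r → ℤ) (i : Fin r) :
    permAut σ a i = a (σ.symm i) := rfl

@[simp] theorem signAut_apply (ε : Fin r → ℤˣ) (a : Fin r → ℤ) (i : Fin r) :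
    signAut ε a i = ε i * a i := rfl

theorem aut_permAut_ratX (σ : Equiv.Perm (Fin r)) (i : Fin r) :
    aut (permAut σ) (ratX i) = ratX (σ i) := by
  rw [ratX, aut_mono, ratX]
  congr 1
  ext j
  simp [Pi.single_apply, Equiv.symm_apply_eq]

theorem flipAut_apply_self (i : Fin r) (a : Fin r → ℤ) : flipAut i a i = -a i := by
  simp [flipAut]

theorem flipAut_apply_of_ne {i j : Fin r} (h : j ≠ i) (a : Fin r → ℤ) :
    flipAut i a j = a j := by
  simp [flipAut, Pi.mulSingle_eq_of_ne h]

theorem aut_flipAut_ratX_self (i : Fin r) : aut (flipAut i) (ratX i) = (ratX i)⁻¹ := by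
  rw [ratX, aut_mono, ← mono_neg]
  congr 1
  ext j
  by_cases h : j = i
  · subst h; simp [flipAut_apply_self]
  · simp [flipAut_apply_of_ne h, h]

theorem aut_flipAut_ratX_of_ne {i j : Fin r} (h : j ≠ i) :
    aut (flipAut i) (ratX j) = ratX j := by
  rw [ratX, aut_mono]
  congr 1
  ext k
  by_cases hk : k = i
  · subst hk; simp [flipAut_apply_self, h.symm]
  · simp [flipAut_apply_of_ne hk]

theorem flipAut_mul_self (i : Fin r) : flipAut i * flipAut i = 1 := by
  rw [flipAut, ← map_mul, ← Pi.mulSingle_mul]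
  simp

theorem flipAut_comm (i j : Fin r) : flipAut i * flipAut j = flipAut j * flipAut i := by
  rw [flipAut, flipAut, ← map_mul, ← map_mul, mul_comm]

theorem permAut_mul_flipAut (σ : Equiv.Perm (Fin r)) (i : Fin r) :
    permAut σ * flipAut i = flipAut (σ i) * permAut σ := by
  ext1 a
  ext j
  change flipAut i a (σ.symm j) = flipAut (σ i) (permAut σ a) j
  by_cases h : j = σ i
  · subst h
    simp [flipAut_apply_self]
  · have : σ.symm j ≠ i := fun h' => h (by rw [← h', Equiv.apply_symm_apply])
    simp [flipAut_apply_of_ne h, flipAut_apply_of_ne this]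

theorem ratX_injective : Function.Injective (ratX : Fin r → RatFun r) := by
  intro i j h
  have := congrFun (mono_injective h) i
  by_contra hij
  simp [hij] at this

end HeckeB
end

noncomputable section

namespace HeckeB

/-! ### Demazure–Lusztig operators -/

/-- The algebra of `ℂ`-linear operators on the field of rational functions. -/
abbrev Op (r : ℕ) : Type := Module.End ℂ (RatFun r)

variable {r : ℕ}

/-- Multiplication by a rational function. -/
def mulOp : RatFun r →ₐ[ℂ] Op r := Algebra.lmul ℂ (RatFun r)

@[simp] theorem mulOp_apply (k z : RatFun r) : mulOp k z = k * z := rfl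

theorem mulOp_injective : Function.Injective (mulOp : RatFun r → Op r) := by
  intro a b h
  simpa using LinearMap.congr_fun h 1

/-- A lattice automorphism as an operator. -/
def autOp : LatAut r →* Op r where
  toFun g := (aut g).toLinearMap
  map_one' := by rw [map_one]; rfl
  map_mul' g h := by rw [map_mul]; rfl

@[simp] theorem autOp_apply (g : LatAut r) (z : RatFun r) : autOp g z = aut g z := rfl

theorem autOp_mul_mulOp (g : LatAut r) (k : RatFun r) :
    autOp g * mulOp k = mulOp (aut g k) * autOp g := by
  ext z
  simp

/-- The transposition of two coordinates. -/
abbrev swapAut (a b : Fin r) : LatAut r := permAut (Equiv.swap a b)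

theorem aut_swapAut_self (a b : Fin r) (z : RatFun r) :
    aut (swapAut a b) (aut (swapAut a b) z) = z := by
  rw [← aut_mul_apply, ← map_mul, Equiv.swap_mul_self, map_one, map_one]; rfl

theorem aut_flipAut_self (a : Fin r) (z : RatFun r) :
    aut (flipAut a) (aut (flipAut a) z) = z := by
  rw [← aut_mul_apply, flipAut_mul_self, map_one]; rfl

theorem aut_swapAut_ratX_left (a b : Fin r) : aut (swapAut a b) (ratX a) = ratX b := by
  rw [aut_permAut_ratX, Equiv.swap_apply_left]

theorem aut_swapAut_ratX_right (a b : Fin r) : aut (swapAut a b) (ratX b) = ratX a := by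
  rw [aut_permAut_ratX, Equiv.swap_apply_right]

theorem aut_swapAut_ratX_of_ne {a b c : Fin r} (h : c ≠ a) (h' : c ≠ b) :
    aut (swapAut a b) (ratX c) = ratX c := by
  rw [aut_permAut_ratX, Equiv.swap_apply_of_ne_of_ne h h']

theorem ratX_sub_ne_zero {a b : Fin r} (h : a ≠ b) : ratX b - ratX a ≠ 0 :=
  sub_ne_zero.2 fun h' => h (ratX_injective h').symm

theorem ratX_sq_sub_ne_zero (a : Fin r) : ratX a ^ 2 - 1 ≠ 0 := by
  intro h
  have h2 : mono (Pi.single a 1 + Pi.single a 1 : Fin r → ℤ) = mono 0 := by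
    rw [mono_add, mono_zero]
    change ratX a * ratX a = 1
    linear_combination h
  have := congrFun (mono_injective h2) a
  simp at this

variable (p : ℂˣ)

/-- A non-zero complex number as a rational function. -/
def cst (r : ℕ) : RatFun r := algebraMap ℂ (RatFun r) (p : ℂ)

theorem cst_ne_zero : cst p r ≠ 0 := by simp [cst]

theorem aut_cst (g : LatAut r) : aut g (cst p r) = cst p r := AlgEquiv.commutes _ _

/-- The operator by which `T_i` acts if `a` and `b` stand for the indices `i` and `i + 1`. -/
def opT (a b : Fin r) : Op r :=
  mulOp (((cst p r)⁻¹ * ratX b - cst p r * ratX a) / (ratX b - ratX a)) * autOp (swapAut a b) +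
    mulOp ((cst p r - (cst p r)⁻¹) * ratX b / (ratX b - ratX a))

/-- The operator by which `T_0` acts if `a` stands for the index `1`. -/
def opT₀ (a : Fin r) : Op r :=
  mulOp (((cst p r)⁻¹ * ratX a ^ 2 - cst p r) / (ratX a ^ 2 - 1)) * autOp (flipAut a) +
    mulOp ((cst p r - (cst p r)⁻¹) * ratX a ^ 2 / (ratX a ^ 2 - 1))

theorem opT_apply (a b : Fin r) (z : RatFun r) : opT p a b z =
    (((cst p r)⁻¹ * ratX b - cst p r * ratX a) / (ratX b - ratX a)) * aut (swapAut a b) z +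
    ((cst p r - (cst p r)⁻¹) * ratX b / (ratX b - ratX a)) * z := rfl

theorem opT₀_apply (a : Fin r) (z : RatFun r) : opT₀ p a z =
    (((cst p r)⁻¹ * ratX a ^ 2 - cst p r) / (ratX a ^ 2 - 1)) * aut (flipAut a) z +
    ((cst p r - (cst p r)⁻¹) * ratX a ^ 2 / (ratX a ^ 2 - 1)) * z := rfl

section Relations

variable {a b c d : Fin r}

theorem opT_quadratic (hab : a ≠ b) :
    opT p a b * opT p a b = mulOp (cst p r - (cst p r)⁻¹) * opT p a b + 1 := by
  ext z
  change _ = (cst p r - (cst p r)⁻¹) * opT p a b z + z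
  simp only [Module.End.mul_apply, opT_apply, map_mul, map_sub, map_div₀, map_add, map_inv₀,
    aut_cst, aut_swapAut_ratX_left, aut_swapAut_ratX_right, aut_swapAut_self]
  have h1 := ratX_sub_ne_zero hab
  have h3 := cst_ne_zero (r := r) p
  generalize aut (swapAut a b) z = w
  generalize ratX a = x at *
  generalize ratX b = y at *
  generalize cst p r = q at *
  have h4 : x - y = -(y - x) := by ring
  rw [h4]
  field_simp
  ring

theorem opT₀_quadratic (a : Fin r) :
    opT₀ p a * opT₀ p a = mulOp (cst p r - (cst p r)⁻¹) * opT₀ p a + 1 := by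
  ext z
  change _ = (cst p r - (cst p r)⁻¹) * opT₀ p a z + z
  simp only [Module.End.mul_apply, opT₀_apply, map_mul, map_sub, map_div₀, map_add, map_inv₀,
    map_pow, map_one, aut_cst, aut_flipAut_ratX_self, aut_flipAut_self]
  have h1 := ratX_sq_sub_ne_zero a
  have h3 := cst_ne_zero (r := r) p
  have h5 := ratX_ne_zero a
  generalize aut (flipAut a) z = w
  generalize ratX a = x at *
  generalize cst p r = q at *
  have h4 : x⁻¹ ^ 2 - 1 = -(x ^ 2 - 1) / x ^ 2 := by field_simp; ring
  rw [h4]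
  field_simp
  ring

set_option maxRecDepth 4000 in
theorem opT_braid (hab : a ≠ b) (hbc : b ≠ c) (hac : a ≠ c) :
    opT p a b * opT p b c * opT p a b = opT p b c * opT p a b * opT p b c := by
  ext z
  have hb : aut (swapAut a b) (aut (swapAut b c) (aut (swapAut a b) z)) =
      aut (swapAut b c) (aut (swapAut a b) (aut (swapAut b c) z)) := by
    simp only [← aut_mul_apply, ← map_mul]
    rw [← mul_assoc, ← mul_assoc, Equiv.swap_mul_swap_mul_swap hab hac, Equiv.swap_comm a b,
      Equiv.swap_comm b c, Equiv.swap_mul_swap_mul_swap hbc.symm hac.symm, Equiv.swap_comm]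
  simp only [Module.End.mul_apply, opT_apply, map_mul, map_sub, map_div₀, map_add, map_inv₀,
    aut_cst, aut_swapAut_ratX_left, aut_swapAut_ratX_right, aut_swapAut_self,
    aut_swapAut_ratX_of_ne hac.symm hbc.symm, aut_swapAut_ratX_of_ne hab hac, hb]
  have h1 := ratX_sub_ne_zero hab
  have h2 := ratX_sub_ne_zero hbc
  have h6 := ratX_sub_ne_zero hac
  have h3 := cst_ne_zero (r := r) p
  generalize aut (swapAut b c) (aut (swapAut a b) (aut (swapAut b c) z)) = w1
  generalize aut (swapAut b c) (aut (swapAut a b) z) = w2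
  generalize aut (swapAut a b) (aut (swapAut b c) z) = w3
  generalize aut (swapAut b c) z = w4
  generalize aut (swapAut a b) z = w5
  generalize ratX a = x at *
  generalize ratX b = y at *
  generalize ratX c = u at *
  generalize cst p r = q at *
  have h4 : x - y = -(y - x) := by ring
  have h5 : y - u = -(u - y) := by ring
  rw [h4, h5]
  field_simp
  ring

theorem swapAut_mul_flipAut (a b : Fin r) :
    swapAut a b * flipAut a = flipAut b * swapAut a b := by
  rw [permAut_mul_flipAut, Equiv.swap_apply_left]

theorem swapAut_mul_self (a b : Fin r) : swapAut a b * swapAut a b = 1 := by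
  rw [← map_mul, Equiv.swap_mul_self, map_one]

theorem ratX_mul_sub_ne_zero (hab : a ≠ b) : ratX a * ratX b - 1 ≠ 0 := by
  intro h
  have h2 : mono (Pi.single a 1 + Pi.single b 1 : Fin r → ℤ) = mono 0 := by
    rw [mono_add, mono_zero]
    exact sub_eq_zero.1 h
  have := congrFun (mono_injective h2) a
  simp [hab] at this

set_option maxRecDepth 8000 in
theorem opT₀_opT_braid (p' : ℂˣ) (hab : a ≠ b) :
    opT₀ p a * opT p' a b * opT₀ p a * opT p' a b =
      opT p' a b * opT₀ p a * opT p' a b * opT₀ p a := by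
  ext z
  -- Both sides are combinations of the eight elements of the dihedral group that the two
  -- reflections generate. Its longest element is the only one with two reduced words.
  have hg : swapAut a b * flipAut a * swapAut a b * flipAut a =
      flipAut a * swapAut a b * flipAut a * swapAut a b := by
    have h1 : swapAut a b * flipAut a * swapAut a b = flipAut b := by
      rw [swapAut_mul_flipAut, mul_assoc, swapAut_mul_self, mul_one]
    rw [h1, mul_assoc, mul_assoc, ← mul_assoc (swapAut a b), h1, flipAut_comm]
  have hb : aut (swapAut a b) (aut (flipAut a) (aut (swapAut a b) (aut (flipAut a) z))) =
      aut (flipAut a) (aut (swapAut a b) (aut (flipAut a) (aut (swapAut a b) z))) := by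
    simp only [← aut_mul_apply, ← mul_assoc, hg]
  simp only [Module.End.mul_apply, opT_apply, opT₀_apply, map_mul, map_sub, map_div₀, map_add,
    map_inv₀, map_pow, map_one,
    aut_cst, aut_swapAut_ratX_left, aut_swapAut_ratX_right, aut_swapAut_self,
    aut_flipAut_ratX_self, aut_flipAut_self, aut_flipAut_ratX_of_ne hab.symm, hb]
  have h1 := ratX_sub_ne_zero hab
  have h2 := ratX_sq_sub_ne_zero a
  have h3 := ratX_sq_sub_ne_zero b
  have h4 := ratX_mul_sub_ne_zero hab
  have h5 := cst_ne_zero (r := r) p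
  have h6 := cst_ne_zero (r := r) p'
  have h7 := ratX_ne_zero a
  have h8 := ratX_ne_zero b
  generalize aut (flipAut a) (aut (swapAut a b) (aut (flipAut a) (aut (swapAut a b) z))) = w1
  generalize aut (swapAut a b) (aut (flipAut a) (aut (swapAut a b) z)) = w2
  generalize aut (flipAut a) (aut (swapAut a b) (aut (flipAut a) z)) = w3
  generalize aut (swapAut a b) (aut (flipAut a) z) = w4
  generalize aut (flipAut a) (aut (swapAut a b) z) = w5
  generalize aut (swapAut a b) z = w6
  generalize aut (flipAut a) z = w7
  generalize ratX a = x at *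
  generalize ratX b = y at *
  generalize cst p r = q at *
  generalize cst p' r = q' at *
  have e1 : x - y = -(y - x) := by ring
  have e2 : y - x⁻¹ = (x * y - 1) / x := by field_simp
  have e3 : x⁻¹ ^ 2 - 1 = -(x ^ 2 - 1) / x ^ 2 := by field_simp; ring
  have e4 : y⁻¹ ^ 2 - 1 = -(y ^ 2 - 1) / y ^ 2 := by field_simp; ring
  have e5 : x - y⁻¹ = (x * y - 1) / y := by field_simp
  have e7 : x⁻¹ - y⁻¹ = (y - x) / (x * y) := by field_simp
  have e8 : x⁻¹ - y = -(x * y - 1) / x := by field_simp; ring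
  simp only [e1, e2, e3, e4, e5, e7, e8]
  field_simp
  ring

theorem swapAut_mul_swapAut_comm (hac : a ≠ c) (had : a ≠ d) (hbc : b ≠ c) (hbd : b ≠ d) :
    swapAut a b * swapAut c d = swapAut c d * swapAut a b := by
  have h : Equiv.Perm.Disjoint (Equiv.swap a b) (Equiv.swap c d) := by
    intro i
    by_cases hc : i = c
    · subst hc; exact Or.inl (Equiv.swap_apply_of_ne_of_ne hac.symm hbc.symm)
    · by_cases hd : i = d
      · subst hd; exact Or.inl (Equiv.swap_apply_of_ne_of_ne had.symm hbd.symm)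
      · exact Or.inr (Equiv.swap_apply_of_ne_of_ne hc hd)
  rw [← map_mul, ← map_mul, h.commute.eq]

theorem opT_comm (hac : a ≠ c) (had : a ≠ d) (hbc : b ≠ c) (hbd : b ≠ d) (p' : ℂˣ) :
    opT p a b * opT p' c d = opT p' c d * opT p a b := by
  ext z
  have hb : aut (swapAut a b) (aut (swapAut c d) z) = aut (swapAut c d) (aut (swapAut a b) z) := by
    rw [← aut_mul_apply, ← aut_mul_apply, swapAut_mul_swapAut_comm hac had hbc hbd]
  simp only [Module.End.mul_apply, opT_apply, map_mul, map_sub, map_div₀, map_add, map_inv₀,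
    aut_cst, aut_swapAut_ratX_of_ne hac.symm hbc.symm, aut_swapAut_ratX_of_ne had.symm hbd.symm,
    aut_swapAut_ratX_of_ne hac had, aut_swapAut_ratX_of_ne hbc hbd, hb]
  ring

theorem opT₀_opT_comm (hab : a ≠ b) (hac : a ≠ c) (p' : ℂˣ) :
    opT₀ p a * opT p' b c = opT p' b c * opT₀ p a := by
  ext z
  have hb : aut (flipAut a) (aut (swapAut b c) z) = aut (swapAut b c) (aut (flipAut a) z) := by
    rw [← aut_mul_apply, ← aut_mul_apply, permAut_mul_flipAut,
      Equiv.swap_apply_of_ne_of_ne hab hac]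
  simp only [Module.End.mul_apply, opT_apply, opT₀_apply, map_mul, map_sub, map_div₀, map_add,
    map_inv₀, map_pow, map_one, aut_cst, aut_swapAut_ratX_of_ne hab hac,
    aut_flipAut_ratX_of_ne hab.symm, aut_flipAut_ratX_of_ne hac.symm, hb]
  ring

theorem opT₀_comm (hab : a ≠ b) (p' : ℂˣ) : opT₀ p a * opT₀ p' b = opT₀ p' b * opT₀ p a := by
  ext z
  have hb : aut (flipAut a) (aut (flipAut b) z) = aut (flipAut b) (aut (flipAut a) z) := by
    rw [← aut_mul_apply, ← aut_mul_apply, flipAut_comm]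
  simp only [Module.End.mul_apply, opT₀_apply, map_mul, map_sub, map_div₀, map_add,
    map_inv₀, map_pow, map_one, aut_cst, aut_flipAut_ratX_of_ne hab,
    aut_flipAut_ratX_of_ne hab.symm, hb]
  ring

theorem opT_mul_ratX_mul (hab : a ≠ b) :
    opT p a b * mulOp (ratX a) * opT p a b = mulOp (ratX b) := by
  ext z
  simp only [Module.End.mul_apply, opT_apply, map_mul, map_sub, map_div₀, map_add, map_inv₀,
    mulOp_apply, aut_cst, aut_swapAut_ratX_left, aut_swapAut_ratX_right, aut_swapAut_self]
  have h1 := ratX_sub_ne_zero hab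
  have h3 := cst_ne_zero (r := r) p
  generalize aut (swapAut a b) z = w
  generalize ratX a = x at *
  generalize ratX b = y at *
  generalize cst p r = q at *
  have h4 : x - y = -(y - x) := by ring
  rw [h4]
  field_simp
  ring

theorem opT₀_mul_ratX_inv_mul (a : Fin r) :
    opT₀ p a * mulOp (ratX a)⁻¹ * opT₀ p a = mulOp (ratX a) := by
  ext z
  simp only [Module.End.mul_apply, opT₀_apply, map_mul, map_sub, map_div₀, map_add, map_inv₀,
    map_pow, map_one, mulOp_apply, aut_cst, aut_flipAut_ratX_self, aut_flipAut_self]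
  have h1 := ratX_sq_sub_ne_zero a
  have h3 := cst_ne_zero (r := r) p
  have h5 := ratX_ne_zero a
  generalize aut (flipAut a) z = w
  generalize ratX a = x at *
  generalize cst p r = q at *
  have h4 : x⁻¹ ^ 2 - 1 = -(x ^ 2 - 1) / x ^ 2 := by field_simp; ring
  rw [h4]
  field_simp
  ring

/-- Only the transposition in the Demazure–Lusztig operator moves functions, so multiplication by an
invariant function commutes with it. -/
theorem opT_mul_mulOp {k : RatFun r} (hk : aut (swapAut a b) k = k) :
    opT p a b * mulOp k = mulOp k * opT p a b := by
  ext z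
  simp only [Module.End.mul_apply, opT_apply, map_mul, mulOp_apply, hk]
  ring

theorem opT₀_mul_mulOp {k : RatFun r} (hk : aut (flipAut a) k = k) :
    opT₀ p a * mulOp k = mulOp k * opT₀ p a := by
  ext z
  simp only [Module.End.mul_apply, opT₀_apply, map_mul, mulOp_apply, hk]
  ring

theorem autOp_mul_opT (σ : Equiv.Perm (Fin r)) (a b : Fin r) :
    autOp (permAut σ) * opT p a b = opT p (σ a) (σ b) * autOp (permAut σ) := by
  ext z
  have hb : aut (permAut σ) (aut (swapAut a b) z) =
      aut (swapAut (σ a) (σ b)) (aut (permAut σ) z) := by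
    rw [← aut_mul_apply, ← aut_mul_apply, ← map_mul, ← map_mul]
    rw [Equiv.mul_swap_eq_swap_mul]
  simp only [Module.End.mul_apply, opT_apply, map_mul, map_sub, map_div₀, map_add, map_inv₀,
    aut_cst, aut_permAut_ratX, autOp_apply, hb]

theorem autOp_mul_opT₀ (σ : Equiv.Perm (Fin r)) (a : Fin r) :
    autOp (permAut σ) * opT₀ p a = opT₀ p (σ a) * autOp (permAut σ) := by
  ext z
  have hb : aut (permAut σ) (aut (flipAut a) z) =
      aut (flipAut (σ a)) (aut (permAut σ) z) := by
    rw [← aut_mul_apply, ← aut_mul_apply, permAut_mul_flipAut]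
  simp only [Module.End.mul_apply, opT₀_apply, map_mul, map_sub, map_div₀, map_add, map_inv₀,
    map_pow, map_one, aut_cst, aut_permAut_ratX, autOp_apply, hb]

end Relations

end HeckeB
end

noncomputable section

namespace HeckeB

/-! ### The representation of the Hecke algebra on rational functions -/

section Rep

variable (p₀ p₁ : ℂˣ) {n r : ℕ}

theorem adjoin_gen (n : ℕ) : Algebra.adjoin ℂ (Set.range (gen p₀ p₁ n)) = ⊤ := by
  have h1 : Function.Surjective (mk p₀ p₁ n) := RingQuot.mkAlgHom_surjective ℂ _
  have h2 := congrArg (Subalgebra.map (mk p₀ p₁ n)) (FreeAlgebra.adjoin_range_ι ℂ (HeckeGen n))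
  rw [AlgHom.map_adjoin, ← Set.range_comp, Algebra.map_top,
    (AlgHom.range_eq_top _).2 h1] at h2
  exact h2

/-- A subalgebra that contains the generators is everything. -/
theorem mem_of_gen_mem {S : Subalgebra ℂ (HeckeB p₀ p₁ n)} (h : ∀ g, gen p₀ p₁ n g ∈ S)
    (x : HeckeB p₀ p₁ n) : x ∈ S := by
  have : Algebra.adjoin ℂ (Set.range (gen p₀ p₁ n)) ≤ S := by
    rw [Algebra.adjoin_le_iff]
    rintro _ ⟨g, rfl⟩
    exact h g
  exact this (by rw [adjoin_gen]; trivial)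

/-- The operators by which the generators act if `ι` says which variables are used. -/
def genOp (ι : Fin n → Fin r) : HeckeGen n → Op r
  | .T i => if (i : ℕ) = 0 then opT₀ p₀ (ι i) else opT p₁ (ι ⟨i - 1, by omega⟩) (ι i)
  | .X i => mulOp (ratX (ι i))
  | .Xinv i => mulOp (ratX (ι i))⁻¹

theorem genOp_T_zero (ι : Fin n → Fin r) (h : 0 < n) :
    genOp p₀ p₁ ι (.T ⟨0, h⟩) = opT₀ p₀ (ι ⟨0, h⟩) := rfl

theorem genOp_T_succ (ι : Fin n → Fin r) (k : ℕ) (h : k + 1 < n) :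
    genOp p₀ p₁ ι (.T ⟨k + 1, h⟩) = opT p₁ (ι ⟨k, by omega⟩) (ι ⟨k + 1, h⟩) := rfl

theorem mulOp_cst_sub (p : ℂˣ) :
    mulOp (cst p r - (cst p r)⁻¹) = algebraMap ℂ (Op r) p - algebraMap ℂ (Op r) (p : ℂ)⁻¹ := by
  rw [map_sub, cst, ← map_inv₀, AlgHom.commutes, AlgHom.commutes]

theorem quadratic_factor {A : Type*} [Ring A] [Algebra ℂ A] (p : ℂˣ) (x : A)
    (h : x * x = (algebraMap ℂ A p - algebraMap ℂ A (p : ℂ)⁻¹) * x + 1) :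
    (x - algebraMap ℂ A p) * (x + algebraMap ℂ A (p : ℂ)⁻¹) = 0 := by
  have h1 : algebraMap ℂ A p * algebraMap ℂ A (p : ℂ)⁻¹ = 1 := by
    rw [← map_mul, mul_inv_cancel₀ p.ne_zero, map_one]
  have h2 : x * algebraMap ℂ A (p : ℂ)⁻¹ = algebraMap ℂ A (p : ℂ)⁻¹ * x :=
    (Algebra.commutes _ _).symm
  rw [sub_mul, mul_add, mul_add, h1, h2, h]
  noncomm_ring

variable (ι : Fin n → Fin r) (hι : Function.Injective ι)

include hι in
/-- The Demazure–Lusztig operators satisfy the defining relations. -/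
theorem genOp_rel (x y : FreeAlgebra ℂ (HeckeGen n)) (h : Rel p₀ p₁ n x y) :
    FreeAlgebra.lift ℂ (genOp p₀ p₁ ι) x = FreeAlgebra.lift ℂ (genOp p₀ p₁ ι) y := by
  have hne : ∀ {i j : ℕ} (hi : i < n) (hj : j < n), i ≠ j → ι ⟨i, hi⟩ ≠ ι ⟨j, hj⟩ :=
    fun hi hj hij h => hij (Fin.mk.inj (hι h))
  induction h with
  | X_mul_Xinv i h =>
    simp only [map_mul, FreeAlgebra.lift_ι_apply, map_one, genOp]
    rw [← map_mul, mul_inv_cancel₀ (ratX_ne_zero _), map_one]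
  | Xinv_mul_X i h =>
    simp only [map_mul, FreeAlgebra.lift_ι_apply, map_one, genOp]
    rw [← map_mul, inv_mul_cancel₀ (ratX_ne_zero _), map_one]
  | X_comm i j hi hj =>
    simp only [map_mul, FreeAlgebra.lift_ι_apply, genOp]
    rw [← map_mul, mul_comm, map_mul]
  | braid_zero h0 h1 =>
    simp only [map_mul, FreeAlgebra.lift_ι_apply]
    rw [genOp_T_zero, genOp_T_succ p₀ p₁ ι 0]
    exact opT₀_opT_braid _ _ (hne _ _ (by omega))
  | braid i hi h h' =>
    obtain ⟨k, rfl⟩ : ∃ k, i = k + 1 := ⟨i - 1, by omega⟩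
    simp only [map_mul, FreeAlgebra.lift_ι_apply]
    rw [genOp_T_succ, genOp_T_succ]
    exact opT_braid _ (hne _ _ (by omega)) (hne _ _ (by omega)) (hne _ _ (by omega))
  | T_comm i j hi hj hij =>
    obtain ⟨l, rfl⟩ : ∃ k, j = k + 1 := ⟨j - 1, by omega⟩
    simp only [map_mul, FreeAlgebra.lift_ι_apply]
    rcases i with - | k
    · rw [genOp_T_zero, genOp_T_succ]
      exact opT₀_opT_comm _ (hne _ _ (by omega)) (hne _ _ (by omega)) _
    · rw [genOp_T_succ, genOp_T_succ]
      exact opT_comm _ (hne _ _ (by omega)) (hne _ _ (by omega)) (hne _ _ (by omega))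
        (hne _ _ (by omega)) _
  | quadratic_zero h =>
    simp only [map_mul, map_sub, map_add, FreeAlgebra.lift_ι_apply, map_zero, AlgHom.commutes]
    rw [genOp_T_zero]
    refine quadratic_factor _ _ ?_
    rw [opT₀_quadratic, mulOp_cst_sub]
  | quadratic i hi h =>
    obtain ⟨k, rfl⟩ : ∃ k, i = k + 1 := ⟨i - 1, by omega⟩
    simp only [map_mul, map_sub, map_add, FreeAlgebra.lift_ι_apply, map_zero, AlgHom.commutes]
    rw [genOp_T_succ]
    refine quadratic_factor _ _ ?_
    rw [opT_quadratic _ (hne _ _ (by omega)), mulOp_cst_sub]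
  | T_zero_X h =>
    simp only [map_mul, FreeAlgebra.lift_ι_apply]
    rw [genOp_T_zero]
    exact opT₀_mul_ratX_inv_mul _ _
  | T_X k h h' =>
    simp only [map_mul, FreeAlgebra.lift_ι_apply]
    rw [genOp_T_succ]
    exact opT_mul_ratX_mul _ (hne _ _ (by omega))
  | T_X_comm i k hi hk h₁ h₂ =>
    simp only [map_mul, FreeAlgebra.lift_ι_apply]
    rcases i with - | i
    · rw [genOp_T_zero]
      exact opT₀_mul_mulOp _ (aut_flipAut_ratX_of_ne (hne _ _ h₂))
    · rw [genOp_T_succ]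
      exact opT_mul_mulOp _ (aut_swapAut_ratX_of_ne (hne _ _ (by omega)) (hne _ _ h₂))

/-- The representation of the affine Hecke algebra by Demazure–Lusztig operators in the
variables selected by `ι`. -/
def rep : HeckeB p₀ p₁ n →ₐ[ℂ] Op r :=
  RingQuot.liftAlgHom ℂ ⟨FreeAlgebra.lift ℂ (genOp p₀ p₁ ι),
    fun {x y} h => genOp_rel p₀ p₁ ι hι x y h⟩

theorem rep_gen (g : HeckeGen n) : rep p₀ p₁ ι hι (gen p₀ p₁ n g) = genOp p₀ p₁ ι g := by
  exact (RingQuot.liftAlgHom_mkAlgHom_apply ℂ (FreeAlgebra.lift ℂ (genOp p₀ p₁ ι))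
    (fun {x y} h => genOp_rel p₀ p₁ ι hι x y h) (FreeAlgebra.ι ℂ g)).trans
    (FreeAlgebra.lift_ι_apply _ _)

end Rep

/-! ### Laurent monomials -/

section Monomial

variable (p₀ p₁ : ℂˣ) {n r : ℕ}

theorem gen_rel {x y : FreeAlgebra ℂ (HeckeGen n)} (h : Rel p₀ p₁ n x y) :
    mk p₀ p₁ n x = mk p₀ p₁ n y := RingQuot.mkAlgHom_rel ℂ h

theorem unitX_comm (i j : Fin n) : Commute (unitX p₀ p₁ i) (unitX p₀ p₁ j) := by
  have h := gen_rel p₀ p₁ (Rel.X_comm (p₀ := p₀) (p₁ := p₁) i.1 j.1 i.2 j.2)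
  rw [map_mul, map_mul] at h
  exact Units.ext h

theorem prod_map_mul_of_commute {G ι : Type*} [Monoid G] (f g : ι → G)
    (h : ∀ i j, Commute (g i) (f j)) (l : List ι) :
    (l.map fun i => f i * g i).prod = (l.map f).prod * (l.map g).prod := by
  induction l with
  | nil => simp
  | cons a l ih =>
    simp only [List.map_cons, List.prod_cons, ih]
    have : Commute (g a) (l.map f).prod := by
      refine Commute.list_prod_right _ _ fun x hx => ?_
      obtain ⟨j, -, rfl⟩ := List.mem_map.1 hx
      exact h a j
    rw [mul_assoc, ← mul_assoc (g a), this.eq]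
    simp only [mul_assoc]

theorem monomial_add (a b : Fin n → ℤ) :
    monomial p₀ p₁ (a + b) = monomial p₀ p₁ a * monomial p₀ p₁ b := by
  rw [monomial, monomial, monomial, ← Units.val_mul]
  congr 1
  simp only [List.ofFn_eq_map, Pi.add_apply, zpow_add]
  exact prod_map_mul_of_commute _ _ (fun i j => ((unitX_comm p₀ p₁ i j).zpow_zpow _ _)) _

theorem monomial_zero : monomial p₀ p₁ (0 : Fin n → ℤ) = 1 := by
  rw [monomial]
  simp [List.ofFn_eq_map]

theorem monomial_single (i : Fin n) (k : ℤ) :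
    monomial p₀ p₁ (Pi.single i k) =
      ((unitX p₀ p₁ i ^ k : (HeckeB p₀ p₁ n)ˣ) : HeckeB p₀ p₁ n) := by
  rw [monomial]
  congr 1
  rw [List.ofFn_eq_map]
  have : ∀ l : List (Fin n), l.Nodup →
      (l.map fun j => unitX p₀ p₁ j ^ (Pi.single i k : Fin n → ℤ) j).prod =
        if i ∈ l then unitX p₀ p₁ i ^ k else 1 := by
    intro l
    induction l with
    | nil => simp
    | cons a l ih =>
      intro hl
      rw [List.nodup_cons] at hl
      rw [List.map_cons, List.prod_cons, ih hl.2]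
      by_cases h : a = i
      · subst h
        simp [hl.1]
      · simp [h, Ne.symm h]
  rw [this _ (List.nodup_finRange n), if_pos (List.mem_finRange i)]

/-- Laurent polynomials as a commutative subalgebra of the affine Hecke algebra. -/
def laurentHom (n : ℕ) : AddMonoidAlgebra ℂ (Fin n → ℤ) →ₐ[ℂ] HeckeB p₀ p₁ n :=
  AddMonoidAlgebra.lift ℂ (HeckeB p₀ p₁ n) (Fin n → ℤ)
    { toFun := fun a => monomial p₀ p₁ a.toAdd
      map_one' := monomial_zero p₀ p₁
      map_mul' := fun a b => monomial_add p₀ p₁ a.toAdd b.toAdd }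

theorem laurentHom_single (a : Fin n → ℤ) (c : ℂ) :
    laurentHom p₀ p₁ n (AddMonoidAlgebra.single a c) = c • monomial p₀ p₁ a := by
  rw [laurentHom, AddMonoidAlgebra.lift_single]; rfl

theorem laurent_eq (f : (Fin n → ℤ) →₀ ℂ) :
    laurent p₀ p₁ f = laurentHom p₀ p₁ n (AddMonoidAlgebra.ofCoeff f) := by
  conv_rhs => rw [← AddMonoidAlgebra.sum_coeff_single (AddMonoidAlgebra.ofCoeff f)]
  simp only [Finsupp.sum, map_sum, laurentHom_single]
  rfl

/-- The Laurent polynomial `X_{i+1}`. -/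
def varX (i : Fin n) : AddMonoidAlgebra ℂ (Fin n → ℤ) := AddMonoidAlgebra.single (Pi.single i 1) 1

/-- The Laurent polynomial `X_{i+1}⁻¹`. -/
def varXinv (i : Fin n) : AddMonoidAlgebra ℂ (Fin n → ℤ) :=
  AddMonoidAlgebra.single (Pi.single i (-1)) 1

theorem laurentHom_varX (i : Fin n) : laurentHom p₀ p₁ n (varX i) = gen p₀ p₁ n (.X i) := by
  rw [varX, laurentHom_single, one_smul, monomial_single, zpow_one]; rfl

theorem laurentHom_varXinv (i : Fin n) :
    laurentHom p₀ p₁ n (varXinv i) = gen p₀ p₁ n (.Xinv i) := by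
  rw [varXinv, laurentHom_single, one_smul, monomial_single, zpow_neg_one]; rfl

theorem toRat_varX (i : Fin n) : toRat n (varX i) = ratX i := rfl

theorem toRat_varXinv (i : Fin n) : toRat n (varXinv i) = (ratX i)⁻¹ := by
  rw [ratX, ← mono_neg, ← Pi.single_neg]; rfl

/-- The Laurent polynomials are generated by the variables and their inverses. -/
theorem laurent_mem_of_var_mem {S : Subalgebra ℂ (AddMonoidAlgebra ℂ (Fin n → ℤ))}
    (h : ∀ i, varX i ∈ S) (h' : ∀ i, varXinv i ∈ S) (f) : f ∈ S := by
  rw [← AddMonoidAlgebra.sum_coeff_single f]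
  refine sum_mem fun a _ => ?_
  have h1 : AddMonoidAlgebra.single a (f.coeff a) =
      f.coeff a • AddMonoidAlgebra.single a (1 : ℂ) := by simp
  rw [h1]
  refine S.smul_mem ?_ _
  have h2 : ∀ (i : Fin n) (k : ℤ), AddMonoidAlgebra.single (Pi.single i k) (1 : ℂ) ∈ S := by
    intro i k
    obtain ⟨k, rfl | rfl⟩ := k.eq_nat_or_neg
    · convert S.pow_mem (h i) k using 1
      rw [varX, AddMonoidAlgebra.single_pow, one_pow, ← Pi.single_smul]; simp
    · convert S.pow_mem (h' i) k using 1
      rw [varXinv, AddMonoidAlgebra.single_pow, one_pow, ← Pi.single_smul]; simp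
  have h3 : AddMonoidAlgebra.single a (1 : ℂ) =
      ∏ i, AddMonoidAlgebra.single (Pi.single i (a i)) (1 : ℂ) := by
    conv_lhs => rw [← Finset.univ_sum_single a]
    generalize (Finset.univ : Finset (Fin n)) = s
    classical
    induction s using Finset.induction_on with
    | empty => simp [AddMonoidAlgebra.one_def]
    | insert i s hi ih =>
      rw [Finset.sum_insert hi, Finset.prod_insert hi, ← ih, AddMonoidAlgebra.single_mul_single,
        one_mul]
  rw [h3]
  exact prod_mem fun i _ => h2 i _

/-- Two algebra homomorphisms on Laurent polynomials agree if they do on the variables. -/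
theorem laurent_hom_ext {A : Type*} [Ring A] [Algebra ℂ A]
    {f g : AddMonoidAlgebra ℂ (Fin n → ℤ) →ₐ[ℂ] A} (h : ∀ i, f (varX i) = g (varX i))
    (h' : ∀ i, f (varXinv i) = g (varXinv i)) : f = g := by
  refine AlgHom.ext fun x => ?_
  exact laurent_mem_of_var_mem (S := AlgHom.equalizer f g) h h' x

theorem rep_laurentHom (f : AddMonoidAlgebra ℂ (Fin r → ℤ)) :
    rep p₀ p₁ id Function.injective_id (laurentHom p₀ p₁ r f) = mulOp (toRat r f) := by
  have : (rep p₀ p₁ id Function.injective_id).comp (laurentHom p₀ p₁ r) =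
      (mulOp (r := r)).comp (toRat r) := by
    refine laurent_hom_ext (fun i => ?_) fun i => ?_
    · rw [AlgHom.comp_apply, AlgHom.comp_apply, laurentHom_varX, rep_gen, toRat_varX]; rfl
    · rw [AlgHom.comp_apply, AlgHom.comp_apply, laurentHom_varXinv, rep_gen, toRat_varXinv]; rfl
  exact DFunLike.congr_fun this f

end Monomial

end HeckeB
end

noncomputable section

namespace HeckeB

/-! ### Reduced words in the finite Hecke algebra -/

section Words

variable {R : Type*} [Ring R] [Algebra ℂ R]

/-- The relations of the finite Hecke algebra of type `B_n` for `t 0, …, t (n - 1)`, where the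
parameters of the quadratic relations may be arbitrary. -/
structure IsHeckeFamily (t : ℕ → R) (n : ℕ) : Prop where
  quadratic : ∀ i < n, ∃ c : ℂ, t i * t i = c • t i + 1
  braid_zero : 1 < n → t 0 * t 1 * t 0 * t 1 = t 1 * t 0 * t 1 * t 0
  braid : ∀ i, 1 ≤ i → i + 1 < n → t i * t (i + 1) * t i = t (i + 1) * t i * t (i + 1)
  comm : ∀ i j, i + 1 < j → j < n → t i * t j = t j * t i

variable (t : ℕ → R) {n : ℕ}

/-- The word `t_k ⋯ t_1 t_0`. -/
def descWord : ℕ → R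
  | 0 => t 0
  | k + 1 => t (k + 1) * descWord k

/-- The word `t_{k-j+1} ⋯ t_{k-1} t_k` of length `j`. -/
def ascWord (k : ℕ) : ℕ → R
  | 0 => 1
  | j + 1 => t (k - j) * ascWord k j

variable {t} (ht : IsHeckeFamily t n)
include ht

theorem mul_descWord_of_gt (k i : ℕ) (hi : k + 1 < i) (hn : i < n) :
    t i * descWord t k = descWord t k * t i := by
  induction k with
  | zero => exact (ht.comm 0 i (by omega) hn).symm
  | succ k ih =>
    rw [descWord, ← mul_assoc, ← ht.comm (k + 1) i hi hn, mul_assoc, ih (by omega), mul_assoc]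

theorem mul_descWord_of_lt (k i : ℕ) (h1 : 1 ≤ i) (hi : i < k) (hn : k < n) :
    t i * descWord t k = descWord t k * t (i + 1) := by
  induction k with
  | zero => omega
  | succ k ih =>
    rcases Nat.lt_succ_iff_lt_or_eq.1 hi with h | h
    · rw [descWord, ← mul_assoc, ht.comm i (k + 1) (by omega) hn, mul_assoc, ih h (by omega),
        mul_assoc]
    · subst h
      obtain ⟨m, rfl⟩ : ∃ m, i = m + 1 := ⟨i - 1, by omega⟩
      rw [descWord, descWord, ← mul_assoc, ← mul_assoc, ht.braid (m + 1) h1 hn, mul_assoc,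
        mul_descWord_of_gt ht m (m + 1 + 1) (by omega) hn]
      simp only [mul_assoc]

/-- In the Weyl group, the reflection in the coordinate `k + 1`, conjugated to the first one,
commutes with the reflections in other coordinates. This is what replaces a repeated word `t_{k+1} ⋯
t_0` by a decreasing pair followed by `t_1`. -/
theorem descWord_mul_self (k : ℕ) (hn : k + 1 < n) :
    descWord t (k + 1) * descWord t (k + 1) = descWord t k * descWord t (k + 1) * t 1 := by
  induction k with
  | zero =>
    simp only [descWord, zero_add, ← mul_assoc]
    exact (ht.braid_zero (by omega)).symm
  | succ k ih =>
    have h1 := mul_descWord_of_gt ht k (k + 1 + 1) (by omega) hn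
    have h2 := ih (by omega)
    have h3 := ht.braid (k + 1) (by omega) hn
    have h4 : t (k + 1) * (descWord t k * descWord t (k + 1)) =
        descWord t k * descWord t (k + 1) * t 1 := by
      rw [← h2, ← mul_assoc]; rfl
    calc descWord t (k + 1 + 1) * descWord t (k + 1 + 1)
        = t (k + 1 + 1) * t (k + 1) * (descWord t k * t (k + 1 + 1)) *
            (t (k + 1) * descWord t k) := by simp only [descWord, mul_assoc]
      _ = (t (k + 1 + 1) * t (k + 1) * t (k + 1 + 1)) * descWord t k *
            (t (k + 1) * descWord t k) := by rw [← h1]; simp only [mul_assoc]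
      _ = t (k + 1) * t (k + 1 + 1) *
            (t (k + 1) * (descWord t k * descWord t (k + 1))) := by
          rw [← h3]; simp only [descWord, mul_assoc]
      _ = t (k + 1) * (t (k + 1 + 1) * descWord t k) * descWord t (k + 1) * t 1 := by
          rw [h4]; simp only [mul_assoc]
      _ = _ := by rw [h1]; simp only [descWord, mul_assoc]

theorem mul_ascWord_of_lt (k j i : ℕ) (hi : i + j < k) (hn : k < n) :
    t i * ascWord t k j = ascWord t k j * t i := by
  induction j with
  | zero => simp [ascWord]
  | succ j ih =>
    rw [ascWord, ← mul_assoc, ht.comm i (k - j) (by omega) (by omega), mul_assoc,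
      ih (by omega), mul_assoc]

theorem mul_ascWord_of_gt (k j i : ℕ) (hj : j ≤ k) (hi : k < i + j) (hik : i + 1 ≤ k) (hn : k < n) :
    t (i + 1) * ascWord t k j = ascWord t k j * t i := by
  induction j with
  | zero => omega
  | succ j ih =>
    by_cases h : k < i + j
    · rw [ascWord, ← mul_assoc, ← ht.comm (k - j) (i + 1) (by omega) (by omega), mul_assoc,
        ih (by omega) h, mul_assoc]
    · obtain rfl : k = i + j := by omega
      obtain ⟨m, rfl⟩ : ∃ m, j = m + 1 := ⟨j - 1, by omega⟩
      have e1 : i + (m + 1) - (m + 1) = i := by omega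
      have e2 : i + (m + 1) - m = i + 1 := by omega
      rw [ascWord, ascWord, e1, e2, ← mul_assoc, ← mul_assoc,
        ← ht.braid i (by omega) (by omega), mul_assoc,
        mul_ascWord_of_lt ht (i + (m + 1)) m i (by omega) hn]
      simp only [mul_assoc]

omit ht

variable (t)

/-- Words that represent the elements of the symmetric group generated by `t_1, …, t_k`. -/
def typeAWords : ℕ → List R
  | 0 => [1]
  | k + 1 => (List.range (k + 2)).flatMap fun j =>
      (typeAWords k).map fun x => ascWord t (k + 1) j * x

omit [Algebra ℂ R] in
theorem length_typeAWords (k : ℕ) : (typeAWords t k).length = (k + 1).factorial := by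
  induction k with
  | zero => rfl
  | succ k ih => simp [typeAWords, List.length_flatMap, ih, Nat.factorial_succ]

/-- Words that represent the cosets of the symmetric group in the group of type `B_n`, using
only those `t_k ⋯ t_0` for which `k ≥ n - j`. -/
def cosetWords (n : ℕ) : ℕ → List R
  | 0 => [1]
  | j + 1 => cosetWords n j ++ (cosetWords n j).map fun x => descWord t (n - 1 - j) * x

omit [Algebra ℂ R] in
theorem length_cosetWords (n j : ℕ) : (cosetWords t n j).length = 2 ^ j := by
  induction j with
  | zero => rfl
  | succ j ih => simp [cosetWords, ih, pow_succ]; ring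

variable {t}

theorem ascWord_mul_mem {k j : ℕ} (hj : j < k + 2) {y : R}
    (hy : y ∈ Submodule.span ℂ {x | x ∈ typeAWords t k}) :
    ascWord t (k + 1) j * y ∈ Submodule.span ℂ {x | x ∈ typeAWords t (k + 1)} := by
  induction hy using Submodule.span_induction with
  | mem y hy =>
    refine Submodule.subset_span ?_
    simp only [typeAWords, Set.mem_ofPred_eq, List.mem_flatMap, List.mem_map, List.mem_range]
    exact ⟨j, hj, y, hy, rfl⟩
  | zero => simp
  | add y z _ _ hy hz => rw [mul_add]; exact add_mem hy hz
  | smul c y _ hy => rw [mul_smul_comm]; exact Submodule.smul_mem _ _ hy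

include ht in
theorem mul_mem_span_typeAWords (k : ℕ) (hk : k < n) (i : ℕ) (h1 : 1 ≤ i) (hi : i ≤ k) {y : R}
    (hy : y ∈ Submodule.span ℂ {x | x ∈ typeAWords t k}) :
    t i * y ∈ Submodule.span ℂ {x | x ∈ typeAWords t k} := by
  induction k generalizing i y with
  | zero => omega
  | succ k ih =>
    induction hy using Submodule.span_induction with
    | mem y hy =>
      simp only [typeAWords, Set.mem_ofPred_eq, List.mem_flatMap, List.mem_map,
        List.mem_range] at hy
      obtain ⟨j, hj, x, hx, rfl⟩ := hy
      have hx : x ∈ Submodule.span ℂ {x | x ∈ typeAWords t k} := Submodule.subset_span hx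
      -- The word starts with `t_{k+2-j}`: the index `i` lies below its left neighbour, extends the
      -- word, or occurs in it.
      rcases lt_trichotomy (i + j) (k + 1) with h | h | h
      · rw [← mul_assoc, mul_ascWord_of_lt ht (k + 1) j i h hk, mul_assoc]
        exact ascWord_mul_mem hj (ih (by omega) i h1 (by omega) hx)
      · have : t i * (ascWord t (k + 1) j * x) = ascWord t (k + 1) (j + 1) * x := by
          rw [ascWord, ← mul_assoc]; congr; omega
        rw [this]
        exact ascWord_mul_mem (by omega) hx
      · obtain ⟨m, rfl⟩ : ∃ m, i = m + 1 := ⟨i - 1, by omega⟩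
        by_cases h' : m + j = k + 1
        · obtain ⟨l, rfl⟩ : ∃ l, j = l + 1 := ⟨j - 1, by omega⟩
          obtain ⟨c, hc⟩ := ht.quadratic (m + 1) (by omega)
          have e : k + 1 - l = m + 1 := by omega
          have : t (m + 1) * (ascWord t (k + 1) (l + 1) * x) =
              c • (ascWord t (k + 1) (l + 1) * x) + ascWord t (k + 1) l * x := by
            rw [ascWord, e, mul_assoc, ← mul_assoc (t (m + 1)) (t (m + 1)), hc, add_mul, one_mul,
              smul_mul_assoc]
          rw [this]
          exact add_mem (Submodule.smul_mem _ _ (ascWord_mul_mem hj hx))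
            (ascWord_mul_mem (by omega) hx)
        · rw [← mul_assoc, mul_ascWord_of_gt ht (k + 1) j m (by omega) (by omega) hi hk, mul_assoc]
          exact ascWord_mul_mem hj (ih (by omega) m (by omega) (by omega) hx)
    | zero => simp
    | add y z _ _ hy hz => rw [mul_add]; exact add_mem hy hz
    | smul c y _ hy => rw [mul_smul_comm]; exact Submodule.smul_mem _ _ hy

/-- The sum of the spaces `x * H` for the coset words `x` that involve only `t_k ⋯ t_0` with
`k ≥ n - j`. -/
def cosetSpan (t : ℕ → R) (n : ℕ) (H : Submodule ℂ R) (j : ℕ) : Submodule ℂ R :=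
  Submodule.span ℂ {y | ∃ x ∈ cosetWords t n j, ∃ h ∈ H, y = x * h}

theorem cosetSpan_zero (H : Submodule ℂ R) : cosetSpan t n H 0 = H := by
  rw [cosetSpan]
  convert Submodule.span_eq H using 2
  ext y
  simp [cosetWords]

theorem cosetSpan_le_succ (H : Submodule ℂ R) (j : ℕ) :
    cosetSpan t n H j ≤ cosetSpan t n H (j + 1) := by
  refine Submodule.span_mono ?_
  rintro _ ⟨x, hx, h, hh, rfl⟩
  exact ⟨x, by simp [cosetWords, hx], h, hh, rfl⟩

theorem descWord_mul_mem {H : Submodule ℂ R} {j k : ℕ} (hk : n - 1 - j = k) {y : R}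
    (hy : y ∈ cosetSpan t n H j) : descWord t k * y ∈ cosetSpan t n H (j + 1) := by
  subst hk
  induction hy using Submodule.span_induction with
  | mem y hy =>
    obtain ⟨x, hx, h, hh, rfl⟩ := hy
    refine Submodule.subset_span ⟨descWord t (n - 1 - j) * x, ?_, h, hh, (mul_assoc _ _ _).symm⟩
    simp only [cosetWords, List.mem_append, List.mem_map]
    exact Or.inr ⟨x, hx, rfl⟩
  | zero => simp
  | add y z _ _ hy hz => rw [mul_add]; exact add_mem hy hz
  | smul c y _ hy => rw [mul_smul_comm]; exact Submodule.smul_mem _ _ hy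

theorem cosetSpan_succ_induction {H : Submodule ℂ R} {j k : ℕ} (hk : n - 1 - j = k)
    {S : Submodule ℂ R} {f : R →ₗ[ℂ] R} (h1 : ∀ y ∈ cosetSpan t n H j, f y ∈ S)
    (h2 : ∀ y ∈ cosetSpan t n H j, f (descWord t k * y) ∈ S) {y : R}
    (hy : y ∈ cosetSpan t n H (j + 1)) : f y ∈ S := by
  subst hk
  induction hy using Submodule.span_induction with
  | mem y hy =>
    obtain ⟨x, hx, h, hh, rfl⟩ := hy
    simp only [cosetWords, List.mem_append, List.mem_map] at hx
    rcases hx with hx | ⟨x, hx, rfl⟩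
    · exact h1 _ (Submodule.subset_span ⟨x, hx, h, hh, rfl⟩)
    · rw [mul_assoc]
      exact h2 _ (Submodule.subset_span ⟨x, hx, h, hh, rfl⟩)
  | zero => simp
  | add y z _ _ hy hz => rw [map_add]; exact add_mem hy hz
  | smul c y _ hy => rw [map_smul]; exact Submodule.smul_mem _ _ hy

section Stable

include ht

variable {H : Submodule ℂ R} (hH : ∀ i, 1 ≤ i → i < n → ∀ y ∈ H, t i * y ∈ H)

include hH

/-- The case `i < n - j`: the generator `t_i` moves past each `t_k ⋯ t_0` with `k ≥ n - j`, which
raises its index by one, and is absorbed by `H`. -/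
theorem mul_mem_cosetSpan_of_lt (j : ℕ) (hj : j ≤ n) (i : ℕ) (h1 : 1 ≤ i) (hi : i + j < n) {y : R}
    (hy : y ∈ cosetSpan t n H j) : t i * y ∈ cosetSpan t n H j := by
  induction j generalizing i y with
  | zero => rw [cosetSpan_zero] at hy ⊢; exact hH i h1 (by omega) y hy
  | succ j ih =>
    refine cosetSpan_succ_induction (k := n - 1 - j) (f := LinearMap.mulLeft ℂ (t i)) rfl
      (fun y hy => ?_) (fun y hy => ?_) hy
    · exact cosetSpan_le_succ _ _ (ih (by omega) i h1 (by omega) hy)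
    · rw [LinearMap.mulLeft_apply, ← mul_assoc,
        mul_descWord_of_lt ht _ i h1 (by omega) (by omega), mul_assoc]
      exact descWord_mul_mem rfl (ih (by omega) (i + 1) (by omega) (by omega) hy)

/-- The case `i > n - j`. Either `t_i` commutes with the leftmost factor, or both `t_i ⋯ t_0` and
`t_{i-1} ⋯ t_0` may occur on the left, and `t_i` maps their combinations to each other by the
quadratic relation and `descWord_mul_self`. -/
theorem mul_mem_cosetSpan_of_gt (j : ℕ) (hj : j ≤ n) (i : ℕ) (h1 : n < i + j) (hi : i < n) {y : R}
    (hy : y ∈ cosetSpan t n H j) : t i * y ∈ cosetSpan t n H j := by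
  induction j generalizing i y with
  | zero => omega
  | succ j ih =>
    by_cases h : n < i + j
    · refine cosetSpan_succ_induction (k := n - 1 - j) (f := LinearMap.mulLeft ℂ (t i)) rfl
        (fun y hy => ?_) (fun y hy => ?_) hy
      · exact cosetSpan_le_succ _ _ (ih (by omega) i h hi hy)
      · rw [LinearMap.mulLeft_apply, ← mul_assoc,
          mul_descWord_of_gt ht _ i (by omega) (by omega), mul_assoc]
        exact descWord_mul_mem rfl (ih (by omega) i h hi hy)
    · obtain ⟨l, rfl⟩ : ∃ l, j = l + 1 := ⟨j - 1, by omega⟩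
      obtain ⟨k, rfl⟩ : ∃ k, i = k + 1 := ⟨i - 1, by omega⟩
      have e1 : n - 1 - (l + 1) = k := by omega
      have e2 : n - 1 - l = k + 1 := by omega
      obtain ⟨c, hc⟩ := ht.quadratic (k + 1) hi
      refine cosetSpan_succ_induction (k := k) (f := LinearMap.mulLeft ℂ (t (k + 1))) e1
        (fun y hy => ?_) (fun y hy => ?_) hy
      · refine cosetSpan_succ_induction (k := k + 1) (f := LinearMap.mulLeft ℂ (t (k + 1))) e2
          (fun y hy => ?_) (fun y hy => ?_) hy
        · exact cosetSpan_le_succ _ _ (cosetSpan_le_succ _ _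
            (mul_mem_cosetSpan_of_lt ht hH l (by omega) (k + 1) (by omega) (by omega) hy))
        · have : t (k + 1) * (descWord t (k + 1) * y) =
              c • (descWord t (k + 1) * y) + descWord t k * y := by
            rw [descWord, mul_assoc, ← mul_assoc (t (k + 1)) (t (k + 1)), hc, add_mul, one_mul,
              smul_mul_assoc]
          rw [LinearMap.mulLeft_apply, this]
          exact add_mem (Submodule.smul_mem _ _ (cosetSpan_le_succ _ _ (descWord_mul_mem e2 hy)))
            (descWord_mul_mem e1 (cosetSpan_le_succ _ _ hy))
      · rw [LinearMap.mulLeft_apply, ← mul_assoc]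
        change descWord t (k + 1) * y ∈ _
        refine cosetSpan_succ_induction (k := k + 1)
          (f := LinearMap.mulLeft ℂ (descWord t (k + 1))) e2 (fun y hy => ?_) (fun y hy => ?_) hy
        · exact cosetSpan_le_succ _ _ (descWord_mul_mem e2 hy)
        · rw [LinearMap.mulLeft_apply, ← mul_assoc, descWord_mul_self ht k hi, mul_assoc,
            mul_assoc]
          refine descWord_mul_mem e1 (descWord_mul_mem e2 ?_)
          exact mul_mem_cosetSpan_of_lt ht hH l (by omega) 1 le_rfl (by omega) hy

/-- If `H` is stable under `t_1, …, t_{n-1}` then the sum of the `x * H` for all coset words `x`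
is stable under `t_0, …, t_{n-1}`. -/
theorem mul_mem_cosetSpan (i : ℕ) (hi : i < n) {y : R} (hy : y ∈ cosetSpan t n H n) :
    t i * y ∈ cosetSpan t n H n := by
  rcases Nat.eq_zero_or_pos i with rfl | h
  · obtain ⟨j, rfl⟩ : ∃ j, n = j + 1 := ⟨n - 1, by omega⟩
    have e : j + 1 - 1 - j = 0 := by omega
    obtain ⟨c, hc⟩ := ht.quadratic 0 hi
    refine cosetSpan_succ_induction (k := 0) (f := LinearMap.mulLeft ℂ (t 0)) e
      (fun y hy => ?_) (fun y hy => ?_) hy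
    · exact descWord_mul_mem e hy
    · rw [LinearMap.mulLeft_apply, descWord, ← mul_assoc, hc, add_mul, one_mul, smul_mul_assoc]
      exact add_mem (Submodule.smul_mem _ _ (descWord_mul_mem e hy)) (cosetSpan_le_succ _ _ hy)
  · exact mul_mem_cosetSpan_of_gt ht hH n le_rfl i (by omega) hi hy

end Stable

/-- Words that represent the elements of the Weyl group of type `B_n`. -/
def typeBWords (t : ℕ → R) (n : ℕ) : List R :=
  (cosetWords t n n).flatMap fun x => (typeAWords t (n - 1)).map fun y => x * y

omit [Algebra ℂ R] in
theorem length_typeBWords (t : ℕ → R) (n : ℕ) :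
    (typeBWords t n).length = 2 ^ n * n.factorial := by
  have : (n - 1 + 1).factorial = n.factorial := by
    rcases n with - | n
    · rfl
    · rfl
  simp [typeBWords, List.length_flatMap, length_typeAWords, length_cosetWords, this]

theorem span_typeBWords (t : ℕ → R) (n : ℕ) :
    Submodule.span ℂ {x | x ∈ typeBWords t n} =
      cosetSpan t n (Submodule.span ℂ {x | x ∈ typeAWords t (n - 1)}) n := by
  refine le_antisymm (Submodule.span_le.2 ?_) (Submodule.span_le.2 ?_)
  · intro y hy
    simp only [typeBWords, Set.mem_ofPred_eq, List.mem_flatMap, List.mem_map] at hy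
    obtain ⟨x, hx, z, hz, rfl⟩ := hy
    exact Submodule.subset_span ⟨x, hx, z, Submodule.subset_span hz, rfl⟩
  · rintro _ ⟨x, hx, z, hz, rfl⟩
    refine Submodule.span_induction (p := fun z _ => x * z ∈ _) ?_ ?_ ?_ ?_ hz
    · intro z hz
      refine Submodule.subset_span ?_
      simp only [typeBWords, Set.mem_ofPred_eq, List.mem_flatMap, List.mem_map]
      exact ⟨x, hx, z, hz, rfl⟩
    · simp
    · intro y z _ _ hy hz
      rw [mul_add]; exact add_mem hy hz
    · intro c y _ hy
      rw [mul_smul_comm]; exact Submodule.smul_mem _ _ hy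

include ht in
theorem mul_mem_span_typeBWords (i : ℕ) (hi : i < n) {y : R}
    (hy : y ∈ Submodule.span ℂ {x | x ∈ typeBWords t n}) :
    t i * y ∈ Submodule.span ℂ {x | x ∈ typeBWords t n} := by
  rw [span_typeBWords] at hy ⊢
  exact mul_mem_cosetSpan ht (fun i h1 hi y hy =>
    mul_mem_span_typeAWords ht (n - 1) (by omega) i h1 (by omega) hy) i hi hy

omit [Algebra ℂ R] in
theorem one_mem_typeBWords (t : ℕ → R) (n : ℕ) : (1 : R) ∈ typeBWords t n := by
  have h1 : ∀ k, (1 : R) ∈ typeAWords t k := by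
    intro k
    induction k with
    | zero => simp [typeAWords]
    | succ k ih =>
      simp only [typeAWords, List.mem_flatMap, List.mem_map, List.mem_range]
      exact ⟨0, by omega, 1, ih, by simp [ascWord]⟩
  have h2 : ∀ j, (1 : R) ∈ cosetWords t n j := by
    intro j
    induction j with
    | zero => simp [cosetWords]
    | succ j ih => simp [cosetWords, ih]
  simp only [typeBWords, List.mem_flatMap, List.mem_map]
  exact ⟨1, h2 n, 1, h1 _, mul_one 1⟩

end Words

end HeckeB
end

noncomputable section

namespace HeckeB

/-! ### Spanning sets of the affine Hecke algebra -/

section Skew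

variable {A L : Type*} [Ring A] [Algebra ℂ A] [CommRing L] [Algebra ℂ L]

/-- The elements `f` of a commutative algebra that can be moved past `T` up to terms without `T`
and the automorphism `σ`. -/
def skewSubalgebra (ℓ : L →ₐ[ℂ] A) (σ : L ≃ₐ[ℂ] L) (T : A) : Subalgebra ℂ L where
  carrier := {f | ∃ g, T * ℓ f = ℓ (σ f) * T + ℓ g}
  mul_mem' := by
    rintro f f' ⟨g, hg⟩ ⟨g', hg'⟩
    refine ⟨σ f * g' + g * f', ?_⟩
    rw [map_mul, ← mul_assoc, hg, add_mul, mul_assoc, hg', map_mul, map_mul, map_add, map_mul,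
      map_mul]
    noncomm_ring
  add_mem' := by
    rintro f f' ⟨g, hg⟩ ⟨g', hg'⟩
    refine ⟨g + g', ?_⟩
    rw [map_add, mul_add, hg, hg', map_add, map_add, map_add]
    noncomm_ring
  algebraMap_mem' c := by
    refine ⟨0, ?_⟩
    simp only [AlgHom.commutes, AlgEquiv.commutes, map_zero, add_zero]
    exact (Algebra.commutes c T).symm

theorem mem_skewSubalgebra_of_mul_eq_one {ℓ : L →ₐ[ℂ] A} {σ : L ≃ₐ[ℂ] L} {T : A} {f f' : L}
    (h : f * f' = 1) (hf : f ∈ skewSubalgebra ℓ σ T) : f' ∈ skewSubalgebra ℓ σ T := by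
  obtain ⟨g, hg⟩ := hf
  refine ⟨-(σ f' * g * f'), ?_⟩
  have h1 : ℓ f * ℓ f' = 1 := by rw [← map_mul, h, map_one]
  have h2 : ℓ (σ f') * ℓ (σ f) = 1 := by
    rw [← map_mul, ← map_mul, mul_comm, h, map_one, map_one]
  have h3 : ℓ (σ f') * (T * ℓ f) * ℓ f' = ℓ (σ f') * T := by
    rw [mul_assoc, mul_assoc, h1, mul_one]
  rw [hg, mul_add, add_mul, ← mul_assoc, h2, one_mul] at h3
  rw [map_neg, map_mul, map_mul, ← h3]
  noncomm_ring

end Skew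

variable (p₀ p₁ : ℂˣ) (n : ℕ)

/-- The generators `T_i`, continued by one. -/
def tGen (i : ℕ) : HeckeB p₀ p₁ n := if h : i < n then gen p₀ p₁ n (.T ⟨i, h⟩) else 1

variable {n}

theorem tGen_eq {i : ℕ} (h : i < n) : tGen p₀ p₁ n i = gen p₀ p₁ n (.T ⟨i, h⟩) := dif_pos h

theorem quadratic_of_factor {A : Type*} [Ring A] [Algebra ℂ A] (p : ℂˣ) (x : A)
    (h : (x - algebraMap ℂ A p) * (x + algebraMap ℂ A (p : ℂ)⁻¹) = 0) :
    x * x = ((p : ℂ) - (p : ℂ)⁻¹) • x + 1 := by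
  have h1 : algebraMap ℂ A p * algebraMap ℂ A (p : ℂ)⁻¹ = 1 := by
    rw [← map_mul, mul_inv_cancel₀ p.ne_zero, map_one]
  have h2 : x * algebraMap ℂ A (p : ℂ)⁻¹ = algebraMap ℂ A (p : ℂ)⁻¹ * x :=
    (Algebra.commutes _ _).symm
  rw [sub_mul, mul_add, mul_add, h1, h2] at h
  rw [sub_smul, Algebra.smul_def, Algebra.smul_def, ← sub_eq_zero, ← h]
  noncomm_ring

/-- The parameter of the quadratic relation for `T_i`. -/
def param (i : ℕ) : ℂˣ := if i = 0 then p₀ else p₁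

theorem tGen_mul_self {i : ℕ} (hi : i < n) : tGen p₀ p₁ n i * tGen p₀ p₁ n i =
    ((param p₀ p₁ i : ℂ) - (param p₀ p₁ i : ℂ)⁻¹) • tGen p₀ p₁ n i + 1 := by
  rw [tGen_eq p₀ p₁ hi]
  refine quadratic_of_factor _ _ ?_
  rcases i with - | i
  · have h := gen_rel p₀ p₁ (Rel.quadratic_zero (p₀ := p₀) (p₁ := p₁) hi)
    simp only [map_mul, map_sub, map_add, map_zero, AlgHom.commutes] at h
    exact h
  · have h := gen_rel p₀ p₁ (Rel.quadratic (p₀ := p₀) (p₁ := p₁) (i + 1) (by omega) hi)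
    simp only [map_mul, map_sub, map_add, map_zero, AlgHom.commutes] at h
    exact h

theorem isHeckeFamily_tGen : IsHeckeFamily (tGen p₀ p₁ n) n where
  quadratic i hi := ⟨_, tGen_mul_self p₀ p₁ hi⟩
  braid_zero h := by
    rw [tGen_eq p₀ p₁ h, tGen_eq p₀ p₁ (zero_lt_one.trans h)]
    have h := gen_rel p₀ p₁ (Rel.braid_zero (p₀ := p₀) (p₁ := p₁) (zero_lt_one.trans h) h)
    simp only [map_mul] at h
    exact h
  braid i hi h := by
    rw [tGen_eq p₀ p₁ h, tGen_eq p₀ p₁ (i.lt_succ_self.trans h)]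
    have h := gen_rel p₀ p₁ (Rel.braid (p₀ := p₀) (p₁ := p₁) i hi (i.lt_succ_self.trans h) h)
    simp only [map_mul] at h
    exact h
  comm i j hij hj := by
    have hi : i < n := by omega
    rw [tGen_eq p₀ p₁ hj, tGen_eq p₀ p₁ hi]
    have h := gen_rel p₀ p₁ (Rel.T_comm (p₀ := p₀) (p₁ := p₁) i j hi hj hij)
    simp only [map_mul] at h
    exact h

/-- The lattice automorphism by which `T_i` acts: a sign change for `i = 0` and a
transposition otherwise. -/
def reflAut (i : Fin n) : LatAut n :=
  if (i : ℕ) = 0 then flipAut i else swapAut ⟨i - 1, by omega⟩ i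

theorem reflAut_zero (h : 0 < n) : reflAut ⟨0, h⟩ = flipAut (⟨0, h⟩ : Fin n) := rfl

theorem reflAut_succ (k : ℕ) (h : k + 1 < n) :
    reflAut ⟨k + 1, h⟩ = swapAut (⟨k, by omega⟩ : Fin n) ⟨k + 1, h⟩ := rfl

/-- The action of lattice automorphisms on Laurent polynomials. -/
def laurentAut (g : LatAut n) :
    AddMonoidAlgebra ℂ (Fin n → ℤ) ≃ₐ[ℂ] AddMonoidAlgebra ℂ (Fin n → ℤ) :=
  AddMonoidAlgebra.domCongr ℂ ℂ g.toAddEquiv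

theorem toRat_laurentAut (g : LatAut n) (f : AddMonoidAlgebra ℂ (Fin n → ℤ)) :
    toRat n (laurentAut g f) = aut g (toRat n f) :=
  (IsFractionRing.algEquivOfAlgEquiv_algebraMap (R := ℂ)
    (K := FractionRing (AddMonoidAlgebra ℂ (Fin n → ℤ)))
    (L := FractionRing (AddMonoidAlgebra ℂ (Fin n → ℤ)))
    (AddMonoidAlgebra.domCongr ℂ ℂ g.toAddEquiv) f).symm

theorem laurentAut_permAut_varX (σ : Equiv.Perm (Fin n)) (a : Fin n) :
    laurentAut (permAut σ) (varX a) = varX (σ a) :=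
  toRat_injective (by rw [toRat_laurentAut, toRat_varX, toRat_varX, aut_permAut_ratX])

theorem laurentAut_permAut_varXinv (σ : Equiv.Perm (Fin n)) (a : Fin n) :
    laurentAut (permAut σ) (varXinv a) = varXinv (σ a) :=
  toRat_injective (by
    rw [toRat_laurentAut, toRat_varXinv, toRat_varXinv, map_inv₀, aut_permAut_ratX])

theorem laurentAut_flipAut_varX_self (a : Fin n) : laurentAut (flipAut a) (varX a) = varXinv a :=
  toRat_injective (by rw [toRat_laurentAut, toRat_varX, toRat_varXinv, aut_flipAut_ratX_self])

theorem laurentAut_flipAut_varXinv_self (a : Fin n) :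
    laurentAut (flipAut a) (varXinv a) = varX a :=
  toRat_injective (by
    rw [toRat_laurentAut, toRat_varX, toRat_varXinv, map_inv₀, aut_flipAut_ratX_self, inv_inv])

theorem laurentAut_flipAut_varX_of_ne {a b : Fin n} (h : b ≠ a) :
    laurentAut (flipAut a) (varX b) = varX b :=
  toRat_injective (by rw [toRat_laurentAut, toRat_varX, aut_flipAut_ratX_of_ne h])

theorem laurentAut_flipAut_varXinv_of_ne {a b : Fin n} (h : b ≠ a) :
    laurentAut (flipAut a) (varXinv b) = varXinv b :=
  toRat_injective (by rw [toRat_laurentAut, toRat_varXinv, map_inv₀, aut_flipAut_ratX_of_ne h])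

theorem varX_mul_varXinv (i : Fin n) : varX i * varXinv i = 1 := by
  rw [varX, varXinv, AddMonoidAlgebra.single_mul_single, ← Pi.single_add]
  simp [AddMonoidAlgebra.one_def]

theorem varX_mem_skewSubalgebra (i j : Fin n) :
    varX j ∈ skewSubalgebra (laurentHom p₀ p₁ n) (laurentAut (reflAut i)) (gen p₀ p₁ n (.T i)) := by
  obtain ⟨i, hi⟩ := i
  have hq := tGen_mul_self p₀ p₁ hi
  rw [tGen_eq p₀ p₁ hi] at hq
  rcases i with - | i
  · rw [reflAut_zero]
    by_cases h : j = ⟨0, hi⟩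
    · subst h
      have h := gen_rel p₀ p₁ (Rel.T_zero_X (p₀ := p₀) (p₁ := p₁) hi)
      simp only [map_mul] at h
      change gen p₀ p₁ n (.T ⟨0, hi⟩) * gen p₀ p₁ n (.Xinv ⟨0, hi⟩) * gen p₀ p₁ n (.T ⟨0, hi⟩) =
        gen p₀ p₁ n (.X ⟨0, hi⟩) at h
      refine ⟨((param p₀ p₁ 0 : ℂ) - (param p₀ p₁ 0 : ℂ)⁻¹) • varX ⟨0, hi⟩, ?_⟩
      rw [laurentAut_flipAut_varX_self, laurentHom_varXinv, map_smul, laurentHom_varX, ← h,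
        ← mul_assoc, ← mul_assoc, hq]
      simp only [add_mul, smul_mul_assoc, one_mul]
      abel
    · rw [← Ne, Ne, Fin.ext_iff] at h
      have h' := gen_rel p₀ p₁ (Rel.T_X_comm (p₀ := p₀) (p₁ := p₁) 0 j hi j.2 (by omega) h)
      simp only [map_mul] at h'
      refine ⟨0, ?_⟩
      rw [laurentAut_flipAut_varX_of_ne (fun h' => h (congrArg Fin.val h')), map_zero, add_zero,
        laurentHom_varX]
      exact h'
  · rw [reflAut_succ]
    have h := gen_rel p₀ p₁ (Rel.T_X (p₀ := p₀) (p₁ := p₁) i (by omega) hi)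
    simp only [map_mul] at h
    change gen p₀ p₁ n (.T ⟨i + 1, hi⟩) * gen p₀ p₁ n (.X ⟨i, _⟩) * gen p₀ p₁ n (.T ⟨i + 1, hi⟩) =
        gen p₀ p₁ n (.X ⟨i + 1, hi⟩) at h
    by_cases h1 : j = ⟨i, by omega⟩
    · subst h1
      refine ⟨-(((param p₀ p₁ (i + 1) : ℂ) - (param p₀ p₁ (i + 1) : ℂ)⁻¹) • varX ⟨i + 1, hi⟩), ?_⟩
      rw [laurentAut_permAut_varX, Equiv.swap_apply_left, map_neg, map_smul, laurentHom_varX,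
        laurentHom_varX, ← h, mul_assoc _ _ (gen p₀ p₁ n (.T ⟨i + 1, hi⟩) : HeckeB p₀ p₁ n), hq]
      simp only [mul_add, mul_smul_comm, mul_one, mul_assoc]
      abel
    by_cases h2 : j = ⟨i + 1, hi⟩
    · subst h2
      refine ⟨((param p₀ p₁ (i + 1) : ℂ) - (param p₀ p₁ (i + 1) : ℂ)⁻¹) • varX ⟨i + 1, hi⟩, ?_⟩
      rw [laurentAut_permAut_varX, Equiv.swap_apply_right, map_smul, laurentHom_varX,
        laurentHom_varX, ← h, ← mul_assoc, ← mul_assoc, hq]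
      simp only [add_mul, smul_mul_assoc, one_mul]
      abel
    · have h1' := h1
      have h2' := h2
      rw [Fin.ext_iff] at h1' h2'
      have h' := gen_rel p₀ p₁ (Rel.T_X_comm (p₀ := p₀) (p₁ := p₁) (i + 1) j hi j.2
        (by simp only at h1'; omega) h2')
      simp only [map_mul] at h'
      refine ⟨0, ?_⟩
      rw [laurentAut_permAut_varX, Equiv.swap_apply_of_ne_of_ne h1 h2, map_zero, add_zero,
        laurentHom_varX]
      exact h'

/-- The Bernstein relation, in the weak form that `T_i f - s_i(f) T_i` is a Laurent polynomial. -/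
theorem exists_T_mul_laurentHom (i : Fin n) (f : AddMonoidAlgebra ℂ (Fin n → ℤ)) :
    ∃ g, gen p₀ p₁ n (.T i) * laurentHom p₀ p₁ n f =
      laurentHom p₀ p₁ n (laurentAut (reflAut i) f) * gen p₀ p₁ n (.T i) + laurentHom p₀ p₁ n g :=
  laurent_mem_of_var_mem (fun j => varX_mem_skewSubalgebra p₀ p₁ i j)
    (fun j => mem_skewSubalgebra_of_mul_eq_one (varX_mul_varXinv j)
      (varX_mem_skewSubalgebra p₀ p₁ i j)) f

theorem exists_laurentHom_mul_T (i : Fin n) (f : AddMonoidAlgebra ℂ (Fin n → ℤ)) :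
    ∃ f' g, laurentHom p₀ p₁ n f * gen p₀ p₁ n (.T i) =
      gen p₀ p₁ n (.T i) * laurentHom p₀ p₁ n f' + laurentHom p₀ p₁ n g := by
  obtain ⟨g, hg⟩ := exists_T_mul_laurentHom p₀ p₁ i ((laurentAut (reflAut i)).symm f)
  refine ⟨(laurentAut (reflAut i)).symm f, -g, ?_⟩
  rw [hg, AlgEquiv.apply_symm_apply, map_neg]
  abel

/-- A subspace that contains `1` and is stable under left multiplication by the generators is
everything. -/
theorem eq_top_of_gen_mul_mem {S : Submodule ℂ (HeckeB p₀ p₁ n)} (h1 : 1 ∈ S)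
    (hS : ∀ g, ∀ x ∈ S, gen p₀ p₁ n g * x ∈ S) : S = ⊤ := by
  let B : Subalgebra ℂ (HeckeB p₀ p₁ n) :=
    { carrier := {h | ∀ x ∈ S, h * x ∈ S}
      mul_mem' := fun {a b} ha hb x hx => by rw [mul_assoc]; exact ha _ (hb x hx)
      add_mem' := fun {a b} ha hb x hx => by rw [add_mul]; exact add_mem (ha x hx) (hb x hx)
      algebraMap_mem' := fun c x hx => by
        rw [← Algebra.smul_def]; exact S.smul_mem c hx }
  rw [eq_top_iff]
  intro x _
  have := mem_of_gen_mem p₀ p₁ (S := B) hS x 1 h1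
  rwa [mul_one] at this

/-- The spanning half of the Poincaré–Birkhoff–Witt theorem: Laurent monomials times words in the
finite Hecke algebra span the affine Hecke algebra. -/
theorem span_monomial_mul_typeBWords :
    Submodule.span ℂ {x | ∃ (a : Fin n → ℤ) (e : _) (_ : e ∈ typeBWords (tGen p₀ p₁ n) n),
      x = monomial p₀ p₁ a * e} = ⊤ := by
  set S := Submodule.span ℂ {x | ∃ (a : Fin n → ℤ) (e : _)
    (_ : e ∈ typeBWords (tGen p₀ p₁ n) n), x = monomial p₀ p₁ a * e} with hS
  have h1 : ∀ (a : Fin n → ℤ), ∀ y ∈ Submodule.span ℂ {x | x ∈ typeBWords (tGen p₀ p₁ n) n},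
      monomial p₀ p₁ a * y ∈ S := by
    intro a y hy
    induction hy using Submodule.span_induction with
    | mem y hy => exact Submodule.subset_span ⟨a, y, hy, rfl⟩
    | zero => simp
    | add y z _ _ hy hz => rw [mul_add]; exact add_mem hy hz
    | smul c y _ hy => rw [mul_smul_comm]; exact Submodule.smul_mem _ _ hy
  have h2 : ∀ f, ∀ y ∈ Submodule.span ℂ {x | x ∈ typeBWords (tGen p₀ p₁ n) n},
      laurentHom p₀ p₁ n f * y ∈ S := by
    intro f y hy
    rw [← AddMonoidAlgebra.sum_coeff_single f, Finsupp.sum, map_sum, Finset.sum_mul]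
    refine sum_mem fun a _ => ?_
    rw [laurentHom_single, smul_mul_assoc]
    exact S.smul_mem _ (h1 a y hy)
  refine eq_top_of_gen_mul_mem p₀ p₁ ?_ ?_
  · refine Submodule.subset_span ⟨0, 1, one_mem_typeBWords _ _, ?_⟩
    rw [monomial_zero, one_mul]
  · intro g x hx
    induction hx using Submodule.span_induction with
    | mem x hx =>
      obtain ⟨a, e, he, rfl⟩ := hx
      have he' := Submodule.subset_span (R := ℂ) (s := {x | x ∈ typeBWords (tGen p₀ p₁ n) n}) he
      have ha : monomial p₀ p₁ a = laurentHom p₀ p₁ n (AddMonoidAlgebra.single a 1) := by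
        rw [laurentHom_single, one_smul]
      cases g with
      | T i =>
        obtain ⟨g, hg⟩ := exists_T_mul_laurentHom p₀ p₁ i (AddMonoidAlgebra.single a 1)
        rw [ha, ← mul_assoc, hg, add_mul, mul_assoc]
        refine add_mem (h2 _ _ ?_) (h2 _ _ he')
        have := mul_mem_span_typeBWords (isHeckeFamily_tGen p₀ p₁) i i.2 he'
        rwa [tGen_eq p₀ p₁ i.2] at this
      | X i =>
        rw [ha, ← laurentHom_varX, ← mul_assoc, ← map_mul]
        exact h2 _ _ he'
      | Xinv i =>
        rw [ha, ← laurentHom_varXinv, ← mul_assoc, ← map_mul]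
        exact h2 _ _ he'
    | zero => simp
    | add y z _ _ hy hz => rw [mul_add]; exact add_mem hy hz
    | smul c y _ hy => rw [mul_smul_comm]; exact Submodule.smul_mem _ _ hy

theorem laurentHom_mem_typeA (f : AddMonoidAlgebra ℂ (Fin n → ℤ)) :
    laurentHom p₀ p₁ n f ∈ typeA p₀ p₁ n := by
  refine laurent_mem_of_var_mem (S := (typeA p₀ p₁ n).comap (laurentHom p₀ p₁ n)) ?_ ?_ f
  · intro i
    rw [Subalgebra.mem_comap, laurentHom_varX]
    exact Algebra.subset_adjoin (Or.inr ⟨i, Or.inl rfl⟩)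
  · intro i
    rw [Subalgebra.mem_comap, laurentHom_varXinv]
    exact Algebra.subset_adjoin (Or.inr ⟨i, Or.inr rfl⟩)

theorem tGen_mem_typeA {i : ℕ} (h1 : 1 ≤ i) (hi : i < n) :
    tGen p₀ p₁ n i ∈ typeA p₀ p₁ n := by
  rw [tGen_eq p₀ p₁ hi]
  exact Algebra.subset_adjoin (Or.inl ⟨⟨i, hi⟩, h1, rfl⟩)

/-- The affine Hecke algebra of type `B_n` is the sum of `2 ^ n` cosets of the one of type `A`. -/
theorem cosetSpan_typeA_eq_top :
    cosetSpan (tGen p₀ p₁ n) n (Subalgebra.toSubmodule (typeA p₀ p₁ n)) n = ⊤ := by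
  set Q := cosetSpan (tGen p₀ p₁ n) n (Subalgebra.toSubmodule (typeA p₀ p₁ n)) n with hQ
  have hT : ∀ i : Fin n, ∀ y ∈ Q, gen p₀ p₁ n (.T i) * y ∈ Q := by
    intro i y hy
    have := mul_mem_cosetSpan (isHeckeFamily_tGen p₀ p₁)
      (H := Subalgebra.toSubmodule (typeA p₀ p₁ n))
      (fun i h1 hi y hy => (typeA p₀ p₁ n).mul_mem (tGen_mem_typeA p₀ p₁ h1 hi) hy) i i.2 hy
    rwa [tGen_eq p₀ p₁ i.2] at this
  -- The span of the products of a word and a Laurent polynomial on its right.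
  let S : Submodule ℂ (HeckeB p₀ p₁ n) := Submodule.span ℂ
    {x | ∃ e ∈ Submonoid.closure {x | ∃ i < n, x = tGen p₀ p₁ n i}, ∃ f,
      x = e * laurentHom p₀ p₁ n f}
  have hS1 : ∀ i < n, ∀ y ∈ S, tGen p₀ p₁ n i * y ∈ S := by
    intro i hi y hy
    induction hy using Submodule.span_induction with
    | mem y hy =>
      obtain ⟨e, he, f, rfl⟩ := hy
      exact Submodule.subset_span ⟨_, mul_mem (Submonoid.subset_closure ⟨i, hi, rfl⟩) he, f,
        (mul_assoc _ _ _).symm⟩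
    | zero => simp
    | add y z _ _ hy hz => rw [mul_add]; exact add_mem hy hz
    | smul c y _ hy => rw [mul_smul_comm]; exact Submodule.smul_mem _ _ hy
  -- A Laurent polynomial on the left is moved to the right through the word.
  have hS2 : ∀ e ∈ Submonoid.closure {x | ∃ i < n, x = tGen p₀ p₁ n i}, ∀ f f',
      laurentHom p₀ p₁ n f * (e * laurentHom p₀ p₁ n f') ∈ S := by
    intro e he
    induction he using Submonoid.closure_induction_left with
    | one =>
      intro f f'
      rw [one_mul, ← map_mul]
      exact Submodule.subset_span ⟨1, one_mem _, _, (one_mul _).symm⟩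
    | mul_left x hx y _ ih =>
      intro f f'
      obtain ⟨i, hi, rfl⟩ := hx
      obtain ⟨f1, g1, h⟩ := exists_laurentHom_mul_T p₀ p₁ ⟨i, hi⟩ f
      rw [← tGen_eq p₀ p₁ hi] at h
      rw [mul_assoc, ← mul_assoc, h, add_mul, mul_assoc]
      exact add_mem (hS1 i hi _ (ih _ _)) (ih _ _)
  have hS3 : S = ⊤ := by
    refine eq_top_of_gen_mul_mem p₀ p₁
      (Submodule.subset_span ⟨1, one_mem _, 1, by rw [map_one, mul_one]⟩) ?_
    intro g y hy
    cases g with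
    | T i => rw [← tGen_eq p₀ p₁ i.2]; exact hS1 i i.2 y hy
    | X i =>
      rw [← laurentHom_varX]
      induction hy using Submodule.span_induction with
      | mem y hy => obtain ⟨e, he, f, rfl⟩ := hy; exact hS2 e he _ f
      | zero => simp
      | add y z _ _ hy hz => rw [mul_add]; exact add_mem hy hz
      | smul c y _ hy => rw [mul_smul_comm]; exact Submodule.smul_mem _ _ hy
    | Xinv i =>
      rw [← laurentHom_varXinv]
      induction hy using Submodule.span_induction with
      | mem y hy => obtain ⟨e, he, f, rfl⟩ := hy; exact hS2 e he _ f
      | zero => simp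
      | add y z _ _ hy hz => rw [mul_add]; exact add_mem hy hz
      | smul c y _ hy => rw [mul_smul_comm]; exact Submodule.smul_mem _ _ hy
  -- Words followed by Laurent polynomials lie in `Q`, which contains the Laurent polynomials and is
  -- stable under all `T_i`.
  rw [eq_top_iff, ← hS3]
  refine Submodule.span_le.2 ?_
  rintro _ ⟨e, he, f, rfl⟩
  have hone : ∀ j, (1 : HeckeB p₀ p₁ n) ∈ cosetWords (tGen p₀ p₁ n) n j := by
    intro j
    induction j with
    | zero => simp [cosetWords]
    | succ j ih => simp [cosetWords, ih]
  induction he using Submonoid.closure_induction_left with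
  | one => exact Submodule.subset_span ⟨1, hone n, _, laurentHom_mem_typeA p₀ p₁ f, rfl⟩
  | mul_left x hx y _ ih =>
    obtain ⟨i, hi, rfl⟩ := hx
    rw [mul_assoc, tGen_eq p₀ p₁ hi]
    exact hT _ _ ih

end HeckeB
end

noncomputable section

namespace HeckeB

/-! ### Faithfulness of the representation -/

section Faithful

variable {r : ℕ}

/-- Operators as functions, linearly over the rational functions. -/
def opFun (r : ℕ) : Op r →ₗ[RatFun r] (RatFun r → RatFun r) where
  toFun x := x
  map_add' _ _ := rfl
  map_smul' _ _ := rfl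

/-- Lattice automorphisms are linearly independent over the rational functions, by Dedekind's
theorem. -/
theorem linearIndependent_autOp :
    LinearIndependent (RatFun r) (fun g : LatAut r => autOp g) := by
  refine LinearIndependent.of_comp (opFun r) ?_
  have h := linearIndependent_monoidHom (RatFun r) (RatFun r)
  refine h.comp (fun g : LatAut r => ((aut g : RatFun r ≃ₐ[ℂ] RatFun r) : RatFun r →* RatFun r)) ?_
  intro g g' hg
  refine aut_injective (AlgEquiv.ext fun x => ?_)
  exact DFunLike.congr_fun hg x

theorem smul_eq_mulOp_mul (k : RatFun r) (x : Op r) : k • x = mulOp k * x := rfl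

theorem smul_mono_sub_ne_zero {a b : Fin r → ℤ} (h : a ≠ b) {c d : ℂ} (hc : c ≠ 0) :
    algebraMap ℂ (RatFun r) c * mono a - algebraMap ℂ (RatFun r) d * mono b ≠ 0 := by
  intro h0
  have h1 : LinearIndependent ℂ ![mono a, mono b] := by
    have h2 := linearIndependent_mono.comp ![a, b] (by
      intro i j hij
      fin_cases i <;> fin_cases j <;> simp_all [eq_comm])
    convert h2 using 1
    ext i
    fin_cases i <;> rfl
  refine hc (LinearIndependent.pair_iff.1 h1 c (-d) ?_).1
  rw [Algebra.smul_def, Algebra.smul_def, map_neg, neg_mul, ← sub_eq_add_neg, h0]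

/-- A reflection is recovered from its Demazure–Lusztig operator over the rational functions,
because the coefficient of the reflection in that operator does not vanish. -/
theorem autOp_swap_eq (p : ℂˣ) {a b : Fin r} (hab : a ≠ b) : ∃ k l : RatFun r,
    autOp (swapAut a b) = mulOp k * (opT p a b - mulOp l) := by
  have h1 := ratX_sub_ne_zero hab
  have h2 : (cst p r)⁻¹ * ratX b - cst p r * ratX a ≠ 0 := by
    rw [cst, ← map_inv₀]
    refine smul_mono_sub_ne_zero (fun h => ?_) (inv_ne_zero p.ne_zero)
    have := congrFun h a
    simp [hab] at this
  refine ⟨((cst p r)⁻¹ * ratX b - cst p r * ratX a)⁻¹ * (ratX b - ratX a),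
    (cst p r - (cst p r)⁻¹) * ratX b / (ratX b - ratX a), ?_⟩
  rw [opT, add_sub_cancel_right, ← mul_assoc, ← map_mul]
  have : ((cst p r)⁻¹ * ratX b - cst p r * ratX a)⁻¹ * (ratX b - ratX a) *
    (((cst p r)⁻¹ * ratX b - cst p r * ratX a) / (ratX b - ratX a)) = 1 := by
    rw [mul_assoc, mul_div_cancel₀ _ h1, inv_mul_cancel₀ h2]
  rw [this, map_one, one_mul]

theorem autOp_flip_eq (p : ℂˣ) (a : Fin r) : ∃ k l : RatFun r,
    autOp (flipAut a) = mulOp k * (opT₀ p a - mulOp l) := by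
  have h1 := ratX_sq_sub_ne_zero a
  have h2 : (cst p r)⁻¹ * ratX a ^ 2 - cst p r ≠ 0 := by
    have : (cst p r)⁻¹ * ratX a ^ 2 - cst p r = algebraMap ℂ (RatFun r) (p : ℂ)⁻¹ *
        mono (Pi.single a 1 + Pi.single a 1) - algebraMap ℂ (RatFun r) p * mono 0 := by
      rw [mono_add, mono_zero, cst, ← map_inv₀, ratX, pow_two, mul_one]
    rw [this]
    refine smul_mono_sub_ne_zero (fun h => ?_) (inv_ne_zero p.ne_zero)
    have := congrFun h a
    simp at this
  refine ⟨((cst p r)⁻¹ * ratX a ^ 2 - cst p r)⁻¹ * (ratX a ^ 2 - 1),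
    (cst p r - (cst p r)⁻¹) * ratX a ^ 2 / (ratX a ^ 2 - 1), ?_⟩
  rw [opT₀, add_sub_cancel_right, ← mul_assoc, ← map_mul]
  have : ((cst p r)⁻¹ * ratX a ^ 2 - cst p r)⁻¹ * (ratX a ^ 2 - 1) *
    (((cst p r)⁻¹ * ratX a ^ 2 - cst p r) / (ratX a ^ 2 - 1)) = 1 := by
    rw [mul_assoc, mul_div_cancel₀ _ h1, inv_mul_cancel₀ h2]
  rw [this, map_one, one_mul]

/-- The lattice automorphisms that preserve a space of operators. -/
def stabMonoid (V : Submodule (RatFun r) (Op r)) : Submonoid (LatAut r) where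
  carrier := {g | ∀ x ∈ V, autOp g * x ∈ V}
  mul_mem' := fun {g h} hg hh x hx => by
    rw [map_mul, mul_assoc]; exact hg _ (hh x hx)
  one_mem' := fun x hx => by rwa [map_one, one_mul]

variable (p₀ p₁ : ℂˣ) {n : ℕ} {ι : Fin n → Fin r} (hι : Function.Injective ι)
  {V : Submodule (RatFun r) (Op r)}
  (hV : ∀ i : Fin n, ∀ x ∈ V, genOp p₀ p₁ ι (.T i) * x ∈ V)

include hι hV

/-- A space of operators over the rational functions that is stable under the operators of the `T_i`
is stable under the reflections themselves. -/
theorem swapAut_mem_stabMonoid (k : ℕ) (hk : k + 1 < n) :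
    swapAut (ι ⟨k, by omega⟩) (ι ⟨k + 1, hk⟩) ∈ stabMonoid V := by
  intro x hx
  obtain ⟨c, l, h⟩ := autOp_swap_eq p₁ (a := ι ⟨k, by omega⟩) (b := ι ⟨k + 1, hk⟩)
    (fun h => by have := hι h; simp at this)
  rw [h, mul_assoc, sub_mul]
  exact V.smul_mem c (sub_mem (hV ⟨k + 1, hk⟩ x hx) (V.smul_mem l hx))

omit hι in
theorem flipAut_zero_mem_stabMonoid (h0 : 0 < n) : flipAut (ι ⟨0, h0⟩) ∈ stabMonoid V := by
  intro x hx
  obtain ⟨c, l, h⟩ := autOp_flip_eq p₀ (ι ⟨0, h0⟩)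
  rw [h, mul_assoc, sub_mul]
  exact V.smul_mem c (sub_mem (hV ⟨0, h0⟩ x hx) (V.smul_mem l hx))

omit hV in
theorem viaEmbedding_swap (i j : Fin n) :
    Equiv.Perm.viaEmbeddingHom ⟨ι, hι⟩ (Equiv.swap i j) = Equiv.swap (ι i) (ι j) := by
  ext1 x
  rw [Equiv.Perm.viaEmbeddingHom_apply]
  by_cases hx : ∃ y, ι y = x
  · obtain ⟨y, rfl⟩ := hx
    exact (Equiv.Perm.viaEmbedding_apply _ ⟨ι, hι⟩ y).trans
      (Function.Injective.map_swap hι i j y)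
  · rw [Equiv.Perm.viaEmbedding_apply_of_notMem _ ⟨ι, hι⟩ x (by simpa using hx),
      Equiv.swap_apply_of_ne_of_ne] <;>
    · rintro rfl
      exact hx ⟨_, rfl⟩

theorem permAut_mem_stabMonoid (σ : Equiv.Perm (Fin n)) :
    permAut (Equiv.Perm.viaEmbeddingHom ⟨ι, hι⟩ σ) ∈ stabMonoid V := by
  rcases n with - | n
  · rw [Subsingleton.elim σ 1, map_one, map_one]; exact one_mem _
  have h : Submonoid.closure (Set.range fun i : Fin n => Equiv.swap i.castSucc i.succ) ≤
      (stabMonoid V).comap (permAut.comp (Equiv.Perm.viaEmbeddingHom ⟨ι, hι⟩)) := by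
    rw [Submonoid.closure_le]
    rintro _ ⟨i, rfl⟩
    change permAut (Equiv.Perm.viaEmbeddingHom ⟨ι, hι⟩ _) ∈ stabMonoid V
    rw [viaEmbedding_swap hι]
    exact swapAut_mem_stabMonoid p₀ p₁ hι hV i (by omega)
  rw [Equiv.Perm.mclosure_swap_castSucc_succ] at h
  exact h (Submonoid.mem_top σ)

theorem flipAut_mem_stabMonoid (j : Fin n) : flipAut (ι j) ∈ stabMonoid V := by
  have h0 : 0 < n := j.pos
  have h1 := permAut_mem_stabMonoid p₀ p₁ hι hV (Equiv.swap ⟨0, h0⟩ j)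
  have h2 := flipAut_zero_mem_stabMonoid p₀ p₁ hV h0
  rw [viaEmbedding_swap hι] at h1
  have h3 := mul_mem (mul_mem h1 h2) h1
  rwa [swapAut_mul_flipAut, mul_assoc, swapAut_mul_self, mul_one] at h3

end Faithful

theorem signAut_mul_permAut_injective {r : ℕ} :
    Function.Injective fun x : (Fin r → ℤˣ) × Equiv.Perm (Fin r) => signAut x.1 * permAut x.2 := by
  rintro ⟨ε, σ⟩ ⟨ε', σ'⟩ h
  have key : ∀ i j, (ε j : ℤ) * (Pi.single i 1 : Fin r → ℤ) (σ.symm j) =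
      ε' j * (Pi.single i 1 : Fin r → ℤ) (σ'.symm j) := fun i j =>
    congrFun (LinearEquiv.congr_fun h (Pi.single i 1)) j
  have h1 : ∀ j, σ.symm j = σ'.symm j := by
    intro j
    have := key (σ.symm j) j
    rw [Pi.single_eq_same, mul_one] at this
    by_contra hne
    rw [Pi.single_eq_of_ne (Ne.symm hne), mul_zero] at this
    exact (ε j).ne_zero this
  have h2 : σ = σ' := Equiv.symm_bijective.injective (Equiv.ext h1)
  subst h2
  have h3 : ε = ε' := by
    ext j
    have := key (σ.symm j) j
    rwa [Pi.single_eq_same, mul_one, mul_one] at this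
  rw [h3]

section Tensor

variable (p₀ p₁ : ℂˣ) (n m : ℕ)

/-- The action of `H^B_n` on rational functions in `n + m` variables through the first `n`
variables. -/
def leftRep : HeckeB p₀ p₁ n →ₐ[ℂ] Op (n + m) :=
  rep p₀ p₁ (Fin.castAdd m) (Fin.castAdd_injective n m)

/-- The action of `H^B_m` on rational functions in `n + m` variables through the last `m`
variables. -/
def rightRep : HeckeB p₀ p₁ m →ₐ[ℂ] Op (n + m) :=
  rep p₀ p₁ (Fin.natAdd n) (Fin.natAdd_injective m n)

variable {n m}

theorem castAdd_ne_natAdd (i : Fin n) (j : Fin m) : Fin.castAdd m i ≠ Fin.natAdd n j := by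
  intro h
  have := congrArg Fin.val h
  simp at this
  omega

theorem genOp_commute (g : HeckeGen n) (g' : HeckeGen m) :
    Commute (genOp p₀ p₁ (Fin.castAdd m) g) (genOp p₀ p₁ (Fin.natAdd n) g') := by
  have hne := castAdd_ne_natAdd (n := n) (m := m)
  rcases g with ⟨i, hi⟩ | i | i <;> rcases g' with ⟨j, hj⟩ | j | j
  · rcases i with - | i <;> rcases j with - | j
    · exact opT₀_comm _ (hne _ _) _
    · exact opT₀_opT_comm _ (hne _ _) (hne _ _) _
    · exact (opT₀_opT_comm _ (hne _ _).symm (hne _ _).symm _).symm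
    · exact opT_comm _ (hne _ _) (hne _ _) (hne _ _) (hne _ _) _
  · rcases i with - | i
    · exact opT₀_mul_mulOp _ (aut_flipAut_ratX_of_ne (hne _ _).symm)
    · exact opT_mul_mulOp _ (aut_swapAut_ratX_of_ne (hne _ _).symm (hne _ _).symm)
  · rcases i with - | i
    · exact opT₀_mul_mulOp _ (by rw [map_inv₀, aut_flipAut_ratX_of_ne (hne _ _).symm])
    · exact opT_mul_mulOp _ (by rw [map_inv₀, aut_swapAut_ratX_of_ne (hne _ _).symm (hne _ _).symm])
  · rcases j with - | j
    · exact (opT₀_mul_mulOp _ (aut_flipAut_ratX_of_ne (hne _ _))).symm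
    · exact (opT_mul_mulOp _ (aut_swapAut_ratX_of_ne (hne _ _) (hne _ _))).symm
  · exact (Commute.all (ratX (Fin.castAdd m i)) (ratX (Fin.natAdd n j))).map mulOp
  · exact (Commute.all (ratX (Fin.castAdd m i)) (ratX (Fin.natAdd n j))⁻¹).map mulOp
  · rcases j with - | j
    · exact (opT₀_mul_mulOp _ (by rw [map_inv₀, aut_flipAut_ratX_of_ne (hne _ _)])).symm
    · exact (opT_mul_mulOp _ (by
        rw [map_inv₀, aut_swapAut_ratX_of_ne (hne _ _) (hne _ _)])).symm
  · exact (Commute.all (ratX (Fin.castAdd m i))⁻¹ (ratX (Fin.natAdd n j))).map mulOp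
  · exact (Commute.all (ratX (Fin.castAdd m i))⁻¹ (ratX (Fin.natAdd n j))⁻¹).map mulOp

theorem leftRep_commute_rightRep (x : HeckeB p₀ p₁ n) (y : HeckeB p₀ p₁ m) :
    Commute (leftRep p₀ p₁ n m x) (rightRep p₀ p₁ n m y) := by
  refine mem_of_gen_mem p₀ p₁ (S := (Subalgebra.centralizer ℂ
    {rightRep p₀ p₁ n m y}).comap (leftRep p₀ p₁ n m)) (fun g => ?_) x _ rfl |>.symm
  rintro _ rfl
  refine (mem_of_gen_mem p₀ p₁ (S := (Subalgebra.centralizer ℂ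
    {leftRep p₀ p₁ n m (gen p₀ p₁ n g)}).comap (rightRep p₀ p₁ n m)) (fun g' => ?_) y _ rfl).symm
  rintro _ rfl
  have key : Commute (leftRep p₀ p₁ n m (gen p₀ p₁ n g)) (rightRep p₀ p₁ n m (gen p₀ p₁ m g')) := by
    rw [leftRep, rightRep, rep_gen, rep_gen]
    exact genOp_commute p₀ p₁ g g'
  exact key.eq

variable (n m)

/-- The action of `H^B_n ⊗ H^B_m` on rational functions in `n + m` variables. -/
def tensorRep : HeckeB p₀ p₁ n ⊗[ℂ] HeckeB p₀ p₁ m →ₐ[ℂ] Op (n + m) :=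
  Algebra.TensorProduct.lift (leftRep p₀ p₁ n m) (rightRep p₀ p₁ n m)
    (leftRep_commute_rightRep p₀ p₁)

variable {n m}

theorem tensorRep_tmul (x : HeckeB p₀ p₁ n) (y : HeckeB p₀ p₁ m) :
    tensorRep p₀ p₁ n m (x ⊗ₜ y) = leftRep p₀ p₁ n m x * rightRep p₀ p₁ n m y :=
  Algebra.TensorProduct.lift_tmul ..

theorem rep_monomial {r : ℕ} {ι : Fin n → Fin r} (hι : Function.Injective ι)
    (e : (Fin n → ℤ) →+ (Fin r → ℤ)) (he : ∀ i k, e (Pi.single i k) = Pi.single (ι i) k)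
    (a : Fin n → ℤ) : rep p₀ p₁ ι hι (monomial p₀ p₁ a) = mulOp (mono (e a)) := by
  have : (rep p₀ p₁ ι hι).comp (laurentHom p₀ p₁ n) =
      ((mulOp (r := r)).comp (toRat r)).comp (AddMonoidAlgebra.mapDomainAlgHom ℂ ℂ e) := by
    refine laurent_hom_ext (fun i => ?_) fun i => ?_
    · simp only [AlgHom.comp_apply]
      rw [laurentHom_varX, rep_gen, varX, AddMonoidAlgebra.mapDomainAlgHom_apply,
        AddMonoidAlgebra.mapDomain_single, he]
      rfl
    · simp only [AlgHom.comp_apply]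
      rw [laurentHom_varXinv, rep_gen, varXinv, AddMonoidAlgebra.mapDomainAlgHom_apply,
        AddMonoidAlgebra.mapDomain_single, he]
      change mulOp _ = mulOp (toRat r (varXinv _))
      rw [toRat_varXinv]
  have h := DFunLike.congr_fun this (AddMonoidAlgebra.single a 1)
  simp only [AlgHom.comp_apply] at h
  rw [laurentHom_single, one_smul, AddMonoidAlgebra.mapDomainAlgHom_apply,
    AddMonoidAlgebra.mapDomain_single] at h
  exact h

theorem leftRep_monomial (a : Fin n → ℤ) :
    leftRep p₀ p₁ n m (monomial p₀ p₁ a) = mulOp (mono (Fin.append a 0)) := by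
  refine rep_monomial p₀ p₁ _
    { toFun := fun a => Fin.append a 0
      map_zero' := by ext i; refine Fin.addCases (fun i => ?_) (fun i => ?_) i <;> simp
      map_add' := fun a b => by
        ext i; refine Fin.addCases (fun i => ?_) (fun i => ?_) i <;> simp } (fun i k => ?_) a
  ext j
  refine Fin.addCases (fun j => ?_) (fun j => ?_) j
  · simp [Pi.single_apply, Fin.ext_iff]
  · simp [(castAdd_ne_natAdd i j).symm]

theorem rightRep_monomial (a : Fin m → ℤ) :
    rightRep p₀ p₁ n m (monomial p₀ p₁ a) = mulOp (mono (Fin.append 0 a)) := by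
  refine rep_monomial p₀ p₁ _
    { toFun := fun a => Fin.append 0 a
      map_zero' := by ext i; refine Fin.addCases (fun i => ?_) (fun i => ?_) i <;> simp
      map_add' := fun a b => by
        ext i; refine Fin.addCases (fun i => ?_) (fun i => ?_) i <;> simp } (fun i k => ?_) a
  ext j
  refine Fin.addCases (fun j => ?_) (fun j => ?_) j
  · simp [castAdd_ne_natAdd j i]
  · simp [Pi.single_apply, Fin.ext_iff]

/-- The index set of the words in the finite Hecke algebra. -/
abbrev WordIdx (n : ℕ) : Type := Fin (typeBWords (tGen p₀ p₁ n) n).length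

/-- The words in the finite Hecke algebra as a family. -/
def word (i : WordIdx p₀ p₁ n) : HeckeB p₀ p₁ n := (typeBWords (tGen p₀ p₁ n) n).get i

/-- The images of the pairs of words as operators. -/
def wordOp (x : WordIdx p₀ p₁ n × WordIdx p₀ p₁ m) : Op (n + m) :=
  leftRep p₀ p₁ n m (word p₀ p₁ x.1) * rightRep p₀ p₁ n m (word p₀ p₁ x.2)

/-- The products of a Laurent monomial and a pair of words. -/
def pbw (x : (Fin (n + m) → ℤ) × (WordIdx p₀ p₁ n × WordIdx p₀ p₁ m)) :
    HeckeB p₀ p₁ n ⊗[ℂ] HeckeB p₀ p₁ m :=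
  (monomial p₀ p₁ (fun i => x.1 (Fin.castAdd m i)) * word p₀ p₁ x.2.1) ⊗ₜ
    (monomial p₀ p₁ (fun i => x.1 (Fin.natAdd n i)) * word p₀ p₁ x.2.2)

theorem tensorRep_pbw (x : (Fin (n + m) → ℤ) × (WordIdx p₀ p₁ n × WordIdx p₀ p₁ m)) :
    tensorRep p₀ p₁ n m (pbw p₀ p₁ x) = mono x.1 • wordOp p₀ p₁ x.2 := by
  rw [pbw, tensorRep_tmul, map_mul, map_mul, mul_assoc,
    ← mul_assoc (leftRep p₀ p₁ n m (word _ _ _)),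
    (leftRep_commute_rightRep p₀ p₁ _ _).eq, leftRep_monomial, rightRep_monomial, mul_assoc,
    ← mul_assoc, ← map_mul, ← mono_add]
  have : Fin.append (fun i => x.1 (Fin.castAdd m i)) 0 +
      Fin.append 0 (fun i => x.1 (Fin.natAdd n i)) =
      x.1 := by
    ext i
    refine Fin.addCases (fun i => ?_) (fun i => ?_) i <;> simp
  rw [this]
  rfl

theorem span_monomial_mul_word :
    Submodule.span ℂ (Set.range fun x : (Fin n → ℤ) × WordIdx p₀ p₁ n =>
      monomial p₀ p₁ x.1 * word p₀ p₁ x.2) = ⊤ := by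
  rw [← span_monomial_mul_typeBWords]
  congr 1
  ext x
  constructor
  · rintro ⟨⟨a, i⟩, rfl⟩
    exact ⟨a, _, List.get_mem _ i, rfl⟩
  · rintro ⟨a, e, he, rfl⟩
    obtain ⟨i, rfl⟩ := List.get_of_mem he
    exact ⟨⟨a, i⟩, rfl⟩

/-- The spanning half of the Poincaré–Birkhoff–Witt theorem for the tensor product. -/
theorem span_pbw : Submodule.span ℂ (Set.range (pbw p₀ p₁ (n := n) (m := m))) = ⊤ := by
  have h := TensorProduct.map₂_mk_top_top_eq_top (R := ℂ) (M := HeckeB p₀ p₁ n)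
    (N := HeckeB p₀ p₁ m)
  rw [← span_monomial_mul_word, ← span_monomial_mul_word, Submodule.map₂_span_span] at h
  rw [eq_top_iff, ← h]
  refine Submodule.span_mono ?_
  rintro _ ⟨_, ⟨⟨a, i⟩, rfl⟩, _, ⟨⟨b, j⟩, rfl⟩, rfl⟩
  refine ⟨⟨Fin.append a b, i, j⟩, ?_⟩
  simp [pbw]

/-- The span over the rational functions of the operators from `H^B_n ⊗ H^B_m`. -/
def opSpan : Submodule (RatFun (n + m)) (Op (n + m)) :=
  Submodule.span _ (Set.range (wordOp p₀ p₁ (n := n) (m := m)))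

theorem tensorRep_mem_opSpan (c : HeckeB p₀ p₁ n ⊗[ℂ] HeckeB p₀ p₁ m) :
    tensorRep p₀ p₁ n m c ∈ opSpan p₀ p₁ (n := n) (m := m) := by
  have hc : c ∈ Submodule.span ℂ (Set.range (pbw p₀ p₁ (n := n) (m := m))) := by
    rw [span_pbw]; trivial
  induction hc using Submodule.span_induction with
  | mem c hc =>
    obtain ⟨x, rfl⟩ := hc
    rw [tensorRep_pbw]
    exact Submodule.smul_mem _ _ (Submodule.subset_span ⟨_, rfl⟩)
  | zero => rw [map_zero]; exact zero_mem _
  | add x y _ _ hx hy => rw [map_add]; exact add_mem hx hy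
  | smul c x _ hx =>
    rw [map_smul, ← algebraMap_smul (RatFun (n + m))]
    exact Submodule.smul_mem _ _ hx

theorem opSpan_induction {P : Op (n + m) → Prop} {x : Op (n + m)}
    (hx : x ∈ opSpan p₀ p₁ (n := n) (m := m))
    (smul_rep : ∀ (k : RatFun (n + m)) (c : HeckeB p₀ p₁ n ⊗[ℂ] HeckeB p₀ p₁ m),
      P (mulOp k * tensorRep p₀ p₁ n m c))
    (zero : P 0) (add : ∀ x y, P x → P y → P (x + y)) : P x := by
  obtain ⟨f, rfl⟩ := (Submodule.mem_span_range_iff_exists_fun _).1 hx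
  refine Finset.sum_induction _ P (fun x y => add x y) zero fun i _ => ?_
  have : wordOp p₀ p₁ i = tensorRep p₀ p₁ n m (word p₀ p₁ i.1 ⊗ₜ word p₀ p₁ i.2) := by
    rw [tensorRep_tmul]; rfl
  rw [this]
  exact smul_rep _ _

/-- The span is stable under left multiplication by an operator `T` that is a combination of `1` and
an automorphism, as `T` can then be moved past the coefficients. -/
theorem mul_mem_opSpan {T : Op (n + m)} {c : HeckeB p₀ p₁ n ⊗[ℂ] HeckeB p₀ p₁ m}
    (hT : tensorRep p₀ p₁ n m c = T) {σ : LatAut (n + m)} {k₁ k₂ k₃ l : RatFun (n + m)}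
    (h1 : T = mulOp k₁ * autOp σ + mulOp k₂) (h2 : autOp σ = mulOp k₃ * (T - mulOp l))
    {x : Op (n + m)} (hx : x ∈ opSpan p₀ p₁ (n := n) (m := m)) :
    T * x ∈ opSpan p₀ p₁ (n := n) (m := m) := by
  have hsmul : ∀ (k : RatFun (n + m)) {y}, y ∈ opSpan p₀ p₁ (n := n) (m := m) →
      mulOp k * y ∈ opSpan p₀ p₁ (n := n) (m := m) := fun k y hy => Submodule.smul_mem _ k hy
  refine opSpan_induction p₀ p₁ (P := fun x => T * x ∈ opSpan p₀ p₁) hx (fun k d => ?_) ?_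
    fun x y hx hy => ?_
  · have h3 : autOp σ * (mulOp k * tensorRep p₀ p₁ n m d) =
        mulOp (aut σ k * k₃) * (tensorRep p₀ p₁ n m (c * d) - mulOp l * tensorRep p₀ p₁ n m d) := by
      rw [← mul_assoc, autOp_mul_mulOp, mul_assoc, h2, map_mul, map_mul, hT]
      simp only [mul_assoc, sub_mul]
    rw [h1, add_mul, mul_assoc, h3]
    refine add_mem (hsmul _ (hsmul _ (sub_mem (tensorRep_mem_opSpan p₀ p₁ _)
      (hsmul _ (tensorRep_mem_opSpan p₀ p₁ _))))) (hsmul _ (hsmul _ (tensorRep_mem_opSpan p₀ p₁ _)))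
  · rw [mul_zero]; exact zero_mem _
  · rw [mul_add]; exact add_mem hx hy

theorem genOp_left_mul_mem (i : Fin n) {x : Op (n + m)}
    (hx : x ∈ opSpan p₀ p₁ (n := n) (m := m)) :
    genOp p₀ p₁ (Fin.castAdd m) (.T i) * x ∈ opSpan p₀ p₁ (n := n) (m := m) := by
  have hT : tensorRep p₀ p₁ n m (gen p₀ p₁ n (.T i) ⊗ₜ 1) =
      genOp p₀ p₁ (Fin.castAdd m) (.T i) := by
    rw [tensorRep_tmul, map_one, mul_one, leftRep, rep_gen]
  obtain ⟨i, hi⟩ := i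
  rcases i with - | i
  · obtain ⟨k, l, h⟩ := autOp_flip_eq p₀ (Fin.castAdd m ⟨0, hi⟩)
    exact mul_mem_opSpan p₀ p₁ hT rfl h hx
  · obtain ⟨k, l, h⟩ := autOp_swap_eq p₁ (a := Fin.castAdd m (⟨i, by omega⟩ : Fin n))
      (b := Fin.castAdd m ⟨i + 1, hi⟩) (by simp [Fin.ext_iff])
    exact mul_mem_opSpan p₀ p₁ hT rfl h hx

theorem genOp_right_mul_mem (i : Fin m) {x : Op (n + m)}
    (hx : x ∈ opSpan p₀ p₁ (n := n) (m := m)) :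
    genOp p₀ p₁ (Fin.natAdd n) (.T i) * x ∈ opSpan p₀ p₁ (n := n) (m := m) := by
  have hT : tensorRep p₀ p₁ n m (1 ⊗ₜ gen p₀ p₁ m (.T i)) =
      genOp p₀ p₁ (Fin.natAdd n) (.T i) := by
    rw [tensorRep_tmul, map_one, one_mul, rightRep, rep_gen]
  obtain ⟨i, hi⟩ := i
  rcases i with - | i
  · obtain ⟨k, l, h⟩ := autOp_flip_eq p₀ (Fin.natAdd n ⟨0, hi⟩)
    exact mul_mem_opSpan p₀ p₁ hT rfl h hx
  · obtain ⟨k, l, h⟩ := autOp_swap_eq p₁ (a := Fin.natAdd n (⟨i, by omega⟩ : Fin m))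
      (b := Fin.natAdd n ⟨i + 1, hi⟩) (by simp [Fin.ext_iff])
    exact mul_mem_opSpan p₀ p₁ hT rfl h hx

variable (n m) in
/-- The signed permutations that preserve the two blocks of variables. -/
def blockElt (x : (Fin (n + m) → ℤˣ) × (Equiv.Perm (Fin n) × Equiv.Perm (Fin m))) :
    LatAut (n + m) :=
  signAut x.1 * permAut
    (Equiv.Perm.viaEmbeddingHom ⟨Fin.castAdd m, Fin.castAdd_injective n m⟩ x.2.1 *
      Equiv.Perm.viaEmbeddingHom ⟨Fin.natAdd n, Fin.natAdd_injective m n⟩ x.2.2)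

theorem blockElt_injective : Function.Injective (blockElt n m) := by
  rintro ⟨ε, σ, τ⟩ ⟨ε', σ', τ'⟩ h
  have h := signAut_mul_permAut_injective (a₁ := ⟨_, _⟩) (a₂ := ⟨_, _⟩) h
  rw [Prod.mk.injEq] at h
  obtain ⟨rfl, h⟩ := h
  have hσ : σ = σ' := by
    ext1 i
    have h1 := Equiv.congr_fun h (Fin.castAdd m i)
    simp only [Equiv.Perm.mul_apply, Equiv.Perm.viaEmbeddingHom_apply] at h1
    have hr : Fin.castAdd m i ∉
        Set.range (⟨Fin.natAdd n, Fin.natAdd_injective m n⟩ : Fin m ↪ _) := by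
      rintro ⟨j, hj⟩
      exact castAdd_ne_natAdd i j hj.symm
    rw [Equiv.Perm.viaEmbedding_apply_of_notMem _ _ _ hr,
      Equiv.Perm.viaEmbedding_apply_of_notMem _ _ _ hr] at h1
    have e1 := Equiv.Perm.viaEmbedding_apply σ ⟨Fin.castAdd m, Fin.castAdd_injective n m⟩ i
    have e2 := Equiv.Perm.viaEmbedding_apply σ' ⟨Fin.castAdd m, Fin.castAdd_injective n m⟩ i
    exact Fin.castAdd_injective n m (e1.symm.trans (h1.trans e2))
  subst hσ
  have h := mul_left_cancel h
  have hτ : τ = τ' := Equiv.Perm.viaEmbeddingHom_injective _ h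
  rw [hτ]

theorem blockElt_mem_stabMonoid
    (x : (Fin (n + m) → ℤˣ) × (Equiv.Perm (Fin n) × Equiv.Perm (Fin m))) :
    blockElt n m x ∈ stabMonoid (opSpan p₀ p₁ (n := n) (m := m)) := by
  have hl := fun i x hx => genOp_left_mul_mem p₀ p₁ (n := n) (m := m) i (x := x) hx
  have hr := fun i x hx => genOp_right_mul_mem p₀ p₁ (n := n) (m := m) i (x := x) hx
  obtain ⟨ε, σ, τ⟩ := x
  refine mul_mem ?_ ?_
  · have hflip : ∀ j, flipAut j ∈ stabMonoid (opSpan p₀ p₁ (n := n) (m := m)) := by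
      intro j
      refine Fin.addCases (fun j => ?_) (fun j => ?_) j
      · exact flipAut_mem_stabMonoid p₀ p₁ (Fin.castAdd_injective n m) hl j
      · exact flipAut_mem_stabMonoid p₀ p₁ (Fin.natAdd_injective m n) hr j
    change signAut ε ∈ _
    rw [← Finset.univ_prod_mulSingle ε]
    suffices h : ∏ i, Pi.mulSingle i (ε i) ∈
        (stabMonoid (opSpan p₀ p₁ (n := n) (m := m))).comap signAut from h
    refine prod_mem fun i _ => ?_
    rcases Int.units_eq_one_or (ε i) with h | h
    · rw [h, Pi.mulSingle_one]; exact one_mem _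
    · rw [h]; exact hflip i
  · rw [map_mul]
    exact mul_mem (permAut_mem_stabMonoid p₀ p₁ _ hl σ) (permAut_mem_stabMonoid p₀ p₁ _ hr τ)

/-- There are as many pairs of words as signed permutations that preserve the blocks. The span of
the former contains all of the latter, and these are linearly independent by Dedekind. -/
theorem linearIndependent_wordOp :
    LinearIndependent (RatFun (n + m)) (wordOp p₀ p₁ (n := n) (m := m)) := by
  rw [linearIndependent_iff_card_le_finrank_span]
  have h1 := (linearIndependent_autOp (r := n + m)).comp _ blockElt_injective
  have h2 := finrank_span_eq_card h1
  have h3 : Fintype.card ((Fin (n + m) → ℤˣ) × (Equiv.Perm (Fin n) × Equiv.Perm (Fin m))) =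
      Fintype.card (WordIdx p₀ p₁ n × WordIdx p₀ p₁ m) := by
    simp [length_typeBWords, Fintype.card_perm, pow_add]
    ring
  rw [← h3, ← h2]
  have : Module.Finite (RatFun (n + m))
      (Submodule.span (RatFun (n + m)) (Set.range (wordOp p₀ p₁ (n := n) (m := m)))) :=
    FiniteDimensional.span_of_finite _ (Set.finite_range _)
  refine Submodule.finrank_mono (Submodule.span_le.2 ?_)
  rintro _ ⟨x, rfl⟩
  have h4 := blockElt_mem_stabMonoid p₀ p₁ x 1
    (by rw [← map_one (tensorRep p₀ p₁ n m)]; exact tensorRep_mem_opSpan p₀ p₁ 1)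
  rwa [mul_one] at h4

/-- A linear map that sends a spanning family to a linearly independent one is injective. -/
theorem injective_of_linearIndependent {ι V W : Type*} [AddCommGroup V] [Module ℂ V]
    [AddCommGroup W] [Module ℂ W] (f : V →ₗ[ℂ] W) {v : ι → V}
    (hv : Submodule.span ℂ (Set.range v) = ⊤) (hf : LinearIndependent ℂ fun i => f (v i)) :
    Function.Injective f := by
  rw [injective_iff_map_eq_zero]
  intro x hx
  have hx' : x ∈ Submodule.span ℂ (Set.range v) := by rw [hv]; trivial
  obtain ⟨c, rfl⟩ := Finsupp.mem_span_range_iff_exists_finsupp.1 hx'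
  rw [Finsupp.sum, map_sum] at hx
  simp only [map_smul] at hx
  rw [linearIndependent_iff.1 hf c hx]
  simp

/-- The algebra `H^B_n ⊗ H^B_m` acts faithfully on rational functions. -/
theorem tensorRep_injective : Function.Injective (tensorRep p₀ p₁ n m) := by
  refine injective_of_linearIndependent (tensorRep p₀ p₁ n m).toLinearMap (span_pbw p₀ p₁) ?_
  have h : (fun x => (tensorRep p₀ p₁ n m).toLinearMap (pbw p₀ p₁ x)) =
      fun x => mono x.1 • wordOp p₀ p₁ x.2 := funext (tensorRep_pbw p₀ p₁)
  rw [h]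
  exact linearIndependent_smul (linearIndependent_mono (r := n + m))
    (linearIndependent_wordOp p₀ p₁ (n := n) (m := m))

end Tensor

end HeckeB
end

noncomputable section

/-! ### The localized Hecke algebra as an algebra of operators -/

namespace UnivLoc

section Lift

variable {A B : Type*} [Ring A] [Algebra ℂ A] [Ring B] [Algebra ℂ B] {S : Set A}

/-- The universal property of `UnivLoc S`. -/
def lift (f : A →ₐ[ℂ] B) (h : ∀ s : S, IsUnit (f s)) : UnivLoc S →ₐ[ℂ] B :=
  RingQuot.liftAlgHom ℂ ⟨FreeAlgebra.lift ℂ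
    (Sum.elim f fun s : S => (((h s).unit⁻¹ : Bˣ) : B)), fun {x y} hxy => by
    induction hxy with
    | add a b => simp [FreeAlgebra.lift_ι_apply]
    | mul a b => simp [FreeAlgebra.lift_ι_apply]
    | scalar c => simp [FreeAlgebra.lift_ι_apply]
    | mul_inv s => simp [FreeAlgebra.lift_ι_apply]
    | inv_mul s => simp [FreeAlgebra.lift_ι_apply]⟩

theorem lift_of (f : A →ₐ[ℂ] B) (h : ∀ s : S, IsUnit (f s)) (a : A) :
    lift f h (of S a) = f a := by
  exact (RingQuot.liftAlgHom_mkAlgHom_apply ℂ _ _ _).trans (FreeAlgebra.lift_ι_apply _ _)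

/-- The quotient map from the free algebra. -/
def proj (S : Set A) : FreeAlgebra ℂ (A ⊕ S) →ₐ[ℂ] UnivLoc S := RingQuot.mkAlgHom ℂ (Rel S)

/-- An additive subgroup of the localization that contains `1` and is stable under right
multiplication by elements of `A` and by the adjoined inverses is everything. -/
theorem mem_of_mul_mem (P : AddSubgroup (UnivLoc S)) (one : 1 ∈ P)
    (mul : ∀ x ∈ P, ∀ a, x * of S a ∈ P)
    (inv : ∀ x ∈ P, ∀ s : S, ∀ y, of S (s : A) * y = 1 → y * of S (s : A) = 1 → x * y ∈ P)
    (x : UnivLoc S) : x ∈ P := by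
  have h1 : Function.Surjective (proj S) := RingQuot.mkAlgHom_surjective ℂ _
  have key : ∀ (z : FreeAlgebra ℂ (A ⊕ S)) (x : UnivLoc S), x ∈ P →
      x * proj S z ∈ P := by
    intro z
    induction z using FreeAlgebra.induction with
    | grade0 c =>
      intro x hx
      have := mul x hx (algebraMap ℂ A c)
      rw [AlgHom.commutes] at this
      rw [AlgHom.commutes]
      exact this
    | grade1 g =>
      intro x hx
      rcases g with a | s
      · exact mul x hx a
      · refine inv x hx s _ ?_ ?_
        · have h := RingQuot.mkAlgHom_rel ℂ (Rel.mul_inv s)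
          rw [map_mul, map_one] at h
          exact h
        · have h := RingQuot.mkAlgHom_rel ℂ (Rel.inv_mul s)
          rw [map_mul, map_one] at h
          exact h
    | mul a b ha hb =>
      intro x hx
      have := hb _ (ha x hx)
      rwa [map_mul, ← mul_assoc]
    | add a b ha hb =>
      intro x hx
      rw [map_add, mul_add]
      exact add_mem (ha x hx) (hb x hx)
  obtain ⟨z, rfl⟩ := h1 x
  have := key z 1 one
  rwa [one_mul] at this

end Lift

end UnivLoc

namespace HeckeB

section LocRep

variable (p₀ p₁ : ℂˣ) (r : ℕ)

/-- The representation of the affine Hecke algebra by Demazure–Lusztig operators. -/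
def dlRep : HeckeB p₀ p₁ r →ₐ[ℂ] Op r := rep p₀ p₁ id Function.injective_id

variable {r}

theorem dlRep_laurentHom (f : AddMonoidAlgebra ℂ (Fin r → ℤ)) :
    dlRep p₀ p₁ r (laurentHom p₀ p₁ r f) = mulOp (toRat r f) := rep_laurentHom p₀ p₁ f

theorem dlRep_gen (g : HeckeGen r) : dlRep p₀ p₁ r (gen p₀ p₁ r g) = genOp p₀ p₁ id g :=
  rep_gen _ _ _ _ _

theorem leftRep_zero (x : HeckeB p₀ p₁ r) : leftRep p₀ p₁ r 0 x = dlRep p₀ p₁ r x := rfl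

/-- The case of an empty second block of variables. -/
theorem dlRep_injective : Function.Injective (dlRep p₀ p₁ r) := by
  intro x y h
  have h1 : tensorRep p₀ p₁ r 0 (x ⊗ₜ 1) = tensorRep p₀ p₁ r 0 (y ⊗ₜ 1) := by
    rw [tensorRep_tmul, tensorRep_tmul, leftRep_zero, leftRep_zero, h]
  have : Nontrivial (HeckeB p₀ p₁ 0) := (dlRep p₀ p₁ 0).toRingHom.domain_nontrivial
  exact Algebra.TensorProduct.includeLeft_injective (S := ℂ)
    (algebraMap ℂ (HeckeB p₀ p₁ 0)).injective (tensorRep_injective p₀ p₁ h1)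

theorem toRat_ne_zero {f : AddMonoidAlgebra ℂ (Fin r → ℤ)} (hf : f ≠ 0) : toRat r f ≠ 0 :=
  fun h => hf (toRat_injective (h.trans (map_zero _).symm))

theorem isUnit_mulOp {k : RatFun r} (hk : k ≠ 0) : IsUnit (mulOp k) :=
  (IsUnit.mk0 k hk).map mulOp

/-- The span of the affine Hecke algebra over the rational functions. -/
def locSpan : Submodule (RatFun r) (Op r) :=
  Submodule.span _ (Set.range (dlRep p₀ p₁ r))

theorem locSpan_finite : Module.Finite (RatFun r) (locSpan p₀ p₁ (r := r)) := by
  have h : locSpan p₀ p₁ (r := r) = Submodule.span (RatFun r)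
      (Set.range fun i : WordIdx p₀ p₁ r => dlRep p₀ p₁ r (word p₀ p₁ i)) := by
    refine le_antisymm (Submodule.span_le.2 ?_) (Submodule.span_mono ?_)
    · rintro _ ⟨a, rfl⟩
      have ha : a ∈ Submodule.span ℂ (Set.range fun x : (Fin r → ℤ) × WordIdx p₀ p₁ r =>
          monomial p₀ p₁ x.1 * word p₀ p₁ x.2) := by
        rw [span_monomial_mul_word]; trivial
      induction ha using Submodule.span_induction with
      | mem a ha =>
        obtain ⟨x, rfl⟩ := ha
        change dlRep p₀ p₁ r (monomial p₀ p₁ x.1 * _) ∈ _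
        have : monomial p₀ p₁ x.1 = laurentHom p₀ p₁ r (AddMonoidAlgebra.single x.1 1) := by
          rw [laurentHom_single, one_smul]
        rw [map_mul, this, dlRep_laurentHom]
        exact Submodule.smul_mem _ (toRat r _) (Submodule.subset_span ⟨x.2, rfl⟩)
      | zero => rw [map_zero]; exact zero_mem _
      | add x y _ _ hx hy => rw [map_add]; exact add_mem hx hy
      | smul c x _ hx =>
        rw [map_smul, ← algebraMap_smul (RatFun r)]
        exact Submodule.smul_mem _ _ hx
    · rintro _ ⟨i, rfl⟩
      exact ⟨_, rfl⟩
  rw [h]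
  exact FiniteDimensional.span_of_finite _ (Set.finite_range _)

/-- Common denominators on the left. -/
theorem exists_mul_eq_of_mem_locSpan {x : Op r} (hx : x ∈ locSpan p₀ p₁ (r := r)) :
    ∃ f a, f ≠ 0 ∧ mulOp (toRat r f) * x = dlRep p₀ p₁ r a := by
  induction hx using Submodule.span_induction with
  | mem x hx =>
    obtain ⟨a, rfl⟩ := hx
    exact ⟨1, a, one_ne_zero, by rw [map_one, map_one, one_mul]⟩
  | zero => exact ⟨1, 0, one_ne_zero, by rw [mul_zero, map_zero]⟩
  | add x y _ _ hx hy =>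
    obtain ⟨f, a, hf, ha⟩ := hx
    obtain ⟨g, b, hg, hb⟩ := hy
    refine ⟨f * g, laurentHom p₀ p₁ r g * a + laurentHom p₀ p₁ r f * b, mul_ne_zero hf hg, ?_⟩
    rw [map_add, map_mul (dlRep p₀ p₁ r), map_mul (dlRep p₀ p₁ r), dlRep_laurentHom,
      dlRep_laurentHom, ← ha, ← hb, mul_add, ← mul_assoc, ← mul_assoc, ← map_mul, ← map_mul,
      ← map_mul, ← map_mul, mul_comm g f]
  | smul k x _ hx =>
    obtain ⟨f, a, hf, ha⟩ := hx
    obtain ⟨g, h, hh, hk⟩ := exists_toRat_mul_eq k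
    refine ⟨f * h, laurentHom p₀ p₁ r g * a, mul_ne_zero hf hh, ?_⟩
    have h1 : toRat r (f * h) * k = toRat r g * toRat r f := by
      rw [map_mul, mul_assoc, hk, mul_comm]
    rw [map_mul (dlRep p₀ p₁ r), dlRep_laurentHom, ← ha, smul_eq_mulOp_mul, ← mul_assoc,
      ← mul_assoc, ← map_mul, ← map_mul, h1]

theorem mul_mulOp_mem_locSpan (f : AddMonoidAlgebra ℂ (Fin r → ℤ)) {x : Op r}
    (hx : x ∈ locSpan p₀ p₁ (r := r)) : x * mulOp (toRat r f) ∈ locSpan p₀ p₁ (r := r) := by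
  induction hx using Submodule.span_induction with
  | mem x hx =>
    obtain ⟨a, rfl⟩ := hx
    rw [← dlRep_laurentHom p₀ p₁, ← map_mul]
    exact Submodule.subset_span ⟨_, rfl⟩
  | zero => rw [zero_mul]; exact zero_mem _
  | add x y _ _ hx hy => rw [add_mul]; exact add_mem hx hy
  | smul k x _ hx =>
    rw [smul_mul_assoc]
    exact Submodule.smul_mem _ _ hx

/-- The Ore condition. Right multiplication by a nonzero Laurent polynomial is injective, hence
surjective, on the finite-dimensional span of the Hecke algebra over the rational functions. -/
theorem exists_laurent_mul_eq (a : HeckeB p₀ p₁ r) {g : AddMonoidAlgebra ℂ (Fin r → ℤ)}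
    (hg : g ≠ 0) : ∃ f a', f ≠ 0 ∧ laurentHom p₀ p₁ r f * a = a' * laurentHom p₀ p₁ r g := by
  have := locSpan_finite p₀ p₁ (r := r)
  let R : locSpan p₀ p₁ (r := r) →ₗ[RatFun r] locSpan p₀ p₁ (r := r) :=
    { toFun := fun x => ⟨x.1 * mulOp (toRat r g), mul_mulOp_mem_locSpan p₀ p₁ g x.2⟩
      map_add' := fun x y => Subtype.ext (add_mul _ _ _)
      map_smul' := fun k x => Subtype.ext (smul_mul_assoc _ _ _) }
  have hinj : Function.Injective R := by
    intro x y h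
    exact Subtype.ext ((isUnit_mulOp (toRat_ne_zero hg)).mul_left_injective
      (congrArg Subtype.val h))
  have hsurj := @LinearMap.surjective_of_injective (RatFun r) (locSpan p₀ p₁ (r := r)) _ _ _ _
    R hinj
  obtain ⟨⟨w, hw⟩, h⟩ := hsurj ⟨dlRep p₀ p₁ r a, Submodule.subset_span ⟨a, rfl⟩⟩
  have h : w * mulOp (toRat r g) = dlRep p₀ p₁ r a := congrArg Subtype.val h
  obtain ⟨f, a', hf, ha'⟩ := exists_mul_eq_of_mem_locSpan p₀ p₁ hw
  refine ⟨f, a', hf, dlRep_injective p₀ p₁ ?_⟩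
  rw [map_mul, map_mul, dlRep_laurentHom, dlRep_laurentHom, ← h, ← mul_assoc, ha']

/-- The representation of the localized Hecke algebra on rational functions. -/
def locRep (r : ℕ) : Loc p₀ p₁ r →ₐ[ℂ] Op r :=
  UnivLoc.lift (dlRep p₀ p₁ r) (by
    rintro ⟨x, f, hf, hx⟩
    change IsUnit (dlRep p₀ p₁ r x)
    rw [hx, laurent_eq, dlRep_laurentHom]
    exact isUnit_mulOp (toRat_ne_zero fun h => hf (congrArg AddMonoidAlgebra.coeff h)))

theorem locRep_toLoc (a : HeckeB p₀ p₁ r) :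
    locRep p₀ p₁ r (toLoc p₀ p₁ r a) = dlRep p₀ p₁ r a := UnivLoc.lift_of _ _ _

theorem isUnit_toLoc {f : AddMonoidAlgebra ℂ (Fin r → ℤ)} (hf : f ≠ 0) :
    IsUnit (toLoc p₀ p₁ r (laurentHom p₀ p₁ r f)) := by
  have hf' : f.coeff ≠ 0 := fun h => hf (by ext a; rw [h]; rfl)
  have := UnivLoc.isUnit_of
    {x : HeckeB p₀ p₁ r | ∃ f : (Fin r → ℤ) →₀ ℂ, f ≠ 0 ∧ x = laurent p₀ p₁ f}
    ⟨laurent p₀ p₁ f.coeff, f.coeff, hf', rfl⟩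
  change IsUnit (toLoc p₀ p₁ r (laurent p₀ p₁ f.coeff)) at this
  rwa [laurent_eq] at this

/-- Every element of the localization is a left fraction with a Laurent polynomial as
denominator. -/
theorem exists_laurent_mul_eq_toLoc (x : Loc p₀ p₁ r) : ∃ f a, f ≠ 0 ∧
    toLoc p₀ p₁ r (laurentHom p₀ p₁ r f) * x = toLoc p₀ p₁ r a := by
  let P : AddSubgroup (Loc p₀ p₁ r) :=
    { carrier := {x | ∃ f a, f ≠ 0 ∧
        toLoc p₀ p₁ r (laurentHom p₀ p₁ r f) * x = toLoc p₀ p₁ r a}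
      zero_mem' := ⟨1, 0, one_ne_zero, by rw [mul_zero, map_zero]⟩
      add_mem' := by
        rintro x y ⟨f, a, hf, ha⟩ ⟨g, b, hg, hb⟩
        refine ⟨f * g, laurentHom p₀ p₁ r g * a + laurentHom p₀ p₁ r f * b,
          mul_ne_zero hf hg, ?_⟩
        rw [map_add, map_mul (toLoc p₀ p₁ r), map_mul (toLoc p₀ p₁ r), ← ha, ← hb, mul_add,
          ← mul_assoc, ← mul_assoc, ← map_mul, ← map_mul, ← map_mul, ← map_mul, mul_comm g f]
      neg_mem' := by
        rintro x ⟨f, a, hf, ha⟩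
        exact ⟨f, -a, hf, by rw [mul_neg, ha, map_neg]⟩ }
  refine UnivLoc.mem_of_mul_mem P ⟨1, 1, one_ne_zero, by rw [map_one, mul_one]⟩ ?_ ?_ x
  · rintro x ⟨f, a, hf, ha⟩ b
    exact ⟨f, a * b, hf, by rw [← mul_assoc, ha, map_mul]; rfl⟩
  · rintro x ⟨f, a, hf, ha⟩ ⟨z, g, hg, rfl⟩ y hy -
    have hg' : AddMonoidAlgebra.ofCoeff g ≠ 0 := fun h => hg (congrArg AddMonoidAlgebra.coeff h)
    obtain ⟨f', a', hf', h⟩ := exists_laurent_mul_eq p₀ p₁ a hg'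
    refine ⟨f' * f, a', mul_ne_zero hf' hf, ?_⟩
    change toLoc p₀ p₁ r (laurent p₀ p₁ g) * y = 1 at hy
    rw [laurent_eq] at hy
    have hy : toLoc p₀ p₁ r (laurentHom p₀ p₁ r (AddMonoidAlgebra.ofCoeff g)) * y = 1 := hy
    rw [map_mul, map_mul, ← mul_assoc, mul_assoc (toLoc p₀ p₁ r _), ha, ← map_mul, h, map_mul,
      mul_assoc, hy, mul_one]

/-- The Demazure–Lusztig representation remains faithful on the localization, because its elements
are left fractions. -/
theorem locRep_injective : Function.Injective (locRep p₀ p₁ r) := by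
  rw [injective_iff_map_eq_zero]
  intro x hx
  obtain ⟨f, a, hf, h⟩ := exists_laurent_mul_eq_toLoc p₀ p₁ x
  have h1 := congrArg (locRep p₀ p₁ r) h
  rw [map_mul, hx, mul_zero, locRep_toLoc] at h1
  have h2 : a = 0 := dlRep_injective p₀ p₁ (h1.symm.trans (map_zero _).symm)
  rw [h2, map_zero] at h
  exact (isUnit_toLoc p₀ p₁ hf).mul_right_eq_zero.1 h

end LocRep

end HeckeB
end

noncomputable section

namespace HeckeB

/-! ### The operators of the intertwiners and of the two Hecke algebras -/

section LocOps

variable (p₀ p₁ : ℂˣ) {r : ℕ}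

theorem locRep_locX (i : Fin r) : locRep p₀ p₁ r (locX p₀ p₁ i) = mulOp (ratX i) := by
  rw [locRep_toLoc, dlRep_gen]; rfl

theorem locRep_locXinv (i : Fin r) : locRep p₀ p₁ r (locXinv p₀ p₁ i) = mulOp (ratX i)⁻¹ := by
  rw [locRep_toLoc, dlRep_gen]; rfl

theorem locRep_locT (i : Fin r) : locRep p₀ p₁ r (locT p₀ p₁ i) = genOp p₀ p₁ id (.T i) := by
  rw [locRep_toLoc, dlRep_gen]

theorem toLoc_varX (i : Fin r) :
    toLoc p₀ p₁ r (laurentHom p₀ p₁ r (varX i)) = locX p₀ p₁ i := by rw [laurentHom_varX]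

theorem toLoc_varXinv (i : Fin r) :
    toLoc p₀ p₁ r (laurentHom p₀ p₁ r (varXinv i)) = locXinv p₀ p₁ i := by
  rw [laurentHom_varXinv]

theorem locRep_inverse {f : AddMonoidAlgebra ℂ (Fin r → ℤ)} (hf : toRat r f ≠ 0) :
    locRep p₀ p₁ r (Ring.inverse (toLoc p₀ p₁ r (laurentHom p₀ p₁ r f))) =
      mulOp (toRat r f)⁻¹ := by
  have hf' : f ≠ 0 := fun h => hf (by rw [h, map_zero])
  obtain ⟨u, hu⟩ := isUnit_toLoc p₀ p₁ hf'
  have h1 : locRep p₀ p₁ r u = mulOp (toRat r f) := by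
    rw [hu, locRep_toLoc, dlRep_laurentHom]
  rw [← hu, Ring.inverse_unit]
  refine (isUnit_mulOp hf).mul_left_cancel ?_
  rw [← map_mul, mul_inv_cancel₀ hf, map_one, ← h1, ← map_mul, Units.mul_inv, map_one]

/-- `c X_a - d X_b` does not vanish. -/
theorem ratX_comb_ne_zero {a b : Fin r} (hab : a ≠ b) (p q : ℂˣ) :
    cst p r * ratX a - cst q r * ratX b ≠ 0 := by
  refine smul_mono_sub_ne_zero (fun h => ?_) p.ne_zero
  have := congrFun h a
  simp [hab] at this

theorem ratX_comb_inv_ne_zero {a b : Fin r} (hab : a ≠ b) (p q : ℂˣ) :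
    cst p r * ratX a - cst q r * (ratX b)⁻¹ ≠ 0 := by
  rw [ratX, ratX, ← mono_neg]
  refine smul_mono_sub_ne_zero (fun h => ?_) p.ne_zero
  have := congrFun h a
  simp [hab] at this

theorem cst_inv (p : ℂˣ) : cst p⁻¹ r = (cst p r)⁻¹ := by
  simp [cst]

theorem smul_eq_cst_mul (p : ℂˣ) (k : RatFun r) : (p : ℂ) • k = cst p r * k :=
  Algebra.smul_def _ _

theorem inv_smul_eq_cst_mul (p : ℂˣ) (k : RatFun r) : (p : ℂ)⁻¹ • k = (cst p r)⁻¹ * k := by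
  rw [← cst_inv, ← smul_eq_cst_mul, Units.val_inv_eq_inv_val]

/-- The normalized intertwiners act as transpositions of adjacent variables. -/
theorem locRep_intertwiner (k : ℕ) (h : k + 1 < r) :
    locRep p₀ p₁ r (intertwiner p₀ p₁ k h) =
      autOp (swapAut ⟨k, by omega⟩ ⟨k + 1, h⟩) := by
  set a : Fin r := ⟨k, by omega⟩
  set b : Fin r := ⟨k + 1, h⟩
  have hab : a ≠ b := by simp [a, b]
  set f : AddMonoidAlgebra ℂ (Fin r → ℤ) :=
    (p₁ : ℂ)⁻¹ • 1 - (p₁ : ℂ) • (varX a * varXinv b) with hf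
  have h1 : toRat r f = (cst p₁ r)⁻¹ - cst p₁ r * (ratX a * (ratX b)⁻¹) := by
    rw [hf, map_sub, map_smul, map_smul, map_one, map_mul, toRat_varX, toRat_varXinv,
      smul_eq_cst_mul, inv_smul_eq_cst_mul, mul_one]
  have hb := ratX_ne_zero b
  have hp := cst_ne_zero (r := r) p₁
  have hbb := ratX_sub_ne_zero hab
  have h2 : (cst p₁ r)⁻¹ * ratX b - cst p₁ r * ratX a ≠ 0 := by
    rw [← cst_inv]; exact ratX_comb_ne_zero hab.symm _ _
  have h3 : toRat r f ≠ 0 := by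
    intro h0
    refine h2 ?_
    have := congrArg (· * ratX b) h0
    simp only [h1, zero_mul] at this
    rw [← this]
    field_simp
  have h4 : toLoc p₀ p₁ r (laurentHom p₀ p₁ r f) =
      (p₁ : ℂ)⁻¹ • 1 - (p₁ : ℂ) • (locX p₀ p₁ a * locXinv p₀ p₁ b) := by
    simp only [hf, map_sub, map_smul, map_one, map_mul, toLoc_varX, toLoc_varXinv]
  clear_value f
  rw [intertwiner, ← h4, map_mul, locRep_inverse p₀ p₁ h3, map_sub, map_mul, map_sub, map_one,
    map_mul,
    map_smul, map_one, locRep_locX, locRep_locXinv, locRep_locT, genOp_T_succ]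
  ext z
  -- Everything is now expressed by `z` and its image under the transposition. The multiples of `z`
  -- cancel.
  simp only [Module.End.mul_apply, LinearMap.sub_apply, mulOp_apply, opT_apply, autOp_apply,
    LinearMap.smul_apply, Module.End.one_apply, sub_smul, smul_eq_cst_mul, inv_smul_eq_cst_mul,
    id, h1]
  change ((cst p₁ r)⁻¹ - cst p₁ r * (ratX a * (ratX b)⁻¹))⁻¹ *
    ((((cst p₁ r)⁻¹ * ratX b - cst p₁ r * ratX a) / (ratX b - ratX a) * aut (swapAut a b) z +
      (cst p₁ r - (cst p₁ r)⁻¹) * ratX b / (ratX b - ratX a) * z) -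
      ratX a * ((ratX b)⁻¹ *
        (((cst p₁ r)⁻¹ * ratX b - cst p₁ r * ratX a) / (ratX b - ratX a) * aut (swapAut a b) z +
      (cst p₁ r - (cst p₁ r)⁻¹) * ratX b / (ratX b - ratX a) * z)) -
      (cst p₁ r * z - (cst p₁ r)⁻¹ * z)) = aut (swapAut a b) z
  rw [h1] at h3
  rw [inv_mul_eq_iff_eq_mul₀ h3]
  generalize aut (swapAut a b) z = w at *
  generalize ratX a = x at *
  generalize ratX b = y at *
  generalize cst p₁ r = q at *
  clear_value a b
  field_simp
  ring

/-- The product `s_1 ⋯ s_k` of transpositions moves the last position to the first. -/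
theorem prod_swap_apply (k : ℕ) (hk : k < r) :
    (List.ofFn fun i : Fin k =>
      (Equiv.swap ⟨i, by omega⟩ ⟨i + 1, by omega⟩ : Equiv.Perm (Fin r))).prod ⟨k, hk⟩ =
        ⟨0, by omega⟩ := by
  induction k with
  | zero => simp
  | succ k ih =>
    rw [List.ofFn_succ_last, List.prod_append, List.prod_singleton, Equiv.Perm.mul_apply]
    simp only [Fin.val_last, Equiv.swap_apply_right]
    exact ih (by omega)

theorem locRep_leftGen {n m : ℕ} (g : HeckeGen n) :
    locRep p₀ p₁ (n + m) (leftGen p₀ p₁ n m (n + m) rfl g) =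
      leftRep p₀ p₁ n m (gen p₀ p₁ n g) := by
  rw [leftRep, rep_gen]
  rcases g with i | i | i
  · exact locRep_locT p₀ p₁ _
  · exact locRep_locX p₀ p₁ _
  · exact locRep_locXinv p₀ p₁ _

theorem locRep_rightGen {n m : ℕ} (g : HeckeGen m) :
    locRep p₀ p₁ (n + m) (rightGen p₀ p₁ n m (n + m) rfl g) =
      rightRep p₀ p₁ n m (gen p₀ p₁ m g) := by
  rw [rightRep, rep_gen]
  rcases g with ⟨i, hi⟩ | i | i
  · rcases i with - | i
    · rw [genOp_T_zero]
      change locRep p₀ p₁ (n + m) ((List.ofFn fun k : Fin n =>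
        intertwiner p₀ p₁ (r := n + m) k (by omega)).reverse.prod * locT p₀ p₁ ⟨0, by omega⟩ *
          (List.ofFn fun k : Fin n => intertwiner p₀ p₁ (r := n + m) k (by omega)).prod) = _
      set l : List (Equiv.Perm (Fin (n + m))) := List.ofFn fun i : Fin n =>
        (Equiv.swap ⟨i, by omega⟩ ⟨i + 1, by omega⟩ : Equiv.Perm (Fin (n + m))) with hl
      -- The intertwiners in `φ_n ⋯ φ_1 T_0 φ_1 ⋯ φ_n` become transpositions, so that the product is
      -- a conjugate of the operator of `T_0`.
      have h1 : (List.ofFn fun k : Fin n =>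
          intertwiner p₀ p₁ (r := n + m) k (by omega)).map (locRep p₀ p₁ (n + m)) =
          l.map fun σ => autOp (permAut σ) := by
        rw [hl, List.map_ofFn, List.map_ofFn]
        exact congrArg _ (funext fun k => locRep_intertwiner p₀ p₁ _ _)
      have h2 : (l.map fun x => x⁻¹) = l := by
        rw [hl, List.map_ofFn]
        exact congrArg _ (funext fun k => Equiv.swap_inv _ _)
      have h3 : ∀ l : List (Equiv.Perm (Fin (n + m))),
          (l.map fun σ => autOp (permAut σ)).prod = autOp (permAut l.prod) := by
        intro l
        exact (map_list_prod (autOp.comp permAut) l).symm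
      have h4 : l.reverse.prod = l.prod⁻¹ := by rw [List.prod_reverse_noncomm, h2]
      rw [map_mul, map_mul, map_list_prod, map_list_prod, List.map_reverse, h1, ← List.map_reverse,
        h3, h3, h4, locRep_locT, genOp_T_zero, autOp_mul_opT₀, mul_assoc, ← map_mul, ← map_mul,
        inv_mul_cancel, map_one, map_one, mul_one]
      congr 1
      rw [Equiv.Perm.inv_eq_iff_eq]
      exact (prod_swap_apply n (by omega)).symm
    · rw [genOp_T_succ]
      exact (locRep_locT p₀ p₁ _).trans (genOp_T_succ p₀ p₁ id (n + i) _)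
  · exact locRep_locX p₀ p₁ _
  · exact locRep_locXinv p₀ p₁ _

end LocOps

/-! ### The coefficient ring and its denominator -/

section Coeff

variable (p₀ p₁ : ℂˣ) (n m : ℕ)

/-- The coefficient ring `ℂ[X_1^{±1}, …, X_{n+m}^{±1}, D⁻¹]` as a ring of rational functions. -/
def coeffFun : Subalgebra ℂ (RatFun (n + m)) :=
  ((coeffRing p₀ p₁ n m (n + m) rfl).map (locRep p₀ p₁ (n + m))).comap mulOp

variable {n m}

/-- The two indices belong to different blocks `{1, …, n}` and `{n + 1, …, n + m}`. -/
def DiffBlock (n : ℕ) {r : ℕ} (a b : Fin r) : Prop := ¬ (a.val < n ↔ b.val < n)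

theorem DiffBlock.symm {r : ℕ} {a b : Fin r} (h : DiffBlock n a b) : DiffBlock n b a :=
  fun h' => h h'.symm

theorem toRat_mem_coeffFun (f : AddMonoidAlgebra ℂ (Fin (n + m) → ℤ)) :
    toRat (n + m) f ∈ coeffFun p₀ p₁ n m := by
  refine laurent_mem_of_var_mem (S := (coeffFun p₀ p₁ n m).comap (toRat (n + m)))
    (fun i => ?_) (fun i => ?_) f
  · exact ⟨_, Algebra.subset_adjoin (Or.inl ⟨i, Or.inl rfl⟩), locRep_locX p₀ p₁ i⟩
  · refine ⟨_, Algebra.subset_adjoin (Or.inl ⟨i, Or.inr rfl⟩), ?_⟩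
    refine (locRep_locXinv p₀ p₁ i).trans ?_
    rw [← toRat_varXinv]; rfl

theorem ratX_mem_coeffFun (i : Fin (n + m)) : ratX i ∈ coeffFun p₀ p₁ n m :=
  toRat_mem_coeffFun p₀ p₁ (varX i)

theorem ratX_inv_mem_coeffFun (i : Fin (n + m)) : (ratX i)⁻¹ ∈ coeffFun p₀ p₁ n m := by
  rw [← toRat_varXinv]
  exact toRat_mem_coeffFun p₀ p₁ _

theorem cst_mem_coeffFun (p : ℂˣ) : cst p (n + m) ∈ coeffFun p₀ p₁ n m :=
  Subalgebra.algebraMap_mem _ _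

theorem inv_mem_coeffFun {f : AddMonoidAlgebra ℂ (Fin (n + m) → ℤ)} (hf : toRat (n + m) f ≠ 0)
    (h : toLoc p₀ p₁ (n + m) (laurentHom p₀ p₁ (n + m) f) ∈ denominators p₀ p₁ n m (n + m) rfl) :
    (toRat (n + m) f)⁻¹ ∈ coeffFun p₀ p₁ n m :=
  ⟨_, Algebra.subset_adjoin (Or.inr ⟨_, h, rfl⟩), locRep_inverse p₀ p₁ hf⟩

/-- The inverses adjoined to the coefficient ring, as functions. -/
theorem inv_ratX_sub_mem_coeffFun (i : Fin n) (j : Fin m) (p : ℂˣ)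
    (hp : p = 1 ∨ p = p₁ ^ 2 ∨ p = p₁⁻¹ ^ 2) :
    (ratX (Fin.castAdd m i) - cst p (n + m) * ratX (Fin.natAdd n j))⁻¹ ∈ coeffFun p₀ p₁ n m := by
  have h1 : toRat (n + m) (varX (Fin.castAdd m i) - (p : ℂ) • varX (Fin.natAdd n j)) =
      ratX (Fin.castAdd m i) - cst p (n + m) * ratX (Fin.natAdd n j) := by
    rw [map_sub, map_smul, toRat_varX, toRat_varX, smul_eq_cst_mul]
  rw [← h1]
  refine inv_mem_coeffFun p₀ p₁ ?_ ?_
  · rw [h1]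
    have := ratX_comb_ne_zero (castAdd_ne_natAdd i j) 1 p
    rwa [cst, Units.val_one, map_one, one_mul] at this
  · refine ⟨i, j, ?_⟩
    simp only [map_sub, map_smul, toLoc_varX]
    rcases hp with rfl | rfl | rfl
    · refine Or.inr (Or.inr (Or.inr (Or.inr (Or.inl ?_))))
      rw [Units.val_one, one_smul]; rfl
    · refine Or.inl ?_
      rw [Units.val_pow_eq_pow_val]; rfl
    · refine Or.inr (Or.inl ?_)
      rw [Units.val_pow_eq_pow_val, Units.val_inv_eq_inv_val]; rfl

theorem inv_ratX_sub_inv_mem_coeffFun (i : Fin n) (j : Fin m) (p : ℂˣ)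
    (hp : p = 1 ∨ p = p₁ ^ 2 ∨ p = p₁⁻¹ ^ 2) :
    (ratX (Fin.castAdd m i) - cst p (n + m) * (ratX (Fin.natAdd n j))⁻¹)⁻¹ ∈
      coeffFun p₀ p₁ n m := by
  have h1 : toRat (n + m) (varX (Fin.castAdd m i) - (p : ℂ) • varXinv (Fin.natAdd n j)) =
      ratX (Fin.castAdd m i) - cst p (n + m) * (ratX (Fin.natAdd n j))⁻¹ := by
    rw [map_sub, map_smul, toRat_varX, toRat_varXinv, smul_eq_cst_mul]
  rw [← h1]
  refine inv_mem_coeffFun p₀ p₁ ?_ ?_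
  · rw [h1]
    have := ratX_comb_inv_ne_zero (castAdd_ne_natAdd i j) 1 p
    rwa [cst, Units.val_one, map_one, one_mul] at this
  · refine ⟨i, j, ?_⟩
    simp only [map_sub, map_smul, toLoc_varX, toLoc_varXinv]
    rcases hp with rfl | rfl | rfl
    · refine Or.inr (Or.inr (Or.inr (Or.inr (Or.inr ?_))))
      rw [Units.val_one, one_smul]; rfl
    · refine Or.inr (Or.inr (Or.inl ?_))
      rw [Units.val_pow_eq_pow_val]; rfl
    · refine Or.inr (Or.inr (Or.inr (Or.inl ?_)))
      rw [Units.val_pow_eq_pow_val, Units.val_inv_eq_inv_val]; rfl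

theorem exists_of_diffBlock {a b : Fin (n + m)} (h : DiffBlock n a b) :
    (∃ i j, a = Fin.castAdd m i ∧ b = Fin.natAdd n j) ∨
      ∃ i j, b = Fin.castAdd m i ∧ a = Fin.natAdd n j := by
  revert h
  refine Fin.addCases (fun i => ?_) (fun i => ?_) a <;>
    refine Fin.addCases (fun j => ?_) (fun j => ?_) b <;> intro h
  · simp [DiffBlock] at h
  · exact Or.inl ⟨i, j, rfl, rfl⟩
  · exact Or.inr ⟨j, i, rfl, rfl⟩
  · simp [DiffBlock] at h

theorem inv_ratX_sub_ratX_mem_coeffFun {a b : Fin (n + m)} (h : DiffBlock n a b) :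
    (ratX b - ratX a)⁻¹ ∈ coeffFun p₀ p₁ n m := by
  have h1 : ∀ (i : Fin n) (j : Fin m), (ratX (Fin.castAdd m i) - ratX (Fin.natAdd n j))⁻¹ ∈
      coeffFun p₀ p₁ n m := fun i j => by
    have := inv_ratX_sub_mem_coeffFun p₀ p₁ i j 1 (Or.inl rfl)
    rwa [cst, Units.val_one, map_one, one_mul] at this
  rcases exists_of_diffBlock h with ⟨i, j, rfl, rfl⟩ | ⟨i, j, rfl, rfl⟩
  · rw [← neg_sub, inv_neg]
    exact neg_mem (h1 i j)
  · exact h1 i j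

theorem inv_comb_mem_coeffFun {a b : Fin (n + m)} (h : DiffBlock n a b) :
    ((cst p₁ (n + m))⁻¹ * ratX b - cst p₁ (n + m) * ratX a)⁻¹ ∈ coeffFun p₀ p₁ n m := by
  have hp := cst_ne_zero (r := n + m) p₁
  rcases exists_of_diffBlock h with ⟨i, j, rfl, rfl⟩ | ⟨i, j, rfl, rfl⟩
  · have h1 := inv_ratX_sub_mem_coeffFun p₀ p₁ i j (p₁⁻¹ ^ 2) (by simp)
    have h2 := mul_mem (neg_mem (cst_mem_coeffFun p₀ p₁ (n := n) (m := m) p₁⁻¹)) h1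
    have h3 : cst (p₁⁻¹ ^ 2) (n + m) = (cst p₁ (n + m))⁻¹ ^ 2 := by simp [cst]
    rw [h3, cst_inv] at h2
    convert h2 using 1
    rw [neg_mul, ← mul_inv, ← inv_neg]
    congr 1
    field_simp
    ring
  · have h1 := inv_ratX_sub_mem_coeffFun p₀ p₁ i j (p₁ ^ 2) (by simp)
    have h2 := mul_mem (cst_mem_coeffFun p₀ p₁ (n := n) (m := m) p₁) h1
    have h3 : cst (p₁ ^ 2) (n + m) = (cst p₁ (n + m)) ^ 2 := by simp [cst]
    rw [h3] at h2
    convert h2 using 1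
    have h4 : (cst p₁ (n + m))⁻¹ * ratX (Fin.castAdd m i) -
        cst p₁ (n + m) * ratX (Fin.natAdd n j) = (cst p₁ (n + m))⁻¹ *
          (ratX (Fin.castAdd m i) - cst p₁ (n + m) ^ 2 * ratX (Fin.natAdd n j)) := by
      field_simp
    rw [h4, mul_inv, inv_inv]

theorem inv_comb_mul_mem_coeffFun (i : Fin n) (j : Fin m) :
    ((cst p₁ (n + m))⁻¹ - cst p₁ (n + m) * (ratX (Fin.castAdd m i) * ratX (Fin.natAdd n j)))⁻¹ ∈
      coeffFun p₀ p₁ n m := by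
  have hp := cst_ne_zero (r := n + m) p₁
  have hX := ratX_ne_zero (Fin.natAdd n j)
  have h1 := inv_ratX_sub_inv_mem_coeffFun p₀ p₁ i j (p₁⁻¹ ^ 2) (by simp)
  have h2 := mul_mem (mul_mem (neg_mem (cst_mem_coeffFun p₀ p₁ (n := n) (m := m) p₁⁻¹))
    (ratX_inv_mem_coeffFun p₀ p₁ (Fin.natAdd n j))) h1
  have h3 : cst (p₁⁻¹ ^ 2) (n + m) = (cst p₁ (n + m))⁻¹ ^ 2 := by simp [cst]
  rw [h3, cst_inv] at h2
  convert h2 using 1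
  rw [neg_mul, neg_mul, ← mul_inv, ← mul_inv, ← inv_neg]
  congr 1
  field_simp
  ring

end Coeff

end HeckeB
end

noncomputable section

namespace HeckeB

/-! ### Extending maps to fractions with powers of one denominator -/

section Frac

variable {A S E : Type*} [AddCommGroup A] [Module ℂ A] [Ring S] [Algebra ℂ S]
  [AddCommGroup E] [Module ℂ E]

/-- Elements of the form `ρ(a) u⁻ᵏ`. -/
def fracs (ρ : A →ₗ[ℂ] S) (u : S) (d : A →ₗ[ℂ] A) (hd : ∀ a, ρ (d a) = ρ a * u) :
    Submodule ℂ S where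
  carrier := {x | ∃ (k : ℕ) (a : A), x * u ^ k = ρ a}
  zero_mem' := ⟨0, 0, by simp⟩
  add_mem' := by
    rintro x y ⟨k, a, ha⟩ ⟨l, b, hb⟩
    have hd' : ∀ (k : ℕ) a, ρ ((d ^ k) a) = ρ a * u ^ k := by
      intro k
      induction k with
      | zero => intro a; simp
      | succ k ih => intro a; rw [pow_succ', pow_succ, Module.End.mul_apply, hd, ih, mul_assoc]
    refine ⟨k + l, (d ^ l) a + (d ^ k) b, ?_⟩
    rw [map_add, hd', hd', ← ha, ← hb, add_mul, mul_assoc, mul_assoc, ← pow_add, ← pow_add,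
      add_comm l k]
  smul_mem' := by
    rintro c x ⟨k, a, ha⟩
    exact ⟨k, c • a, by rw [map_smul, smul_mul_assoc, ha]⟩

/-- A map `g` on `A` extends to fractions `ρ(a) u⁻ᵏ` as `T⁻ᵏ g(a)`, if `T` is invertible and `g`
turns multiplication by the denominator into `T`. -/
theorem exists_fracs_lift {ρ : A →ₗ[ℂ] S} (hρ : Function.Injective ρ) {u : S}
    {d : A →ₗ[ℂ] A} (hd : ∀ a, ρ (d a) = ρ a * u) (g : A →ₗ[ℂ] E) (T : E ≃ₗ[ℂ] E)
    (hT : ∀ a, g (d a) = T (g a)) :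
    ∃ θ : fracs ρ u d hd →ₗ[ℂ] E, ∀ (x : fracs ρ u d hd) (k : ℕ) (a : A),
      (x : S) * u ^ k = ρ a → (T ^ k) (θ x) = g a := by
  have hd' : ∀ (k : ℕ) a, ρ ((d ^ k) a) = ρ a * u ^ k := by
    intro k
    induction k with
    | zero => intro a; simp
    | succ k ih => intro a; rw [pow_succ', pow_succ, Module.End.mul_apply, hd, ih, mul_assoc]
  have hT' : ∀ (k : ℕ) a, g ((d ^ k) a) = (T ^ k) (g a) := by
    intro k
    induction k with
    | zero => intro a; rfl
    | succ k ih =>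
      intro a
      rw [pow_succ', pow_succ', Module.End.mul_apply, hT, ih, LinearEquiv.mul_apply]
  have hex : ∀ x : fracs ρ u d hd, ∃ e : E, ∀ (k : ℕ) (a : A),
      (x : S) * u ^ k = ρ a → (T ^ k) e = g a := by
    rintro ⟨x, k, a, ha⟩
    refine ⟨(T ^ k).symm (g a), fun l b hb => (T ^ k).injective ?_⟩
    -- Two fractions with the same value agree after bringing them to the same denominator; this
    -- uses that `ρ` is injective.
    have h1 : (d ^ l) a = (d ^ k) b := by
      refine hρ ?_
      rw [hd', hd', ← ha, ← hb, mul_assoc, mul_assoc, ← pow_add, ← pow_add, add_comm]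
    rw [← hT', ← h1, hT', ← LinearEquiv.mul_apply, ← pow_add, add_comm, pow_add,
      LinearEquiv.mul_apply, LinearEquiv.apply_symm_apply]
  choose θ hθ using hex
  refine ⟨{ toFun := θ, map_add' := ?_, map_smul' := ?_ }, hθ⟩
  · intro x y
    obtain ⟨k, a, ha⟩ := x.2
    obtain ⟨l, b, hb⟩ := y.2
    have h1 : ((x + y : fracs ρ u d hd) : S) * u ^ (k + l) = ρ ((d ^ l) a + (d ^ k) b) := by
      rw [map_add, hd', hd', ← ha, ← hb, Submodule.coe_add, add_mul, mul_assoc, mul_assoc,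
        ← pow_add, ← pow_add, add_comm l k]
    refine (T ^ (k + l)).injective ?_
    rw [hθ _ _ _ h1, map_add, map_add, hT', hT', ← hθ _ _ _ ha, ← hθ _ _ _ hb,
      ← LinearEquiv.mul_apply, ← LinearEquiv.mul_apply, ← pow_add, ← pow_add, add_comm l k]
  · intro c x
    obtain ⟨k, a, ha⟩ := x.2
    have h1 : ((c • x : fracs ρ u d hd) : S) * u ^ k = ρ (c • a) := by
      rw [map_smul, ← ha, Submodule.coe_smul, smul_mul_assoc]
    refine (T ^ k).injective ?_
    rw [hθ _ _ _ h1, map_smul, RingHom.id_apply, map_smul, hθ _ _ _ ha]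

end Frac

section FracAlg

variable {C S E : Type*} [Ring C] [Algebra ℂ C] [Ring S] [Algebra ℂ S] [Ring E] [Algebra ℂ E]

omit [Algebra ℂ S] in
theorem commute_of_mul_pow_eq {u x y : S} (hu : IsUnit u) {k : ℕ} (h : x * u ^ k = y)
    (hy : Commute u y) : Commute u x := by
  refine (hu.pow k).mul_right_cancel ?_
  rw [mul_assoc, h, hy.eq, ← h, mul_assoc, mul_assoc, ← pow_succ, ← pow_succ']

/-- The algebra of elements `φ(c) φ(δ)⁻ᵏ`, for central `δ`. -/
def fracAlg (φ : C →ₐ[ℂ] S) {δ : C} (hδ : ∀ c, Commute δ c) (hu : IsUnit (φ δ)) :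
    Subalgebra ℂ S :=
  { fracs φ.toLinearMap (φ δ) (LinearMap.mulRight ℂ δ) (fun a => map_mul φ a δ) with
    mul_mem' := by
      rintro x y ⟨k, a, ha⟩ ⟨l, b, hb⟩
      have ha : x * φ δ ^ k = φ a := ha
      have hb : y * φ δ ^ l = φ b := hb
      refine ⟨k + l, a * b, ?_⟩
      have h1 : Commute (φ δ) y := commute_of_mul_pow_eq hu hb ((hδ b).map φ)
      change _ = φ (a * b)
      rw [map_mul, ← ha, ← hb, pow_add, mul_assoc, mul_assoc, ← mul_assoc (φ δ ^ k) y,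
        (h1.pow_left k).eq, mul_assoc]
    algebraMap_mem' := fun c => ⟨0, algebraMap ℂ C c, by
      change _ = φ _
      rw [pow_zero, mul_one, AlgHom.commutes]⟩ }

theorem mem_fracAlg {φ : C →ₐ[ℂ] S} {δ : C} {hδ : ∀ c, Commute δ c} {hu : IsUnit (φ δ)} {x : S} :
    x ∈ fracAlg φ hδ hu ↔ ∃ (k : ℕ) (c : C), x * φ δ ^ k = φ c := Iff.rfl

theorem apply_mem_fracAlg {φ : C →ₐ[ℂ] S} {δ : C} {hδ : ∀ c, Commute δ c} {hu : IsUnit (φ δ)}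
    (c : C) : φ c ∈ fracAlg φ hδ hu := ⟨0, c, by rw [pow_zero, mul_one]; rfl⟩

/-- The universal property of inverting a central element `δ`, for an algebra `C` that is realized
faithfully inside `S`. -/
theorem exists_fracAlg_lift {φ : C →ₐ[ℂ] S} (hφ : Function.Injective φ) {δ : C}
    (hδ : ∀ c, Commute δ c) (hu : IsUnit (φ δ)) (ψ : C →ₐ[ℂ] E) (hψ : IsUnit (ψ δ)) :
    ∃ θ : fracAlg φ hδ hu →ₐ[ℂ] E, ∀ c, θ ⟨φ c, apply_mem_fracAlg c⟩ = ψ c := by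
  let T : E ≃ₗ[ℂ] E := LinearEquiv.ofBijective (LinearMap.mulRight ℂ (ψ δ))
    ⟨hψ.mul_left_injective, fun x => by
      obtain ⟨u, hu⟩ := hψ
      exact ⟨x * (u⁻¹ : Eˣ), by rw [LinearMap.mulRight_apply, ← hu, Units.inv_mul_cancel_right]⟩⟩
  have hTa : ∀ (k : ℕ) x, (T ^ k) x = x * ψ δ ^ k := by
    intro k
    induction k with
    | zero => intro x; rw [pow_zero, pow_zero, mul_one]; rfl
    | succ k ih =>
      intro x
      rw [pow_succ', LinearEquiv.mul_apply, ih, pow_succ, ← mul_assoc]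
      rfl
  obtain ⟨θ, hθ⟩ := exists_fracs_lift (ρ := φ.toLinearMap) hφ
    (d := LinearMap.mulRight ℂ δ) (fun a => map_mul φ a δ) ψ.toLinearMap T
    (fun a => map_mul ψ a δ)
  simp only [hTa] at hθ
  let θ' : fracAlg φ hδ hu → E := θ
  have hθ' : ∀ (x : fracAlg φ hδ hu) (k : ℕ) (c : C), (x : S) * φ δ ^ k = φ c →
      θ' x * ψ δ ^ k = ψ c := hθ
  have hone : ∀ (x : fracAlg φ hδ hu) (c : C), (x : S) = φ c → θ' x = ψ c := fun x c h => by
    have := hθ' x 0 c (by rw [pow_zero, mul_one, h])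
    rwa [pow_zero, mul_one] at this
  refine ⟨AlgHom.ofLinearMap { toFun := θ', map_add' := θ.map_add, map_smul' := θ.map_smul } ?_ ?_,
    fun c => hone _ c rfl⟩
  · change θ' 1 = 1
    rw [hone 1 1 (by rw [map_one]; rfl), map_one]
  · intro x y
    change θ' (x * y) = θ' x * θ' y
    obtain ⟨k, a, ha⟩ := x.2
    obtain ⟨l, b, hb⟩ := y.2
    have ha : (x : S) * φ δ ^ k = φ a := ha
    have hb : (y : S) * φ δ ^ l = φ b := hb
    have h1 : Commute (φ δ) y := commute_of_mul_pow_eq hu hb ((hδ b).map φ)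
    have h2 : Commute (ψ δ) (θ' y) := commute_of_mul_pow_eq hψ (hθ' y l b hb) ((hδ b).map ψ)
    have h3 : ((x * y : fracAlg φ hδ hu) : S) * φ δ ^ (k + l) = φ (a * b) := by
      rw [map_mul, ← ha, ← hb, pow_add]
      change (x : S) * y * _ = _
      rw [mul_assoc, mul_assoc, ← mul_assoc (φ δ ^ k) (y : S), (h1.pow_left k).eq, mul_assoc]
    have h4 := hθ' _ _ _ h3
    refine (hψ.pow (k + l)).mul_right_cancel ?_
    rw [h4, map_mul, ← hθ' x k a ha, ← hθ' y l b hb, pow_add, mul_assoc, mul_assoc,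
      ← mul_assoc (ψ δ ^ k), (h2.pow_left k).eq, mul_assoc]

end FracAlg

/-! ### The symmetric denominator -/

section Delta

/-- The rational function `X + X⁻¹` in one of the variables. -/
def ratChi {r : ℕ} (i : Fin r) : RatFun r := ratX i + (ratX i)⁻¹

/-- The Laurent polynomial `X + X⁻¹` in one of the variables. -/
def varChi {r : ℕ} (i : Fin r) : AddMonoidAlgebra ℂ (Fin r → ℤ) := varX i + varXinv i

theorem toRat_varChi {r : ℕ} (i : Fin r) : toRat r (varChi i) = ratChi i := by
  rw [varChi, map_add, toRat_varX, toRat_varXinv, ratChi]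

theorem aut_flipAut_ratChi {r : ℕ} (a i : Fin r) : aut (flipAut a) (ratChi i) = ratChi i := by
  by_cases h : i = a
  · subst h
    rw [ratChi, map_add, map_inv₀, aut_flipAut_ratX_self, inv_inv, add_comm]
  · rw [ratChi, map_add, map_inv₀, aut_flipAut_ratX_of_ne h]

theorem aut_permAut_ratChi {r : ℕ} (σ : Equiv.Perm (Fin r)) (i : Fin r) :
    aut (permAut σ) (ratChi i) = ratChi (σ i) := by
  rw [ratChi, map_add, map_inv₀, aut_permAut_ratX, ratChi]

variable {n m : ℕ}

/-- Invariance under the reflections that preserve the two blocks of variables. -/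
structure IsBlockSym (k : RatFun (n + m)) : Prop where
  flip : ∀ a, aut (flipAut a) k = k
  swap_left : ∀ i j, aut (swapAut (Fin.castAdd m i) (Fin.castAdd m j)) k = k
  swap_right : ∀ i j, aut (swapAut (Fin.natAdd n i) (Fin.natAdd n j)) k = k

theorem swap_castAdd_castAdd (i j l : Fin n) :
    Equiv.swap (Fin.castAdd m i) (Fin.castAdd m j) (Fin.castAdd m l) =
      Fin.castAdd m (Equiv.swap i j l) :=
  ((Fin.castAdd_injective n m).map_swap i j l).symm

theorem swap_natAdd_natAdd (i j l : Fin m) :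
    Equiv.swap (Fin.natAdd n i) (Fin.natAdd n j) (Fin.natAdd n l) =
      Fin.natAdd n (Equiv.swap i j l) :=
  ((Fin.natAdd_injective m n).map_swap i j l).symm

theorem swap_castAdd_natAdd (i j : Fin n) (l : Fin m) :
    Equiv.swap (Fin.castAdd m i) (Fin.castAdd m j) (Fin.natAdd n l) = Fin.natAdd n l :=
  Equiv.swap_apply_of_ne_of_ne (castAdd_ne_natAdd i l).symm (castAdd_ne_natAdd j l).symm

theorem swap_natAdd_castAdd (i j : Fin m) (l : Fin n) :
    Equiv.swap (Fin.natAdd n i) (Fin.natAdd n j) (Fin.castAdd m l) = Fin.castAdd m l :=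
  Equiv.swap_apply_of_ne_of_ne (castAdd_ne_natAdd l i) (castAdd_ne_natAdd l j)

/-- A product over pairs of variables from the two blocks is invariant. -/
theorem isBlockSym_prod_prod (F : RatFun (n + m) → RatFun (n + m) → RatFun (n + m))
    (hF : ∀ g x y, aut g (F x y) = F (aut g x) (aut g y)) :
    IsBlockSym (∏ i : Fin n, ∏ j : Fin m, F (ratChi (Fin.castAdd m i))
      (ratChi (Fin.natAdd n j))) where
  flip a := by simp only [map_prod, hF, aut_flipAut_ratChi]
  swap_left i j := by
    simp only [map_prod, hF, aut_permAut_ratChi, swap_castAdd_castAdd, swap_castAdd_natAdd]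
    exact Equiv.prod_comp (Equiv.swap i j) fun l => ∏ k : Fin m,
      F (ratChi (Fin.castAdd m l)) (ratChi (Fin.natAdd n k))
  swap_right i j := by
    simp only [map_prod, hF, aut_permAut_ratChi, swap_natAdd_natAdd, swap_natAdd_castAdd]
    refine Finset.prod_congr rfl fun l _ => ?_
    exact Equiv.prod_comp (Equiv.swap i j) fun k =>
      F (ratChi (Fin.castAdd m l)) (ratChi (Fin.natAdd n k))

/-- Products over each block are invariant if they involve the variables only through `X + X⁻¹`. -/
theorem isBlockSym_prod_mul_prod (F G : RatFun (n + m) → RatFun (n + m))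
    (hF : ∀ g x, aut g (F x) = F (aut g x)) (hG : ∀ g x, aut g (G x) = G (aut g x)) :
    IsBlockSym ((∏ i : Fin n, F (ratChi (Fin.castAdd m i))) *
      ∏ j : Fin m, G (ratChi (Fin.natAdd n j))) where
  flip a := by simp only [map_mul, map_prod, hF, hG, aut_flipAut_ratChi]
  swap_left i j := by
    simp only [map_mul, map_prod, hF, hG, aut_permAut_ratChi, swap_castAdd_castAdd,
      swap_castAdd_natAdd]
    rw [Equiv.prod_comp (Equiv.swap i j) fun l => F (ratChi (Fin.castAdd m l))]
  swap_right i j := by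
    simp only [map_mul, map_prod, hF, hG, aut_permAut_ratChi, swap_natAdd_natAdd,
      swap_natAdd_castAdd]
    rw [Equiv.prod_comp (Equiv.swap i j) fun l => G (ratChi (Fin.natAdd n l))]

theorem commute_mulOp_genOp {s r : ℕ} (p₀ p₁ : ℂˣ) (ι : Fin s → Fin r) {k : RatFun r}
    (h0 : ∀ i, aut (flipAut (ι i)) k = k) (h1 : ∀ i j, aut (swapAut (ι i) (ι j)) k = k)
    (g : HeckeGen s) : Commute (mulOp k) (genOp p₀ p₁ ι g) := by
  rcases g with ⟨i, hi⟩ | i | i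
  · rcases i with - | i
    · rw [genOp_T_zero]
      exact (opT₀_mul_mulOp p₀ (h0 _)).symm
    · rw [genOp_T_succ]
      exact (opT_mul_mulOp p₁ (h1 _ _)).symm
  · exact (Commute.all _ _).map mulOp
  · exact (Commute.all _ _).map mulOp

theorem commute_mulOp_rep {s r : ℕ} (p₀ p₁ : ℂˣ) {ι : Fin s → Fin r} (hι : Function.Injective ι)
    {k : RatFun r} (h0 : ∀ i, aut (flipAut (ι i)) k = k)
    (h1 : ∀ i j, aut (swapAut (ι i) (ι j)) k = k) (x : HeckeB p₀ p₁ s) :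
    Commute (mulOp k) (rep p₀ p₁ ι hι x) := by
  refine mem_of_gen_mem p₀ p₁ (S := (Subalgebra.centralizer ℂ {mulOp k}).comap (rep p₀ p₁ ι hι))
    (fun g => ?_) x _ rfl
  rintro _ rfl
  change mulOp k * rep p₀ p₁ ι hι (gen p₀ p₁ s g) = rep p₀ p₁ ι hι (gen p₀ p₁ s g) * mulOp k
  rw [rep_gen]
  exact commute_mulOp_genOp p₀ p₁ ι h0 h1 g

/-- Multiplication by an invariant function commutes with the two Hecke algebras. -/
theorem IsBlockSym.commute_tensorRep (p₀ p₁ : ℂˣ) {k : RatFun (n + m)} (hk : IsBlockSym k)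
    (c : HeckeB p₀ p₁ n ⊗[ℂ] HeckeB p₀ p₁ m) :
    Commute (mulOp k) (tensorRep p₀ p₁ n m c) := by
  induction c using TensorProduct.induction_on with
  | zero => rw [map_zero]; exact Commute.zero_right _
  | tmul x y =>
    rw [tensorRep_tmul]
    exact (commute_mulOp_rep p₀ p₁ _ (fun _ => hk.flip _) hk.swap_left x).mul_right
      (commute_mulOp_rep p₀ p₁ _ (fun _ => hk.flip _) hk.swap_right y)
  | add x y hx hy => rw [map_add]; exact hx.add_right hy

variable (p₀ p₁ : ℂˣ) (n m)

/-- A Laurent polynomial that is invariant under the reflections preserving the two blocks of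
variables and that is divisible by all elements inverted in the coefficient ring. Up to a monomial
it is the denominator `D`: the factor of a pair is, with `χ = X + X⁻¹`,
`(χ_i - χ_j) (χ_i - p₁² X_j - p₁⁻² X_j⁻¹) (χ_i - p₁⁻² X_j - p₁² X_j⁻¹)`. -/
def delta : AddMonoidAlgebra ℂ (Fin (n + m) → ℤ) :=
  ∏ i : Fin n, ∏ j : Fin m, (varChi (Fin.castAdd m i) - varChi (Fin.natAdd n j)) *
    (varChi (Fin.castAdd m i) ^ 2 + varChi (Fin.natAdd n j) ^ 2 -
      algebraMap ℂ _ ((p₁ : ℂ) ^ 2 + ((p₁ : ℂ)⁻¹) ^ 2) *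
        (varChi (Fin.castAdd m i) * varChi (Fin.natAdd n j)) +
      algebraMap ℂ _ (((p₁ : ℂ) ^ 2 - ((p₁ : ℂ)⁻¹) ^ 2) ^ 2))

/-- The symmetric denominator as a rational function. -/
def ratDelta : RatFun (n + m) := toRat (n + m) (delta n m p₁)

theorem isBlockSym_ratDelta : IsBlockSym (ratDelta n m p₁) := by
  rw [ratDelta, delta]
  generalize (p₁ : ℂ) ^ 2 + ((p₁ : ℂ)⁻¹) ^ 2 = s
  generalize ((p₁ : ℂ) ^ 2 - ((p₁ : ℂ)⁻¹) ^ 2) ^ 2 = t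
  simp only [map_prod, map_mul, map_sub, map_add, map_pow, AlgHom.commutes, toRat_varChi]
  exact isBlockSym_prod_prod (n := n) (m := m) (fun x y => (x - y) * (x ^ 2 + y ^ 2 -
      algebraMap ℂ _ s * (x * y) + algebraMap ℂ _ t)) (fun g x y => by
    simp only [map_mul, map_sub, map_add, map_pow, AlgEquiv.commutes])

variable {n m}

/-- The factorization of one factor of the symmetric denominator. -/
theorem delta_factor {R : Type*} [CommRing R] {x x' y y' c c' : R} (hx : x * x' = 1)
    (hy : y * y' = 1) (hc : c * c' = 1) :
    (x + x' - (y + y')) * ((x + x') ^ 2 + (y + y') ^ 2 - (c + c') * ((x + x') * (y + y')) +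
      (c - c') ^ 2) = x' ^ 3 * ((x - y) * (x - y') * ((x - c * y) * (x - c' * y')) *
        ((x - c' * y) * (x - c * y'))) := by
  -- The case of one pair of factors. It is used for the parameters `1`, `c` and `c'`.
  have key : ∀ c c' : R, c * c' = 1 →
      x + x' - c * y - c' * y' = x' * ((x - c * y) * (x - c' * y')) := fun c c' hc => by
    linear_combination (-x + c' * y' + c * y) * hx - x' * c * c' * hy - x' * hc
  have h1 := key 1 1 (one_mul 1)
  have h2 := key c c' hc
  have h3 := key c' c (by rw [mul_comm, hc])
  have h4 : (x + x') ^ 2 + (y + y') ^ 2 - (c + c') * ((x + x') * (y + y')) + (c - c') ^ 2 =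
      (x + x' - c * y - c' * y') * (x + x' - c' * y - c * y') := by
    linear_combination (-(y ^ 2 + y' ^ 2) - 2) * hc + (2 - c ^ 2 - c' ^ 2) * hy
  have h5 : x + x' - (y + y') = x' * ((x - y) * (x - y')) := by linear_combination h1
  rw [h4, h5, h2, h3]
  ring

theorem smul_eq_algebraMap_mul {R : Type*} [Ring R] [Algebra ℂ R] (c : ℂ) (x : R) :
    c • x = algebraMap ℂ R c * x := Algebra.smul_def c x

/-- The product of all six elements inverted for a pair of variables divides the symmetric
denominator. -/
theorem dvd_delta (i : Fin n) (j : Fin m) {f : AddMonoidAlgebra ℂ (Fin (n + m) → ℤ)}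
    (hf : f ∣ (varX (Fin.castAdd m i) - varX (Fin.natAdd n j)) *
        (varX (Fin.castAdd m i) - varXinv (Fin.natAdd n j)) *
        ((varX (Fin.castAdd m i) - (p₁ : ℂ) ^ 2 • varX (Fin.natAdd n j)) *
        (varX (Fin.castAdd m i) - ((p₁ : ℂ)⁻¹) ^ 2 • varXinv (Fin.natAdd n j))) *
        ((varX (Fin.castAdd m i) - ((p₁ : ℂ)⁻¹) ^ 2 • varX (Fin.natAdd n j)) *
        (varX (Fin.castAdd m i) - (p₁ : ℂ) ^ 2 • varXinv (Fin.natAdd n j)))) :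
    f ∣ delta n m p₁ := by
  refine dvd_trans ?_ (Finset.dvd_prod_of_mem _ (Finset.mem_univ i))
  refine dvd_trans ?_ (Finset.dvd_prod_of_mem _ (Finset.mem_univ j))
  have hc : algebraMap ℂ (AddMonoidAlgebra ℂ (Fin (n + m) → ℤ)) ((p₁ : ℂ) ^ 2) *
      algebraMap ℂ _ (((p₁ : ℂ)⁻¹) ^ 2) = 1 := by
    rw [← map_mul, ← mul_pow, mul_inv_cancel₀ p₁.ne_zero, one_pow, map_one]
  have h := delta_factor (varX_mul_varXinv (Fin.castAdd m i))
    (varX_mul_varXinv (Fin.natAdd n j)) hc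
  rw [varChi, varChi, map_add, map_pow _ (_ - _), map_sub (algebraMap ℂ _), h]
  simp only [← smul_eq_algebraMap_mul]
  exact hf.mul_left _

/-- The symmetric denominator is a denominator for every element of the coefficient ring. -/
theorem exists_mul_delta_pow {x : Loc p₀ p₁ (n + m)}
    (hx : x ∈ coeffRing p₀ p₁ n m (n + m) rfl) : ∃ f : RatFun (n + m),
      locRep p₀ p₁ (n + m) x = mulOp f ∧
        ∃ (k : ℕ) (g : _), f * ratDelta n m p₁ ^ k = toRat _ g := by
  induction hx using Algebra.adjoin_induction with
  | mem x hx =>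
    rcases hx with ⟨i, rfl | rfl⟩ | ⟨d, ⟨i, j, hd⟩, rfl⟩
    · exact ⟨_, locRep_locX p₀ p₁ i, 0, varX i, by rw [pow_zero, mul_one]; rfl⟩
    · exact ⟨_, locRep_locXinv p₀ p₁ i, 0, varXinv i, by rw [pow_zero, mul_one, toRat_varXinv]⟩
    -- An adjoined inverse has a divisor `f` of the symmetric denominator as its denominator.
    · have key : ∀ f : AddMonoidAlgebra ℂ (Fin (n + m) → ℤ), toRat (n + m) f ≠ 0 →
          d = toLoc p₀ p₁ (n + m) (laurentHom p₀ p₁ (n + m) f) → f ∣ delta n m p₁ →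
          ∃ f : RatFun (n + m), locRep p₀ p₁ (n + m) (Ring.inverse d) = mulOp f ∧
            ∃ (k : ℕ) (g : _), f * ratDelta n m p₁ ^ k = toRat _ g := by
        rintro f hf rfl ⟨g, hg⟩
        refine ⟨_, locRep_inverse p₀ p₁ hf, 1, g, ?_⟩
        rw [pow_one, ratDelta, hg, map_mul, inv_mul_cancel_left₀ hf]
      have h1 : ∀ p : ℂˣ, toRat (n + m) (varX (Fin.castAdd m i) - (p : ℂ) • varX (Fin.natAdd n j))
          ≠ 0 := fun p => by
        have := ratX_comb_ne_zero (castAdd_ne_natAdd i j) 1 p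
        rwa [cst, Units.val_one, map_one, one_mul, ← smul_eq_cst_mul, ← toRat_varX, ← toRat_varX,
          ← map_smul, ← map_sub] at this
      have h2 : ∀ p : ℂˣ, toRat (n + m)
          (varX (Fin.castAdd m i) - (p : ℂ) • varXinv (Fin.natAdd n j)) ≠ 0 := fun p => by
        have := ratX_comb_inv_ne_zero (castAdd_ne_natAdd i j) 1 p
        rwa [cst, Units.val_one, map_one, one_mul, ← smul_eq_cst_mul, ← toRat_varX,
          ← toRat_varXinv, ← map_smul, ← map_sub] at this
      have e1 : ((p₁ ^ 2 : ℂˣ) : ℂ) = (p₁ : ℂ) ^ 2 := rfl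
      have e2 : ((p₁⁻¹ ^ 2 : ℂˣ) : ℂ) = ((p₁ : ℂ)⁻¹) ^ 2 := by
        rw [Units.val_pow_eq_pow_val, Units.val_inv_eq_inv_val]
      -- The six kinds of factors of `D`.
      rcases hd with hd | hd | hd | hd | hd | hd
      · refine key _ (h1 (p₁ ^ 2)) (by simp only [map_sub, map_smul, toLoc_varX]; exact hd)
          (dvd_delta p₁ i j ?_)
        exact Dvd.dvd.mul_right (Dvd.dvd.mul_left (Dvd.intro _ rfl) _) _
      · refine key _ (h1 (p₁⁻¹ ^ 2)) (by simp only [map_sub, map_smul, toLoc_varX, e2]; exact hd)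
          (dvd_delta p₁ i j ?_)
        rw [e2]
        exact Dvd.dvd.mul_left (Dvd.intro _ rfl) _
      · refine key _ (h2 (p₁ ^ 2))
          (by simp only [map_sub, map_smul, toLoc_varX, toLoc_varXinv]; exact hd)
          (dvd_delta p₁ i j ?_)
        exact Dvd.dvd.mul_left (Dvd.intro_left _ rfl) _
      · refine key _ (h2 (p₁⁻¹ ^ 2))
          (by simp only [map_sub, map_smul, toLoc_varX, toLoc_varXinv, e2]; exact hd)
          (dvd_delta p₁ i j ?_)
        rw [e2]
        exact Dvd.dvd.mul_right (Dvd.dvd.mul_left (Dvd.intro_left _ rfl) _) _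
      · refine key _ (h1 1)
          (by simp only [map_sub, toLoc_varX, Units.val_one, one_smul]; exact hd)
          (dvd_delta p₁ i j ?_)
        rw [Units.val_one, one_smul]
        exact Dvd.dvd.mul_right (Dvd.dvd.mul_right (Dvd.intro _ rfl) _) _
      · refine key _ (h2 1)
          (by simp only [map_sub, toLoc_varX, toLoc_varXinv, Units.val_one, one_smul];
              exact hd)
          (dvd_delta p₁ i j ?_)
        rw [Units.val_one, one_smul]
        exact Dvd.dvd.mul_right (Dvd.dvd.mul_right (Dvd.intro_left _ rfl) _) _
  | algebraMap c =>
    refine ⟨algebraMap ℂ _ c, ?_, 0, algebraMap ℂ _ c, ?_⟩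
    · rw [AlgHom.commutes, AlgHom.commutes]
    · rw [pow_zero, mul_one, AlgHom.commutes]
  | add x y _ _ hx hy =>
    obtain ⟨f, hf, k, g, hg⟩ := hx
    obtain ⟨f', hf', k', g', hg'⟩ := hy
    -- The exponents of the denominators may be added.
    refine ⟨f + f', by rw [map_add, hf, hf', map_add], k + k',
      g * delta n m p₁ ^ k' + g' * delta n m p₁ ^ k, ?_⟩
    rw [map_add, map_mul, map_mul, ← hg, ← hg', map_pow, map_pow, ← ratDelta]
    ring
  | mul x y _ _ hx hy =>
    obtain ⟨f, hf, k, g, hg⟩ := hx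
    obtain ⟨f', hf', k', g', hg'⟩ := hy
    refine ⟨f * f', by rw [map_mul, hf, hf', map_mul], k + k', g * g', ?_⟩
    rw [map_mul, ← hg, ← hg']
    ring

/-- By `delta_factor`, up to a monomial each factor is a product of six differences of distinct
monomials. -/
theorem ratDelta_ne_zero : ratDelta n m p₁ ≠ 0 := by
  rw [ratDelta, delta]
  simp only [map_prod, map_mul, map_sub, map_add, map_pow, AlgHom.commutes, toRat_varChi]
  refine Finset.prod_ne_zero_iff.2 fun i _ => Finset.prod_ne_zero_iff.2 fun j _ => ?_
  have hne := castAdd_ne_natAdd i j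
  have hc : cst (p₁ ^ 2) (n + m) * cst (p₁⁻¹ ^ 2) (n + m) = 1 := by
    rw [cst, cst, ← map_mul, ← Units.val_mul, ← mul_pow, mul_inv_cancel, one_pow, Units.val_one,
      map_one]
  have h := delta_factor (mul_inv_cancel₀ (ratX_ne_zero (Fin.castAdd m i)))
    (mul_inv_cancel₀ (ratX_ne_zero (Fin.natAdd n j))) hc
  have e : ∀ p : ℂˣ, cst (p ^ 2) (n + m) = algebraMap ℂ _ (p : ℂ) ^ 2 := fun p => by
    rw [cst, Units.val_pow_eq_pow_val, map_pow]
  have h1 : ∀ p : ℂˣ, ratX (Fin.castAdd m i) - cst p (n + m) * ratX (Fin.natAdd n j) ≠ 0 :=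
    fun p => by
      have := ratX_comb_ne_zero hne 1 p
      rwa [cst, Units.val_one, map_one, one_mul] at this
  have h2 : ∀ p : ℂˣ, ratX (Fin.castAdd m i) - cst p (n + m) * (ratX (Fin.natAdd n j))⁻¹ ≠ 0 :=
    fun p => by
      have := ratX_comb_inv_ne_zero hne 1 p
      rwa [cst, Units.val_one, map_one, one_mul] at this
  have h3 := h1 1
  have h4 := h2 1
  rw [cst, Units.val_one, map_one, one_mul] at h3 h4
  rw [e, e, Units.val_inv_eq_inv_val] at h
  have h5 := mul_ne_zero (pow_ne_zero 3 (inv_ne_zero (ratX_ne_zero (Fin.castAdd m i))))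
    (mul_ne_zero (mul_ne_zero (mul_ne_zero h3 h4) (mul_ne_zero (h1 (p₁ ^ 2)) (h2 (p₁⁻¹ ^ 2))))
      (mul_ne_zero (h1 (p₁⁻¹ ^ 2)) (h2 (p₁ ^ 2))))
  rw [e, e, Units.val_inv_eq_inv_val, ← h] at h5
  simpa only [ratChi] using h5

end Delta

end HeckeB
end

noncomputable section

namespace HeckeB

/-! ### Shuffles -/

section Shuffle

variable {n r : ℕ}

/-- The shuffles of the two blocks of positions `{1, …, n}` and `{n + 1, …, r}`, generated by
exchanging adjacent values that come from different blocks. -/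
inductive IsShuffle (n : ℕ) {r : ℕ} : Equiv.Perm (Fin r) → Prop
  | one : IsShuffle n 1
  | step (w : Equiv.Perm (Fin r)) (k : ℕ) (h : k + 1 < r) (hw : IsShuffle n w)
      (hd : DiffBlock n (w.symm ⟨k, by omega⟩) (w.symm ⟨k + 1, h⟩)) :
      IsShuffle n (Equiv.swap ⟨k, by omega⟩ ⟨k + 1, h⟩ * w)

theorem swap_adjacent_lt {k : ℕ} (h : k + 1 < r) {a b : Fin r} (hab : a < b)
    (hne : ¬ (a = ⟨k, by omega⟩ ∧ b = ⟨k + 1, h⟩)) :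
    Equiv.swap (⟨k, by omega⟩ : Fin r) ⟨k + 1, h⟩ a <
      Equiv.swap (⟨k, by omega⟩ : Fin r) ⟨k + 1, h⟩ b := by
  rw [Equiv.swap_apply_def, Equiv.swap_apply_def]
  simp only [Fin.lt_def, Fin.ext_iff] at *
  split_ifs <;> simp <;> omega

theorem IsShuffle.lt {w : Equiv.Perm (Fin r)} (hw : IsShuffle n w) :
    ∀ {i j : Fin r}, (i.val < n ↔ j.val < n) → i < j → w i < w j := by
  induction hw with
  | one => intro i j _ h; exact h
  | step w k h hw hd ih =>
    intro i j hb hij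
    refine swap_adjacent_lt h (ih hb hij) ?_
    rintro ⟨h1, h2⟩
    rw [← h1, ← h2, Equiv.symm_apply_apply, Equiv.symm_apply_apply] at hd
    exact hd hb

theorem IsShuffle.symm_lt {w : Equiv.Perm (Fin r)} (hw : IsShuffle n w) {a b : Fin r}
    (hb : (w.symm a).val < n ↔ (w.symm b).val < n) (hab : a < b) : w.symm a < w.symm b := by
  by_contra hlt
  rcases (not_lt.1 hlt).eq_or_lt with h | h
  · exact hab.ne (w.symm.injective h).symm
  · have := hw.lt hb.symm h
    rw [Equiv.apply_symm_apply, Equiv.apply_symm_apply] at this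
    exact lt_asymm hab this

/-- Adjacent values of a shuffle that come from the same block come from adjacent positions. -/
theorem IsShuffle.adjacent {w : Equiv.Perm (Fin r)} (hw : IsShuffle n w) {k : ℕ} (h : k + 1 < r)
    (hd : ¬ DiffBlock n (w.symm ⟨k, by omega⟩) (w.symm ⟨k + 1, h⟩)) :
    (w.symm ⟨k + 1, h⟩).val = (w.symm ⟨k, by omega⟩).val + 1 := by
  have hb := not_not.1 hd
  have hlt := hw.symm_lt hb (by simp [Fin.lt_def])
  by_contra hne
  rw [Fin.lt_def] at hlt
  have h1 := (w.symm ⟨k + 1, h⟩).isLt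
  set c : Fin r := ⟨(w.symm ⟨k, by omega⟩).val + 1, by omega⟩ with hc
  have hcv : c.val = (w.symm ⟨k, by omega⟩).val + 1 := rfl
  have h2 := hw.lt (i := w.symm ⟨k, by omega⟩) (j := c) (by omega) (by rw [Fin.lt_def]; omega)
  have h3 := hw.lt (i := c) (j := w.symm ⟨k + 1, h⟩) (by omega) (by rw [Fin.lt_def]; omega)
  rw [Equiv.apply_symm_apply, Fin.lt_def] at h2 h3
  simp only at h2 h3
  omega

/-- The smallest value of a shuffle is taken at the beginning of one of the blocks. -/
theorem IsShuffle.symm_zero {w : Equiv.Perm (Fin r)} (hw : IsShuffle n w) (h : 0 < r) :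
    (w.symm ⟨0, h⟩).val = 0 ∨ (w.symm ⟨0, h⟩).val = n := by
  by_contra! hne
  have h1 := (w.symm ⟨0, h⟩).isLt
  have h2 := hw.lt (i := ⟨(w.symm ⟨0, h⟩).val - 1, by omega⟩) (j := w.symm ⟨0, h⟩)
    (by simp only; omega) (by rw [Fin.lt_def]; simp only; omega)
  rw [Equiv.apply_symm_apply, Fin.lt_def] at h2
  simp at h2

/-- A shuffle is determined by the set of values that come from the first block. -/
theorem IsShuffle.ext {w w' : Equiv.Perm (Fin r)} (hw : IsShuffle n w) (hw' : IsShuffle n w')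
    (h : ∀ a, (w.symm a).val < n ↔ (w'.symm a).val < n) : w = w' := by
  have hmono : StrictMono fun i => w'.symm (w i) := by
    intro i j hij
    have hi := h (w i)
    have hj := h (w j)
    rw [Equiv.symm_apply_apply] at hi hj
    by_cases hb : i.val < n ↔ j.val < n
    · exact hw'.symm_lt (by rw [← hi, ← hj, hb]) (hw.lt hb hij)
    · simp only [Fin.lt_def] at *
      omega
  have h1 : Set.range (fun i => w'.symm (w i)) = Set.range (id : Fin r → Fin r) := by
    rw [Set.range_id]
    exact (w'.symm.surjective.comp w.surjective).range_eq
  have h2 := (hmono.range_inj strictMono_id).1 h1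
  ext1 i
  have := congrFun h2 i
  rw [Equiv.symm_apply_eq] at this
  exact this

/-- If a shuffle takes a positive value at the first position of the second block, then the
preceding value comes from the first block. -/
theorem IsShuffle.diffBlock_pred {w : Equiv.Perm (Fin r)} (hw : IsShuffle n w) {k : ℕ}
    (h : k + 1 < r) (hk : (w.symm ⟨k + 1, h⟩).val = n) : (w.symm ⟨k, by omega⟩).val < n := by
  by_contra hn
  have := hw.symm_lt (a := ⟨k, by omega⟩) (b := ⟨k + 1, h⟩) (by omega) (by simp [Fin.lt_def])
  rw [Fin.lt_def] at this
  omega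

/-- The first position of the second block can be shuffled to any place inside the first block, one
step to the left at a time. -/
theorem exists_isShuffle_apply (hn : n < r) (j : ℕ) :
    ∀ (hj : j ≤ n), ∃ w : Equiv.Perm (Fin r), IsShuffle n w ∧ w ⟨n, hn⟩ = ⟨n - j, by omega⟩ := by
  induction j with
  | zero => intro _; exact ⟨1, .one, rfl⟩
  | succ j ih =>
    intro hj
    obtain ⟨w, hw, h⟩ := ih (by omega)
    have e : (⟨n - j, by omega⟩ : Fin r) = ⟨n - (j + 1) + 1, by omega⟩ := by
      rw [Fin.ext_iff]; simp only; omega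
    rw [e] at h
    have h1 : w.symm ⟨n - (j + 1) + 1, by omega⟩ = ⟨n, hn⟩ := by rw [← h, Equiv.symm_apply_apply]
    have h2 := hw.diffBlock_pred (k := n - (j + 1)) (by omega) (by rw [h1])
    refine ⟨_, .step w (n - (j + 1)) (by omega) hw ?_, ?_⟩
    · rw [DiffBlock, h1]
      simp only
      omega
    · rw [Equiv.Perm.mul_apply, h, Equiv.swap_apply_right]

end Shuffle

/-! ### Unnormalized intertwiners -/

section Tau

variable (p₀ p₁ : ℂˣ) {r : ℕ}

/-- The unnormalized intertwiner `T_i (X_i - X_{i+1}) + (p₁ - p₁⁻¹) X_{i+1}` for `i = k + 1`. -/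
def tau (k : ℕ) (h : k + 1 < r) : HeckeB p₀ p₁ r :=
  gen p₀ p₁ r (.T ⟨k + 1, h⟩) *
      (gen p₀ p₁ r (.X ⟨k, by omega⟩) - gen p₀ p₁ r (.X ⟨k + 1, h⟩)) +
    ((p₁ : ℂ) - (p₁ : ℂ)⁻¹) • gen p₀ p₁ r (.X ⟨k + 1, h⟩)

/-- The combination of `T_i` and variables in the unnormalized intertwiner cancels the identity part
of the Demazure–Lusztig operator. -/
theorem opT_mul_sub (p : ℂˣ) {a b : Fin r} (hab : a ≠ b) :
    opT p a b * mulOp (ratX a - ratX b) + mulOp ((cst p r - (cst p r)⁻¹) * ratX b) =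
      mulOp ((cst p r)⁻¹ * ratX b - cst p r * ratX a) * autOp (swapAut a b) := by
  ext z
  simp only [Module.End.mul_apply, LinearMap.add_apply, mulOp_apply, opT_apply, autOp_apply]
  rw [map_mul, map_sub, aut_swapAut_ratX_left, aut_swapAut_ratX_right]
  have h1 := ratX_sub_ne_zero hab
  generalize aut (swapAut a b) z = w at *
  generalize ratX a = x at *
  generalize ratX b = y at *
  field_simp
  ring

/-- The intertwiner acts as a transposition followed by a multiplication. -/
theorem dlRep_tau (k : ℕ) (h : k + 1 < r) :
    dlRep p₀ p₁ r (tau p₀ p₁ k h) =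
      mulOp ((cst p₁ r)⁻¹ * ratX ⟨k + 1, h⟩ - cst p₁ r * ratX ⟨k, by omega⟩) *
        autOp (swapAut ⟨k, by omega⟩ ⟨k + 1, h⟩) := by
  rw [tau, map_add, map_mul, map_sub, map_smul, dlRep_gen, dlRep_gen, dlRep_gen, genOp_T_succ,
    ← opT_mul_sub p₁ (a := ⟨k, by omega⟩) (b := ⟨k + 1, h⟩) (by simp)]
  congr 1
  · rw [map_sub]; rfl
  · rw [sub_mul, ← smul_eq_cst_mul, ← inv_smul_eq_cst_mul, ← sub_smul, map_smul]; rfl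

theorem dlRep_tau' (k : ℕ) (h : k + 1 < r) :
    dlRep p₀ p₁ r (tau p₀ p₁ k h) = autOp (swapAut ⟨k, by omega⟩ ⟨k + 1, h⟩) *
      mulOp ((cst p₁ r)⁻¹ * ratX ⟨k, by omega⟩ - cst p₁ r * ratX ⟨k + 1, h⟩) := by
  rw [dlRep_tau, autOp_mul_mulOp]
  congr 2
  rw [map_sub, map_mul, map_mul, map_inv₀, aut_cst, aut_swapAut_ratX_left, aut_swapAut_ratX_right]

/-- Moving `(p₁⁻¹ X_a - p₁ X_b)⁻¹` past `T_0`. The pole at `X_a = ±1` in the correction term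
cancels. -/
theorem inv_comb_mul_opT₀ (p p' : ℂˣ) {a b : Fin r} (hab : a ≠ b) :
    mulOp ((cst p' r)⁻¹ * ratX a - cst p' r * ratX b)⁻¹ * opT₀ p a =
      opT₀ p a * mulOp (ratX a * ((cst p' r)⁻¹ - cst p' r * (ratX b * ratX a))⁻¹) +
        mulOp (-((cst p r - (cst p r)⁻¹) * (cst p' r)⁻¹ * ratX a ^ 2) *
          ((cst p' r)⁻¹ * ratX a - cst p' r * ratX b)⁻¹ *
            ((cst p' r)⁻¹ - cst p' r * (ratX b * ratX a))⁻¹) := by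
  have hne1 : (cst p' r)⁻¹ * ratX a - cst p' r * ratX b ≠ 0 := by
    rw [← cst_inv]
    exact ratX_comb_ne_zero hab _ _
  have hne2 : (cst p' r)⁻¹ - cst p' r * (ratX b * ratX a) ≠ 0 := by
    intro h0
    refine ratX_comb_inv_ne_zero hab p' p'⁻¹ ?_
    rw [cst_inv]
    have h2 := ratX_ne_zero b
    have h3 : ((cst p' r)⁻¹ - cst p' r * (ratX b * ratX a)) * (-(ratX b)⁻¹) = 0 := by
      rw [h0, zero_mul]
    rw [← h3]
    field_simp
    ring
  ext z
  simp only [Module.End.mul_apply, LinearMap.add_apply, mulOp_apply, opT₀_apply]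
  simp only [map_mul, map_inv₀, map_sub, aut_cst, aut_flipAut_ratX_self,
    aut_flipAut_ratX_of_ne hab.symm]
  have h1 := ratX_sq_sub_ne_zero a
  have h2 := ratX_ne_zero a
  have h3 := cst_ne_zero (r := r) p'
  generalize aut (flipAut a) z = w at *
  generalize ratX a = x at *
  generalize ratX b = y at *
  generalize cst p' r = q at *
  have h4 : q⁻¹ - q * (y * x⁻¹) = (q⁻¹ * x - q * y) / x := by field_simp
  rw [h4]
  generalize cst p r - (cst p r)⁻¹ = c at *
  generalize (cst p r)⁻¹ * x ^ 2 - cst p r = d at *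
  -- The identity is linear in `z` and its reflection `w`. The denominators `u` and `v` are kept as
  -- unknowns, and their definitions enter only in the end.
  generalize hu : q⁻¹ * x - q * y = u at *
  generalize hv : q⁻¹ - q * (y * x) = v at *
  have h5 : q * v = 1 - q ^ 2 * y * x := by rw [← hv]; field_simp
  have h6 : q * u = x - q ^ 2 * y := by rw [← hu]; field_simp
  field_simp
  linear_combination (c * x ^ 2 * z) * h5 - (c * x ^ 3 * z) * h6

end Tau

/-! ### The bimodule as a space of operators -/

section BimodOps

variable (p₀ p₁ : ℂˣ) {n m : ℕ}

theorem coeffRing_le_bimod {f : Loc p₀ p₁ (n + m)} (hf : f ∈ coeffRing p₀ p₁ n m (n + m) rfl) :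
    f ∈ bimod p₀ p₁ n m (n + m) rfl := Submodule.subset_span hf

theorem toLoc_mul_mem_bimod (a : HeckeB p₀ p₁ (n + m)) {x : Loc p₀ p₁ (n + m)}
    (hx : x ∈ bimod p₀ p₁ n m (n + m) rfl) :
    toLoc p₀ p₁ (n + m) a * x ∈ bimod p₀ p₁ n m (n + m) rfl :=
  Submodule.smul_mem _ a hx

theorem mul_mem_bimod {x f : Loc p₀ p₁ (n + m)} (hx : x ∈ bimod p₀ p₁ n m (n + m) rfl)
    (hf : f ∈ coeffRing p₀ p₁ n m (n + m) rfl) : x * f ∈ bimod p₀ p₁ n m (n + m) rfl := by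
  induction hx using Submodule.span_induction with
  | mem x hx => exact coeffRing_le_bimod p₀ p₁ (mul_mem hx hf)
  | zero => rw [zero_mul]; exact zero_mem _
  | add x y _ _ hx hy => rw [add_mul]; exact add_mem hx hy
  | smul a x _ hx =>
    have : a • x * f = a • (x * f) := mul_assoc (toLoc p₀ p₁ (n + m) a) x f
    rw [this]
    exact Submodule.smul_mem _ a hx

theorem exists_of_mem_coeffFun {f : RatFun (n + m)} (hf : f ∈ coeffFun p₀ p₁ n m) :
    ∃ x ∈ coeffRing p₀ p₁ n m (n + m) rfl, locRep p₀ p₁ (n + m) x = mulOp f := hf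

/-- The operator of a shuffle is the image of an element of the bimodule. -/
theorem exists_mem_bimod_of_isShuffle {w : Equiv.Perm (Fin (n + m))} (hw : IsShuffle n w) :
    ∃ x ∈ bimod p₀ p₁ n m (n + m) rfl, locRep p₀ p₁ (n + m) x = autOp (permAut w) := by
  induction hw with
  | one => exact ⟨1, coeffRing_le_bimod p₀ p₁ (one_mem _), by rw [map_one, map_one, map_one]⟩
  | step w k h hw hd ih =>
    obtain ⟨x, hx, hxw⟩ := ih
    obtain ⟨f, hf, hff⟩ := exists_of_mem_coeffFun p₀ p₁ (inv_comb_mem_coeffFun p₀ p₁ hd.symm)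
    refine ⟨toLoc p₀ p₁ _ (tau p₀ p₁ k h) * (x * f),
      toLoc_mul_mem_bimod p₀ p₁ _ (mul_mem_bimod p₀ p₁ hx hf), ?_⟩
    have hne : (cst p₁ (n + m))⁻¹ * ratX ⟨k, by omega⟩ - cst p₁ (n + m) * ratX ⟨k + 1, h⟩ ≠ 0 := by
      rw [← cst_inv]
      exact ratX_comb_ne_zero (by simp) _ _
    rw [map_mul, map_mul, hxw, hff, locRep_toLoc, dlRep_tau', autOp_mul_mulOp (permAut w),
      map_inv₀ (aut _), map_sub (aut _), map_mul (aut _), map_mul (aut _), map_inv₀ (aut _),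
        aut_cst, aut_permAut_ratX,
      aut_permAut_ratX, Equiv.apply_symm_apply, Equiv.apply_symm_apply, mul_assoc,
      ← mul_assoc (mulOp _) (mulOp _), ← map_mul, mul_inv_cancel₀ hne, map_one, one_mul,
      ← map_mul, ← map_mul]

/-- Every element of the bimodule is a fraction with a power of the symmetric denominator. -/
theorem exists_mul_ratDelta_pow {x : Loc p₀ p₁ (n + m)}
    (hx : x ∈ bimod p₀ p₁ n m (n + m) rfl) : ∃ (k : ℕ) (a : HeckeB p₀ p₁ (n + m)),
      locRep p₀ p₁ (n + m) x * mulOp (ratDelta n m p₁) ^ k = dlRep p₀ p₁ (n + m) a := by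
  induction hx using Submodule.span_induction with
  | mem x hx =>
    obtain ⟨f, hf, k, g, hg⟩ := exists_mul_delta_pow p₀ p₁ hx
    exact ⟨k, laurentHom p₀ p₁ _ g, by rw [hf, ← map_pow, ← map_mul, hg, dlRep_laurentHom]⟩
  | zero => exact ⟨0, 0, by simp⟩
  | add x y _ _ hx hy =>
    obtain ⟨k, a, ha⟩ := hx
    obtain ⟨l, b, hb⟩ := hy
    refine ⟨k + l, a * laurentHom p₀ p₁ _ (delta n m p₁ ^ l) +
      b * laurentHom p₀ p₁ _ (delta n m p₁ ^ k), ?_⟩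
    rw [map_add (dlRep _ _ _), map_mul (dlRep _ _ _), map_mul (dlRep _ _ _), dlRep_laurentHom,
      dlRep_laurentHom, map_pow, map_pow, map_pow, map_pow, ← ratDelta, ← ha, ← hb, map_add,
      add_mul, mul_assoc, mul_assoc, ← pow_add, ← pow_add, add_comm l k]
  | smul a x _ hx =>
    obtain ⟨k, b, hb⟩ := hx
    refine ⟨k, a * b, ?_⟩
    have : a • x = toLoc p₀ p₁ (n + m) a * x := rfl
    rw [this, map_mul, map_mul, mul_assoc, hb, locRep_toLoc]

/-- The action of `T_0` in the variable number `n + 1`, composed with a shuffle, comes from the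
bimodule. The step moves the variable by an adjacent transposition `s`; to write `s` as
`τ (p₁⁻¹ X_a - p₁ X_b)⁻¹`, the inverse is moved past `T_0`, and the correction term has its
pole at `X_a = ±1` cancelled. -/
theorem exists_mem_bimod_opT₀_mul (j : ℕ) : ∀ (hj : j < n + m) (w : Equiv.Perm (Fin (n + m))),
    IsShuffle n w → (w.symm ⟨j, hj⟩).val = n → ∃ x ∈ bimod p₀ p₁ n m (n + m) rfl,
      locRep p₀ p₁ (n + m) x = opT₀ p₀ ⟨j, hj⟩ * autOp (permAut w) := by
  induction j with
  | zero =>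
    intro hj w hw _
    obtain ⟨x, hx, hxw⟩ := exists_mem_bimod_of_isShuffle p₀ p₁ hw
    exact ⟨_, toLoc_mul_mem_bimod p₀ p₁ (gen p₀ p₁ _ (.T ⟨0, hj⟩)) hx, by
      rw [map_mul, locRep_locT, hxw, genOp_T_zero]; rfl⟩
  | succ j ih =>
    intro hj w hw hn
    -- The value `j` comes from the first block, so exchanging `j` and `j + 1` gives a shuffle `w'`
    -- to which the induction hypothesis applies.
    have hi := hw.diffBlock_pred hj hn
    have ih := ih (by omega)
    have hs := IsShuffle.step w j hj hw (by rw [DiffBlock]; omega)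
    have htau := dlRep_tau' p₀ p₁ j hj
    obtain ⟨a, ha⟩ : ∃ a : Fin (n + m), a = ⟨j, by omega⟩ := ⟨_, rfl⟩
    obtain ⟨b, hb⟩ : ∃ b : Fin (n + m), b = ⟨j + 1, hj⟩ := ⟨_, rfl⟩
    have hab : a ≠ b := by simp [ha, hb]
    rw [← ha] at hi ih
    rw [← hb] at hn
    rw [← ha, ← hb] at hs htau
    rw [← hb]
    have hd : DiffBlock n (w.symm a) (w.symm b) := by rw [DiffBlock]; omega
    obtain ⟨w', hw'⟩ : ∃ w', w' = Equiv.swap a b * w := ⟨_, rfl⟩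
    rw [← hw'] at hs
    have ea : w'.symm a = w.symm b := by
      rw [Equiv.symm_apply_eq, hw', Equiv.Perm.mul_apply, Equiv.apply_symm_apply,
        Equiv.swap_apply_right]
    have eb : w'.symm b = w.symm a := by
      rw [Equiv.symm_apply_eq, hw', Equiv.Perm.mul_apply, Equiv.apply_symm_apply,
        Equiv.swap_apply_left]
    obtain ⟨x, hx, hxw⟩ := ih w' hs (by rw [ea]; exact hn)
    obtain ⟨y, hy, hyw⟩ := exists_mem_bimod_of_isShuffle p₀ p₁ hs
    have ei : w.symm a = Fin.castAdd m ⟨(w.symm a).val, hi⟩ := rfl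
    have hm : 0 < m := by have := (w.symm b).isLt; omega
    have en : w.symm b = Fin.natAdd n ⟨0, hm⟩ := Fin.ext hn
    obtain ⟨q, hq⟩ : ∃ q, q = cst p₁ (n + m) := ⟨_, rfl⟩
    obtain ⟨c, hc⟩ : ∃ c, c = cst p₀ (n + m) - (cst p₀ (n + m))⁻¹ := ⟨_, rfl⟩
    rw [← hq] at htau
    have hne1 : q⁻¹ * ratX a - q * ratX b ≠ 0 := by
      rw [hq, ← cst_inv]
      exact ratX_comb_ne_zero hab _ _
    -- The coefficients on the right of `T_0` and of the correction term. Moved past `w'`, they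
    -- involve one variable of each block and lie in the coefficient ring.
    obtain ⟨f₁, hf₁⟩ : ∃ f₁, f₁ = ratX a * (q⁻¹ - q * (ratX b * ratX a))⁻¹ := ⟨_, rfl⟩
    obtain ⟨f₂, hf₂⟩ : ∃ f₂, f₂ = -(c * q⁻¹ * ratX a ^ 2) * (q⁻¹ * ratX a - q * ratX b)⁻¹ *
      (q⁻¹ - q * (ratX b * ratX a))⁻¹ := ⟨_, rfl⟩
    have key : mulOp (q⁻¹ * ratX a - q * ratX b)⁻¹ * opT₀ p₀ a =
        opT₀ p₀ a * mulOp f₁ + mulOp f₂ := by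
      rw [hf₁, hf₂, hc, hq]
      exact inv_comb_mul_opT₀ p₀ p₁ hab
    have hg₁ : aut (permAut w'.symm) f₁ ∈ coeffFun p₀ p₁ n m := by
      have := mul_mem (ratX_mem_coeffFun p₀ p₁ (w.symm b))
        (inv_comb_mul_mem_coeffFun p₀ p₁ ⟨(w.symm a).val, hi⟩ ⟨0, hm⟩)
      rw [← ei, ← en] at this
      simpa only [hf₁, map_mul, map_inv₀, map_sub, hq, aut_cst, aut_permAut_ratX, ea, eb] using this
    have hg₂ : aut (permAut w'.symm) f₂ ∈ coeffFun p₀ p₁ n m := by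
      have h1 := inv_comb_mul_mem_coeffFun p₀ p₁ ⟨(w.symm a).val, hi⟩ ⟨0, hm⟩
      rw [← ei, ← en] at h1
      have h2 := inv_comb_mem_coeffFun p₀ p₁ hd
      have h3 : c * q⁻¹ * ratX (w.symm b) ^ 2 ∈ coeffFun p₀ p₁ n m := by
        rw [hc]
        refine mul_mem (mul_mem (sub_mem (cst_mem_coeffFun p₀ p₁ _) ?_) ?_)
          (pow_mem (ratX_mem_coeffFun p₀ p₁ _) 2)
        · rw [← cst_inv]; exact cst_mem_coeffFun p₀ p₁ _
        · rw [hq, ← cst_inv]; exact cst_mem_coeffFun p₀ p₁ _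
      have := mul_mem (mul_mem (neg_mem h3) h2) h1
      simpa only [hf₂, map_mul, map_neg, map_pow, map_inv₀, map_sub, hq, hc, aut_cst,
        aut_permAut_ratX, ea, eb] using this
    obtain ⟨g₁, hg₁, e₁⟩ := exists_of_mem_coeffFun p₀ p₁ hg₁
    obtain ⟨g₂, hg₂, e₂⟩ := exists_of_mem_coeffFun p₀ p₁ hg₂
    have hinv : ∀ f, aut (permAut w') (aut (permAut w'.symm) f) = f := fun f => by
      rw [← aut_mul_apply, ← map_mul]
      have : w' * w'.symm = 1 := mul_inv_cancel w'
      rw [this, map_one, map_one]; rfl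
    -- The element is `τ` times an element for `w'`; conjugation by the transposition turns `T_0` in
    -- the variable `j` into `T_0` in the variable `j + 1`.
    refine ⟨toLoc p₀ p₁ _ (tau p₀ p₁ j hj) * (x * g₁ + y * g₂), toLoc_mul_mem_bimod p₀ p₁ _
      (add_mem (mul_mem_bimod p₀ p₁ hx hg₁) (mul_mem_bimod p₀ p₁ hy hg₂)), ?_⟩
    have hk : opT₀ p₀ a * autOp (permAut w') * mulOp (aut (permAut w'.symm) f₁) +
        autOp (permAut w') * mulOp (aut (permAut w'.symm) f₂) =
        mulOp (q⁻¹ * ratX a - q * ratX b)⁻¹ * (opT₀ p₀ a * autOp (permAut w')) := by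
      rw [mul_assoc, autOp_mul_mulOp, autOp_mul_mulOp, hinv, hinv, ← mul_assoc, ← mul_assoc,
        ← add_mul, key]
    rw [map_mul, map_add, map_mul, map_mul, hxw, hyw, e₁, e₂, hk, locRep_toLoc, htau, mul_assoc,
      ← mul_assoc (mulOp _) (mulOp _), ← map_mul, mul_inv_cancel₀ hne1, map_one,
      one_mul, ← mul_assoc, autOp_mul_opT₀, Equiv.swap_apply_left, mul_assoc, ← map_mul,
      ← map_mul, hw', ← mul_assoc (Equiv.swap a b), Equiv.swap_mul_self, one_mul]

end BimodOps

end HeckeB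
end

noncomputable section

namespace HeckeB

/-! ### The localized tensor product of the two Hecke algebras -/

section BlockAlg

variable (p₀ p₁ : ℂˣ) (n m : ℕ)

/-- Laurent polynomials in all variables as elements of `H^B_n ⊗ H^B_m`. -/
def laurentTensor :
    AddMonoidAlgebra ℂ (Fin (n + m) → ℤ) →ₐ[ℂ] HeckeB p₀ p₁ n ⊗[ℂ] HeckeB p₀ p₁ m :=
  AddMonoidAlgebra.lift ℂ _ (Fin (n + m) → ℤ)
    { toFun := fun a => monomial p₀ p₁ (fun i => a.toAdd (Fin.castAdd m i)) ⊗ₜ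
        monomial p₀ p₁ (fun i => a.toAdd (Fin.natAdd n i))
      map_one' := by
        change monomial p₀ p₁ (0 : Fin n → ℤ) ⊗ₜ monomial p₀ p₁ (0 : Fin m → ℤ) = 1
        rw [monomial_zero, monomial_zero]; rfl
      map_mul' := fun a b => by
        rw [Algebra.TensorProduct.tmul_mul_tmul, ← monomial_add, ← monomial_add]; rfl }

theorem laurentTensor_single (a : Fin (n + m) → ℤ) :
    laurentTensor p₀ p₁ n m (AddMonoidAlgebra.single a 1) =
      monomial p₀ p₁ (fun i => a (Fin.castAdd m i)) ⊗ₜ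
        monomial p₀ p₁ (fun i => a (Fin.natAdd n i)) := by
  rw [laurentTensor, AddMonoidAlgebra.lift_single, one_smul]; rfl

variable {n m}

theorem laurentTensor_varX_castAdd (i : Fin n) :
    laurentTensor p₀ p₁ n m (varX (Fin.castAdd m i)) = gen p₀ p₁ n (.X i) ⊗ₜ 1 := by
  rw [varX, laurentTensor_single, ← laurentHom_varX, varX, laurentHom_single, one_smul]
  congr 1
  · congr 1; ext j; simp [Pi.single_apply]
  · rw [← monomial_zero]; congr 1; ext j
    simp [(castAdd_ne_natAdd i j).symm]

theorem laurentTensor_varX_natAdd (i : Fin m) :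
    laurentTensor p₀ p₁ n m (varX (Fin.natAdd n i)) = 1 ⊗ₜ gen p₀ p₁ m (.X i) := by
  rw [varX, laurentTensor_single, ← laurentHom_varX, varX, laurentHom_single, one_smul]
  congr 1
  · rw [← monomial_zero]; congr 1; ext j
    simp [castAdd_ne_natAdd j i]
  · congr 1; ext j; simp [Pi.single_apply]

theorem tensorRep_laurentTensor (f : AddMonoidAlgebra ℂ (Fin (n + m) → ℤ)) :
    tensorRep p₀ p₁ n m (laurentTensor p₀ p₁ n m f) = mulOp (toRat (n + m) f) := by
  have h : (tensorRep p₀ p₁ n m).comp (laurentTensor p₀ p₁ n m) =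
      (mulOp (r := n + m)).comp (toRat (n + m)) := by
    refine AddMonoidAlgebra.algHom_ext (fun a => ?_) (Subsingleton.elim _ _)
    change tensorRep p₀ p₁ n m (laurentTensor p₀ p₁ n m (AddMonoidAlgebra.single a 1)) =
      mulOp (mono a)
    rw [laurentTensor_single, tensorRep_tmul, leftRep_monomial, rightRep_monomial, ← map_mul,
      ← mono_add]
    congr 2
    ext i
    refine Fin.addCases (fun i => ?_) (fun i => ?_) i <;> simp
  exact DFunLike.congr_fun h f

variable (n m)

/-- The symmetric denominator as an element of `H^B_n ⊗ H^B_m`. -/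
def deltaTensor : HeckeB p₀ p₁ n ⊗[ℂ] HeckeB p₀ p₁ m := laurentTensor p₀ p₁ n m (delta n m p₁)

theorem tensorRep_deltaTensor :
    tensorRep p₀ p₁ n m (deltaTensor p₀ p₁ n m) = mulOp (ratDelta n m p₁) :=
  tensorRep_laurentTensor p₀ p₁ _

/-- The symmetric denominator is central. -/
theorem commute_deltaTensor (c : HeckeB p₀ p₁ n ⊗[ℂ] HeckeB p₀ p₁ m) :
    Commute (deltaTensor p₀ p₁ n m) c := by
  refine tensorRep_injective p₀ p₁ ?_
  rw [map_mul, map_mul, tensorRep_deltaTensor]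
  exact (isBlockSym_ratDelta n m p₁).commute_tensorRep p₀ p₁ c

theorem isUnit_tensorRep_deltaTensor : IsUnit (tensorRep p₀ p₁ n m (deltaTensor p₀ p₁ n m)) := by
  rw [tensorRep_deltaTensor]
  exact isUnit_mulOp (ratDelta_ne_zero p₁)

/-- The algebra `(H^B_n ⊗ H^B_m)[D⁻¹]` as an algebra of operators. -/
def blockAlg : Subalgebra ℂ (Op (n + m)) :=
  fracAlg (tensorRep p₀ p₁ n m) (commute_deltaTensor p₀ p₁ n m)
    (isUnit_tensorRep_deltaTensor p₀ p₁ n m)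

variable {n m}

theorem tensorRep_mem_blockAlg (c : HeckeB p₀ p₁ n ⊗[ℂ] HeckeB p₀ p₁ m) :
    tensorRep p₀ p₁ n m c ∈ blockAlg p₀ p₁ n m := apply_mem_fracAlg c

theorem mulOp_mem_blockAlg {f : RatFun (n + m)} (hf : f ∈ coeffFun p₀ p₁ n m) :
    mulOp f ∈ blockAlg p₀ p₁ n m := by
  obtain ⟨x, hx, hxf⟩ := exists_of_mem_coeffFun p₀ p₁ hf
  obtain ⟨f', hf', k, g, hg⟩ := exists_mul_delta_pow p₀ p₁ hx
  have : f = f' := mulOp_injective (hxf.symm.trans hf')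
  subst this
  refine mem_fracAlg.2 ⟨k, laurentTensor p₀ p₁ n m g, ?_⟩
  rw [tensorRep_deltaTensor, tensorRep_laurentTensor, ← hg, map_mul, map_pow]

theorem genOp_castAdd_mem_blockAlg (g : HeckeGen n) :
    genOp p₀ p₁ (Fin.castAdd m) g ∈ blockAlg p₀ p₁ n m := by
  have h := tensorRep_mem_blockAlg p₀ p₁ (gen p₀ p₁ n g ⊗ₜ (1 : HeckeB p₀ p₁ m))
  rwa [tensorRep_tmul, map_one, mul_one, leftRep, rep_gen] at h

theorem genOp_natAdd_mem_blockAlg (g : HeckeGen m) :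
    genOp p₀ p₁ (Fin.natAdd n) g ∈ blockAlg p₀ p₁ n m := by
  have h := tensorRep_mem_blockAlg p₀ p₁ ((1 : HeckeB p₀ p₁ n) ⊗ₜ gen p₀ p₁ m g)
  rwa [tensorRep_tmul, map_one, one_mul, rightRep, rep_gen] at h

end BlockAlg

/-! ### The projection onto block-preserving operators -/

section Proj

variable (n m : ℕ)

/-- The lattice automorphisms that preserve the sublattice of the first block. -/
def blockGroup : Subgroup (LatAut (n + m)) where
  carrier := {g | ∀ a : Fin (n + m) → ℤ,
    (∀ j, a (Fin.natAdd n j) = 0) ↔ ∀ j, g a (Fin.natAdd n j) = 0}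
  one_mem' _ := Iff.rfl
  mul_mem' {_ h} hg hh a := (hh a).trans (hg (h a))
  inv_mem' {g} hg a := by
    have h := hg (g⁻¹ a)
    have e : g (g⁻¹ a) = a := g.apply_symm_apply a
    rw [e] at h
    exact h.symm

/-- The span over the rational functions of the lattice automorphisms. -/
def autSpan (r : ℕ) : Submodule (RatFun r) (Op r) := Submodule.span _ (Set.range autOp)

open Classical in
theorem exists_blockProj : ∃ π : Op (n + m) →ₗ[RatFun (n + m)] Op (n + m),
    ∀ g, π (autOp g) = if g ∈ blockGroup n m then autOp g else 0 := by
  have hli := linearIndependent_autOp (r := n + m)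
  obtain ⟨π, hπ⟩ := LinearMap.exists_extend ((Finsupp.linearCombination (RatFun (n + m))
    fun g => if g ∈ blockGroup n m then autOp g else 0) ∘ₗ hli.repr)
  refine ⟨π, fun g => ?_⟩
  have h := LinearMap.congr_fun hπ ⟨autOp g, Submodule.subset_span ⟨g, rfl⟩⟩
  have h2 : hli.repr ⟨autOp g, Submodule.subset_span ⟨g, rfl⟩⟩ = Finsupp.single g 1 :=
    hli.repr_eq_single g _ rfl
  change π (autOp g) = Finsupp.linearCombination _ _ (hli.repr _) at h
  rw [h, h2, Finsupp.linearCombination_single, one_smul]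

/-- A projection of the span of the lattice automorphisms onto the span of the block-preserving
ones, linear over the rational functions. -/
def blockProj : Op (n + m) →ₗ[RatFun (n + m)] Op (n + m) := (exists_blockProj n m).choose

variable {n m}

open Classical in
theorem blockProj_autOp (g : LatAut (n + m)) :
    blockProj n m (autOp g) = if g ∈ blockGroup n m then autOp g else 0 :=
  (exists_blockProj n m).choose_spec g

theorem blockProj_mulOp_mul (k : RatFun (n + m)) (x : Op (n + m)) :
    blockProj n m (mulOp k * x) = mulOp k * blockProj n m x :=
  (blockProj n m).map_smul k x

theorem autSpan_induction {r : ℕ} {P : Op r → Prop} {x : Op r} (hx : x ∈ autSpan r)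
    (aut : ∀ (k : RatFun r) (g : LatAut r), P (mulOp k * autOp g)) (zero : P 0)
    (add : ∀ x y, P x → P y → P (x + y)) : P x := by
  obtain ⟨f, rfl⟩ := (Finsupp.mem_span_range_iff_exists_finsupp).1 hx
  exact Finset.sum_induction _ P add zero fun g _ => aut _ _

theorem mulOp_mul_autOp_mem_autSpan {r : ℕ} (k : RatFun r) (g : LatAut r) :
    mulOp k * autOp g ∈ autSpan r :=
  Submodule.smul_mem _ k (Submodule.subset_span ⟨g, rfl⟩)

theorem autOp_mul_mem_autSpan {r : ℕ} (g : LatAut r) {x : Op r} (hx : x ∈ autSpan r) :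
    autOp g * x ∈ autSpan r := by
  refine autSpan_induction (P := fun x => autOp g * x ∈ autSpan r) hx (fun k h => ?_) ?_
    fun x y hx hy => ?_
  · rw [← mul_assoc, autOp_mul_mulOp, mul_assoc, ← map_mul]
    exact mulOp_mul_autOp_mem_autSpan _ _
  · rw [mul_zero]; exact zero_mem _
  · rw [mul_add]; exact add_mem hx hy

variable (n m)

/-- The operators through which the projection is linear on both sides. -/
def biLin : Subalgebra ℂ (Op (n + m)) where
  carrier := {b | ∀ x ∈ autSpan (n + m),
    (x * b ∈ autSpan (n + m) ∧ blockProj n m (x * b) = blockProj n m x * b) ∧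
    (b * x ∈ autSpan (n + m) ∧ blockProj n m (b * x) = b * blockProj n m x)}
  mul_mem' {b c} hb hc x hx := by
    obtain ⟨⟨h1, h2⟩, -⟩ := hb x hx
    obtain ⟨⟨h3, h4⟩, -⟩ := hc _ h1
    obtain ⟨-, h5, h6⟩ := hc x hx
    obtain ⟨-, h7, h8⟩ := hb _ h5
    rw [← mul_assoc, h4, h2, mul_assoc b c x, h8, h6]
    exact ⟨⟨h3, mul_assoc _ _ _⟩, h7, (mul_assoc _ _ _).symm⟩
  add_mem' {b c} hb hc x hx := by
    obtain ⟨⟨h1, h2⟩, h3, h4⟩ := hb x hx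
    obtain ⟨⟨h5, h6⟩, h7, h8⟩ := hc x hx
    rw [mul_add, add_mul, map_add, map_add, h2, h4, h6, h8, mul_add, add_mul]
    exact ⟨⟨add_mem h1 h5, rfl⟩, add_mem h3 h7, rfl⟩
  algebraMap_mem' c x hx := by
    rw [← Algebra.commutes c x, ← Algebra.commutes c (blockProj n m x),
      ← AlgHom.commutes (mulOp (r := n + m)), blockProj_mulOp_mul]
    have := Submodule.smul_mem _ (algebraMap ℂ (RatFun (n + m)) c) hx
    exact ⟨⟨this, rfl⟩, this, rfl⟩

variable {n m}

theorem mulOp_mem_biLin (k : RatFun (n + m)) : mulOp k ∈ biLin n m := by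
  intro x hx
  refine ⟨?_, Submodule.smul_mem _ k hx, blockProj_mulOp_mul k x⟩
  refine autSpan_induction (P := fun x => x * mulOp k ∈ autSpan (n + m) ∧
    blockProj n m (x * mulOp k) = blockProj n m x * mulOp k) hx (fun l g => ?_) ?_
    fun x y hx hy => ?_
  · rw [mul_assoc, autOp_mul_mulOp, ← mul_assoc, ← map_mul]
    refine ⟨mulOp_mul_autOp_mem_autSpan _ _, ?_⟩
    rw [blockProj_mulOp_mul, blockProj_mulOp_mul, blockProj_autOp]
    split_ifs
    · rw [map_mul, mul_assoc, mul_assoc, autOp_mul_mulOp]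
    · rw [mul_zero, mul_zero, zero_mul]
  · rw [zero_mul, map_zero, zero_mul]; exact ⟨zero_mem _, rfl⟩
  · rw [add_mul, map_add, map_add, add_mul, hx.2, hy.2]; exact ⟨add_mem hx.1 hy.1, rfl⟩

theorem autOp_mem_biLin {h : LatAut (n + m)} (hh : h ∈ blockGroup n m) :
    autOp h ∈ biLin n m := by
  intro x hx
  refine autSpan_induction (P := fun x =>
    (x * autOp h ∈ autSpan (n + m) ∧ blockProj n m (x * autOp h) = blockProj n m x * autOp h) ∧
    (autOp h * x ∈ autSpan (n + m) ∧ blockProj n m (autOp h * x) = autOp h * blockProj n m x))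
    hx (fun l g => ?_) ?_ fun x y hx hy => ?_
  · have h1 : g * h ∈ blockGroup n m ↔ g ∈ blockGroup n m :=
      Subgroup.mul_mem_cancel_right _ hh
    have h2 : h * g ∈ blockGroup n m ↔ g ∈ blockGroup n m :=
      Subgroup.mul_mem_cancel_left _ hh
    rw [mul_assoc, ← map_mul, ← mul_assoc, autOp_mul_mulOp, mul_assoc, ← map_mul]
    refine ⟨⟨mulOp_mul_autOp_mem_autSpan _ _, ?_⟩, mulOp_mul_autOp_mem_autSpan _ _, ?_⟩
    · rw [blockProj_mulOp_mul, blockProj_mulOp_mul, blockProj_autOp, blockProj_autOp]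
      by_cases hg : g ∈ blockGroup n m
      · rw [if_pos (h1.2 hg), if_pos hg, map_mul, mul_assoc]
      · rw [if_neg (fun h => hg (h1.1 h)), if_neg hg, mul_zero, zero_mul]
    · rw [blockProj_mulOp_mul, blockProj_mulOp_mul, blockProj_autOp, blockProj_autOp]
      by_cases hg : g ∈ blockGroup n m
      · rw [if_pos (h2.2 hg), if_pos hg, map_mul, ← mul_assoc, ← mul_assoc, autOp_mul_mulOp]
      · rw [if_neg (fun h => hg (h2.1 h)), if_neg hg, mul_zero, mul_zero, mul_zero]
  · simp
  · obtain ⟨⟨h1, h2⟩, h3, h4⟩ := hx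
    obtain ⟨⟨h5, h6⟩, h7, h8⟩ := hy
    rw [mul_add, add_mul, map_add, map_add, map_add, h2, h4, h6, h8, mul_add, add_mul]
    exact ⟨⟨add_mem h1 h5, rfl⟩, add_mem h3 h7, rfl⟩

theorem swapAut_castAdd_mem_blockGroup (i j : Fin n) :
    swapAut (Fin.castAdd m i) (Fin.castAdd m j) ∈ blockGroup n m := by
  intro a
  refine forall_congr' fun l => ?_
  rw [permAut_apply, Equiv.symm_swap, swap_castAdd_natAdd]

theorem swapAut_natAdd_mem_blockGroup (i j : Fin m) :
    swapAut (Fin.natAdd n i) (Fin.natAdd n j) ∈ blockGroup n m := by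
  intro a
  have h : ∀ l, swapAut (Fin.natAdd n i) (Fin.natAdd n j) a (Fin.natAdd n l) =
      a (Fin.natAdd n (Equiv.swap i j l)) := fun l => by
    rw [permAut_apply, Equiv.symm_swap, swap_natAdd_natAdd]
  simp only [h]
  exact ((Equiv.swap i j).forall_congr_left (p := fun l => a (Fin.natAdd n l) = 0)).trans
    (by simp only [Equiv.symm_swap])

theorem flipAut_mem_blockGroup (i : Fin (n + m)) : flipAut i ∈ blockGroup n m := by
  intro a
  refine forall_congr' fun l => ?_
  by_cases h : Fin.natAdd n l = i
  · rw [h, flipAut_apply_self, neg_eq_zero]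
  · rw [flipAut_apply_of_ne h]

/-- A permutation whose lattice automorphism preserves the blocks maps the first block of
positions to itself. -/
theorem lt_iff_of_permAut_mem_blockGroup {σ : Equiv.Perm (Fin (n + m))}
    (h : permAut σ ∈ blockGroup n m) (i : Fin (n + m)) : i.val < n ↔ (σ i).val < n := by
  have key : ∀ b : Fin (n + m),
      (∀ j : Fin m, (Pi.single b 1 : Fin (n + m) → ℤ) (Fin.natAdd n j) = 0)
      ↔ b.val < n := by
    intro b
    constructor
    · intro hb
      by_contra hn
      have := hb ⟨b.val - n, by omega⟩
      have e : Fin.natAdd n (⟨b.val - n, by omega⟩ : Fin m) = b := by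
        rw [Fin.ext_iff, Fin.val_natAdd]
        simp only
        omega
      rw [e, Pi.single_eq_same] at this
      exact one_ne_zero this
    · intro hb j
      refine Pi.single_eq_of_ne ?_ _
      rw [Ne, Fin.ext_iff, Fin.val_natAdd]
      omega
  have h1 := h (Pi.single i 1)
  have e : permAut σ (Pi.single i 1) = Pi.single (σ i) 1 := by
    ext j
    simp [Pi.single_apply, Equiv.symm_apply_eq]
  rwa [e, key, key] at h1

theorem genOp_mem_biLin {s : ℕ} (p₀ p₁ : ℂˣ) {ι : Fin s → Fin (n + m)}
    (hι : ∀ i j, swapAut (ι i) (ι j) ∈ blockGroup n m) (g : HeckeGen s) :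
    genOp p₀ p₁ ι g ∈ biLin n m := by
  rcases g with ⟨i, hi⟩ | i | i
  · rcases i with - | i
    · rw [genOp_T_zero]
      exact add_mem (mul_mem (mulOp_mem_biLin _) (autOp_mem_biLin (flipAut_mem_blockGroup _)))
        (mulOp_mem_biLin _)
    · rw [genOp_T_succ]
      exact add_mem (mul_mem (mulOp_mem_biLin _) (autOp_mem_biLin (hι _ _))) (mulOp_mem_biLin _)
  · exact mulOp_mem_biLin _
  · exact mulOp_mem_biLin _

variable (p₀ p₁ : ℂˣ)

variable (n m) in
/-- The operators whose coefficients at all shuffles lie in the localized tensor product. -/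
def shuffleSpace : Submodule ℂ (Op (n + m)) where
  carrier := {x | x ∈ autSpan (n + m) ∧ ∀ w : Equiv.Perm (Fin (n + m)), IsShuffle n w →
    blockProj n m (autOp (permAut w.symm) * x) ∈ blockAlg p₀ p₁ n m}
  zero_mem' := ⟨zero_mem _, fun w _ => by rw [mul_zero, map_zero]; exact zero_mem _⟩
  add_mem' hx hy := ⟨add_mem hx.1 hy.1, fun w hw => by
    rw [mul_add, map_add]; exact add_mem (hx.2 w hw) (hy.2 w hw)⟩
  smul_mem' c x hx := ⟨by
    rw [← algebraMap_smul (RatFun (n + m))]; exact Submodule.smul_mem _ _ hx.1, fun w hw => by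
    rw [mul_smul_comm, ← algebraMap_smul (RatFun (n + m)), map_smul, algebraMap_smul]
    exact Subalgebra.smul_mem _ (hx.2 w hw) c⟩

/-- A generator, moved past the inverse of a shuffle `w`, becomes an operator on the variables that
`w` places at the positions in question. If these lie in one block, the operator belongs to `H^B_n ⊗
H^B_m`; otherwise its coefficients belong to the coefficient ring and its transposition leads to
another shuffle. -/
theorem genOp_mul_mem_shuffleSpace (g : HeckeGen (n + m)) {x : Op (n + m)}
    (hx : x ∈ shuffleSpace n m p₀ p₁) : genOp p₀ p₁ id g * x ∈ shuffleSpace n m p₀ p₁ := by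
  obtain ⟨hx1, hx2⟩ := hx
  -- Operators of multiplication keep all coefficients in place.
  have hmul : ∀ k : RatFun (n + m), (∀ w : Equiv.Perm (Fin (n + m)),
      aut (permAut w.symm) k ∈ coeffFun p₀ p₁ n m) →
      mulOp k * x ∈ shuffleSpace n m p₀ p₁ := fun k hk => by
    refine ⟨Submodule.smul_mem _ k hx1, fun w hw => ?_⟩
    rw [← mul_assoc, autOp_mul_mulOp, mul_assoc, blockProj_mulOp_mul]
    exact mul_mem (mulOp_mem_blockAlg p₀ p₁ (hk w)) (hx2 w hw)
  -- Operators of the localized tensor product may be pulled out of the projection.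
  have hleft : ∀ (w : Equiv.Perm (Fin (n + m))), IsShuffle n w → ∀ T ∈ biLin n m,
      T ∈ blockAlg p₀ p₁ n m →
      blockProj n m (T * (autOp (permAut w.symm) * x)) ∈ blockAlg p₀ p₁ n m := by
    intro w hw T hT hT'
    rw [(hT _ (autOp_mul_mem_autSpan _ hx1)).2.2]
    exact mul_mem hT' (hx2 w hw)
  have hbl : ∀ g, genOp p₀ p₁ (Fin.castAdd m : Fin n → _) g ∈ biLin n m :=
    genOp_mem_biLin p₀ p₁ swapAut_castAdd_mem_blockGroup
  have hbr : ∀ g, genOp p₀ p₁ (Fin.natAdd n : Fin m → _) g ∈ biLin n m :=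
    genOp_mem_biLin p₀ p₁ swapAut_natAdd_mem_blockGroup
  rcases g with ⟨i, hi⟩ | i | i
  · rcases i with - | k
    · rw [genOp_T_zero, id]
      refine ⟨?_, fun w hw => ?_⟩
      · rw [opT₀, add_mul, mul_assoc]
        exact add_mem (Submodule.smul_mem _ _ (autOp_mul_mem_autSpan _ hx1))
          (Submodule.smul_mem _ _ hx1)
      · rw [← mul_assoc, autOp_mul_opT₀, mul_assoc]
        -- The smallest value comes from the beginning of a block, so the operator is the one of
        -- `T_0` in that block.
        by_cases hn : (w.symm ⟨0, hi⟩).val < n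
        · have h0 : (w.symm ⟨0, hi⟩).val = 0 := by have := hw.symm_zero hi; omega
          have e : w.symm ⟨0, hi⟩ = Fin.castAdd m (⟨0, by omega⟩ : Fin n) := Fin.ext h0
          rw [e]
          exact hleft w hw _ (hbl (.T ⟨0, by omega⟩))
            (genOp_castAdd_mem_blockAlg p₀ p₁ (.T ⟨0, by omega⟩))
        · have h0 : (w.symm ⟨0, hi⟩).val = n := by have := hw.symm_zero hi; omega
          have hm : 0 < m := by have := (w.symm ⟨0, hi⟩).isLt; omega
          have e : w.symm ⟨0, hi⟩ = Fin.natAdd n (⟨0, hm⟩ : Fin m) := Fin.ext h0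
          rw [e]
          exact hleft w hw _ (hbr (.T ⟨0, hm⟩)) (genOp_natAdd_mem_blockAlg p₀ p₁ (.T ⟨0, hm⟩))
    · rw [genOp_T_succ, id, id]
      refine ⟨?_, fun w hw => ?_⟩
      · rw [opT, add_mul, mul_assoc]
        exact add_mem (Submodule.smul_mem _ _ (autOp_mul_mem_autSpan _ hx1))
          (Submodule.smul_mem _ _ hx1)
      · rw [← mul_assoc, autOp_mul_opT, mul_assoc]
        by_cases hd : DiffBlock n (w.symm ⟨k, by omega⟩) (w.symm ⟨k + 1, hi⟩)
        · -- the transposition leads to another shuffle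
          have hs := IsShuffle.step w k hi hw hd
          have e : swapAut (w.symm ⟨k, by omega⟩) (w.symm ⟨k + 1, hi⟩) * permAut w.symm =
              permAut (Equiv.swap (⟨k, by omega⟩ : Fin (n + m)) ⟨k + 1, hi⟩ * w).symm := by
            rw [swapAut, ← map_mul]
            congr 1
            change _ = w⁻¹ * Equiv.swap _ _
            rw [Equiv.mul_swap_eq_swap_mul]; rfl
          have hp := cst_mem_coeffFun p₀ p₁ (n := n) (m := m) p₁
          have hp' := cst_mem_coeffFun p₀ p₁ (n := n) (m := m) p₁⁻¹
          rw [cst_inv] at hp'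
          have hX := ratX_mem_coeffFun p₀ p₁ (n := n) (m := m)
          have hi' := inv_ratX_sub_ratX_mem_coeffFun p₀ p₁ hd
          rw [opT, add_mul, mul_assoc, ← mul_assoc (autOp _), ← map_mul, e, map_add,
            blockProj_mulOp_mul, blockProj_mulOp_mul]
          refine add_mem (mul_mem (mulOp_mem_blockAlg p₀ p₁ ?_) (hx2 _ hs))
            (mul_mem (mulOp_mem_blockAlg p₀ p₁ ?_) (hx2 w hw))
          · rw [div_eq_mul_inv]
            exact mul_mem (sub_mem (mul_mem hp' (hX _)) (mul_mem hp (hX _))) hi'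
          · rw [div_eq_mul_inv]
            exact mul_mem (mul_mem (sub_mem hp hp') (hX _)) hi'
        · have hadj := hw.adjacent hi hd
          have hb := not_not.1 hd
          by_cases hn : (w.symm ⟨k, by omega⟩).val < n
          · have hn' := hb.1 hn
            have e1 : w.symm ⟨k, by omega⟩ =
                Fin.castAdd m (⟨(w.symm ⟨k, by omega⟩).val, hn⟩ : Fin n) := rfl
            have e2 : w.symm ⟨k + 1, hi⟩ =
                Fin.castAdd m (⟨(w.symm ⟨k, by omega⟩).val + 1, by omega⟩ : Fin n) := Fin.ext hadj
            rw [e2]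
            exact hleft w hw _ (hbl (.T ⟨(w.symm ⟨k, by omega⟩).val + 1, by omega⟩))
              (genOp_castAdd_mem_blockAlg p₀ p₁ (.T ⟨(w.symm ⟨k, by omega⟩).val + 1, by omega⟩))
          · have hlt := (w.symm ⟨k + 1, hi⟩).isLt
            have e1 : w.symm ⟨k, by omega⟩ =
                Fin.natAdd n (⟨(w.symm ⟨k, by omega⟩).val - n, by omega⟩ : Fin m) := by
              rw [Fin.ext_iff, Fin.val_natAdd]; simp only; omega
            have e2 : w.symm ⟨k + 1, hi⟩ =
                Fin.natAdd n (⟨(w.symm ⟨k, by omega⟩).val - n + 1, by omega⟩ : Fin m) := by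
              rw [Fin.ext_iff, Fin.val_natAdd]; simp only; omega
            have h3 : opT p₁ (w.symm ⟨k, by omega⟩) (w.symm ⟨k + 1, hi⟩) =
                genOp p₀ p₁ (Fin.natAdd n : Fin m → _)
                  (.T ⟨(w.symm ⟨k, by omega⟩).val - n + 1, by omega⟩) := by
              rw [genOp_T_succ, ← e1, ← e2]
            rw [h3]
            exact hleft w hw _ (hbr _) (genOp_natAdd_mem_blockAlg p₀ p₁ _)
  · refine hmul _ fun w => ?_
    rw [aut_permAut_ratX]
    exact ratX_mem_coeffFun p₀ p₁ _
  · refine hmul _ fun w => ?_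
    rw [map_inv₀, aut_permAut_ratX]
    exact ratX_inv_mem_coeffFun p₀ p₁ _

theorem dlRep_mul_mem_shuffleSpace (a : HeckeB p₀ p₁ (n + m)) {x : Op (n + m)}
    (hx : x ∈ shuffleSpace n m p₀ p₁) :
    dlRep p₀ p₁ (n + m) a * x ∈ shuffleSpace n m p₀ p₁ := by
  let S : Subalgebra ℂ (HeckeB p₀ p₁ (n + m)) :=
    { carrier := {a | ∀ x ∈ shuffleSpace n m p₀ p₁,
        dlRep p₀ p₁ (n + m) a * x ∈ shuffleSpace n m p₀ p₁}
      mul_mem' := fun {a b} ha hb x hx => by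
        rw [map_mul, mul_assoc]; exact ha _ (hb x hx)
      add_mem' := fun {a b} ha hb x hx => by
        rw [map_add, add_mul]; exact add_mem (ha x hx) (hb x hx)
      algebraMap_mem' := fun c x hx => by
        rw [AlgHom.commutes, ← Algebra.smul_def]
        exact Submodule.smul_mem _ c hx }
  refine mem_of_gen_mem p₀ p₁ (S := S) (fun g x hx => ?_) a x hx
  rw [dlRep_gen]
  exact genOp_mul_mem_shuffleSpace p₀ p₁ g hx

/-- The bimodule is spanned over the Hecke algebra by the coefficient ring, so only the coefficient
ring has to be checked. -/
theorem locRep_mem_shuffleSpace {x : Loc p₀ p₁ (n + m)}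
    (hx : x ∈ bimod p₀ p₁ n m (n + m) rfl) :
    locRep p₀ p₁ (n + m) x ∈ shuffleSpace n m p₀ p₁ := by
  induction hx using Submodule.span_induction with
  | mem x hx =>
    obtain ⟨f, hf, -⟩ := exists_mul_delta_pow p₀ p₁ hx
    have hfm : f ∈ coeffFun p₀ p₁ n m := ⟨x, hx, hf⟩
    rw [hf]
    refine ⟨?_, fun w hw => ?_⟩
    · have := mulOp_mul_autOp_mem_autSpan f 1
      rwa [map_one, mul_one] at this
    · have h1 : autOp (permAut w.symm) ∈ autSpan (n + m) := Submodule.subset_span ⟨_, rfl⟩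
      rw [(mulOp_mem_biLin f _ h1).1.2, blockProj_autOp]
      split_ifs with h
      · -- a shuffle that preserves the blocks is trivial
        have h2 : w = 1 := hw.ext .one fun a =>
          (lt_iff_of_permAut_mem_blockGroup h a).symm
        have h3 : permAut w.symm = 1 := by rw [h2]; exact map_one permAut
        rw [h3, map_one, one_mul]
        exact mulOp_mem_blockAlg p₀ p₁ hfm
      · rw [zero_mul]; exact zero_mem _
  | zero => rw [map_zero]; exact zero_mem _
  | add x y _ _ hx hy => rw [map_add]; exact add_mem hx hy
  | smul a x _ hx =>
    have : a • x = toLoc p₀ p₁ (n + m) a * x := rfl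
    rw [this, map_mul, locRep_toLoc]
    exact dlRep_mul_mem_shuffleSpace p₀ p₁ a hx

/-- The projection maps the bimodule to the localized tensor product. -/
theorem blockProj_locRep_mem {x : Loc p₀ p₁ (n + m)} (hx : x ∈ bimod p₀ p₁ n m (n + m) rfl) :
    blockProj n m (locRep p₀ p₁ (n + m) x) ∈ blockAlg p₀ p₁ n m := by
  have h := (locRep_mem_shuffleSpace p₀ p₁ hx).2 1 .one
  have h3 : permAut (Equiv.symm (1 : Equiv.Perm (Fin (n + m)))) = 1 := map_one permAut
  rwa [h3, map_one, one_mul] at h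

end Proj

end HeckeB
end

noncomputable section

/-! ### Weights of commuting operators -/

section Weights

variable {C Z : Type*} [CommRing C] [Algebra ℂ C] [AddCommGroup Z] [Module ℂ Z]

/-- A weight vector of weight `χ` for a representation `e` of a commutative algebra: a nonzero
vector on which the algebra acts through the character `χ`. -/
def IsWeightVector (e : C →ₐ[ℂ] Module.End ℂ Z) (χ : C →ₐ[ℂ] ℂ) (z : Z) : Prop :=
  z ≠ 0 ∧ ∀ c, e c z = χ c • z

variable [FiniteDimensional ℂ Z] (e : C →ₐ[ℂ] Module.End ℂ Z)

/-- A nonzero stable subspace contains a weight vector: a minimal nonzero stable subspace lies in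
an eigenspace of every operator. -/
theorem exists_isWeightVector_mem (S : Submodule ℂ Z) (hS : S ≠ ⊥)
    (h : ∀ c, ∀ z ∈ S, e c z ∈ S) : ∃ χ, ∃ z ∈ S, IsWeightVector e χ z := by
  obtain ⟨T, ⟨hTS, hT0, hT⟩, hmin⟩ := (wellFounded_lt (α := Submodule ℂ Z)).has_min
    {T | T ≤ S ∧ T ≠ ⊥ ∧ ∀ c, ∀ z ∈ T, e c z ∈ T} ⟨S, le_rfl, hS, h⟩
  obtain ⟨z, hzT, hz⟩ := T.ne_bot_iff.1 hT0
  -- By minimality, each operator acts on `T` as a scalar.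
  have key : ∀ c, ∃ a : ℂ, ∀ z ∈ T, e c z = a • z := by
    intro c
    have : Nontrivial T := (Submodule.nontrivial_iff_ne_bot).2 hT0
    obtain ⟨a, ha⟩ := Module.End.exists_eigenvalue ((e c).restrict (hT c))
    obtain ⟨t, ht⟩ := ha.exists_hasEigenvector
    have ht1 : e c t = a • (t : Z) := congrArg Subtype.val ht.apply_eq_smul
    by_contra! hne
    obtain ⟨y, hy, hya⟩ := hne a
    refine hmin (T ⊓ LinearMap.ker (e c - algebraMap ℂ _ a))
      ⟨inf_le_left.trans hTS, ?_, fun d w hw => ⟨hT d w hw.1, ?_⟩⟩ ?_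
    · refine (Submodule.ne_bot_iff _).2 ⟨t, ⟨t.2, ?_⟩, fun h0 => ht.2 (Subtype.ext h0)⟩
      rw [SetLike.mem_coe, LinearMap.mem_ker, LinearMap.sub_apply, ht1,
        Module.algebraMap_end_apply, sub_self]
    · have hw2 := LinearMap.mem_ker.1 hw.2
      rw [SetLike.mem_coe, LinearMap.mem_ker, ← Module.End.mul_apply, ← AlgHom.commutes e,
        ← map_sub, ← map_mul,
        mul_comm, map_mul, Module.End.mul_apply, map_sub, AlgHom.commutes, hw2, map_zero]
    · refine lt_of_le_of_ne inf_le_left fun h0 => hya ?_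
      have := LinearMap.mem_ker.1 ((inf_eq_left.1 h0) hy)
      rwa [LinearMap.sub_apply, Module.algebraMap_end_apply, sub_eq_zero] at this
  choose χ hχ using key
  have hinj : ∀ a b : ℂ, a • z = b • z → a = b := fun a b h => smul_left_injective ℂ hz h
  refine ⟨{ toFun := χ, map_one' := ?_, map_mul' := fun c d => ?_, map_zero' := ?_,
            map_add' := fun c d => ?_, commutes' := fun a => ?_ }, z, hTS hzT, hz,
    fun c => hχ c z hzT⟩ <;> refine hinj _ _ ?_
  · rw [← hχ _ z hzT, map_one, one_smul]; rfl
  · rw [← hχ _ z hzT, map_mul, Module.End.mul_apply, hχ d z hzT, map_smul, hχ c z hzT, smul_smul,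
      mul_comm]
  · rw [← hχ _ z hzT, map_zero, zero_smul]; rfl
  · rw [← hχ _ z hzT, map_add, LinearMap.add_apply, hχ d z hzT, hχ c z hzT, add_smul]
  · rw [← hχ _ z hzT, AlgHom.commutes]; rfl

/-- An element is invertible as soon as no weight vanishes on it. -/
theorem isUnit_of_weight_ne_zero {f : C} (h : ∀ χ z, IsWeightVector e χ z → χ f ≠ 0) :
    IsUnit (e f) := by
  rw [LinearMap.isUnit_iff_ker_eq_bot]
  by_contra hne
  obtain ⟨χ, z, hz, hw⟩ := exists_isWeightVector_mem e _ hne fun c z hz => by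
    rw [LinearMap.mem_ker] at hz ⊢
    rw [← Module.End.mul_apply, ← map_mul, mul_comm, map_mul, Module.End.mul_apply, hz, map_zero]
  refine h χ z hw ((smul_eq_zero.1 ?_).resolve_right hw.1)
  rw [← hw.2, LinearMap.mem_ker.1 hz]

omit [FiniteDimensional ℂ Z] in
theorem IsWeightVector.hasEigenvalue {e : C →ₐ[ℂ] Module.End ℂ Z} {χ : C →ₐ[ℂ] ℂ} {z : Z}
    (h : IsWeightVector e χ z) (c : C) : (e c).HasEigenvalue (χ c) :=
  Module.End.hasEigenvalue_of_hasEigenvector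
    ⟨Module.End.mem_eigenspace_iff.2 (h.2 c), h.1⟩

end Weights

/-! ### Tensor products of simple modules -/

section Density

variable {A N : Type*} [Ring A] [Algebra ℂ A] [AddCommGroup N] [Module ℂ N] [Module A N]
  [IsScalarTower ℂ A N]

/-- Schur's lemma: a self-map of a finite-dimensional simple module is a scalar. -/
theorem exists_eq_smul_of_isSimpleModule [FiniteDimensional ℂ N] [IsSimpleModule A N]
    (φ : Module.End A N) : ∃ a : ℂ, ∀ z, φ z = a • z := by
  have : Nontrivial N := IsSimpleModule.nontrivial A N
  let φ' : Module.End ℂ N := φ.restrictScalars ℂ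
  obtain ⟨a, ha⟩ := Module.End.exists_eigenvalue φ'
  obtain ⟨t, ht⟩ := ha.exists_hasEigenvector
  have ht1 : φ t = a • t := ht.apply_eq_smul
  refine ⟨a, fun z => ?_⟩
  obtain ⟨x, rfl⟩ := IsSimpleModule.toSpanSingleton_surjective A ht.2 z
  have hc : a • x • t = x • a • t := by
    rw [← smul_assoc, ← algebraMap_smul A a t, smul_smul, ← Algebra.commutes, Algebra.smul_def]
  rw [LinearMap.toSpanSingleton_apply, map_smul, ht1, hc]

/-- Every linear endomorphism of a finite-dimensional simple module is the action of an element of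
the algebra. -/
theorem exists_smul_eq_of_isSimpleModule [FiniteDimensional ℂ N] [IsSimpleModule A N]
    (f : Module.End ℂ N) : ∃ a : A, ∀ z, f z = a • z := by
  let f' : Module.End (Module.End A N) N :=
    { toFun := f
      map_add' := map_add f
      map_smul' := fun φ z => by
        obtain ⟨a, ha⟩ := exists_eq_smul_of_isSimpleModule φ
        rw [Module.End.smul_def, ha, map_smul, RingHom.id_apply, Module.End.smul_def, ha] }
  classical
  let b := Module.finBasis ℂ N
  obtain ⟨a, ha⟩ := jacobson_density f' (Finset.univ.image b)
  refine ⟨a, fun z => ?_⟩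
  have : f = Algebra.lsmul ℂ ℂ N a :=
    b.ext fun i => ha _ (Finset.mem_image_of_mem _ (Finset.mem_univ i))
  rw [this]
  rfl

/-- A nonzero subspace of a tensor product of simple modules that is stable under both algebras is
everything. -/
theorem eq_top_of_tmul_stable {B M : Type*} [Ring B] [Algebra ℂ B] [AddCommGroup M] [Module ℂ M]
    [Module B M] [IsScalarTower ℂ B M] [FiniteDimensional ℂ N] [FiniteDimensional ℂ M]
    [IsSimpleModule A N] [IsSimpleModule B M] (S : Submodule ℂ (N ⊗[ℂ] M)) (hS : S ≠ ⊥)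
    (hA : ∀ (a : A), ∀ z ∈ S, (Algebra.lsmul ℂ ℂ N a).rTensor M z ∈ S)
    (hB : ∀ (b : B), ∀ z ∈ S, (Algebra.lsmul ℂ ℂ M b).lTensor N z ∈ S) : S = ⊤ := by
  obtain ⟨z, hz, hz0⟩ := S.ne_bot_iff.1 hS
  let b := Module.finBasis ℂ N
  let c := Module.finBasis ℂ M
  obtain ⟨⟨i, j⟩, hij⟩ : ∃ ij, (b.tensorProduct c).repr z ij ≠ 0 := by
    by_contra! h
    exact hz0 ((b.tensorProduct c).repr.map_eq_zero_iff.1 (Finsupp.ext h))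
  rw [eq_top_iff, ← TensorProduct.span_tmul_eq_top, Submodule.span_le]
  rintro _ ⟨x, y, rfl⟩
  -- By the density theorem the algebras act by all operators of rank one. A pair of them picks a
  -- nonzero coefficient of `z` and puts `x ⊗ y` in its place.
  obtain ⟨a', ha⟩ := exists_smul_eq_of_isSimpleModule (A := A) ((b.coord i).smulRight x)
  obtain ⟨b', hb⟩ := exists_smul_eq_of_isSimpleModule (A := B) ((c.coord j).smulRight y)
  have ha' : Algebra.lsmul ℂ ℂ N a' = (b.coord i).smulRight x := LinearMap.ext fun z => (ha z).symm
  have hb' : Algebra.lsmul ℂ ℂ M b' = (c.coord j).smulRight y := LinearMap.ext fun z => (hb z).symm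
  have h := hA a' _ (hB b' z hz)
  rw [ha', hb', ← LinearMap.comp_apply, LinearMap.rTensor_comp_lTensor] at h
  have key : TensorProduct.map ((b.coord i).smulRight x) ((c.coord j).smulRight y) z =
      (b.tensorProduct c).repr z (i, j) • (x ⊗ₜ[ℂ] y) := by
    have : TensorProduct.map ((b.coord i).smulRight x) ((c.coord j).smulRight y) =
        ((b.tensorProduct c).coord (i, j)).smulRight (x ⊗ₜ[ℂ] y) := by
      ext u v
      simp [← TensorProduct.smul_tmul', smul_smul]
    rw [this]; rfl
  rw [key] at h
  exact (S.smul_mem_iff hij).1 h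

end Density

namespace HeckeB

/-! ### Disjoint invariant sets of eigenvalues -/

section Separation

variable {p₁ : ℂˣ} {I J : Set ℂˣ}

theorem IsInvariant.mul_zpow_mem (h : IsInvariant p₁ I) {a : ℂˣ} (ha : a ∈ I) (k : ℤ) :
    a * p₁ ^ (2 * k) ∈ I := h a ha ⟨1, k, by simp⟩

theorem IsInvariant.inv_mem (h : IsInvariant p₁ I) {a : ℂˣ} (ha : a ∈ I) : a⁻¹ ∈ I :=
  h a ha ⟨-1, 0, by simp⟩

theorem IsInvariant.mul_sq_mem (h : IsInvariant p₁ I) {a : ℂˣ} (ha : a ∈ I) : a * p₁ ^ 2 ∈ I := by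
  simpa using h.mul_zpow_mem ha 1

theorem IsInvariant.mul_inv_sq_mem (h : IsInvariant p₁ I) {a : ℂˣ} (ha : a ∈ I) :
    a * (p₁⁻¹) ^ 2 ∈ I := by
  simpa using h.mul_zpow_mem ha (-1)

theorem coe_sub_ne_zero_of_disjoint (hd : Disjoint I J) {a b : ℂˣ} (ha : a ∈ I) (hb : b ∈ J) :
    (a : ℂ) - b ≠ 0 := fun h =>
  Set.disjoint_left.1 hd ha (by rwa [Units.ext (sub_eq_zero.1 h)])

variable {n m : ℕ}

/-- A character of Laurent polynomials maps the variables to units. -/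
theorem exists_unit_varX {r : ℕ} (χ : AddMonoidAlgebra ℂ (Fin r → ℤ) →ₐ[ℂ] ℂ) (i : Fin r) :
    ∃ a : ℂˣ, χ (varX i) = a ∧ χ (varXinv i) = (a : ℂ)⁻¹ := by
  have h : χ (varX i) * χ (varXinv i) = 1 := by rw [← map_mul, varX_mul_varXinv, map_one]
  exact ⟨⟨_, _, h, by rw [mul_comm, h]⟩, rfl, (inv_eq_of_mul_eq_one_right h).symm⟩

/-- The symmetric denominator does not vanish at a point whose two blocks of coordinates lie in
disjoint invariant sets. -/
theorem character_delta_ne_zero (hI : IsInvariant p₁ I) (hd : Disjoint I J)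
    (χ : AddMonoidAlgebra ℂ (Fin (n + m) → ℤ) →ₐ[ℂ] ℂ)
    (h1 : ∀ i, ∃ u ∈ I, (u : ℂ) = χ (varX (Fin.castAdd m i)))
    (h2 : ∀ j, (∃ u ∈ J, (u : ℂ) = χ (varX (Fin.natAdd n j))) ∧
      ∃ u ∈ J, (u : ℂ) = χ (varXinv (Fin.natAdd n j))) : χ (delta n m p₁) ≠ 0 := by
  rw [delta, map_prod]
  refine Finset.prod_ne_zero_iff.2 fun i _ => ?_
  rw [map_prod]
  refine Finset.prod_ne_zero_iff.2 fun j _ => ?_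
  obtain ⟨a, ha, hai⟩ := exists_unit_varX χ (Fin.castAdd m i)
  obtain ⟨a', ha', e⟩ := h1 i
  obtain rfl : a' = a := Units.ext (e.trans ha)
  obtain ⟨⟨b, hb, hbj⟩, ⟨b', hb', hbj'⟩⟩ := h2 j
  have hp : (p₁ : ℂ) ^ 2 * ((p₁ : ℂ)⁻¹) ^ 2 = 1 := by
    rw [← mul_pow, mul_inv_cancel₀ p₁.ne_zero, one_pow]
  have hbb : (b : ℂ) * b' = 1 := by rw [hbj, hbj', ← map_mul, varX_mul_varXinv, map_one]
  have h := delta_factor (mul_inv_cancel₀ a'.ne_zero) hbb hp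
  simp only [varChi, map_mul, map_sub, map_add, map_pow, AlgHom.commutes, ha, hai, ← hbj, ← hbj',
    Algebra.algebraMap_self, RingHom.id_apply]
  rw [h]
  -- Each factor vanishes only if a point of `I` is a point of `J` times `1` or `p₁ ^ (±2)`.
  have e1 : ∀ b : ℂˣ, b ∈ J → (a' : ℂ) - b ≠ 0 := fun b hb => coe_sub_ne_zero_of_disjoint hd ha' hb
  have e2 : ∀ b : ℂˣ, b ∈ J → (a' : ℂ) - (p₁ : ℂ) ^ 2 * b ≠ 0 := fun b hb h0 => by
    refine coe_sub_ne_zero_of_disjoint hd (hI.mul_inv_sq_mem ha') hb ?_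
    rw [Units.val_mul, Units.val_pow_eq_pow_val, Units.val_inv_eq_inv_val]
    linear_combination ((p₁ : ℂ)⁻¹) ^ 2 * h0 + b * hp
  have e3 : ∀ b : ℂˣ, b ∈ J → (a' : ℂ) - (p₁ : ℂ)⁻¹ ^ 2 * b ≠ 0 := fun b hb h0 => by
    refine coe_sub_ne_zero_of_disjoint hd (hI.mul_sq_mem ha') hb ?_
    rw [Units.val_mul, Units.val_pow_eq_pow_val]
    linear_combination (p₁ : ℂ) ^ 2 * h0 + b * hp
  exact mul_ne_zero (pow_ne_zero _ (inv_ne_zero a'.ne_zero)) (mul_ne_zero (mul_ne_zero (mul_ne_zero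
    (e1 b hb) (e1 b' hb')) (mul_ne_zero (e2 b hb) (e3 b' hb'))) (mul_ne_zero (e3 b hb) (e2 b' hb')))

theorem character_varXinv_mem (hJ : IsInvariant p₁ J) {r : ℕ}
    (χ : AddMonoidAlgebra ℂ (Fin r → ℤ) →ₐ[ℂ] ℂ) {i : Fin r}
    (h : ∃ u ∈ J, (u : ℂ) = χ (varX i)) : ∃ u ∈ J, (u : ℂ) = χ (varXinv i) := by
  obtain ⟨a, ha, hai⟩ := exists_unit_varX χ i
  obtain ⟨a', ha', e⟩ := h
  obtain rfl : a' = a := Units.ext (e.trans ha)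
  exact ⟨a'⁻¹, hJ.inv_mem ha', by rw [hai, Units.val_inv_eq_inv_val]⟩

end Separation

end HeckeB
end

noncomputable section

namespace HeckeB

/-! ### Balancing in `N ◇ M` -/

section BimodRep

variable (p₀ p₁ : ℂˣ) {n m : ℕ}

/-- The operator on rational functions attached to an element of the bimodule. -/
def bimodRep : Bimod p₀ p₁ n m (n + m) rfl →ₗ[ℂ] Op (n + m) where
  toFun x := locRep p₀ p₁ (n + m) x.val
  map_add' x y := map_add (locRep p₀ p₁ (n + m)) x.val y.val
  map_smul' c x := map_smul (locRep p₀ p₁ (n + m)) c x.val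

/-- Elements of the bimodule may be compared as operators. -/
theorem bimodRep_injective : Function.Injective (bimodRep p₀ p₁ (n := n) (m := m)) :=
  fun _ _ h => Subtype.ext (locRep_injective p₀ p₁ h)

theorem bimodRep_smul (a : HeckeB p₀ p₁ (n + m)) (x : Bimod p₀ p₁ n m (n + m) rfl) :
    bimodRep p₀ p₁ (a • x) = dlRep p₀ p₁ (n + m) a * bimodRep p₀ p₁ x := by
  change locRep p₀ p₁ (n + m) (toLoc p₀ p₁ (n + m) a * x.val) = _
  rw [map_mul, locRep_toLoc]; rfl

theorem exists_bimodRep_eq {o : Op (n + m)}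
    (h : ∃ x ∈ bimod p₀ p₁ n m (n + m) rfl, locRep p₀ p₁ (n + m) x = o) :
    ∃ x : Bimod p₀ p₁ n m (n + m) rfl, bimodRep p₀ p₁ x = o := by
  obtain ⟨x, hx, h⟩ := h
  exact ⟨(⟨x, hx⟩ : bimod p₀ p₁ n m (n + m) rfl), h⟩

/-- The bimodule is stable under the coefficient ring on the right. -/
theorem exists_bimodRep_eq_mul_mulOp (x : Bimod p₀ p₁ n m (n + m) rfl) {f : RatFun (n + m)}
    (hf : f ∈ coeffFun p₀ p₁ n m) :
    ∃ y : Bimod p₀ p₁ n m (n + m) rfl, bimodRep p₀ p₁ y = bimodRep p₀ p₁ x * mulOp f := by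
  obtain ⟨g, hg, hgf⟩ := exists_of_mem_coeffFun p₀ p₁ hf
  refine exists_bimodRep_eq p₀ p₁ ⟨x.val * g, mul_mem_bimod p₀ p₁ (Subtype.prop x) hg, ?_⟩
  rw [map_mul, hgf]; rfl

theorem exists_bimodRep_eq_permAut {w : Equiv.Perm (Fin (n + m))} (hw : IsShuffle n w) :
    ∃ x : Bimod p₀ p₁ n m (n + m) rfl, bimodRep p₀ p₁ x = autOp (permAut w) :=
  exists_bimodRep_eq p₀ p₁ (exists_mem_bimod_of_isShuffle p₀ p₁ hw)

theorem bimodRep_mem_autSpan (x : Bimod p₀ p₁ n m (n + m) rfl) :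
    bimodRep p₀ p₁ x ∈ autSpan (n + m) :=
  (locRep_mem_shuffleSpace p₀ p₁ (Subtype.prop x)).1

theorem blockProj_bimodRep_mem (x : Bimod p₀ p₁ n m (n + m) rfl) :
    blockProj n m (bimodRep p₀ p₁ x) ∈ blockAlg p₀ p₁ n m :=
  blockProj_locRep_mem p₀ p₁ (Subtype.prop x)

end BimodRep

section TensorAction

variable (p₀ p₁ : ℂˣ) (n m : ℕ)
  (N : Type u) [AddCommGroup N] [Module ℂ N] [Module (HeckeB p₀ p₁ n) N]
  [IsScalarTower ℂ (HeckeB p₀ p₁ n) N]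
  (M : Type v) [AddCommGroup M] [Module ℂ M] [Module (HeckeB p₀ p₁ m) M]
  [IsScalarTower ℂ (HeckeB p₀ p₁ m) M]

/-- The action of `H^B_n ⊗ H^B_m` on `N ⊗ M`. -/
def tensorAction : HeckeB p₀ p₁ n ⊗[ℂ] HeckeB p₀ p₁ m →ₐ[ℂ] Module.End ℂ (N ⊗[ℂ] M) :=
  (Module.endTensorEndAlgHom (R := ℂ) (S := ℂ) (A := ℂ)).comp
    (Algebra.TensorProduct.map (Algebra.lsmul ℂ ℂ N) (Algebra.lsmul ℂ ℂ M))

/-- The action of the Laurent polynomials in all variables on `N ⊗ M`. -/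
def laurentAction : AddMonoidAlgebra ℂ (Fin (n + m) → ℤ) →ₐ[ℂ] Module.End ℂ (N ⊗[ℂ] M) :=
  (tensorAction p₀ p₁ n m N M).comp (laurentTensor p₀ p₁ n m)

variable {n m N M}

@[simp] theorem tensorAction_tmul (a : HeckeB p₀ p₁ n) (b : HeckeB p₀ p₁ m) (x : N) (y : M) :
    tensorAction p₀ p₁ n m N M (a ⊗ₜ b) (x ⊗ₜ y) = (a • x) ⊗ₜ (b • y) := rfl

theorem tensorAction_tmul_one (a : HeckeB p₀ p₁ n) :
    tensorAction p₀ p₁ n m N M (a ⊗ₜ 1) = (Algebra.lsmul ℂ ℂ N a).rTensor M := by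
  ext x y
  simp

theorem tensorAction_one_tmul (b : HeckeB p₀ p₁ m) :
    tensorAction p₀ p₁ n m N M (1 ⊗ₜ b) = (Algebra.lsmul ℂ ℂ M b).lTensor N := by
  ext x y
  simp

theorem laurentAction_varX_castAdd (i : Fin n) :
    laurentAction p₀ p₁ n m N M (varX (Fin.castAdd m i)) =
      tensorAction p₀ p₁ n m N M (gen p₀ p₁ n (.X i) ⊗ₜ 1) :=
  congrArg (tensorAction p₀ p₁ n m N M) (laurentTensor_varX_castAdd p₀ p₁ i)

theorem laurentAction_varX_natAdd (i : Fin m) :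
    laurentAction p₀ p₁ n m N M (varX (Fin.natAdd n i)) =
      tensorAction p₀ p₁ n m N M (1 ⊗ₜ gen p₀ p₁ m (.X i)) :=
  congrArg (tensorAction p₀ p₁ n m N M) (laurentTensor_varX_natAdd p₀ p₁ i)

/-- An eigenvalue of the image of an operator under a homomorphism of algebras is an eigenvalue of
the operator. -/
theorem hasEigenvalue_of_algHom {V W : Type*} [AddCommGroup V] [Module ℂ V] [AddCommGroup W]
    [Module ℂ W] [FiniteDimensional ℂ V] (φ : Module.End ℂ V →ₐ[ℂ] Module.End ℂ W)
    {f : Module.End ℂ V} {a : ℂ} (h : (φ f).HasEigenvalue a) : f.HasEigenvalue a := by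
  obtain ⟨w, hw⟩ := h.exists_hasEigenvector
  have h1 := Module.End.aeval_apply_of_hasEigenvector (p := minpoly ℂ f) hw
  rw [Polynomial.aeval_algHom_apply, minpoly.aeval, map_zero, LinearMap.zero_apply] at h1
  exact Module.End.hasEigenvalue_of_isRoot ((smul_eq_zero.1 h1.symm).resolve_right hw.2)

variable {p₀ p₁} {I J : Set ℂˣ}

theorem eigenvalue_castAdd_mem (hN : IsOfType p₀ p₁ (n := n) I N) {i : Fin n} {a : ℂ}
    (h : (laurentAction p₀ p₁ n m N M (varX (Fin.castAdd m i))).HasEigenvalue a) :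
    ∃ u ∈ I, (u : ℂ) = a := by
  have := hN.1
  rw [laurentAction_varX_castAdd, tensorAction_tmul_one] at h
  exact hN.2 i _ (hasEigenvalue_of_algHom (Module.End.rTensorAlgHom ℂ N M) h)

theorem eigenvalue_natAdd_mem (hM : IsOfType p₀ p₁ (n := m) J M) {i : Fin m} {a : ℂ}
    (h : (laurentAction p₀ p₁ n m N M (varX (Fin.natAdd n i))).HasEigenvalue a) :
    ∃ u ∈ J, (u : ℂ) = a := by
  have := hM.1
  rw [laurentAction_varX_natAdd, tensorAction_one_tmul] at h
  exact hM.2 i _ (hasEigenvalue_of_algHom (Module.End.lTensorAlgHom ℂ M N) h)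

/-- The action of the Laurent polynomials on `N ⊗ M` extends to the coefficient ring. -/
theorem isUnit_laurentAction_delta (hI : IsInvariant p₁ I) (hJ : IsInvariant p₁ J)
    (hd : Disjoint I J) (hN : IsOfType p₀ p₁ (n := n) I N) (hM : IsOfType p₀ p₁ (n := m) J M) :
    IsUnit (laurentAction p₀ p₁ n m N M (delta n m p₁)) := by
  have := hN.1
  have := hM.1
  refine isUnit_of_weight_ne_zero _ fun χ z h => character_delta_ne_zero hI hd χ
    (fun i => eigenvalue_castAdd_mem hN (h.hasEigenvalue (varX (Fin.castAdd m i)))) fun j =>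
      ⟨eigenvalue_natAdd_mem hM (h.hasEigenvalue (varX (Fin.natAdd n j))),
      character_varXinv_mem hJ χ (eigenvalue_natAdd_mem hM (h.hasEigenvalue
        (varX (Fin.natAdd n j))))⟩

/-- Linear combinations `X_a - c X_b` of variables in different blocks act invertibly, if `c` is an
even power of the parameter. -/
theorem isUnit_laurentAction_comb (hI : IsInvariant p₁ I) (hJ : IsInvariant p₁ J)
    (hd : Disjoint I J) (hN : IsOfType p₀ p₁ (n := n) I N) (hM : IsOfType p₀ p₁ (n := m) J M)
    {a b : Fin (n + m)} (hab : DiffBlock n a b) (k : ℤ) :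
    IsUnit (laurentAction p₀ p₁ n m N M (varX a - ((p₁ ^ (2 * k) : ℂˣ) : ℂ) • varX b)) := by
  have := hN.1
  have := hM.1
  refine isUnit_of_weight_ne_zero _ fun χ z h => ?_
  rw [map_sub, map_smul, smul_eq_mul]
  rcases exists_of_diffBlock hab with ⟨i, j, rfl, rfl⟩ | ⟨i, j, rfl, rfl⟩
  all_goals
    obtain ⟨u, hu, hu'⟩ := eigenvalue_castAdd_mem hN (h.hasEigenvalue (varX (Fin.castAdd m i)))
    obtain ⟨v, hv, hv'⟩ := eigenvalue_natAdd_mem hM (h.hasEigenvalue (varX (Fin.natAdd n j)))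
    rw [← hu', ← hv']
  · have := coe_sub_ne_zero_of_disjoint hd hu (hJ.mul_zpow_mem hv k)
    rwa [Units.val_mul, mul_comm (v : ℂ)] at this
  · have := coe_sub_ne_zero_of_disjoint hd.symm hv (hI.mul_zpow_mem hu k)
    rwa [Units.val_mul, mul_comm (u : ℂ)] at this

end TensorAction

section DiamondMk

variable (p₀ p₁ : ℂˣ) {n m : ℕ}
  (N : Type u) [AddCommGroup N] [Module ℂ N] [Module (HeckeB p₀ p₁ n) N]
  [IsScalarTower ℂ (HeckeB p₀ p₁ n) N]
  (M : Type v) [AddCommGroup M] [Module ℂ M] [Module (HeckeB p₀ p₁ m) M]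
  [IsScalarTower ℂ (HeckeB p₀ p₁ m) M]

/-- The class of `x ⊗ z` in `N ◇ M`, bilinear in `x` and `z`. -/
def diamondMk : Bimod p₀ p₁ n m (n + m) rfl →ₗ[ℂ] N ⊗[ℂ] M →ₗ[ℂ]
    Diamond p₀ p₁ (n + m) rfl N M :=
  (TensorProduct.mk ℂ _ _).compr₂ ((Submodule.mkQ _).restrictScalars ℂ)

variable {N M}

omit [IsScalarTower ℂ (HeckeB p₀ p₁ n) N] [IsScalarTower ℂ (HeckeB p₀ p₁ m) M] in
theorem smul_diamondMk (a : HeckeB p₀ p₁ (n + m)) (x : Bimod p₀ p₁ n m (n + m) rfl)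
    (z : N ⊗[ℂ] M) : a • diamondMk p₀ p₁ N M x z = diamondMk p₀ p₁ N M (a • x) z := rfl

omit [IsScalarTower ℂ (HeckeB p₀ p₁ n) N] [IsScalarTower ℂ (HeckeB p₀ p₁ m) M] in
theorem diamondMk_induction {P : Diamond p₀ p₁ (n + m) rfl N M → Prop}
    (mk : ∀ x z, P (diamondMk p₀ p₁ N M x z))
    (add : ∀ d d', P d → P d' → P (d + d')) (d) : P d := by
  obtain ⟨t, rfl⟩ := Submodule.mkQ_surjective _ d
  induction t using TensorProduct.induction_on with
  | zero => have := mk 0 0; rwa [map_zero] at this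
  | tmul x z => exact mk x z
  | add x y hx hy => rw [map_add]; exact add _ _ hx hy

/-- In operator form, the relations for `H^B_n` that define `N ◇ M`. -/
theorem diamondMk_castAdd {x y : Bimod p₀ p₁ n m (n + m) rfl} (g : HeckeGen n)
    (h : bimodRep p₀ p₁ y = bimodRep p₀ p₁ x * genOp p₀ p₁ (Fin.castAdd m) g) (z : N ⊗[ℂ] M) :
    diamondMk p₀ p₁ N M y z =
      diamondMk p₀ p₁ N M x (tensorAction p₀ p₁ n m N M (gen p₀ p₁ n g ⊗ₜ 1) z) := by
  induction z using TensorProduct.induction_on with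
  | zero => simp only [map_zero]
  | add z z' hz hz' => simp only [map_add, hz, hz']
  | tmul u v =>
    rw [tensorAction_tmul, one_smul]
    refine (Submodule.Quotient.eq _).2 (Submodule.subset_span (Or.inl ⟨x, y, g, u, v, ?_, rfl⟩))
    refine locRep_injective p₀ p₁ ?_
    rw [map_mul, locRep_leftGen, leftRep, rep_gen]
    exact h

/-- In operator form, the relations for `H^B_m` that define `N ◇ M`. -/
theorem diamondMk_natAdd {x y : Bimod p₀ p₁ n m (n + m) rfl} (g : HeckeGen m)
    (h : bimodRep p₀ p₁ y = bimodRep p₀ p₁ x * genOp p₀ p₁ (Fin.natAdd n) g) (z : N ⊗[ℂ] M) :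
    diamondMk p₀ p₁ N M y z =
      diamondMk p₀ p₁ N M x (tensorAction p₀ p₁ n m N M (1 ⊗ₜ gen p₀ p₁ m g) z) := by
  induction z using TensorProduct.induction_on with
  | zero => simp only [map_zero]
  | add z z' hz hz' => simp only [map_add, hz, hz']
  | tmul u v =>
    rw [tensorAction_tmul, one_smul]
    refine (Submodule.Quotient.eq _).2 (Submodule.subset_span (Or.inr ⟨x, y, g, u, v, ?_, rfl⟩))
    refine locRep_injective p₀ p₁ ?_
    rw [map_mul, locRep_rightGen, rightRep, rep_gen]
    exact h

/-- Classes are balanced over the Laurent polynomials in all variables. -/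
theorem diamondMk_laurent (f : AddMonoidAlgebra ℂ (Fin (n + m) → ℤ))
    {x y : Bimod p₀ p₁ n m (n + m) rfl}
    (h : bimodRep p₀ p₁ y = bimodRep p₀ p₁ x * mulOp (toRat (n + m) f)) (z : N ⊗[ℂ] M) :
    diamondMk p₀ p₁ N M y z = diamondMk p₀ p₁ N M x (laurentAction p₀ p₁ n m N M f z) := by
  let S : Subalgebra ℂ (AddMonoidAlgebra ℂ (Fin (n + m) → ℤ)) :=
    { carrier := {f | ∀ x y : Bimod p₀ p₁ n m (n + m) rfl,
        bimodRep p₀ p₁ y = bimodRep p₀ p₁ x * mulOp (toRat (n + m) f) → ∀ z : N ⊗[ℂ] M,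
        diamondMk p₀ p₁ N M y z = diamondMk p₀ p₁ N M x (laurentAction p₀ p₁ n m N M f z)}
      mul_mem' := fun {f g} hf hg x y h z => by
        obtain ⟨x', hx'⟩ := exists_bimodRep_eq_mul_mulOp p₀ p₁ x (toRat_mem_coeffFun p₀ p₁ f)
        rw [map_mul, map_mul, ← mul_assoc, ← hx'] at h
        rw [hg x' y h, hf x x' hx', map_mul, Module.End.mul_apply]
      add_mem' := fun {f g} hf hg x y h z => by
        obtain ⟨x', hx'⟩ := exists_bimodRep_eq_mul_mulOp p₀ p₁ x (toRat_mem_coeffFun p₀ p₁ f)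
        obtain ⟨x'', hx''⟩ := exists_bimodRep_eq_mul_mulOp p₀ p₁ x (toRat_mem_coeffFun p₀ p₁ g)
        rw [map_add, map_add, mul_add, ← hx', ← hx'', ← map_add] at h
        rw [bimodRep_injective p₀ p₁ h, map_add, LinearMap.add_apply, hf x x' hx', hg x x'' hx'',
          map_add, LinearMap.add_apply, map_add]
      algebraMap_mem' := fun c x y h z => by
        rw [AlgHom.commutes, AlgHom.commutes, ← Algebra.commutes, ← Algebra.smul_def,
          ← map_smul] at h
        rw [bimodRep_injective p₀ p₁ h, AlgHom.commutes, map_smul, Module.algebraMap_end_apply,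
          map_smul, LinearMap.smul_apply] }
  refine laurent_mem_of_var_mem (S := S) (fun i x y h z => ?_) (fun i x y h z => ?_) f x y h z
  · refine Fin.addCases (fun i => ?_) (fun i => ?_) i h
    · intro h
      rw [laurentAction_varX_castAdd]
      exact diamondMk_castAdd p₀ p₁ (.X i) h z
    · intro h
      rw [laurentAction_varX_natAdd]
      exact diamondMk_natAdd p₀ p₁ (.X i) h z
  · have hone : laurentAction p₀ p₁ n m N M (varX i)
        (laurentAction p₀ p₁ n m N M (varXinv i) z) = z := by
      rw [← Module.End.mul_apply, ← map_mul, varX_mul_varXinv, map_one, Module.End.one_apply]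
    have hyx : bimodRep p₀ p₁ x = bimodRep p₀ p₁ y * mulOp (toRat (n + m) (varX i)) := by
      rw [h, mul_assoc, ← map_mul, ← map_mul, mul_comm, varX_mul_varXinv, map_one, map_one, mul_one]
    generalize laurentAction p₀ p₁ n m N M (varXinv i) z = z' at hone
    rw [← hone]
    refine Fin.addCases (fun i => ?_) (fun i => ?_) i hyx
    · intro h
      rw [laurentAction_varX_castAdd]
      exact (diamondMk_castAdd p₀ p₁ (.X i) h z').symm
    · intro h
      rw [laurentAction_varX_natAdd]
      exact (diamondMk_natAdd p₀ p₁ (.X i) h z').symm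

end DiamondMk

end HeckeB
end

noncomputable section

namespace HeckeB

/-! ### The action on shuffle components of `N ◇ M` -/

section Components

variable {p₀ p₁ : ℂˣ} {n m : ℕ}
  {N : Type u} [AddCommGroup N] [Module ℂ N] [Module (HeckeB p₀ p₁ n) N]
  [IsScalarTower ℂ (HeckeB p₀ p₁ n) N]
  {M : Type v} [AddCommGroup M] [Module ℂ M] [Module (HeckeB p₀ p₁ m) M]
  [IsScalarTower ℂ (HeckeB p₀ p₁ m) M]

theorem autOp_permAut_mul_symm {r : ℕ} (w : Equiv.Perm (Fin r)) (k : RatFun r) :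
    mulOp k * autOp (permAut w) = autOp (permAut w) * mulOp (aut (permAut w.symm) k) := by
  rw [autOp_mul_mulOp, ← aut_mul_apply, ← map_mul]
  have : w * w.symm = 1 := mul_inv_cancel w
  rw [this, map_one, map_one]; rfl

/-- Laurent polynomials act on the component of a shuffle through the permuted variables. -/
theorem laurentHom_smul_diamondMk {w : Equiv.Perm (Fin (n + m))}
    {x : Bimod p₀ p₁ n m (n + m) rfl} (hx : bimodRep p₀ p₁ x = autOp (permAut w))
    {f f' : AddMonoidAlgebra ℂ (Fin (n + m) → ℤ)}
    (hf : aut (permAut w.symm) (toRat (n + m) f) = toRat (n + m) f') (z : N ⊗[ℂ] M) :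
    laurentHom p₀ p₁ (n + m) f • diamondMk p₀ p₁ N M x z =
      diamondMk p₀ p₁ N M x (laurentAction p₀ p₁ n m N M f' z) := by
  rw [smul_diamondMk]
  refine diamondMk_laurent p₀ p₁ f' ?_ z
  rw [bimodRep_smul, dlRep_laurentHom, hx, autOp_permAut_mul_symm, hf]

theorem toRat_aeval_varX {r : ℕ} (w : Equiv.Perm (Fin r)) (a : Fin r) (q : Polynomial ℂ) :
    aut (permAut w.symm) (toRat r (Polynomial.aeval (varX a) q)) =
      toRat r (Polynomial.aeval (varX (w.symm a)) q) := by
  rw [← Polynomial.aeval_algHom_apply, ← Polynomial.aeval_algHom_apply, toRat_varX,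
    aut_permAut_ratX, ← Polynomial.aeval_algHom_apply, toRat_varX]

theorem X_smul_diamondMk {w : Equiv.Perm (Fin (n + m))}
    {x : Bimod p₀ p₁ n m (n + m) rfl} (hx : bimodRep p₀ p₁ x = autOp (permAut w))
    (a : Fin (n + m)) (z : N ⊗[ℂ] M) :
    gen p₀ p₁ (n + m) (.X a) • diamondMk p₀ p₁ N M x z =
      diamondMk p₀ p₁ N M x (laurentAction p₀ p₁ n m N M (varX (w.symm a)) z) := by
  rw [← laurentHom_varX]
  refine laurentHom_smul_diamondMk hx ?_ z
  rw [toRat_varX, toRat_varX, aut_permAut_ratX]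

theorem Xinv_smul_diamondMk {w : Equiv.Perm (Fin (n + m))}
    {x : Bimod p₀ p₁ n m (n + m) rfl} (hx : bimodRep p₀ p₁ x = autOp (permAut w))
    (a : Fin (n + m)) (z : N ⊗[ℂ] M) :
    gen p₀ p₁ (n + m) (.Xinv a) • diamondMk p₀ p₁ N M x z =
      diamondMk p₀ p₁ N M x (laurentAction p₀ p₁ n m N M (varXinv (w.symm a)) z) := by
  rw [← laurentHom_varXinv]
  refine laurentHom_smul_diamondMk hx ?_ z
  rw [toRat_varXinv, toRat_varXinv, map_inv₀, aut_permAut_ratX]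

/-- The Laurent polynomial `p₁⁻¹ X_a - p₁ X_b`. -/
def tauFactor (p₁ : ℂˣ) {r : ℕ} (a b : Fin r) : AddMonoidAlgebra ℂ (Fin r → ℤ) :=
  (p₁ : ℂ)⁻¹ • varX a - (p₁ : ℂ) • varX b

theorem toRat_tauFactor {r : ℕ} (a b : Fin r) :
    toRat r (tauFactor p₁ a b) = (cst p₁ r)⁻¹ * ratX a - cst p₁ r * ratX b := by
  rw [tauFactor, map_sub, map_smul, map_smul, toRat_varX, toRat_varX, smul_eq_cst_mul,
    inv_smul_eq_cst_mul]

/-- The intertwiner maps the component of a shuffle to the adjacent one. -/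
theorem tau_smul_diamondMk {w : Equiv.Perm (Fin (n + m))} {k : ℕ} (h : k + 1 < n + m)
    {x x' : Bimod p₀ p₁ n m (n + m) rfl} (hx : bimodRep p₀ p₁ x = autOp (permAut w))
    (hx' : bimodRep p₀ p₁ x' =
      autOp (permAut (Equiv.swap ⟨k, by omega⟩ ⟨k + 1, h⟩ * w))) (z : N ⊗[ℂ] M) :
    tau p₀ p₁ k h • diamondMk p₀ p₁ N M x z = diamondMk p₀ p₁ N M x'
      (laurentAction p₀ p₁ n m N M
        (tauFactor p₁ (w.symm ⟨k, by omega⟩) (w.symm ⟨k + 1, h⟩)) z) := by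
  rw [smul_diamondMk]
  refine diamondMk_laurent p₀ p₁ _ ?_ z
  rw [bimodRep_smul, dlRep_tau', hx, hx', mul_assoc, autOp_permAut_mul_symm, ← mul_assoc,
    ← map_mul, ← map_mul, toRat_tauFactor, map_sub (aut _), map_mul (aut _), map_mul (aut _),
    map_inv₀ (aut _), aut_cst,
    aut_permAut_ratX, aut_permAut_ratX]

/-- The intertwiner maps the component of the adjacent shuffle back. -/
theorem tau_smul_diamondMk' {w : Equiv.Perm (Fin (n + m))} {k : ℕ} (h : k + 1 < n + m)
    {x x' : Bimod p₀ p₁ n m (n + m) rfl} (hx : bimodRep p₀ p₁ x = autOp (permAut w))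
    (hx' : bimodRep p₀ p₁ x' =
      autOp (permAut (Equiv.swap ⟨k, by omega⟩ ⟨k + 1, h⟩ * w))) (z : N ⊗[ℂ] M) :
    tau p₀ p₁ k h • diamondMk p₀ p₁ N M x' z = diamondMk p₀ p₁ N M x
      (laurentAction p₀ p₁ n m N M
        (tauFactor p₁ (w.symm ⟨k + 1, h⟩) (w.symm ⟨k, by omega⟩)) z) := by
  have e : w = Equiv.swap ⟨k, by omega⟩ ⟨k + 1, h⟩ *
      (Equiv.swap ⟨k, by omega⟩ ⟨k + 1, h⟩ * w) := by
    rw [← mul_assoc, Equiv.swap_mul_self, one_mul]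
  rw [tau_smul_diamondMk h hx' (x' := x) (by rw [← e]; exact hx)]
  congr 4
  · rw [Equiv.symm_apply_eq, Equiv.Perm.mul_apply, Equiv.apply_symm_apply, Equiv.swap_apply_right]
  · rw [Equiv.symm_apply_eq, Equiv.Perm.mul_apply, Equiv.apply_symm_apply, Equiv.swap_apply_left]

/-- The generator `T_{k+1}` preserves the component of a shuffle under which the positions `k` and
`k + 1` come from the same block. -/
theorem exists_T_succ_smul_diamondMk {w : Equiv.Perm (Fin (n + m))} (hw : IsShuffle n w) {k : ℕ}
    (h : k + 1 < n + m)
    (hd : ¬ DiffBlock n (w.symm ⟨k, by omega⟩) (w.symm ⟨k + 1, h⟩))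
    {x : Bimod p₀ p₁ n m (n + m) rfl} (hx : bimodRep p₀ p₁ x = autOp (permAut w))
    (z : N ⊗[ℂ] M) : ∃ z', gen p₀ p₁ (n + m) (.T ⟨k + 1, h⟩) • diamondMk p₀ p₁ N M x z =
      diamondMk p₀ p₁ N M x z' := by
  have hadj := hw.adjacent h hd
  have hy : bimodRep p₀ p₁ (gen p₀ p₁ (n + m) (.T ⟨k + 1, h⟩) • x) = bimodRep p₀ p₁ x *
      opT p₁ (w.symm ⟨k, by omega⟩) (w.symm ⟨k + 1, h⟩) := by
    rw [bimodRep_smul, dlRep_gen, genOp_T_succ, hx, autOp_mul_opT, Equiv.apply_symm_apply,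
      Equiv.apply_symm_apply]
    rfl
  have hlt := (w.symm ⟨k + 1, h⟩).isLt
  rw [DiffBlock, not_not] at hd
  generalize w.symm ⟨k, by omega⟩ = a at *
  generalize w.symm ⟨k + 1, h⟩ = b at *
  by_cases ha : a.val < n
  · have hb := hd.1 ha
    refine ⟨_, diamondMk_castAdd p₀ p₁ (.T ⟨a.val + 1, by omega⟩) (hy.trans ?_) z⟩
    rw [genOp_T_succ]
    congr 2
    exact Fin.ext hadj
  · have hb := mt hd.2 ha
    refine ⟨_, diamondMk_natAdd p₀ p₁ (.T ⟨a.val - n + 1, by omega⟩) (hy.trans ?_) z⟩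
    rw [genOp_T_succ]
    congr 2
    · rw [Fin.ext_iff, Fin.val_natAdd]; simp only; omega
    · rw [Fin.ext_iff, Fin.val_natAdd, hadj]; simp only; omega

/-- The generator `T_0` acts on the component of a shuffle through one of the two tensor
factors. -/
theorem T_zero_smul_diamondMk {w : Equiv.Perm (Fin (n + m))} (h : 0 < n + m)
    {x : Bimod p₀ p₁ n m (n + m) rfl} (hx : bimodRep p₀ p₁ x = autOp (permAut w))
    (z : N ⊗[ℂ] M) :
    (∀ hn : 0 < n, (w.symm ⟨0, h⟩).val = 0 →
      gen p₀ p₁ (n + m) (.T ⟨0, h⟩) • diamondMk p₀ p₁ N M x z = diamondMk p₀ p₁ N M x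
        (tensorAction p₀ p₁ n m N M (gen p₀ p₁ n (.T ⟨0, hn⟩) ⊗ₜ 1) z)) ∧
    (∀ hm : 0 < m, (w.symm ⟨0, h⟩).val = n →
      gen p₀ p₁ (n + m) (.T ⟨0, h⟩) • diamondMk p₀ p₁ N M x z = diamondMk p₀ p₁ N M x
        (tensorAction p₀ p₁ n m N M (1 ⊗ₜ gen p₀ p₁ m (.T ⟨0, hm⟩)) z)) := by
  have hy : bimodRep p₀ p₁ (gen p₀ p₁ (n + m) (.T ⟨0, h⟩) • x) = bimodRep p₀ p₁ x *
      opT₀ p₀ (w.symm ⟨0, h⟩) := by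
    rw [bimodRep_smul, dlRep_gen, genOp_T_zero, hx, autOp_mul_opT₀, Equiv.apply_symm_apply]
    rfl
  refine ⟨fun hn h0 => diamondMk_castAdd p₀ p₁ _ (hy.trans ?_) z,
    fun hm h0 => diamondMk_natAdd p₀ p₁ _ (hy.trans ?_) z⟩
  · rw [genOp_T_zero]
    congr 2
    exact Fin.ext h0
  · rw [genOp_T_zero]
    congr 2
    exact Fin.ext h0

omit [IsScalarTower ℂ (HeckeB p₀ p₁ n) N] [IsScalarTower ℂ (HeckeB p₀ p₁ m) M] in
/-- On vectors of the form `(X_i - X_{i+1}) d`, the generator `T_i` is expressed by the intertwiner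
and a variable. -/
theorem T_succ_smul_eq {k : ℕ} (h : k + 1 < n + m) (d : Diamond p₀ p₁ (n + m) rfl N M) :
    gen p₀ p₁ (n + m) (.T ⟨k + 1, h⟩) • ((gen p₀ p₁ (n + m) (.X ⟨k, by omega⟩) -
      gen p₀ p₁ (n + m) (.X ⟨k + 1, h⟩)) • d) = tau p₀ p₁ k h • d -
        ((p₁ : ℂ) - (p₁ : ℂ)⁻¹) • (gen p₀ p₁ (n + m) (.X ⟨k + 1, h⟩) • d) := by
  rw [tau, add_smul, smul_assoc, add_sub_cancel_right, mul_smul]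

variable {I J : Set ℂˣ} (hI : IsInvariant p₁ I) (hJ : IsInvariant p₁ J) (hd : Disjoint I J)
  (hN : IsOfType p₀ p₁ (n := n) I N) (hM : IsOfType p₀ p₁ (n := m) J M)

include hI hJ hd hN hM

/-- The coefficients of the intertwiners between components act invertibly on `N ⊗ M`. -/
theorem isUnit_laurentAction_tauFactor {a b : Fin (n + m)} (hab : DiffBlock n a b) :
    IsUnit (laurentAction p₀ p₁ n m N M (tauFactor p₁ a b)) := by
  have h := isUnit_laurentAction_comb hI hJ hd hN hM hab 1
  have e : tauFactor p₁ a b =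
      (p₁ : ℂ)⁻¹ • (varX a - ((p₁ ^ (2 * 1 : ℤ) : ℂˣ) : ℂ) • varX b) := by
    rw [tauFactor, smul_sub, smul_smul]
    congr 2
    have : (p₁ ^ (2 * 1 : ℤ) : ℂˣ) = p₁ ^ 2 := by norm_cast
    rw [this, Units.val_pow_eq_pow_val, pow_two, inv_mul_cancel_left₀ p₁.ne_zero]
  rw [e, map_smul, ← Units.val_inv_eq_inv_val]
  exact h.smul p₁⁻¹

/-- `N ◇ M` is spanned by its shuffle components. Their span is stable under the generators, which
preserve a component or exchange two of them, and it contains the classes `f ⊗ z` with `f` in the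
coefficient ring, because the denominators act invertibly on `N ⊗ M`. -/
theorem span_diamondMk_eq_top : Submodule.span ℂ {d : Diamond p₀ p₁ (n + m) rfl N M |
    ∃ (w : Equiv.Perm (Fin (n + m))) (x : Bimod p₀ p₁ n m (n + m) rfl) (z : N ⊗[ℂ] M),
      IsShuffle n w ∧ bimodRep p₀ p₁ x = autOp (permAut w) ∧ d = diamondMk p₀ p₁ N M x z} = ⊤ := by
  set V := Submodule.span ℂ {d : Diamond p₀ p₁ (n + m) rfl N M |
    ∃ (w : Equiv.Perm (Fin (n + m))) (x : Bimod p₀ p₁ n m (n + m) rfl) (z : N ⊗[ℂ] M),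
      IsShuffle n w ∧ bimodRep p₀ p₁ x = autOp (permAut w) ∧ d = diamondMk p₀ p₁ N M x z} with hV
  have hmem : ∀ {w} {x : Bimod p₀ p₁ n m (n + m) rfl} (z : N ⊗[ℂ] M), IsShuffle n w →
      bimodRep p₀ p₁ x = autOp (permAut w) → diamondMk p₀ p₁ N M x z ∈ V := fun z hw hx =>
    Submodule.subset_span ⟨_, _, z, hw, hx, rfl⟩
  have hgen : ∀ (g : HeckeGen (n + m)) {w} {x : Bimod p₀ p₁ n m (n + m) rfl} (z : N ⊗[ℂ] M),
      IsShuffle n w → bimodRep p₀ p₁ x = autOp (permAut w) →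
      gen p₀ p₁ (n + m) g • diamondMk p₀ p₁ N M x z ∈ V := by
    intro g w x z hw hx
    rcases g with ⟨i, hi⟩ | i | i
    · rcases i with - | k
      · rcases hw.symm_zero hi with h0 | h0
        · by_cases hn : 0 < n
          · rw [(T_zero_smul_diamondMk hi hx z).1 hn h0]; exact hmem _ hw hx
          · rw [(T_zero_smul_diamondMk hi hx z).2 (by omega) (by omega)]; exact hmem _ hw hx
        · have := (w.symm ⟨0, hi⟩).isLt
          rw [(T_zero_smul_diamondMk hi hx z).2 (by omega) h0]; exact hmem _ hw hx
      · by_cases hdb : DiffBlock n (w.symm ⟨k, by omega⟩) (w.symm ⟨k + 1, hi⟩)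
        · have hs := hw.step w k hi hdb
          obtain ⟨x', hx'⟩ := exists_bimodRep_eq_permAut p₀ p₁ hs
          have hu := isUnit_laurentAction_comb hI hJ hd hN hM hdb 0
          rw [mul_zero, zpow_zero, Units.val_one, one_smul] at hu
          -- For variables `X_a`, `X_b` of different blocks `X_a - X_b` acts invertibly, and `T_i
          -- (X_i - X_{i+1})` differs from the intertwiner by a multiple of `X_{i+1}`.
          obtain ⟨z', rfl⟩ := ((Module.End.isUnit_iff _).1 hu).2 z
          rw [map_sub (laurentAction p₀ p₁ n m N M), LinearMap.sub_apply, map_sub,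
            ← X_smul_diamondMk hx, ← X_smul_diamondMk hx, ← sub_smul, T_succ_smul_eq,
            tau_smul_diamondMk hi hx hx', X_smul_diamondMk hx]
          exact sub_mem (hmem _ hs hx') (V.smul_mem _ (hmem _ hw hx))
        · obtain ⟨z', hz'⟩ := exists_T_succ_smul_diamondMk hw hi hdb hx z
          rw [hz']; exact hmem _ hw hx
    · rw [X_smul_diamondMk hx]; exact hmem _ hw hx
    · rw [Xinv_smul_diamondMk hx]; exact hmem _ hw hx
  have hstable : ∀ a : HeckeB p₀ p₁ (n + m), ∀ d ∈ V, a • d ∈ V := by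
    let S : Subalgebra ℂ (HeckeB p₀ p₁ (n + m)) :=
      { carrier := {a | ∀ d ∈ V, a • d ∈ V}
        mul_mem' := fun {a b} ha hb d hd => by rw [mul_smul]; exact ha _ (hb d hd)
        add_mem' := fun {a b} ha hb d hd => by rw [add_smul]; exact add_mem (ha d hd) (hb d hd)
        algebraMap_mem' := fun c d hd => by rw [algebraMap_smul]; exact V.smul_mem c hd }
    refine fun a => mem_of_gen_mem p₀ p₁ (S := S) (fun g d hd => ?_) a
    rw [hV] at hd
    induction hd using Submodule.span_induction with
    | mem d hd => obtain ⟨w, x, z, hw, hx, rfl⟩ := hd; exact hgen g z hw hx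
    | zero => rw [smul_zero]; exact zero_mem _
    | add d d' _ _ h h' => rw [smul_add]; exact add_mem h h'
    | smul c d _ h => rw [smul_comm]; exact V.smul_mem c h
  obtain ⟨x₁, hx₁⟩ := exists_bimodRep_eq_permAut p₀ p₁ (n := n) (m := m) .one
  have hcoeff : ∀ f ∈ coeffFun p₀ p₁ n m, ∀ (y : Bimod p₀ p₁ n m (n + m) rfl) (z : N ⊗[ℂ] M),
      bimodRep p₀ p₁ y = mulOp f → diamondMk p₀ p₁ N M y z ∈ V := by
    intro f hf y z hy
    obtain ⟨x, hx, hxf⟩ := exists_of_mem_coeffFun p₀ p₁ hf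
    obtain ⟨f', hf', k, g, hg⟩ := exists_mul_delta_pow p₀ p₁ hx
    obtain rfl : f = f' := mulOp_injective (hxf.symm.trans hf')
    have hu := (isUnit_laurentAction_delta hI hJ hd hN hM).pow k
    rw [← map_pow] at hu
    -- With `f δᵏ = g` and `z = δᵏ z'`, the class `f ⊗ z` equals `1 ⊗ g z'`.
    obtain ⟨z', rfl⟩ := ((Module.End.isUnit_iff _).1 hu).2 z
    obtain ⟨y', hy'⟩ := exists_bimodRep_eq_mul_mulOp p₀ p₁ y
      (toRat_mem_coeffFun p₀ p₁ (delta n m p₁ ^ k))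
    rw [← diamondMk_laurent p₀ p₁ _ hy']
    rw [diamondMk_laurent p₀ p₁ g (x := x₁)]
    · exact hmem _ .one hx₁
    · rw [hy', hx₁, map_one, map_one, one_mul, hy, ← map_mul, map_pow, ← ratDelta, hg]
  -- A general element of the bimodule is a combination of elements of the coefficient ring with
  -- coefficients from the Hecke algebra.
  have hall : ∀ x ∈ bimod p₀ p₁ n m (n + m) rfl, ∀ (y : Bimod p₀ p₁ n m (n + m) rfl)
      (z : N ⊗[ℂ] M), bimodRep p₀ p₁ y = locRep p₀ p₁ (n + m) x →
      diamondMk p₀ p₁ N M y z ∈ V := by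
    intro x hx
    induction hx using Submodule.span_induction with
    | mem x hx =>
      obtain ⟨f, hf, -⟩ := exists_mul_delta_pow p₀ p₁ hx
      exact fun y z hy => hcoeff f ⟨x, hx, hf⟩ y z (hy.trans hf)
    | zero =>
      intro y z hy
      rw [map_zero, ← map_zero (bimodRep p₀ p₁)] at hy
      rw [bimodRep_injective p₀ p₁ hy, map_zero, LinearMap.zero_apply]
      exact zero_mem V
    | add x x' hx hx' h h' =>
      intro y z hy
      obtain ⟨u, hu⟩ := exists_bimodRep_eq p₀ p₁ ⟨x, hx, rfl⟩
      obtain ⟨u', hu'⟩ := exists_bimodRep_eq p₀ p₁ ⟨x', hx', rfl⟩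
      rw [map_add, ← hu, ← hu', ← map_add] at hy
      rw [bimodRep_injective p₀ p₁ hy, map_add, LinearMap.add_apply]
      exact add_mem (h u z hu) (h' u' z hu')
    | smul a x hx h =>
      intro y z hy
      obtain ⟨u, hu⟩ := exists_bimodRep_eq p₀ p₁ ⟨x, hx, rfl⟩
      have e : locRep p₀ p₁ (n + m) (a • x) = bimodRep p₀ p₁ (a • u) := by
        rw [bimodRep_smul, hu, ← locRep_toLoc, ← map_mul]; rfl
      rw [e] at hy
      rw [bimodRep_injective p₀ p₁ hy, ← smul_diamondMk]
      exact hstable a _ (h u z hu)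
  refine eq_top_iff.2 fun d _ => ?_
  induction d using diamondMk_induction with
  | add d d' h h' => exact add_mem (h trivial) (h' trivial)
  | mk x z => exact hall x.val (Subtype.prop x) x z rfl

end Components

end HeckeB
end

noncomputable section

namespace HeckeB

/-! ### Nontriviality of `N ◇ M` -/

section Nontrivial

variable {p₀ p₁ : ℂˣ} {n m : ℕ}
  {N : Type u} [AddCommGroup N] [Module ℂ N] [Module (HeckeB p₀ p₁ n) N]
  [IsScalarTower ℂ (HeckeB p₀ p₁ n) N]
  {M : Type v} [AddCommGroup M] [Module ℂ M] [Module (HeckeB p₀ p₁ m) M]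
  [IsScalarTower ℂ (HeckeB p₀ p₁ m) M]

/-- The action of `H^B_n ⊗ H^B_m` on `N ⊗ M` extends to the localization. -/
theorem exists_blockAlg_action
    (hu : IsUnit (laurentAction p₀ p₁ n m N M (delta n m p₁))) :
    ∃ θ : blockAlg p₀ p₁ n m →ₐ[ℂ] Module.End ℂ (N ⊗[ℂ] M), ∀ c,
      θ ⟨tensorRep p₀ p₁ n m c, tensorRep_mem_blockAlg p₀ p₁ c⟩ = tensorAction p₀ p₁ n m N M c :=
  exists_fracAlg_lift (tensorRep_injective p₀ p₁) (commute_deltaTensor p₀ p₁ n m)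
    (isUnit_tensorRep_deltaTensor p₀ p₁ n m) (tensorAction p₀ p₁ n m N M) hu

/-- The action of the algebra `(H^B_n ⊗ H^B_m)[D⁻¹]` on `N ⊗ M`, composed with the projection onto
block-preserving operators, separates the classes `1 ⊗ z`. -/
theorem diamondMk_ne_zero (hu : IsUnit (laurentAction p₀ p₁ n m N M (delta n m p₁)))
    {x : Bimod p₀ p₁ n m (n + m) rfl} (hx : bimodRep p₀ p₁ x = 1) {z : N ⊗[ℂ] M} (hz : z ≠ 0) :
    diamondMk p₀ p₁ N M x z ≠ 0 := by
  obtain ⟨θ, hθ⟩ := exists_blockAlg_action hu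
  let F : Bimod p₀ p₁ n m (n + m) rfl →ₗ[ℂ] Module.End ℂ (N ⊗[ℂ] M) :=
    { toFun := fun x => θ ⟨_, blockProj_bimodRep_mem p₀ p₁ x⟩
      map_add' := fun x y => by
        rw [← map_add]; congr 1; exact Subtype.ext (by simp)
      map_smul' := fun c x => by
        rw [RingHom.id_apply, ← map_smul]; congr 1
        refine Subtype.ext ?_
        change blockProj n m (bimodRep p₀ p₁ (c • x)) = c • blockProj n m (bimodRep p₀ p₁ x)
        rw [map_smul, ← algebraMap_smul (RatFun (n + m)), map_smul, algebraMap_smul] }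
  -- The map `x ⊗ z ↦ θ(π(x)) z`, where `π` is the projection onto block-preserving operators. It is
  -- not a homomorphism of `H^B_{n+m}`-modules.
  let Ψ := TensorProduct.lift F
  have hF : ∀ {x y : Bimod p₀ p₁ n m (n + m) rfl} {b : Op (n + m)} (hb : b ∈ blockAlg p₀ p₁ n m),
      b ∈ biLin n m → bimodRep p₀ p₁ y = bimodRep p₀ p₁ x * b → F y = F x * θ ⟨b, hb⟩ := by
    intro x y b hb hb' h
    have h1 := (hb' _ (bimodRep_mem_autSpan p₀ p₁ x)).1.2
    change θ _ = θ _ * θ _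
    rw [← map_mul]
    congr 1
    refine Subtype.ext ?_
    change blockProj n m (bimodRep p₀ p₁ y) = blockProj n m (bimodRep p₀ p₁ x) * b
    rw [h, h1]
  -- The largest submodule in the kernel. It contains the defining relations of `N ◇ M`, because `π`
  -- is linear over the block-preserving operators on the right.
  let K : Submodule (HeckeB p₀ p₁ (n + m)) (Bimod p₀ p₁ n m (n + m) rfl ⊗[ℂ] (N ⊗[ℂ] M)) :=
    { carrier := {t | ∀ a : HeckeB p₀ p₁ (n + m), Ψ (a • t) = 0}
      zero_mem' := fun a => by rw [smul_zero, map_zero]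
      add_mem' := fun hs ht a => by rw [smul_add, map_add, hs a, ht a, add_zero]
      smul_mem' := fun b t ht a => by rw [smul_smul]; exact ht _ }
  have hK : Submodule.span _ (diamondRel p₀ p₁ (n + m) rfl N M) ≤ K := by
    rw [Submodule.span_le]
    rintro _ (⟨x, y, g, u, v, h, rfl⟩ | ⟨x, y, g, u, v, h, rfl⟩) a
    · have hb := genOp_castAdd_mem_blockAlg p₀ p₁ (m := m) g
      have e : bimodRep p₀ p₁ (a • y) =
          bimodRep p₀ p₁ (a • x) * genOp p₀ p₁ (Fin.castAdd m) g := by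
        rw [bimodRep_smul, bimodRep_smul, mul_assoc]
        congr 1
        change locRep p₀ p₁ (n + m) y.val = locRep p₀ p₁ (n + m) x.val * _
        rw [h, map_mul, locRep_leftGen, leftRep, rep_gen]
      have h2 := hF hb (genOp_mem_biLin p₀ p₁ swapAut_castAdd_mem_blockGroup g) e
      have h3 := hθ (gen p₀ p₁ n g ⊗ₜ 1)
      simp only [tensorRep_tmul, map_one, mul_one, leftRep, rep_gen] at h3
      rw [smul_sub, TensorProduct.smul_tmul', TensorProduct.smul_tmul', map_sub,
        TensorProduct.lift.tmul, TensorProduct.lift.tmul, h2, h3, Module.End.mul_apply,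
        tensorAction_tmul, one_smul, sub_self]
    · have hb := genOp_natAdd_mem_blockAlg p₀ p₁ (n := n) g
      have e : bimodRep p₀ p₁ (a • y) =
          bimodRep p₀ p₁ (a • x) * genOp p₀ p₁ (Fin.natAdd n) g := by
        rw [bimodRep_smul, bimodRep_smul, mul_assoc]
        congr 1
        change locRep p₀ p₁ (n + m) y.val = locRep p₀ p₁ (n + m) x.val * _
        rw [h, map_mul, locRep_rightGen, rightRep, rep_gen]
      have h2 := hF hb (genOp_mem_biLin p₀ p₁ swapAut_natAdd_mem_blockGroup g) e
      have h3 := hθ (1 ⊗ₜ gen p₀ p₁ m g)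
      simp only [tensorRep_tmul, map_one, one_mul, rightRep, rep_gen] at h3
      rw [smul_sub, TensorProduct.smul_tmul', TensorProduct.smul_tmul', map_sub,
        TensorProduct.lift.tmul, TensorProduct.lift.tmul, h2, h3, Module.End.mul_apply,
        tensorAction_tmul, one_smul, sub_self]
  intro h0
  have h1 := hK ((Submodule.Quotient.mk_eq_zero _).1 h0) 1
  rw [one_smul, TensorProduct.mk_apply, TensorProduct.lift.tmul] at h1
  -- The identity preserves the blocks.
  have h2 : F x = 1 := by
    change θ _ = 1
    rw [← map_one θ]
    congr 1
    refine Subtype.ext ?_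
    change blockProj n m (bimodRep p₀ p₁ x) = 1
    rw [hx, ← map_one autOp, blockProj_autOp, if_pos (one_mem _)]
  rw [h2, Module.End.one_apply] at h1
  exact hz h1

end Nontrivial

/-! ### The type of `N ◇ M` -/

section Types

variable {p₀ p₁ : ℂˣ} {n m : ℕ}
  {N : Type u} [AddCommGroup N] [Module ℂ N] [Module (HeckeB p₀ p₁ n) N]
  [IsScalarTower ℂ (HeckeB p₀ p₁ n) N]
  {M : Type v} [AddCommGroup M] [Module ℂ M] [Module (HeckeB p₀ p₁ m) M]
  [IsScalarTower ℂ (HeckeB p₀ p₁ m) M]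

/-- Eigenvalues of the variables on `N ⊗ M` lie in the set that belongs to the block. -/
theorem eigenvalue_varX_mem {I J : Set ℂˣ} (hN : IsOfType p₀ p₁ (n := n) I N)
    (hM : IsOfType p₀ p₁ (n := m) J M) {i : Fin (n + m)} {a : ℂ}
    (h : (laurentAction p₀ p₁ n m N M (varX i)).HasEigenvalue a) :
    ∃ u ∈ (if i.val < n then I else J), (u : ℂ) = a := by
  refine Fin.addCases (fun i => ?_) (fun i => ?_) i h
  · intro h
    rw [if_pos (by simp)]
    exact eigenvalue_castAdd_mem hN h
  · intro h
    rw [if_neg (by simp)]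
    exact eigenvalue_natAdd_mem hM h

variable (p₀ p₁ n m) in
/-- A choice of elements of the bimodule that represent the shuffles. -/
def shuffleElem (w : {w : Equiv.Perm (Fin (n + m)) // IsShuffle n w}) :
    Bimod p₀ p₁ n m (n + m) rfl := (exists_bimodRep_eq_permAut p₀ p₁ w.2).choose

theorem bimodRep_shuffleElem (w : {w : Equiv.Perm (Fin (n + m)) // IsShuffle n w}) :
    bimodRep p₀ p₁ (shuffleElem p₀ p₁ n m w) = autOp (permAut w) :=
  (exists_bimodRep_eq_permAut p₀ p₁ w.2).choose_spec

variable {I J : Set ℂˣ} (hI : IsInvariant p₁ I) (hJ : IsInvariant p₁ J) (hd : Disjoint I J)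
  (hN : IsOfType p₀ p₁ (n := n) I N) (hM : IsOfType p₀ p₁ (n := m) J M)

include hI hJ hd hN hM

open Classical in
/-- In particular `N ◇ M` is finite-dimensional. -/
theorem lsum_shuffleElem_surjective : Function.Surjective
    (LinearMap.lsum ℂ (fun _ => N ⊗[ℂ] M) ℂ fun w => diamondMk p₀ p₁ N M
      (shuffleElem p₀ p₁ n m w)) := by
  rw [← LinearMap.range_eq_top, eq_top_iff, ← span_diamondMk_eq_top hI hJ hd hN hM,
    Submodule.span_le]
  rintro _ ⟨w, x, z, hw, hx, rfl⟩
  refine ⟨Pi.single ⟨w, hw⟩ z, ?_⟩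
  rw [LinearMap.lsum_piSingle]
  have : x = shuffleElem p₀ p₁ n m ⟨w, hw⟩ :=
    bimodRep_injective p₀ p₁ (hx.trans (bimodRep_shuffleElem ⟨w, hw⟩).symm)
  rw [this]

open Classical in
theorem exists_eq_sum_shuffleElem (d : Diamond p₀ p₁ (n + m) rfl N M) :
    ∃ f : {w : Equiv.Perm (Fin (n + m)) // IsShuffle n w} → N ⊗[ℂ] M,
      d = ∑ w, diamondMk p₀ p₁ N M (shuffleElem p₀ p₁ n m w) (f w) := by
  obtain ⟨f, rfl⟩ := lsum_shuffleElem_surjective hI hJ hd hN hM d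
  exact ⟨f, by rw [LinearMap.lsum_apply, LinearMap.sum_apply]; rfl⟩

/-- A variable acts on the component of a shuffle as one of the variables acts on `N ⊗ M`, so it is
annihilated by the product of the minimal polynomials of the latter. -/
theorem isOfType_diamond :
    IsOfType p₀ p₁ (n := n + m) (I ∪ J) (Diamond p₀ p₁ (n + m) rfl N M) := by
  classical
  have := hN.1
  have := hM.1
  refine ⟨Module.Finite.of_surjective _ (lsum_shuffleElem_surjective hI hJ hd hN hM),
    fun b a ha => ?_⟩
  let q : Polynomial ℂ := ∏ i, minpoly ℂ (laurentAction p₀ p₁ n m N M (varX i))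
  have hq : ∀ d : Diamond p₀ p₁ (n + m) rfl N M,
      laurentHom p₀ p₁ (n + m) (Polynomial.aeval (varX b) q) • d = 0 := by
    intro d
    obtain ⟨f, rfl⟩ := exists_eq_sum_shuffleElem hI hJ hd hN hM d
    rw [Finset.smul_sum]
    refine Finset.sum_eq_zero fun w _ => ?_
    rw [laurentHom_smul_diamondMk (bimodRep_shuffleElem w) (toRat_aeval_varX w.1 b q),
      ← Polynomial.aeval_algHom_apply, Polynomial.aeval_eq_zero_of_dvd_aeval_eq_zero
        (Finset.dvd_prod_of_mem (fun i => minpoly ℂ (laurentAction p₀ p₁ n m N M (varX i)))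
          (Finset.mem_univ (w.1.symm b))) (minpoly.aeval _ _),
      LinearMap.zero_apply, map_zero]
  obtain ⟨d, hd⟩ := ha.exists_hasEigenvector
  have h1 := Module.End.aeval_apply_of_hasEigenvector (p := q) hd
  have h2 : Polynomial.aeval (Algebra.lsmul ℂ ℂ (Diamond p₀ p₁ (n + m) rfl N M)
      (gen p₀ p₁ (n + m) (.X b))) q d = 0 := by
    rw [Polynomial.aeval_algHom_apply, ← laurentHom_varX, Polynomial.aeval_algHom_apply]
    exact hq d
  rw [h2] at h1
  have h3 := (smul_eq_zero.1 h1.symm).resolve_right hd.2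
  rw [Polynomial.eval_prod, Finset.prod_eq_zero_iff] at h3
  obtain ⟨i, -, hi⟩ := h3
  obtain ⟨u, hu, hua⟩ := eigenvalue_varX_mem hN hM (Module.End.hasEigenvalue_of_isRoot hi)
  refine ⟨u, ?_, hua⟩
  split_ifs at hu
  · exact Or.inl hu
  · exact Or.inr hu

end Types

end HeckeB
end

noncomputable section

/-- An injective linear map that preserves a finite-dimensional subspace maps it onto itself. -/
theorem exists_mem_apply_eq {Z : Type*} [AddCommGroup Z] [Module ℂ Z] [FiniteDimensional ℂ Z]
    {f : Module.End ℂ Z} (hf : IsUnit f) {P : Submodule ℂ Z} (hP : ∀ z ∈ P, f z ∈ P) {z : Z}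
    (hz : z ∈ P) : ∃ z' ∈ P, f z' = z := by
  have h : Function.Injective (f.restrict hP) := fun x y hxy =>
    Subtype.ext (((Module.End.isUnit_iff f).1 hf).1 (congrArg Subtype.val hxy))
  obtain ⟨z', hz'⟩ := LinearMap.injective_iff_surjective.1 h ⟨z, hz⟩
  exact ⟨z', z'.2, congrArg Subtype.val hz'⟩

namespace HeckeB

/-! ### Irreducibility of `N ◇ M` -/

section Irreducible

variable {p₀ p₁ : ℂˣ} {n m : ℕ}
  {N : Type u} [AddCommGroup N] [Module ℂ N] [Module (HeckeB p₀ p₁ n) N]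
  [IsScalarTower ℂ (HeckeB p₀ p₁ n) N]
  {M : Type v} [AddCommGroup M] [Module ℂ M] [Module (HeckeB p₀ p₁ m) M]
  [IsScalarTower ℂ (HeckeB p₀ p₁ m) M]

/-- The vectors whose classes in the component of a shuffle belong to a given submodule. -/
def componentPreimage (S : Submodule (HeckeB p₀ p₁ (n + m)) (Diamond p₀ p₁ (n + m) rfl N M))
    (w : {w : Equiv.Perm (Fin (n + m)) // IsShuffle n w}) : Submodule ℂ (N ⊗[ℂ] M) :=
  (S.restrictScalars ℂ).comap (diamondMk p₀ p₁ N M (shuffleElem p₀ p₁ n m w))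

variable {S : Submodule (HeckeB p₀ p₁ (n + m)) (Diamond p₀ p₁ (n + m) rfl N M)}

omit [IsScalarTower ℂ (HeckeB p₀ p₁ n) N] [IsScalarTower ℂ (HeckeB p₀ p₁ m) M] in
theorem mem_componentPreimage {w : {w : Equiv.Perm (Fin (n + m)) // IsShuffle n w}}
    {z : N ⊗[ℂ] M} : z ∈ componentPreimage S w ↔
      diamondMk p₀ p₁ N M (shuffleElem p₀ p₁ n m w) z ∈ S := Iff.rfl

theorem varX_mem_componentPreimage {w : {w : Equiv.Perm (Fin (n + m)) // IsShuffle n w}}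
    {z : N ⊗[ℂ] M} (hz : z ∈ componentPreimage S w) (i : Fin (n + m)) :
    laurentAction p₀ p₁ n m N M (varX i) z ∈ componentPreimage S w := by
  have h := S.smul_mem (gen p₀ p₁ (n + m) (.X (w.1 i))) hz
  rwa [X_smul_diamondMk (bimodRep_shuffleElem w), Equiv.symm_apply_apply] at h

theorem tauFactor_mem_componentPreimage {w : {w : Equiv.Perm (Fin (n + m)) // IsShuffle n w}}
    {z : N ⊗[ℂ] M} (hz : z ∈ componentPreimage S w) (a b : Fin (n + m)) :
    laurentAction p₀ p₁ n m N M (tauFactor p₁ a b) z ∈ componentPreimage S w := by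
  rw [tauFactor, map_sub, map_smul, map_smul, LinearMap.sub_apply, LinearMap.smul_apply,
    LinearMap.smul_apply]
  exact sub_mem (Submodule.smul_mem _ _ (varX_mem_componentPreimage hz a))
    (Submodule.smul_mem _ _ (varX_mem_componentPreimage hz b))

/-- The generators of `H^B_n` act on the component of the trivial shuffle as generators of
`H^B_{n+m}`. -/
theorem tensorAction_gen_left_mem {z : N ⊗[ℂ] M}
    (hz : z ∈ componentPreimage S ⟨1, .one⟩) (g : HeckeGen n) :
    tensorAction p₀ p₁ n m N M (gen p₀ p₁ n g ⊗ₜ 1) z ∈ componentPreimage S ⟨1, .one⟩ := by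
  have key : ∀ g' : HeckeGen (n + m), genOp p₀ p₁ id g' = genOp p₀ p₁ (Fin.castAdd m) g →
      tensorAction p₀ p₁ n m N M (gen p₀ p₁ n g ⊗ₜ 1) z ∈ componentPreimage S ⟨1, .one⟩ := by
    intro g' h
    have h1 := S.smul_mem (gen p₀ p₁ (n + m) g') hz
    rw [smul_diamondMk, diamondMk_castAdd p₀ p₁ (x := shuffleElem p₀ p₁ n m ⟨1, .one⟩) g] at h1
    · exact h1
    · rw [bimodRep_smul, bimodRep_shuffleElem, map_one, map_one, mul_one, one_mul, dlRep_gen, h]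
  rcases g with ⟨i, hi⟩ | i | i
  · exact key (.T ⟨i, by omega⟩) rfl
  · exact key (.X (Fin.castAdd m i)) rfl
  · exact key (.Xinv (Fin.castAdd m i)) rfl

/-- All generators of `H^B_m` but `T_0` act on the component of the trivial shuffle as generators of
`H^B_{n+m}`. -/
theorem tensorAction_gen_right_mem {z : N ⊗[ℂ] M}
    (hz : z ∈ componentPreimage S ⟨1, .one⟩) (g : HeckeGen m) (hg : ∀ h, g ≠ .T ⟨0, h⟩) :
    tensorAction p₀ p₁ n m N M (1 ⊗ₜ gen p₀ p₁ m g) z ∈ componentPreimage S ⟨1, .one⟩ := by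
  have key : ∀ g' : HeckeGen (n + m), genOp p₀ p₁ id g' = genOp p₀ p₁ (Fin.natAdd n) g →
      tensorAction p₀ p₁ n m N M (1 ⊗ₜ gen p₀ p₁ m g) z ∈ componentPreimage S ⟨1, .one⟩ := by
    intro g' h
    have h1 := S.smul_mem (gen p₀ p₁ (n + m) g') hz
    rw [smul_diamondMk, diamondMk_natAdd p₀ p₁ (x := shuffleElem p₀ p₁ n m ⟨1, .one⟩) g] at h1
    · exact h1
    · rw [bimodRep_smul, bimodRep_shuffleElem, map_one, map_one, mul_one, one_mul, dlRep_gen, h]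
  rcases g with ⟨i, hi⟩ | i | i
  · rcases i with - | i
    · exact absurd rfl (hg hi)
    · refine key (.T ⟨n + i + 1, by omega⟩) ?_
      rw [genOp_T_succ, genOp_T_succ]
      rfl
  · exact key (.X (Fin.natAdd n i)) rfl
  · exact key (.Xinv (Fin.natAdd n i)) rfl

variable {I J : Set ℂˣ} (hI : IsInvariant p₁ I) (hJ : IsInvariant p₁ J) (hd : Disjoint I J)
  (hN : IsOfType p₀ p₁ (n := n) I N) (hM : IsOfType p₀ p₁ (n := m) J M)

include hI hJ hd hN hM

/-- The vectors that a submodule contains in the component of a shuffle do not depend on the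
shuffle, because the intertwiners are invertible. -/
theorem componentPreimage_eq (w : {w : Equiv.Perm (Fin (n + m)) // IsShuffle n w}) :
    componentPreimage S w = componentPreimage S ⟨1, .one⟩ := by
  have := hN.1
  have := hM.1
  obtain ⟨w, hw⟩ := w
  induction hw with
  | one => rfl
  | step w k h hw hdb ih =>
    rw [← ih]
    have hx := bimodRep_shuffleElem (p₀ := p₀) (p₁ := p₁) ⟨w, hw⟩
    have hx' := bimodRep_shuffleElem (p₀ := p₀) (p₁ := p₁) ⟨_, hw.step w k h hdb⟩
    refine le_antisymm (fun z hz => ?_) (fun z hz => ?_)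
    · obtain ⟨z', hz', rfl⟩ := exists_mem_apply_eq
        (isUnit_laurentAction_tauFactor hI hJ hd hN hM hdb.symm)
        (fun z hz => tauFactor_mem_componentPreimage hz _ _) hz
      rw [mem_componentPreimage, ← tau_smul_diamondMk' h hx hx']
      exact S.smul_mem _ hz'
    · obtain ⟨z', hz', rfl⟩ := exists_mem_apply_eq
        (isUnit_laurentAction_tauFactor hI hJ hd hN hM hdb)
        (fun z hz => tauFactor_mem_componentPreimage hz _ _) hz
      rw [mem_componentPreimage, ← tau_smul_diamondMk h hx hx']
      exact S.smul_mem _ hz'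

/-- The vectors that a submodule contains in a component form a submodule over `H^B_n ⊗ H^B_m`. -/
theorem tensorAction_mem_componentPreimage (c : HeckeB p₀ p₁ n ⊗[ℂ] HeckeB p₀ p₁ m) :
    ∀ z ∈ componentPreimage S ⟨1, .one⟩,
      tensorAction p₀ p₁ n m N M c z ∈ componentPreimage S ⟨1, .one⟩ := by
  let A : Subalgebra ℂ (HeckeB p₀ p₁ n ⊗[ℂ] HeckeB p₀ p₁ m) :=
    { carrier := {c | ∀ z ∈ componentPreimage S ⟨1, .one⟩,
        tensorAction p₀ p₁ n m N M c z ∈ componentPreimage S ⟨1, .one⟩}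
      mul_mem' := fun {a b} ha hb z hz => by
        rw [map_mul, Module.End.mul_apply]; exact ha _ (hb z hz)
      add_mem' := fun {a b} ha hb z hz => by
        rw [map_add, LinearMap.add_apply]; exact add_mem (ha z hz) (hb z hz)
      algebraMap_mem' := fun c z hz => by
        rw [AlgHom.commutes, Module.algebraMap_end_apply]; exact Submodule.smul_mem _ c hz }
  have hl : ∀ a : HeckeB p₀ p₁ n, a ⊗ₜ 1 ∈ A := fun a =>
    mem_of_gen_mem p₀ p₁ (S := A.comap Algebra.TensorProduct.includeLeft)
      (fun g z hz => tensorAction_gen_left_mem hz g) a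
  have hr : ∀ b : HeckeB p₀ p₁ m, 1 ⊗ₜ b ∈ A := fun b =>
    mem_of_gen_mem p₀ p₁ (S := A.comap Algebra.TensorProduct.includeRight)
      (fun g z hz => by
        by_cases hg : ∃ h, g = .T ⟨0, h⟩
        · obtain ⟨h, rfl⟩ := hg
          -- The generator `T_0` of `H^B_m` is the generator `T_0` of `H^B_{n+m}` in the component
          -- of a shuffle that moves the second block to the front.
          obtain ⟨w, hw, hw0⟩ := exists_isShuffle_apply (n := n) (r := n + m) (by omega) n le_rfl
          rw [← componentPreimage_eq hI hJ hd hN hM ⟨w, hw⟩] at hz ⊢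
          have h0 : (w.symm ⟨0, by omega⟩).val = n := by
            have e : (⟨0, by omega⟩ : Fin (n + m)) = ⟨n - n, by omega⟩ := by simp
            rw [e, ← hw0, Equiv.symm_apply_apply]
          have h1 := (T_zero_smul_diamondMk (p₀ := p₀) (p₁ := p₁) (N := N) (M := M) (n := n)
            (m := m) (by omega)
            (bimodRep_shuffleElem ⟨w, hw⟩) z).2 h h0
          rw [mem_componentPreimage]
          refine h1 ▸ S.smul_mem _ hz
        · exact tensorAction_gen_right_mem hz g fun h h' => hg ⟨h, h'⟩) b
  induction c using TensorProduct.induction_on with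
  | zero => exact zero_mem A
  | tmul a b =>
    have := mul_mem (hl a) (hr b)
    rwa [Algebra.TensorProduct.tmul_mul_tmul, mul_one, one_mul] at this
  | add x y hx hy => exact add_mem (S := Subalgebra ℂ _) (s := A) hx hy

/-- A nonzero submodule meets a component: a weight vector in it has only one nonzero component,
because the shuffle can be read off from the eigenvalues of the variables. -/
theorem exists_componentPreimage_ne_bot (hS : S ≠ ⊥) : ∃ w, componentPreimage S w ≠ ⊥ := by
  classical
  have hf := (isOfType_diamond hI hJ hd hN hM).1
  have := hN.1
  have := hM.1
  let e : AddMonoidAlgebra ℂ (Fin (n + m) → ℤ) →ₐ[ℂ]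
      Module.End ℂ (Diamond p₀ p₁ (n + m) rfl N M) :=
    (Algebra.lsmul ℂ ℂ _).comp (laurentHom p₀ p₁ (n + m))
  obtain ⟨χ, v, hvS, hv0, hv⟩ := exists_isWeightVector_mem e (S.restrictScalars ℂ)
    (by rwa [Ne, Submodule.restrictScalars_eq_bot_iff]) fun c z hz => S.smul_mem _ hz
  have hv : ∀ f, laurentHom p₀ p₁ (n + m) f • v = χ f • v := hv
  let W := {w : Equiv.Perm (Fin (n + m)) // IsShuffle n w}
  obtain ⟨F, ⟨f, hF⟩, hmin⟩ := (wellFounded_lt (α := Finset W)).has_min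
    {F | ∃ f : W → N ⊗[ℂ] M, v = ∑ w ∈ F, diamondMk p₀ p₁ N M (shuffleElem p₀ p₁ n m w) (f w)}
    ⟨Finset.univ, exists_eq_sum_shuffleElem hI hJ hd hN hM v⟩
  -- In a shortest sum for `v`, all shuffles have the same pattern of blocks: if the eigenvalue of
  -- `X_a` did not match the block from which `a` comes under `w`, then a polynomial in `X_a` would
  -- remove the component of `w` and multiply `v` by a nonzero scalar.
  have hpat : ∀ w ∈ F, ∀ a, (w.1.symm a).val < n ↔ ∃ u ∈ I, (u : ℂ) = χ (varX a) := by
    intro w hw a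
    by_contra hne
    let q := minpoly ℂ (laurentAction p₀ p₁ n m N M (varX (w.1.symm a)))
    have hq : q.eval (χ (varX a)) ≠ 0 := by
      intro h0
      obtain ⟨u, hu, hua⟩ := eigenvalue_varX_mem hN hM (Module.End.hasEigenvalue_of_isRoot h0)
      refine hne ?_
      split_ifs at hu with hlt
      · exact ⟨fun _ => ⟨u, hu, hua⟩, fun _ => hlt⟩
      · refine ⟨fun h => absurd h hlt, fun ⟨u', hu', h'⟩ => ?_⟩
        exact absurd (h'.trans hua.symm) fun h => Set.disjoint_left.1 hd hu' (Units.ext h ▸ hu)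
    have h1 := hv (Polynomial.aeval (varX a) q)
    rw [← Polynomial.aeval_algHom_apply χ, Polynomial.coe_aeval_eq_eval] at h1
    refine hmin (F.erase w) ⟨fun w' => (q.eval (χ (varX a)))⁻¹ • laurentAction p₀ p₁ n m N M
      (Polynomial.aeval (varX (w'.1.symm a)) q) (f w'), ?_⟩ (Finset.erase_ssubset hw)
    have h2 : laurentHom p₀ p₁ (n + m) (Polynomial.aeval (varX a) q) • v =
        ∑ w' ∈ F, diamondMk p₀ p₁ N M (shuffleElem p₀ p₁ n m w') (laurentAction p₀ p₁ n m N M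
          (Polynomial.aeval (varX (w'.1.symm a)) q) (f w')) := by
      rw [hF, Finset.smul_sum]
      refine Finset.sum_congr rfl fun w' _ => ?_
      rw [laurentHom_smul_diamondMk (bimodRep_shuffleElem w') (toRat_aeval_varX w'.1 a q)]
    rw [h1] at h2
    simp only [map_smul]
    rw [← Finset.smul_sum, eq_inv_smul_iff₀ hq, h2, ← Finset.add_sum_erase _ _ hw,
      ← Polynomial.aeval_algHom_apply, minpoly.aeval, LinearMap.zero_apply, map_zero, zero_add]
  obtain ⟨w, hw⟩ : F.Nonempty := by
    rw [Finset.nonempty_iff_ne_empty]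
    rintro rfl
    exact hv0 hF
  -- A shuffle is determined by its pattern of blocks, so there is only one component.
  have hsing : F = {w} := Finset.eq_singleton_iff_unique_mem.2 ⟨hw, fun w' hw' => Subtype.ext
    (w'.2.ext w.2 fun a => (hpat w' hw' a).trans (hpat w hw a).symm)⟩
  rw [hsing, Finset.sum_singleton] at hF
  refine ⟨w, (Submodule.ne_bot_iff _).2 ⟨f w, ?_, fun h0 => hv0 ?_⟩⟩
  · rw [mem_componentPreimage, ← hF]; exact hvS
  · rw [hF, h0, map_zero]

/-- A nonzero submodule meets some component, hence every component in the same subspace of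
`N ⊗ M`. This subspace is stable under `H^B_n ⊗ H^B_m`, so it is everything. -/
theorem isSimpleModule_diamond [IsSimpleModule (HeckeB p₀ p₁ n) N]
    [IsSimpleModule (HeckeB p₀ p₁ m) M] :
    IsSimpleModule (HeckeB p₀ p₁ (n + m)) (Diamond p₀ p₁ (n + m) rfl N M) := by
  have := hN.1
  have := hM.1
  have hnt : Nontrivial (Diamond p₀ p₁ (n + m) rfl N M) := by
    have : Nontrivial N := IsSimpleModule.nontrivial (HeckeB p₀ p₁ n) N
    have : Nontrivial M := IsSimpleModule.nontrivial (HeckeB p₀ p₁ m) M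
    have : Nontrivial (N ⊗[ℂ] M) := by
      rw [← Module.finrank_pos_iff (R := ℂ), Module.finrank_tensorProduct]
      exact Nat.mul_pos Module.finrank_pos Module.finrank_pos
    obtain ⟨z, hz⟩ := exists_ne (0 : N ⊗[ℂ] M)
    exact ⟨⟨_, _, diamondMk_ne_zero (isUnit_laurentAction_delta hI hJ hd hN hM)
      ((bimodRep_shuffleElem ⟨1, .one⟩).trans (by rw [map_one, map_one])) hz⟩⟩
  refine isSimpleModule_iff _ _ |>.2
    { eq_bot_or_eq_top := fun S => or_iff_not_imp_left.2 fun hS => ?_ }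
  obtain ⟨w, hw⟩ := exists_componentPreimage_ne_bot hI hJ hd hN hM hS
  rw [componentPreimage_eq hI hJ hd hN hM] at hw
  have htop : componentPreimage S ⟨1, .one⟩ = ⊤ := by
    refine eq_top_of_tmul_stable (A := HeckeB p₀ p₁ n) (B := HeckeB p₀ p₁ m) _ hw
      (fun a z hz => ?_) fun b z hz => ?_
    · rw [← tensorAction_tmul_one (m := m) p₀ p₁]
      exact tensorAction_mem_componentPreimage hI hJ hd hN hM _ z hz
    · rw [← tensorAction_one_tmul (n := n) p₀ p₁]
      exact tensorAction_mem_componentPreimage hI hJ hd hN hM _ z hz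
  rw [← Submodule.restrictScalars_eq_top_iff ℂ, eq_top_iff, ← span_diamondMk_eq_top hI hJ hd hN hM,
    Submodule.span_le]
  rintro _ ⟨w, x, z, hw, hx, rfl⟩
  have e : x = shuffleElem p₀ p₁ n m ⟨w, hw⟩ :=
    bimodRep_injective p₀ p₁ (hx.trans (bimodRep_shuffleElem ⟨w, hw⟩).symm)
  have h : z ∈ componentPreimage S ⟨w, hw⟩ := by
    rw [componentPreimage_eq hI hJ hd hN hM, htop]; trivial
  rw [e]
  exact h

end Irreducible

end HeckeB
end

noncomputable section

section Weights

variable {C Z : Type*} [CommRing C] [Algebra ℂ C] [AddCommGroup Z] [Module ℂ Z]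
  [FiniteDimensional ℂ Z] (e : C →ₐ[ℂ] Module.End ℂ Z)

/-- An element acts injectively on a stable subspace as soon as no weight of the subspace vanishes
on it. -/
theorem eq_zero_of_weight_ne_zero {S : Submodule ℂ Z} (hS : ∀ c, ∀ z ∈ S, e c z ∈ S) {f : C}
    (hf : ∀ χ, ∀ z ∈ S, IsWeightVector e χ z → χ f ≠ 0) {z : Z} (hz : z ∈ S) (h : e f z = 0) :
    z = 0 := by
  by_contra hne
  obtain ⟨χ, w, hw, hχ⟩ := exists_isWeightVector_mem e (S ⊓ LinearMap.ker (e f))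
    ((Submodule.ne_bot_iff _).2 ⟨z, ⟨hz, h⟩, hne⟩) fun c w hw => ⟨hS c w hw.1, by
      rw [SetLike.mem_coe, LinearMap.mem_ker, ← Module.End.mul_apply, ← map_mul, mul_comm, map_mul,
        Module.End.mul_apply, LinearMap.mem_ker.1 hw.2, map_zero]⟩
  refine hf χ w hw.1 hχ ((smul_eq_zero.1 ?_).resolve_right hχ.1)
  rw [← hχ.2, LinearMap.mem_ker.1 hw.2]

end Weights

namespace HeckeB

/-! ### Intertwiners and weights -/

section Intertwiner

variable {p₀ p₁ : ℂˣ} {r : ℕ}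

/-- An element of the Hecke algebra whose operator is a lattice involution `g` composed with the
multiplication by a Laurent polynomial `f`. It moves vectors of weight `χ` to vectors of weight
`χ ∘ g`. -/
structure IsIntertwiner (t : HeckeB p₀ p₁ r) (g : LatAut r)
    (f : AddMonoidAlgebra ℂ (Fin r → ℤ)) : Prop where
  sq : g * g = 1
  rep : dlRep p₀ p₁ r t = autOp g * mulOp (toRat r f)

theorem isIntertwiner_tau (k : ℕ) (h : k + 1 < r) : IsIntertwiner (tau p₀ p₁ k h)
    (swapAut ⟨k, by omega⟩ ⟨k + 1, h⟩) (tauFactor p₁ ⟨k, by omega⟩ ⟨k + 1, h⟩) where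
  sq := by rw [← map_mul, Equiv.swap_mul_self, map_one]
  rep := by rw [dlRep_tau', toRat_tauFactor]

variable (p₀ p₁) in
/-- The unnormalized intertwiner `T_0 (X_1 - X_1⁻¹) - (p₀ - p₀⁻¹) X_1`. -/
def tauZero (h : 0 < r) : HeckeB p₀ p₁ r :=
  gen p₀ p₁ r (.T ⟨0, h⟩) * (gen p₀ p₁ r (.X ⟨0, h⟩) - gen p₀ p₁ r (.Xinv ⟨0, h⟩)) -
    ((p₀ : ℂ) - (p₀ : ℂ)⁻¹) • gen p₀ p₁ r (.X ⟨0, h⟩)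

theorem isIntertwiner_tauZero (h : 0 < r) : IsIntertwiner (tauZero p₀ p₁ h) (flipAut ⟨0, h⟩)
    ((p₀ : ℂ) • varX ⟨0, h⟩ - (p₀ : ℂ)⁻¹ • varXinv ⟨0, h⟩) where
  sq := by
    refine LinearEquiv.ext fun a => funext fun j => ?_
    rw [LinearEquiv.mul_apply]
    by_cases hj : j = ⟨0, h⟩
    · rw [hj, flipAut_apply_self, flipAut_apply_self, neg_neg]; rfl
    · rw [flipAut_apply_of_ne hj, flipAut_apply_of_ne hj]; rfl
  rep := by
    rw [tauZero, map_sub, map_mul, map_sub, map_smul, dlRep_gen, dlRep_gen, dlRep_gen,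
      genOp_T_zero]
    change opT₀ p₀ ⟨0, h⟩ * (mulOp (ratX ⟨0, h⟩) - mulOp (ratX ⟨0, h⟩)⁻¹) -
      _ • mulOp (ratX ⟨0, h⟩) = _
    rw [← map_sub, ← map_smul, sub_smul, smul_eq_cst_mul, inv_smul_eq_cst_mul, map_sub (toRat r),
      map_smul (toRat r), map_smul (toRat r), smul_eq_cst_mul, inv_smul_eq_cst_mul, toRat_varX,
      toRat_varXinv]
    ext z
    simp only [Module.End.mul_apply, LinearMap.sub_apply, mulOp_apply, opT₀_apply, autOp_apply]
    simp only [map_mul, map_inv₀, map_sub, aut_cst, aut_flipAut_ratX_self]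
    have h1 := ratX_sq_sub_ne_zero (⟨0, h⟩ : Fin r)
    have h2 := ratX_ne_zero (⟨0, h⟩ : Fin r)
    have h3 := cst_ne_zero (r := r) p₀
    generalize aut (flipAut ⟨0, h⟩) z = w at *
    generalize ratX (⟨0, h⟩ : Fin r) = x at *
    generalize cst p₀ r = q at *
    field_simp
    ring

variable {t : HeckeB p₀ p₁ r} {g : LatAut r} {f : AddMonoidAlgebra ℂ (Fin r → ℤ)}

theorem aut_aut_of_sq (hg : g * g = 1) (k : RatFun r) : aut g (aut g k) = k := by
  rw [← aut_mul_apply, hg, map_one]; rfl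

theorem IsIntertwiner.laurentHom_mul (ht : IsIntertwiner t g f)
    (f' : AddMonoidAlgebra ℂ (Fin r → ℤ)) :
    laurentHom p₀ p₁ r f' * t = t * laurentHom p₀ p₁ r (laurentAut g f') := by
  refine dlRep_injective p₀ p₁ ?_
  rw [map_mul, map_mul, ht.rep, dlRep_laurentHom, dlRep_laurentHom, toRat_laurentAut, mul_assoc,
    ← map_mul, mul_comm (toRat r f), map_mul, ← mul_assoc, ← mul_assoc, autOp_mul_mulOp,
    aut_aut_of_sq ht.sq]

/-- The square of an intertwiner is a Laurent polynomial, so the intertwiner acts injectively where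
that polynomial does. -/
theorem IsIntertwiner.mul_self (ht : IsIntertwiner t g f) :
    t * t = laurentHom p₀ p₁ r (laurentAut g f * f) := by
  refine dlRep_injective p₀ p₁ ?_
  rw [map_mul, ht.rep, dlRep_laurentHom, map_mul, toRat_laurentAut, mul_assoc,
    ← mul_assoc (mulOp _), ← aut_aut_of_sq ht.sq (toRat r f), ← autOp_mul_mulOp, ← mul_assoc,
    ← mul_assoc, ← map_mul autOp, ht.sq, map_one, one_mul, ← map_mul, aut_aut_of_sq ht.sq]

variable (p₀ p₁ r)
variable (L : Type u) [AddCommGroup L] [Module ℂ L] [Module (HeckeB p₀ p₁ r) L]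
  [IsScalarTower ℂ (HeckeB p₀ p₁ r) L]

/-- The action of Laurent polynomials on a module over the Hecke algebra. -/
def laurentSmul : AddMonoidAlgebra ℂ (Fin r → ℤ) →ₐ[ℂ] Module.End ℂ L :=
  (Algebra.lsmul ℂ ℂ L).comp (laurentHom p₀ p₁ r)

variable {p₀ p₁ r L}

theorem laurentSmul_apply (f : AddMonoidAlgebra ℂ (Fin r → ℤ)) (v : L) :
    laurentSmul p₀ p₁ r L f v = laurentHom p₀ p₁ r f • v := rfl

theorem laurentSmul_varX (a : Fin r) :
    laurentSmul p₀ p₁ r L (varX a) = Algebra.lsmul ℂ ℂ L (gen p₀ p₁ r (.X a)) := by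
  rw [← laurentHom_varX]; rfl

theorem IsIntertwiner.laurentSmul_smul (ht : IsIntertwiner t g f)
    (f' : AddMonoidAlgebra ℂ (Fin r → ℤ)) (v : L) :
    laurentSmul p₀ p₁ r L f' (t • v) = t • laurentSmul p₀ p₁ r L (laurentAut g f') v := by
  rw [laurentSmul_apply, laurentSmul_apply, smul_smul, smul_smul, ht.laurentHom_mul]

theorem IsIntertwiner.smul_smul_self (ht : IsIntertwiner t g f) (v : L) :
    t • t • v = laurentSmul p₀ p₁ r L (laurentAut g f * f) v := by
  rw [laurentSmul_apply, smul_smul, ht.mul_self]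

theorem IsIntertwiner.isWeightVector (ht : IsIntertwiner t g f)
    {χ : AddMonoidAlgebra ℂ (Fin r → ℤ) →ₐ[ℂ] ℂ} {v : L}
    (hv : IsWeightVector (laurentSmul p₀ p₁ r L) χ v) (h1 : χ (laurentAut g f) ≠ 0)
    (h2 : χ f ≠ 0) : IsWeightVector (laurentSmul p₀ p₁ r L)
      (χ.comp (laurentAut g : _ →ₐ[ℂ] AddMonoidAlgebra ℂ (Fin r → ℤ))) (t • v) := by
  refine ⟨fun h0 => ?_, fun c => ?_⟩
  · have h3 := ht.smul_smul_self v
    rw [h0, smul_zero, hv.2, map_mul] at h3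
    exact (smul_ne_zero (mul_ne_zero h1 h2) hv.1) h3.symm
  · rw [ht.laurentSmul_smul, hv.2, smul_comm]; rfl

theorem laurentAut_swap_tauFactor (a b : Fin r) :
    laurentAut (swapAut a b) (tauFactor p₁ a b) = tauFactor p₁ b a := by
  rw [tauFactor, map_sub, map_smul, map_smul, laurentAut_permAut_varX, laurentAut_permAut_varX,
    Equiv.swap_apply_left, Equiv.swap_apply_right]; rfl

/-- The factor `p₁⁻¹ X_a - p₁ X_b` does not vanish at points whose coordinates lie in two disjoint
sets, one of which is stable under multiplication by `p₁²`. -/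
theorem character_tauFactor_ne_zero {I J : Set ℂˣ} (hJ : ∀ a ∈ J, a * p₁ ^ 2 ∈ J)
    (hd : Disjoint I J) (χ : AddMonoidAlgebra ℂ (Fin r → ℤ) →ₐ[ℂ] ℂ) {a b : Fin r}
    (ha : ∃ u ∈ I, (u : ℂ) = χ (varX a)) (hb : ∃ u ∈ J, (u : ℂ) = χ (varX b)) :
    χ (tauFactor p₁ a b) ≠ 0 := by
  obtain ⟨u, hu, hua⟩ := ha
  obtain ⟨v, hv, hvb⟩ := hb
  rw [tauFactor, map_sub, map_smul, map_smul, ← hua, ← hvb, smul_eq_mul, smul_eq_mul]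
  intro h0
  refine coe_sub_ne_zero_of_disjoint hd hu (hJ v hv) ?_
  rw [Units.val_mul, Units.val_pow_eq_pow_val]
  have := p₁.ne_zero
  field_simp at h0
  linear_combination h0

end Intertwiner

/-! ### Rearranging patterns -/

section Pattern

variable {r : ℕ}

open Classical in
/-- The sum of the positions, counted from one, that belong to a set. -/
def positionSum (ω : Set (Fin r)) : ℕ := ∑ a, if a ∈ ω then a.val + 1 else 0

theorem positionSum_swap_lt {ω : Set (Fin r)} {k : ℕ} (h : k + 1 < r)
    (h1 : (⟨k + 1, h⟩ : Fin r) ∈ ω) (h0 : (⟨k, by omega⟩ : Fin r) ∉ ω) :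
    positionSum (Equiv.swap (⟨k, by omega⟩ : Fin r) ⟨k + 1, h⟩ ⁻¹' ω) < positionSum ω := by
  classical
  unfold positionSum
  rw [← Equiv.sum_comp (Equiv.swap (⟨k, by omega⟩ : Fin r) ⟨k + 1, h⟩)]
  refine Finset.sum_lt_sum (fun a _ => ?_) ⟨⟨k + 1, h⟩, Finset.mem_univ _, ?_⟩
  · simp only [Set.mem_preimage, Equiv.swap_apply_self]
    split_ifs with ha
    · rw [add_le_add_iff_right]
      by_cases e0 : a = ⟨k, by omega⟩
      · exact absurd (e0 ▸ ha) h0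
      by_cases e1 : a = ⟨k + 1, h⟩
      · rw [e1, Equiv.swap_apply_right]; simp
      · rw [Equiv.swap_apply_of_ne_of_ne e0 e1]
    · exact le_rfl
  · simp [h1]

theorem positionSum_diff_lt {ω : Set (Fin r)} {a : Fin r} (ha : a ∈ ω) :
    positionSum (ω \ {a}) < positionSum ω := by
  classical
  refine Finset.sum_lt_sum (fun b _ => ?_) ⟨a, Finset.mem_univ _, ?_⟩
  · split_ifs with h1 h2 h2
    · exact le_rfl
    · exact absurd h1.1 h2
    · exact Nat.zero_le _
    · exact le_rfl
  · simp [ha]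

/-- Every set of positions becomes an initial segment after exchanging adjacent positions. -/
theorem pattern_induction {P : Set (Fin r) → Prop}
    (sorted : ∀ ω, (∀ k (h : k + 1 < r), ⟨k + 1, h⟩ ∈ ω → ⟨k, by omega⟩ ∈ ω) → P ω)
    (swap : ∀ ω k (h : k + 1 < r), ⟨k + 1, h⟩ ∈ ω → ⟨k, by omega⟩ ∉ ω →
      P (Equiv.swap (⟨k, by omega⟩ : Fin r) ⟨k + 1, h⟩ ⁻¹' ω) → P ω) (ω : Set (Fin r)) : P ω := by
  induction hμ : positionSum ω using Nat.strong_induction_on generalizing ω with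
  | _ μ ih =>
    subst hμ
    by_cases hs : ∀ k (h : k + 1 < r), ⟨k + 1, h⟩ ∈ ω → ⟨k, by omega⟩ ∈ ω
    · exact sorted ω hs
    · push Not at hs
      obtain ⟨k, h, h1, h0⟩ := hs
      exact swap ω k h h1 h0 (ih _ (positionSum_swap_lt h h1 h0) _ rfl)

/-- Every set of positions becomes empty after exchanging adjacent positions and removing the first
position. -/
theorem signPattern_induction {P : Set (Fin r) → Prop} (empty : P ∅)
    (flip : ∀ ω (h : 0 < r), ⟨0, h⟩ ∈ ω → P (ω \ {⟨0, h⟩}) → P ω)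
    (swap : ∀ ω k (h : k + 1 < r), ⟨k + 1, h⟩ ∈ ω → ⟨k, by omega⟩ ∉ ω →
      P (Equiv.swap (⟨k, by omega⟩ : Fin r) ⟨k + 1, h⟩ ⁻¹' ω) → P ω) (ω : Set (Fin r)) : P ω := by
  induction hμ : positionSum ω using Nat.strong_induction_on generalizing ω with
  | _ μ ih =>
    subst hμ
    by_cases hs : ∃ k, ∃ h : k + 1 < r, ⟨k + 1, h⟩ ∈ ω ∧ ⟨k, by omega⟩ ∉ ω
    · obtain ⟨k, h, h1, h0⟩ := hs
      exact swap ω k h h1 h0 (ih _ (positionSum_swap_lt h h1 h0) _ rfl)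
    by_cases h0 : ∃ h : 0 < r, ⟨0, h⟩ ∈ ω
    · obtain ⟨h, h0⟩ := h0
      exact flip ω h h0 (ih _ (positionSum_diff_lt h0) _ rfl)
    · push Not at hs h0
      have hall : ∀ k (h : k < r), ⟨k, h⟩ ∉ ω := by
        intro k
        induction k with
        | zero => exact h0
        | succ k ih => exact fun h h1 => ih _ (hs k h h1)
      have : ω = ∅ := Set.eq_empty_of_forall_notMem fun a => hall a.val a.isLt
      rw [this]
      exact empty

/-- A set of positions closed under predecessors is an initial segment. -/
theorem exists_le_forall_mem_iff {ω : Set (Fin r)}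
    (hs : ∀ k (h : k + 1 < r), ⟨k + 1, h⟩ ∈ ω → ⟨k, by omega⟩ ∈ ω) :
    ∃ n ≤ r, ∀ a : Fin r, a ∈ ω ↔ a.val < n := by
  classical
  have hex : ∃ n, ∀ a ∈ ω, a.val < n := ⟨r, fun a _ => a.isLt⟩
  refine ⟨Nat.find hex, Nat.find_min' hex fun a _ => a.isLt, fun a => ⟨Nat.find_spec hex a,
    fun ha => ?_⟩⟩
  have h1 := Nat.find_min hex (m := Nat.find hex - 1) (by omega)
  push Not at h1
  obtain ⟨b, hb, hbn⟩ := h1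
  have hdown : ∀ j, ∀ c : Fin r, c.val + j = b.val → c ∈ ω := by
    intro j
    induction j with
    | zero => intro c hc; rwa [Fin.ext hc]
    | succ j ih =>
      intro c hc
      exact hs c.val (by omega) (ih ⟨c.val + 1, by omega⟩ (by simp only; omega))
  exact hdown (b.val - a.val) a (by omega)

end Pattern

end HeckeB
end

noncomputable section

/-! ### Simple modules inside a space with two commuting actions -/

section Pair

/-- A finite-dimensional nonzero module over an algebra has a simple submodule. -/
theorem exists_isSimpleModule_submodule {A Y : Type*} [Ring A] [Algebra ℂ A] [AddCommGroup Y]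
    [Module ℂ Y] [Module A Y] [IsScalarTower ℂ A Y] [FiniteDimensional ℂ Y] (S : Submodule A Y)
    (hS : S ≠ ⊥) : ∃ N : Submodule A Y, N ≤ S ∧ IsSimpleModule A N := by
  have : IsArtinian A Y := isArtinian_of_tower ℂ inferInstance
  obtain ⟨N, hN, hNS⟩ := (IsAtomic.eq_bot_or_exists_atom_le S).resolve_left hS
  exact ⟨N, hNS, isSimpleModule_iff_isAtom.2 hN⟩

/-- The action of an algebra on a space through a homomorphism to its endomorphisms. -/
abbrev moduleOfEnd {A Y : Type*} [Ring A] [Algebra ℂ A] [AddCommGroup Y] [Module ℂ Y]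
    (α : A →ₐ[ℂ] Module.End ℂ Y) : Module A Y := Module.compHom Y α.toRingHom

theorem isScalarTower_moduleOfEnd {A Y : Type*} [Ring A] [Algebra ℂ A] [AddCommGroup Y]
    [Module ℂ Y] (α : A →ₐ[ℂ] Module.End ℂ Y) :
    @IsScalarTower ℂ A Y _ (moduleOfEnd α).toSMul _ := by
  let _ := moduleOfEnd α
  refine ⟨fun c a y => ?_⟩
  change α (c • a) y = c • α a y
  rw [map_smul]; rfl

/-- The algebra acting on homomorphisms into a space with a commuting action. -/
def homAction {A B Y N : Type*} [Ring A] [Algebra ℂ A] [Ring B] [Algebra ℂ B] [AddCommGroup Y]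
    [Module ℂ Y] [Module A Y] [IsScalarTower ℂ A Y] [AddCommGroup N] [Module A N]
    (β : B →ₐ[ℂ] Module.End ℂ Y) (h : ∀ (a : A) (b : B) (y : Y), β b (a • y) = a • β b y) :
    B →ₐ[ℂ] Module.End ℂ (N →ₗ[A] Y) where
  toFun b :=
    { toFun := fun φ =>
        { toFun := fun u => β b (φ u)
          map_add' := fun u u' => by rw [map_add, map_add]
          map_smul' := fun a u => by rw [map_smul, h]; rfl }
      map_add' := fun φ φ' => LinearMap.ext fun u => map_add (β b) _ _
      map_smul' := fun c φ => LinearMap.ext fun u => map_smul (β b) c _ }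
  map_one' := by ext φ u; change β 1 (φ u) = φ u; rw [map_one]; rfl
  map_mul' b b' := by ext φ u; change β (b * b') (φ u) = β b (β b' (φ u)); rw [map_mul]; rfl
  map_zero' := by ext φ u; change β 0 (φ u) = 0; rw [map_zero]; rfl
  map_add' b b' := by ext φ u; change β (b + b') (φ u) = β b (φ u) + β b' (φ u); rw [map_add]; rfl
  commutes' c := by
    ext φ u; change β (algebraMap ℂ B c) (φ u) = c • φ u; rw [AlgHom.commutes]; rfl

/-- A nonzero space with two commuting actions receives a nonzero equivariant map from a tensor
product of simple modules `N` and `M`: take for `N` a simple submodule for the first action and for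
`M` a simple module of homomorphisms from `N`. -/
theorem exists_tensor_map {A B : Type*} {Y : Type u} [Ring A] [Algebra ℂ A] [Ring B] [Algebra ℂ B]
    [AddCommGroup Y] [Module ℂ Y] [FiniteDimensional ℂ Y] [Nontrivial Y]
    (α : A →ₐ[ℂ] Module.End ℂ Y) (β : B →ₐ[ℂ] Module.End ℂ Y)
    (hc : ∀ a b, Commute (α a) (β b)) :
    ∃ (N : Type u) (_ : AddCommGroup N) (_ : Module ℂ N) (_ : Module A N)
      (_ : IsScalarTower ℂ A N) (M : Type u) (_ : AddCommGroup M) (_ : Module ℂ M)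
      (_ : Module B M) (_ : IsScalarTower ℂ B M) (ev : N ⊗[ℂ] M →ₗ[ℂ] Y),
      FiniteDimensional ℂ N ∧ IsSimpleModule A N ∧ FiniteDimensional ℂ M ∧ IsSimpleModule B M ∧
      ev ≠ 0 ∧ (∀ a u v, ev ((a • u) ⊗ₜ v) = α a (ev (u ⊗ₜ v))) ∧
      (∀ b u v, ev (u ⊗ₜ (b • v)) = β b (ev (u ⊗ₜ v))) ∧
      (∀ a c, (Algebra.lsmul ℂ ℂ N a).HasEigenvalue c → (α a).HasEigenvalue c) ∧
      (∀ b c, (Algebra.lsmul ℂ ℂ M b).HasEigenvalue c → (β b).HasEigenvalue c) := by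
  let _ := moduleOfEnd α
  have := isScalarTower_moduleOfEnd α
  obtain ⟨N, -, hN⟩ := exists_isSimpleModule_submodule (A := A) (⊤ : Submodule A Y) top_ne_bot
  have hNfin : FiniteDimensional ℂ N := Module.Finite.of_injective
    (N.subtype.restrictScalars ℂ) N.injective_subtype
  have : Nontrivial N := IsSimpleModule.nontrivial A N
  have hcomm : ∀ (a : A) (b : B) (y : Y), β b (a • y) = a • β b y := fun a b y =>
    (LinearMap.congr_fun (hc a b).eq y).symm
  have hfin : FiniteDimensional ℂ (N →ₗ[A] Y) := Module.Finite.of_injective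
    (LinearMap.restrictScalarsₗ ℂ A N Y ℂ) (LinearMap.restrictScalars_injective ℂ)
  let _ := moduleOfEnd (homAction (N := N) β hcomm)
  have := isScalarTower_moduleOfEnd (homAction (N := N) β hcomm)
  have hsub : N.subtype ≠ 0 := fun h0 => by
    obtain ⟨u, hu⟩ := exists_ne (0 : N)
    exact hu (Subtype.ext (LinearMap.congr_fun h0 u))
  obtain ⟨M, -, hM⟩ := exists_isSimpleModule_submodule (A := B) (⊤ : Submodule B (N →ₗ[A] Y))
    ((Submodule.ne_bot_iff _).2 ⟨_, trivial, hsub⟩)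
  have hMfin : FiniteDimensional ℂ M := Module.Finite.of_injective
    (M.subtype.restrictScalars ℂ) M.injective_subtype
  have : Nontrivial M := IsSimpleModule.nontrivial B M
  -- Evaluation of homomorphisms `N → Y`.
  let ev : N ⊗[ℂ] M →ₗ[ℂ] Y := TensorProduct.lift
    (LinearMap.flip ((LinearMap.restrictScalarsₗ ℂ A N Y ℂ) ∘ₗ (M.subtype.restrictScalars ℂ)))
  have hev : ∀ (u : N) (v : M), ev (u ⊗ₜ v) = (v : N →ₗ[A] Y) u := fun u v => rfl
  refine ⟨N, inferInstance, inferInstance, inferInstance, inferInstance, M, inferInstance,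
    inferInstance, inferInstance, inferInstance, ev, hNfin, hN, hMfin, hM, fun h0 => ?_,
    fun a u v => ?_, fun b u v => ?_, fun a c h => ?_, fun b c h => ?_⟩
  · obtain ⟨v, hv⟩ := exists_ne (0 : M)
    refine hv (Subtype.ext (LinearMap.ext fun u => ?_))
    rw [← hev, h0]; rfl
  · rw [hev, map_smul, hev]; rfl
  · rw [hev, hev]; rfl
  · obtain ⟨u, hu⟩ := h.exists_hasEigenvector
    refine Module.End.hasEigenvalue_of_hasEigenvector (x := (u : Y))
      ⟨Module.End.mem_eigenspace_iff.2 ?_, fun h0 => hu.2 (Subtype.ext h0)⟩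
    exact congrArg Subtype.val hu.apply_eq_smul
  · obtain ⟨v, hv⟩ := h.exists_hasEigenvector
    obtain ⟨u, hu⟩ : ∃ u, (v : N →ₗ[A] Y) u ≠ 0 := by
      by_contra! h0
      exact hv.2 (Subtype.ext (LinearMap.ext h0))
    refine Module.End.hasEigenvalue_of_hasEigenvector (x := (v : N →ₗ[A] Y) u)
      ⟨Module.End.mem_eigenspace_iff.2 ?_, hu⟩
    exact LinearMap.congr_fun (congrArg Subtype.val hv.apply_eq_smul) u

end Pair

end

noncomputable section

namespace HeckeB

/-! ### The action of `H^B_n ⊗ H^B_m` on a block subspace -/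

section BlockAction

variable {p₀ p₁ : ℂˣ} {n m : ℕ}
  (L : Type u) [AddCommGroup L] [Module ℂ L] [Module (HeckeB p₀ p₁ (n + m)) L]
  [IsScalarTower ℂ (HeckeB p₀ p₁ (n + m)) L]
  (E : AddMonoidAlgebra ℂ (Fin (n + m) → ℤ))

variable (p₀ p₁) in
/-- The elements that commute with the symmetric denominator and with `E`. -/
def blockCentralizer : Subalgebra ℂ (HeckeB p₀ p₁ (n + m)) :=
  Subalgebra.centralizer ℂ {laurentHom p₀ p₁ (n + m) (delta n m p₁), laurentHom p₀ p₁ (n + m) E}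

theorem mem_blockCentralizer {a : HeckeB p₀ p₁ (n + m)} : a ∈ blockCentralizer p₀ p₁ E ↔
    Commute (laurentHom p₀ p₁ (n + m) (delta n m p₁)) a ∧
      Commute (laurentHom p₀ p₁ (n + m) E) a := by
  rw [blockCentralizer, Subalgebra.mem_centralizer_iff]
  simp only [Set.mem_insert_iff, Set.mem_singleton_iff, forall_eq_or_imp, forall_eq]
  rfl

theorem laurentHom_mem_blockCentralizer (f : AddMonoidAlgebra ℂ (Fin (n + m) → ℤ)) :
    laurentHom p₀ p₁ (n + m) f ∈ blockCentralizer p₀ p₁ E :=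
  (mem_blockCentralizer E).2 ⟨(Commute.all _ _).map (laurentHom p₀ p₁ (n + m)),
    (Commute.all _ _).map (laurentHom p₀ p₁ (n + m))⟩

variable (p₀ p₁) in
/-- The image of the action of `E`. -/
def blockRange : Submodule ℂ L := LinearMap.range (laurentSmul p₀ p₁ (n + m) L E)

variable {L E}

theorem smul_mem_blockRange {a : HeckeB p₀ p₁ (n + m)} (ha : a ∈ blockCentralizer p₀ p₁ E) {y : L}
    (hy : y ∈ blockRange p₀ p₁ L E) : a • y ∈ blockRange p₀ p₁ L E := by
  obtain ⟨v, rfl⟩ := hy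
  refine ⟨a • v, ?_⟩
  rw [laurentSmul_apply, laurentSmul_apply, smul_smul, smul_smul,
    ((mem_blockCentralizer E).1 ha).2.eq]

variable (L E) in
/-- The action of the centralizer on the image of `E`. -/
def centralizerAction : blockCentralizer p₀ p₁ E →ₐ[ℂ] Module.End ℂ (blockRange p₀ p₁ L E) where
  toFun a := (Algebra.lsmul ℂ ℂ L a.1).restrict fun _ hy => smul_mem_blockRange a.2 hy
  map_one' := by ext y; exact one_smul _ (y : L)
  map_mul' a b := by ext y; exact mul_smul a.1 b.1 (y : L)
  map_zero' := by ext y; exact zero_smul _ (y : L)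
  map_add' a b := by ext y; exact add_smul a.1 b.1 (y : L)
  commutes' c := by ext y; exact algebraMap_smul (HeckeB p₀ p₁ (n + m)) c (y : L)

variable (E) in
/-- The representation of the centralizer by operators on rational functions. -/
def centralizerRep : blockCentralizer p₀ p₁ E →ₐ[ℂ] Op (n + m) :=
  (dlRep p₀ p₁ (n + m)).comp (blockCentralizer p₀ p₁ E).val

variable (p₀ p₁ E) in
/-- The symmetric denominator as an element of the centralizer. -/
def centralizerDelta : blockCentralizer p₀ p₁ E :=
  ⟨_, laurentHom_mem_blockCentralizer E (delta n m p₁)⟩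

theorem centralizerRep_injective : Function.Injective (centralizerRep (p₀ := p₀) (p₁ := p₁) E) :=
  (dlRep_injective p₀ p₁).comp Subtype.val_injective

theorem commute_centralizerDelta (c : blockCentralizer p₀ p₁ E) :
    Commute (centralizerDelta p₀ p₁ E) c := Subtype.ext ((mem_blockCentralizer E).1 c.2).1

theorem centralizerRep_delta :
    centralizerRep E (centralizerDelta p₀ p₁ E) = mulOp (ratDelta n m p₁) :=
  dlRep_laurentHom p₀ p₁ _

theorem isUnit_centralizerRep_delta : IsUnit (centralizerRep E (centralizerDelta p₀ p₁ E)) := by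
  rw [centralizerRep_delta]
  exact isUnit_mulOp (ratDelta_ne_zero p₁)

/-- Numerators of fractions that commute with the symmetric denominator and with `E` do so, too. -/
theorem mem_blockCentralizer_of_dlRep_eq (hE : IsBlockSym (toRat (n + m) E))
    {a : HeckeB p₀ p₁ (n + m)} {c : HeckeB p₀ p₁ n ⊗[ℂ] HeckeB p₀ p₁ m} {k : ℕ}
    (h : tensorRep p₀ p₁ n m c * mulOp (ratDelta n m p₁) ^ k = dlRep p₀ p₁ (n + m) a) :
    a ∈ blockCentralizer p₀ p₁ E := by
  have key : ∀ f, IsBlockSym (toRat (n + m) f) → Commute (laurentHom p₀ p₁ (n + m) f) a := by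
    intro f hf
    refine dlRep_injective p₀ p₁ ?_
    rw [map_mul, map_mul, ← h, dlRep_laurentHom, ← map_pow]
    exact (hf.commute_tensorRep p₀ p₁ c).mul_right ((Commute.all _ _).map mulOp)
  exact (mem_blockCentralizer E).2 ⟨key _ (isBlockSym_ratDelta n m p₁), key _ hE⟩

/-- The operators of `H^B_n ⊗ H^B_m` are fractions of elements of the centralizer. -/
theorem tensorRep_mem_fracAlg (hE : IsBlockSym (toRat (n + m) E))
    (c : HeckeB p₀ p₁ n ⊗[ℂ] HeckeB p₀ p₁ m) : tensorRep p₀ p₁ n m c ∈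
      fracAlg (centralizerRep E) (commute_centralizerDelta (p₀ := p₀) (p₁ := p₁))
        isUnit_centralizerRep_delta := by
  set B := fracAlg (centralizerRep E) (commute_centralizerDelta (p₀ := p₀) (p₁ := p₁))
    isUnit_centralizerRep_delta with hB
  have key : ∀ c k a, tensorRep p₀ p₁ n m c * mulOp (ratDelta n m p₁) ^ k =
      dlRep p₀ p₁ (n + m) a → tensorRep p₀ p₁ n m c ∈ B := fun c k a h =>
    mem_fracAlg.2 ⟨k, ⟨a, mem_blockCentralizer_of_dlRep_eq hE h⟩, by
      rw [centralizerRep_delta]; exact h⟩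
  have hl : ∀ g, tensorRep p₀ p₁ n m (gen p₀ p₁ n g ⊗ₜ 1) = genOp p₀ p₁ (Fin.castAdd m) g :=
    fun g => by rw [tensorRep_tmul, map_one, mul_one, leftRep, rep_gen]
  have hr : ∀ g, tensorRep p₀ p₁ n m (1 ⊗ₜ gen p₀ p₁ m g) = genOp p₀ p₁ (Fin.natAdd n) g :=
    fun g => by rw [tensorRep_tmul, map_one, one_mul, rightRep, rep_gen]
  have hleft : ∀ a : HeckeB p₀ p₁ n, tensorRep p₀ p₁ n m (a ⊗ₜ 1) ∈ B := fun a =>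
    mem_of_gen_mem p₀ p₁
      (S := B.comap ((tensorRep p₀ p₁ n m).comp Algebra.TensorProduct.includeLeft)) (fun g => by
        have h2 : ∀ g', genOp p₀ p₁ id g' = genOp p₀ p₁ (Fin.castAdd m) g →
            tensorRep p₀ p₁ n m (gen p₀ p₁ n g ⊗ₜ 1) ∈ B := fun g' h =>
          key _ 0 (gen p₀ p₁ (n + m) g') (by rw [hl, dlRep_gen, h, pow_zero, mul_one])
        rcases g with ⟨i, hi⟩ | i | i
        · exact h2 (.T ⟨i, by omega⟩) rfl
        · exact h2 (.X (Fin.castAdd m i)) rfl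
        · exact h2 (.Xinv (Fin.castAdd m i)) rfl) a
  have hright : ∀ b : HeckeB p₀ p₁ m, tensorRep p₀ p₁ n m (1 ⊗ₜ b) ∈ B := fun b =>
    mem_of_gen_mem p₀ p₁
      (S := B.comap ((tensorRep p₀ p₁ n m).comp Algebra.TensorProduct.includeRight)) (fun g => by
        have h2 : ∀ g', genOp p₀ p₁ id g' = genOp p₀ p₁ (Fin.natAdd n) g →
            tensorRep p₀ p₁ n m (1 ⊗ₜ gen p₀ p₁ m g) ∈ B := fun g' h =>
          key _ 0 (gen p₀ p₁ (n + m) g') (by rw [hr, dlRep_gen, h, pow_zero, mul_one])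
        rcases g with ⟨i, hi⟩ | i | i
        · rcases i with - | i
          -- The operator of `T_0` in the second block is the only one that is not in the image of a
          -- generator of `H^B_{n+m}`. It belongs to the bimodule, hence is a fraction.
          · obtain ⟨x, hx, hxo⟩ := exists_mem_bimod_opT₀_mul p₀ p₁ (n := n) (m := m) n (by omega) 1
              .one rfl
            obtain ⟨k, a, ha⟩ := exists_mul_ratDelta_pow p₀ p₁ hx
            rw [hxo, map_one, map_one, mul_one] at ha
            refine key (1 ⊗ₜ gen p₀ p₁ m (.T ⟨0, hi⟩)) k a ?_
            rw [hr, genOp_T_zero]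
            exact ha
          · refine h2 (.T ⟨n + i + 1, by omega⟩) ?_
            rw [genOp_T_succ, genOp_T_succ]
            rfl
        · exact h2 (.X (Fin.natAdd n i)) rfl
        · exact h2 (.Xinv (Fin.natAdd n i)) rfl) b
  induction c using TensorProduct.induction_on with
  | zero => rw [map_zero]; exact zero_mem B
  | tmul a b =>
    have := mul_mem (hleft a) (hright b)
    rwa [← map_mul, Algebra.TensorProduct.tmul_mul_tmul, mul_one, one_mul] at this
  | add x y hx hy => rw [map_add]; exact add_mem hx hy

/-- If the symmetric denominator acts invertibly on the image of a block-symmetric element, then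
this image is a module over `H^B_n ⊗ H^B_m`, and the bimodule acts from it to the whole module. -/
theorem exists_block_action [FiniteDimensional ℂ L] (hE : IsBlockSym (toRat (n + m) E))
    (hδ : ∀ χ, ∀ y ∈ blockRange p₀ p₁ L E,
      IsWeightVector (laurentSmul p₀ p₁ (n + m) L) χ y → χ (delta n m p₁) ≠ 0) :
    ∃ (Θ : HeckeB p₀ p₁ n ⊗[ℂ] HeckeB p₀ p₁ m →ₐ[ℂ] Module.End ℂ (blockRange p₀ p₁ L E))
      (F : Bimod p₀ p₁ n m (n + m) rfl →ₗ[ℂ] blockRange p₀ p₁ L E →ₗ[ℂ] L),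
      (∀ f y, (Θ (laurentTensor p₀ p₁ n m f) y : L) = laurentSmul p₀ p₁ (n + m) L f y) ∧
      (∀ x, bimodRep p₀ p₁ x = 1 → ∀ y, F x y = y) ∧
      (∀ (a : HeckeB p₀ p₁ (n + m)) x y, F (a • x) y = a • F x y) ∧
      (∀ x y c, bimodRep p₀ p₁ y = bimodRep p₀ p₁ x * tensorRep p₀ p₁ n m c →
        F y = F x ∘ₗ Θ c) := by
  set Y := blockRange p₀ p₁ L E with hY
  set D : Module.End ℂ Y := centralizerAction L E (centralizerDelta p₀ p₁ E) with hD
  -- The weights of the image `Y` of `E` do not vanish on the symmetric denominator.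
  have hDu : IsUnit D := by
    rw [LinearMap.isUnit_iff_ker_eq_bot, LinearMap.ker_eq_bot']
    refine fun y hy => Subtype.ext (eq_zero_of_weight_ne_zero (laurentSmul p₀ p₁ (n + m) L)
      (S := Y) (fun c z hz => ?_) hδ y.2 (congrArg Subtype.val hy))
    exact smul_mem_blockRange (laurentHom_mem_blockCentralizer E c) hz
  -- The action of the centralizer on `Y` extends to fractions, among them the operators of `H^B_n ⊗
  -- H^B_m`.
  obtain ⟨θ, hθ⟩ := exists_fracAlg_lift (centralizerRep_injective (p₀ := p₀) (p₁ := p₁) (E := E))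
    commute_centralizerDelta isUnit_centralizerRep_delta (centralizerAction L E) hDu
  have hmem := tensorRep_mem_fracAlg (p₀ := p₀) (p₁ := p₁) hE
  let Θ := θ.comp ((tensorRep p₀ p₁ n m).codRestrict _ hmem)
  let DE : Y ≃ₗ[ℂ] Y := LinearEquiv.ofBijective D ((Module.End.isUnit_iff D).1 hDu)
  let T : (Y →ₗ[ℂ] L) ≃ₗ[ℂ] (Y →ₗ[ℂ] L) := LinearEquiv.arrowCongr DE.symm (LinearEquiv.refl ℂ L)
  have hT : ∀ (k : ℕ) φ, (T ^ k) φ = φ ∘ₗ (D ^ k) := by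
    intro k
    induction k with
    | zero => intro φ; rfl
    | succ k ih =>
      intro φ
      rw [pow_succ', LinearEquiv.mul_apply, ih, pow_succ]
      ext y; rfl
  -- The same extension for the action `H^B_{n+m} → Hom(Y, L)`, where the denominator acts on the
  -- source. The fractions now contain the bimodule.
  let g : HeckeB p₀ p₁ (n + m) →ₗ[ℂ] Y →ₗ[ℂ] L :=
    (LinearMap.lcomp ℂ L Y.subtype) ∘ₗ (Algebra.lsmul ℂ ℂ L).toLinearMap
  have hg : ∀ a (y : Y), g a y = a • (y : L) := fun _ _ => rfl
  let d : HeckeB p₀ p₁ (n + m) →ₗ[ℂ] HeckeB p₀ p₁ (n + m) :=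
    LinearMap.mulRight ℂ (laurentHom p₀ p₁ (n + m) (delta n m p₁))
  have hd : ∀ a, (dlRep p₀ p₁ (n + m)).toLinearMap (d a) =
      (dlRep p₀ p₁ (n + m)).toLinearMap a * mulOp (ratDelta n m p₁) := fun a => by
    simp only [d, AlgHom.toLinearMap_apply, LinearMap.mulRight_apply, map_mul, dlRep_laurentHom]
    rfl
  obtain ⟨η, hη⟩ := exists_fracs_lift (ρ := (dlRep p₀ p₁ (n + m)).toLinearMap)
    (dlRep_injective p₀ p₁) hd g T
    fun a => by ext y; exact mul_smul a _ (y : L)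
  have hfr : ∀ x : Bimod p₀ p₁ n m (n + m) rfl, bimodRep p₀ p₁ x ∈
      fracs (dlRep p₀ p₁ (n + m)).toLinearMap (mulOp (ratDelta n m p₁)) d hd := fun x =>
    exists_mul_ratDelta_pow p₀ p₁ (Subtype.prop x)
  let F := η ∘ₗ (bimodRep p₀ p₁).codRestrict _ hfr
  have hF : ∀ x k a, bimodRep p₀ p₁ x * mulOp (ratDelta n m p₁) ^ k = dlRep p₀ p₁ (n + m) a →
      F x ∘ₗ (D ^ k) = g a := fun x k a h => by
    rw [← hT]
    exact hη ⟨_, hfr x⟩ k a h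
  -- Identities may be checked after composing with a power of the denominator.
  have hcancel : ∀ (k : ℕ) (φ φ' : Y →ₗ[ℂ] L), φ ∘ₗ (D ^ k) = φ' ∘ₗ (D ^ k) → φ = φ' := by
    intro k φ φ' h
    rw [← hT, ← hT] at h
    exact (T ^ k).injective h
  refine ⟨Θ, F, fun f y => ?_, fun x hx y => ?_, fun a x y => ?_, fun x y c h => ?_⟩
  · have h1 := hθ ⟨_, laurentHom_mem_blockCentralizer E f⟩
    have h2 : (tensorRep p₀ p₁ n m).codRestrict _ hmem (laurentTensor p₀ p₁ n m f) =
        ⟨centralizerRep E ⟨_, laurentHom_mem_blockCentralizer E f⟩, apply_mem_fracAlg _⟩ :=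
      Subtype.ext ((tensorRep_laurentTensor p₀ p₁ f).trans (dlRep_laurentHom p₀ p₁ f).symm)
    have h3 : Θ (laurentTensor p₀ p₁ n m f) =
        centralizerAction L E ⟨_, laurentHom_mem_blockCentralizer E f⟩ := (congrArg θ h2).trans h1
    rw [h3]
    rfl
  · have h1 := hF x 0 1 (by rw [hx, pow_zero, mul_one, map_one])
    have h2 := LinearMap.congr_fun h1 y
    rw [hg, one_smul] at h2
    exact h2
  · obtain ⟨k, b, hb⟩ := hfr x
    have h1 := hF x k b hb
    have h2 := hF (a • x) k (a * b) (by rw [bimodRep_smul, mul_assoc, map_mul]; congr 1)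
    have h3 : F (a • x) = (Algebra.lsmul ℂ ℂ L a) ∘ₗ F x := hcancel k _ _ (by
      rw [h2, LinearMap.comp_assoc, h1]
      ext y
      exact mul_smul a b (y : L))
    rw [h3]; rfl
  · obtain ⟨k, a, ha⟩ := hfr x
    -- With `x δᵏ = a` and `c δˡ = b`, and since `δ` commutes with `c`, `y = x c` satisfies `y δᵏ⁺ˡ
    -- = a b`.
    obtain ⟨l, b, hb⟩ := mem_fracAlg.1 (hmem c)
    have h1 := hF x k a ha
    have hcomm := ((isBlockSym_ratDelta n m p₁).commute_tensorRep p₀ p₁ c).pow_left k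
    rw [centralizerRep_delta] at hb
    have h2 := hF y (k + l) (a * b.1) (by
      rw [h, pow_add, mul_assoc, ← mul_assoc _ (_ ^ k), ← hcomm.eq, mul_assoc, hb, ← mul_assoc,
        map_mul]
      congr 1)
    have h3 : Θ c * D ^ l = centralizerAction L E b := by
      have h4 : (tensorRep p₀ p₁ n m).codRestrict _ hmem c *
          ⟨_, apply_mem_fracAlg (centralizerDelta p₀ p₁ E)⟩ ^ l = ⟨_, apply_mem_fracAlg b⟩ :=
        Subtype.ext (by rw [← centralizerRep_delta] at hb; exact hb)
      have h5 := congrArg θ h4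
      rw [map_mul, map_pow, hθ, hθ] at h5
      exact h5
    have h6 : Commute D (Θ c) := by
      have h7 : Commute (⟨_, apply_mem_fracAlg (centralizerDelta p₀ p₁ E)⟩ :
          fracAlg (centralizerRep E) (commute_centralizerDelta (p₀ := p₀) (p₁ := p₁))
            isUnit_centralizerRep_delta) ((tensorRep p₀ p₁ n m).codRestrict _ hmem c) :=
        Subtype.ext (by
          have := (isBlockSym_ratDelta n m p₁).commute_tensorRep p₀ p₁ c
          rw [← centralizerRep_delta (E := E)] at this
          exact this.eq)
      have h8 := h7.map θ
      rw [hθ] at h8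
      exact h8
    refine hcancel (k + l) _ _ ?_
    rw [h2, LinearMap.comp_assoc]
    have h9 : (Θ c) ∘ₗ (D ^ (k + l)) = (D ^ k) ∘ₗ (centralizerAction L E b) := by
      change Θ c * D ^ (k + l) = D ^ k * _
      rw [← h3, pow_add, ← mul_assoc, ← mul_assoc, (h6.pow_left k).eq]
    rw [h9, ← LinearMap.comp_assoc, h1]
    ext y
    exact mul_smul a b.1 (y : L)

end BlockAction

end HeckeB
end

noncomputable section

section Split

/-- A polynomial that annihilates finitely many operators factors according to a property of its
roots. -/
theorem exists_polynomial_split {V ι : Type*} [AddCommGroup V] [Module ℂ V] [FiniteDimensional ℂ V]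
    [Fintype ι] (f : ι → Module.End ℂ V) (S : ℂ → Prop) : ∃ p q : Polynomial ℂ,
      (∀ i, Polynomial.aeval (f i) (p * q) = 0) ∧ (∀ x, p.IsRoot x → S x) ∧
        ∀ x, q.IsRoot x → ¬ S x := by
  classical
  set P : Polynomial ℂ := ∏ i, minpoly ℂ (f i) with hP
  have hmonic : P.Monic := Polynomial.monic_prod_of_monic _ _ fun i _ =>
    minpoly.monic (Algebra.IsIntegral.isIntegral (f i))
  have hsplit := (IsAlgClosed.splits P).eq_prod_roots_of_monic hmonic
  have hroot : ∀ (s : Multiset ℂ) (x : ℂ),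
      (s.map fun a => Polynomial.X - Polynomial.C a).prod.IsRoot x → x ∈ s := fun s x hx => by
    rw [Polynomial.IsRoot.def, Polynomial.eval_multiset_prod, Multiset.prod_eq_zero_iff] at hx
    simpa [sub_eq_zero, eq_comm] using hx
  refine ⟨((P.roots.filter S).map fun a => Polynomial.X - Polynomial.C a).prod,
    ((P.roots.filter fun a => ¬ S a).map fun a => Polynomial.X - Polynomial.C a).prod,
    fun i => ?_, fun x hx => (Multiset.mem_filter.1 (hroot _ x hx)).2,
    fun x hx => (Multiset.mem_filter.1 (hroot _ x hx)).2⟩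
  rw [← Multiset.prod_add, ← Multiset.map_add, Multiset.filter_add_not, ← hsplit]
  obtain ⟨g, hg⟩ := Finset.dvd_prod_of_mem (fun i => minpoly ℂ (f i)) (Finset.mem_univ i)
  rw [hP, hg, map_mul, minpoly.aeval, zero_mul]

variable {C Z : Type*} [CommRing C] [Algebra ℂ C] [AddCommGroup Z] [Module ℂ Z]

/-- The weights of the image of one factor of an annihilating polynomial are roots of the other
factor. -/
theorem IsWeightVector.isRoot {e : C →ₐ[ℂ] Module.End ℂ Z} {χ : C →ₐ[ℂ] ℂ} {z : Z}
    (h : IsWeightVector e χ z) {c E : C} {p q : Polynomial ℂ}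
    (h0 : Polynomial.aeval (e c) (p * q) = 0) (hE : Polynomial.aeval c p ∣ E)
    (hz : z ∈ LinearMap.range (e E)) : q.IsRoot (χ c) := by
  obtain ⟨w, rfl⟩ := hz
  obtain ⟨g, rfl⟩ := hE
  have h1 := h.2 (Polynomial.aeval c q)
  rw [← Module.End.mul_apply, ← map_mul, ← mul_assoc, ← map_mul, mul_comm q, map_mul,
    ← Polynomial.aeval_algHom_apply, h0, zero_mul, LinearMap.zero_apply,
    ← Polynomial.aeval_algHom_apply] at h1
  exact (smul_eq_zero.1 h1.symm).resolve_right h.1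

end Split

namespace HeckeB

section Converse

variable {p₀ p₁ : ℂˣ} {I J : Set ℂˣ}

/-! ### Weights sorted by blocks -/

section Sorted

variable {r : ℕ} {L : Type u} [AddCommGroup L] [Module ℂ L] [Module (HeckeB p₀ p₁ r) L]
  [IsScalarTower ℂ (HeckeB p₀ p₁ r) L]

theorem exists_mem_of_isWeightVector (hL : IsOfType p₀ p₁ (n := r) I L)
    {χ : AddMonoidAlgebra ℂ (Fin r → ℤ) →ₐ[ℂ] ℂ} {v : L}
    (hv : IsWeightVector (laurentSmul p₀ p₁ r L) χ v) (a : Fin r) :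
    ∃ u ∈ I, (u : ℂ) = χ (varX a) :=
  hL.2 a _ (by have := hv.hasEigenvalue (varX a); rwa [laurentSmul_varX] at this)

/-- Some weight of a module of type `I ∪ J` has its coordinates in `I` before those in `J`. -/
theorem exists_sorted_weight (hI : IsInvariant p₁ I) (hJ : IsInvariant p₁ J) (hd : Disjoint I J)
    (hL : IsOfType p₀ p₁ (n := r) (I ∪ J) L) [Nontrivial L] :
    ∃ n ≤ r, ∃ χ v, IsWeightVector (laurentSmul p₀ p₁ r L) χ v ∧
      ∀ a, (∃ u ∈ I, (u : ℂ) = χ (varX a)) ↔ a.val < n := by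
  have := hL.1
  -- The set `ω` of positions with eigenvalue in `I` is made an initial segment by intertwiners.
  -- They do not annihilate the weight vector, because the two eigenvalues that are exchanged lie in
  -- different sets.
  have key : ∀ ω : Set (Fin r), (∃ χ v, IsWeightVector (laurentSmul p₀ p₁ r L) χ v ∧
      ∀ a, (∃ u ∈ I, (u : ℂ) = χ (varX a)) ↔ a ∈ ω) → ∃ n ≤ r, ∃ χ v,
        IsWeightVector (laurentSmul p₀ p₁ r L) χ v ∧
          ∀ a, (∃ u ∈ I, (u : ℂ) = χ (varX a)) ↔ a.val < n := by
    intro ω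
    induction ω using pattern_induction with
    | sorted ω hs =>
      rintro ⟨χ, v, hv, hω⟩
      obtain ⟨n, hn, h⟩ := exists_le_forall_mem_iff hs
      exact ⟨n, hn, χ, v, hv, fun a => (hω a).trans (h a)⟩
    | swap ω k h h1 h0 ih =>
      rintro ⟨χ, v, hv, hω⟩
      have hI1 := (hω _).2 h1
      have hJ0 : ∃ u ∈ J, (u : ℂ) = χ (varX ⟨k, by omega⟩) := by
        obtain ⟨u, hu | hu, e⟩ := exists_mem_of_isWeightVector hL hv ⟨k, by omega⟩
        · exact absurd ((hω _).1 ⟨u, hu, e⟩) h0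
        · exact ⟨u, hu, e⟩
      refine ih ⟨_, _, (isIntertwiner_tau k h).isWeightVector hv ?_ ?_, fun a => ?_⟩
      · rw [laurentAut_swap_tauFactor]
        exact character_tauFactor_ne_zero (fun _ => hJ.mul_sq_mem) hd χ hI1 hJ0
      · exact character_tauFactor_ne_zero (fun _ => hI.mul_sq_mem) hd.symm χ hJ0 hI1
      · rw [Set.mem_preimage, ← hω, ← laurentAut_permAut_varX]; rfl
  obtain ⟨χ, v, -, hv⟩ := exists_isWeightVector_mem (laurentSmul p₀ p₁ r L) ⊤ top_ne_bot
    fun _ _ _ => trivial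
  exact key {a | ∃ u ∈ I, (u : ℂ) = χ (varX a)} ⟨χ, v, hv, fun _ => Iff.rfl⟩

end Sorted

/-! ### Simple modules of type `I ∪ J` -/

theorem exists_add_inv_iff (hI : IsInvariant p₁ I) {r : ℕ}
    (χ : AddMonoidAlgebra ℂ (Fin r → ℤ) →ₐ[ℂ] ℂ) (a : Fin r) :
    (∃ u ∈ I, (u : ℂ) + (u : ℂ)⁻¹ = χ (varChi a)) ↔ ∃ u ∈ I, (u : ℂ) = χ (varX a) := by
  obtain ⟨b, hb, hb'⟩ := exists_unit_varX χ a
  rw [varChi, map_add, hb, hb']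
  refine ⟨fun ⟨u, hu, h⟩ => ?_, fun ⟨u, hu, h⟩ => ⟨u, hu, by rw [h]⟩⟩
  have hu0 := u.ne_zero
  have hb0 := b.ne_zero
  have h1 : ((u : ℂ) - b) * (u * b - 1) = 0 := by
    field_simp at h
    linear_combination h
  rcases mul_eq_zero.1 h1 with h1 | h1
  · exact ⟨u, hu, sub_eq_zero.1 h1⟩
  · refine ⟨u⁻¹, hI.inv_mem hu, ?_⟩
    rw [Units.val_inv_eq_inv_val]
    exact inv_eq_of_mul_eq_one_right (sub_eq_zero.1 h1)

variable {n m : ℕ} {L : Type u} [AddCommGroup L] [Module ℂ L] [Module (HeckeB p₀ p₁ (n + m)) L]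
  [IsScalarTower ℂ (HeckeB p₀ p₁ (n + m)) L]

/-- The universal property of `N ◇ M`. The relations are required for operators of generators. -/
def diamondLift {N M : Type*} [AddCommGroup N] [Module ℂ N] [Module (HeckeB p₀ p₁ n) N]
    [AddCommGroup M] [Module ℂ M] [Module (HeckeB p₀ p₁ m) M]
    (G : Bimod p₀ p₁ n m (n + m) rfl →ₗ[ℂ] N ⊗[ℂ] M →ₗ[ℂ] L)
    (hG : ∀ (a : HeckeB p₀ p₁ (n + m)) x z, G (a • x) z = a • G x z)
    (hl : ∀ x y g u v, bimodRep p₀ p₁ y = bimodRep p₀ p₁ x *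
      tensorRep p₀ p₁ n m (gen p₀ p₁ n g ⊗ₜ 1) → G y (u ⊗ₜ v) = G x ((gen p₀ p₁ n g • u) ⊗ₜ v))
    (hr : ∀ x y g u v, bimodRep p₀ p₁ y = bimodRep p₀ p₁ x *
      tensorRep p₀ p₁ n m (1 ⊗ₜ gen p₀ p₁ m g) → G y (u ⊗ₜ v) = G x (u ⊗ₜ (gen p₀ p₁ m g • v))) :
    Diamond p₀ p₁ (n + m) rfl N M →ₗ[HeckeB p₀ p₁ (n + m)] L :=
  Submodule.liftQ _
    { toFun := TensorProduct.lift G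
      map_add' := map_add _
      map_smul' := fun a t => by
        induction t using TensorProduct.induction_on with
        | zero => rw [smul_zero, map_zero, smul_zero]
        | tmul x z => exact hG a x z
        | add t t' ht ht' => rw [smul_add, map_add, ht, ht', map_add, smul_add] }
    (Submodule.span_le.2 (by
      rintro _ (⟨x, y, g, u, v, h, rfl⟩ | ⟨x, y, g, u, v, h, rfl⟩)
      · refine (map_sub (TensorProduct.lift G) _ _).trans (sub_eq_zero.2 (hl x y g u v ?_))
        rw [tensorRep_tmul, map_one, mul_one, ← locRep_leftGen]
        exact (congrArg (locRep p₀ p₁ (n + m)) h).trans (map_mul _ _ _)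
      · refine (map_sub (TensorProduct.lift G) _ _).trans (sub_eq_zero.2 (hr x y g u v ?_))
        rw [tensorRep_tmul, map_one, one_mul, ← locRep_rightGen]
        exact (congrArg (locRep p₀ p₁ (n + m)) h).trans (map_mul _ _ _)))

/-- If some weight of a module of type `I ∪ J` is sorted by blocks, then there is a block-symmetric
element whose image is nonzero and has only such weights. -/
theorem exists_blockRange (hI : IsInvariant p₁ I)
    (hL : IsOfType p₀ p₁ (n := n + m) (I ∪ J) L)
    {χ : AddMonoidAlgebra ℂ (Fin (n + m) → ℤ) →ₐ[ℂ] ℂ} {v : L}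
    (hv : IsWeightVector (laurentSmul p₀ p₁ (n + m) L) χ v)
    (hχ : ∀ a, (∃ u ∈ I, (u : ℂ) = χ (varX a)) ↔ a.val < n) :
    ∃ E, IsBlockSym (toRat (n + m) E) ∧ Nontrivial (blockRange p₀ p₁ L E) ∧
      ∀ χ, ∀ y ∈ blockRange p₀ p₁ L E, IsWeightVector (laurentSmul p₀ p₁ (n + m) L) χ y →
        (∀ i : Fin n, ∃ u ∈ I, (u : ℂ) = χ (varX (Fin.castAdd m i))) ∧
        ∀ j : Fin m, ∃ u ∈ J, (u : ℂ) = χ (varX (Fin.natAdd n j)) := by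
  have := hL.1
  -- The roots of `p` are the values of `X + X⁻¹` on `I`, those of `q` are other values, and `p q`
  -- annihilates all `X_a + X_a⁻¹`.
  obtain ⟨p, q, hpq, hp, hq⟩ := exists_polynomial_split
    (fun a : Fin (n + m) => laurentSmul p₀ p₁ (n + m) L (varChi a))
    fun x => ∃ u ∈ I, (u : ℂ) + (u : ℂ)⁻¹ = x
  have hqp : ∀ a, Polynomial.aeval (laurentSmul p₀ p₁ (n + m) L (varChi a)) (q * p) = 0 :=
    fun a => by rw [mul_comm]; exact hpq a
  -- `E` is a product of cofactors, so that its image consists of vectors with sorted weights.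
  obtain ⟨E, hE⟩ : ∃ E : AddMonoidAlgebra ℂ (Fin (n + m) → ℤ),
      E = (∏ i : Fin n, Polynomial.aeval (varChi (Fin.castAdd m i)) q) *
        ∏ j : Fin m, Polynomial.aeval (varChi (Fin.natAdd n j)) p := ⟨_, rfl⟩
  have hsym : IsBlockSym (toRat (n + m) E) := by
    have h1 : ∀ (q : Polynomial ℂ) (a : Fin (n + m)),
        toRat (n + m) (Polynomial.aeval (varChi a) q) = Polynomial.aeval (ratChi a) q :=
      fun q a => by rw [← toRat_varChi, ← Polynomial.aeval_algHom_apply]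
    rw [hE, map_mul, map_prod, map_prod]
    simp only [h1]
    exact isBlockSym_prod_mul_prod (fun x => Polynomial.aeval x q) (fun x => Polynomial.aeval x p)
      (fun g x => (Polynomial.aeval_algHom_apply (aut g : _ →ₐ[ℂ] RatFun (n + m)) x q).symm)
      (fun g x => (Polynomial.aeval_algHom_apply (aut g : _ →ₐ[ℂ] RatFun (n + m)) x p).symm)
  refine ⟨E, hsym, ?_, fun χ y hy hw => ⟨fun i => ?_, fun j => ?_⟩⟩
  · refine ⟨⟨⟨_, ⟨v, rfl⟩⟩, 0, fun h0 => ?_⟩⟩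
    have h1 : laurentSmul p₀ p₁ (n + m) L E v = 0 := congrArg Subtype.val h0
    rw [hv.2] at h1
    refine (smul_ne_zero ?_ hv.1) h1
    have h2 : ∀ (q : Polynomial ℂ) (a : Fin (n + m)),
        χ (Polynomial.aeval (varChi a) q) = q.eval (χ (varChi a)) := fun q a => by
      rw [← Polynomial.aeval_algHom_apply, Polynomial.coe_aeval_eq_eval]
    rw [hE, map_mul, map_prod, map_prod]
    simp only [h2]
    refine mul_ne_zero (Finset.prod_ne_zero_iff.2 fun i _ h3 => hq _ h3 ?_)
      (Finset.prod_ne_zero_iff.2 fun j _ h3 => ?_)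
    · exact (exists_add_inv_iff hI χ _).2 ((hχ _).2 i.isLt)
    · have := (hχ _).1 ((exists_add_inv_iff hI χ _).1 (hp _ h3))
      simp at this
  · rw [hE] at hy
    exact (exists_add_inv_iff hI χ _).1 (hp _ (hw.isRoot (hqp (Fin.castAdd m i))
      (dvd_mul_of_dvd_left
      (Finset.dvd_prod_of_mem (fun i => Polynomial.aeval (varChi (Fin.castAdd m i)) q)
        (Finset.mem_univ i)) _) hy))
  · rw [hE] at hy
    have h1 := (exists_add_inv_iff hI χ _).not.1 (hq _ (hw.isRoot (hpq (Fin.natAdd n j))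
      (dvd_mul_of_dvd_right (Finset.dvd_prod_of_mem
        (fun j => Polynomial.aeval (varChi (Fin.natAdd n j)) p) (Finset.mem_univ j)) _) hy))
    obtain ⟨u, hu | hu, e⟩ := exists_mem_of_isWeightVector hL hw (Fin.natAdd n j)
    exacts [absurd ⟨u, hu, e⟩ h1, ⟨u, hu, e⟩]

/-- A simple module that has a weight sorted by blocks is isomorphic to `N ◇ M`: the image of a
block-symmetric element receives a map from some `N ⊗ M`, which extends to a nonzero map from
`N ◇ M`, and the latter is simple, too. -/
theorem exists_equiv_diamond (hI : IsInvariant p₁ I) (hJ : IsInvariant p₁ J) (hd : Disjoint I J)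
    [IsSimpleModule (HeckeB p₀ p₁ (n + m)) L] (hL : IsOfType p₀ p₁ (n := n + m) (I ∪ J) L)
    {χ : AddMonoidAlgebra ℂ (Fin (n + m) → ℤ) →ₐ[ℂ] ℂ} {v : L}
    (hv : IsWeightVector (laurentSmul p₀ p₁ (n + m) L) χ v)
    (hχ : ∀ a, (∃ u ∈ I, (u : ℂ) = χ (varX a)) ↔ a.val < n) :
    ∃ (N : Type u) (_ : AddCommGroup N) (_ : Module ℂ N) (_ : Module (HeckeB p₀ p₁ n) N)
      (_ : IsScalarTower ℂ (HeckeB p₀ p₁ n) N)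
      (M : Type u) (_ : AddCommGroup M) (_ : Module ℂ M) (_ : Module (HeckeB p₀ p₁ m) M)
      (_ : IsScalarTower ℂ (HeckeB p₀ p₁ m) M),
      IsSimpleModule (HeckeB p₀ p₁ n) N ∧ IsOfType p₀ p₁ (n := n) I N ∧
      IsSimpleModule (HeckeB p₀ p₁ m) M ∧ IsOfType p₀ p₁ (n := m) J M ∧
      Nonempty (L ≃ₗ[HeckeB p₀ p₁ (n + m)] Diamond p₀ p₁ (n + m) rfl N M) := by
  have := hL.1
  obtain ⟨E, hsym, hY, hw⟩ := exists_blockRange hI hL hv hχ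
  obtain ⟨Θ, F, hΘ, hF1, hFs, hF⟩ := exists_block_action (p₀ := p₀) (p₁ := p₁) (L := L) hsym
    fun χ y hy h => character_delta_ne_zero hI hd χ (hw χ y hy h).1 fun j =>
      ⟨(hw χ y hy h).2 j, character_varXinv_mem hJ χ ((hw χ y hy h).2 j)⟩
  -- Eigenvalues on the image of `E` come from weights.
  have hev : ∀ a c, (Θ (laurentTensor p₀ p₁ n m (varX a))).HasEigenvalue c → ∃ χ,
      ∃ y ∈ blockRange p₀ p₁ L E, IsWeightVector (laurentSmul p₀ p₁ (n + m) L) χ y ∧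
        c = χ (varX a) := fun a c h => by
    obtain ⟨y, hy⟩ := h.exists_hasEigenvector
    by_contra! hne
    refine hy.2 (Subtype.ext (eq_zero_of_weight_ne_zero (laurentSmul p₀ p₁ (n + m) L)
      (S := blockRange p₀ p₁ L E) (f := varX a - algebraMap ℂ _ c)
      (fun f z hz => smul_mem_blockRange (laurentHom_mem_blockCentralizer E f) hz)
      (fun χ z hz h => ?_) y.2 ?_))
    · rw [map_sub, AlgHom.commutes]
      exact sub_ne_zero.2 (hne χ z hz h).symm
    · rw [map_sub, AlgHom.commutes, LinearMap.sub_apply, ← hΘ, hy.apply_eq_smul]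
      exact sub_self _
  obtain ⟨N, _, _, _, _, M, _, _, _, _, ev, hNf, hN, hMf, hM, hne, hevl, hevr, hNe, hMe⟩ :=
    exists_tensor_map (Θ.comp Algebra.TensorProduct.includeLeft)
      (Θ.comp Algebra.TensorProduct.includeRight) fun a b => by
        have h1 : Commute (a ⊗ₜ[ℂ] (1 : HeckeB p₀ p₁ m)) ((1 : HeckeB p₀ p₁ n) ⊗ₜ[ℂ] b) := by
          simp [Commute, SemiconjBy]
        exact h1.map Θ
  have hNt : IsOfType p₀ p₁ (n := n) I N := ⟨hNf, fun i c hc => by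
    obtain ⟨χ, y, hy, h, rfl⟩ := hev (Fin.castAdd m i) c (by
      rw [laurentTensor_varX_castAdd]; exact hNe _ c hc)
    exact (hw χ y hy h).1 i⟩
  have hMt : IsOfType p₀ p₁ (n := m) J M := ⟨hMf, fun i c hc => by
    obtain ⟨χ, y, hy, h, rfl⟩ := hev (Fin.natAdd n i) c (by
      rw [laurentTensor_varX_natAdd]; exact hMe _ c hc)
    exact (hw χ y hy h).2 i⟩
  refine ⟨N, _, _, _, inferInstance, M, _, _, _, inferInstance, hN, hNt, hM, hMt, ?_⟩
  have hS := isSimpleModule_diamond hI hJ hd hNt hMt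
  let G : Bimod p₀ p₁ n m (n + m) rfl →ₗ[ℂ] N ⊗[ℂ] M →ₗ[ℂ] L := (LinearMap.lcomp ℂ L ev) ∘ₗ F
  let Φ := diamondLift G
    (fun a x z => hFs a x (ev z))
    (fun x y g u v h => (LinearMap.congr_fun (hF x y _ h) (ev (u ⊗ₜ v))).trans
      (congrArg (F x) (hevl _ u v).symm))
    (fun x y g u v h => (LinearMap.congr_fun (hF x y _ h) (ev (u ⊗ₜ v))).trans
      (congrArg (F x) (hevr _ u v).symm))
  obtain ⟨x, hx⟩ := exists_bimodRep_eq p₀ p₁ (o := 1)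
    ⟨1, Submodule.subset_span (one_mem (coeffRing p₀ p₁ n m (n + m) rfl)), map_one _⟩
  have hΦ : Φ ≠ 0 := fun h0 => hne (LinearMap.ext fun z => Subtype.ext (by
    have h1 : F x (ev z) = 0 := LinearMap.congr_fun h0 (diamondMk p₀ p₁ N M x z)
    rwa [hF1 x hx] at h1))
  exact ⟨(LinearEquiv.ofBijective Φ (LinearMap.bijective_of_ne_zero hΦ)).symm⟩

end Converse

end HeckeB
end

noncomputable section

namespace HeckeB

/-! ### Subspaces of given sign pattern -/

section Sign

open scoped Pointwise

variable {p₀ p₁ : ℂˣ} {r : ℕ}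

open Classical in
/-- The variable `X_a`, inverted if the position `a` belongs to `ω`. -/
def signVar (ω : Set (Fin r)) (a : Fin r) : AddMonoidAlgebra ℂ (Fin r → ℤ) :=
  if a ∈ ω then varXinv a else varX a

theorem signVar_of_mem {ω : Set (Fin r)} {a : Fin r} (h : a ∈ ω) : signVar ω a = varXinv a :=
  if_pos h

theorem signVar_of_notMem {ω : Set (Fin r)} {a : Fin r} (h : a ∉ ω) : signVar ω a = varX a :=
  if_neg h

theorem laurentAut_swap_signVar (x y : Fin r) (ω : Set (Fin r)) (a : Fin r) :
    laurentAut (swapAut x y) (signVar ω a) =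
      signVar (Equiv.swap x y ⁻¹' ω) (Equiv.swap x y a) := by
  by_cases h : a ∈ ω
  · rw [signVar_of_mem h, signVar_of_mem (by simpa), laurentAut_permAut_varXinv]
  · rw [signVar_of_notMem h, signVar_of_notMem (by simpa), laurentAut_permAut_varX]

theorem laurentAut_flip_signVar {x : Fin r} {ω ω' : Set (Fin r)} (hx : x ∈ ω ↔ x ∉ ω')
    (h : ∀ a, a ≠ x → (a ∈ ω ↔ a ∈ ω')) (a : Fin r) :
    laurentAut (flipAut x) (signVar ω a) = signVar ω' a := by
  by_cases hax : a = x
  · subst hax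
    by_cases ha : a ∈ ω
    · rw [signVar_of_mem ha, signVar_of_notMem (hx.1 ha), laurentAut_flipAut_varXinv_self]
    · rw [signVar_of_notMem ha, signVar_of_mem (not_not.1 (hx.not.1 ha)),
        laurentAut_flipAut_varX_self]
  · by_cases ha : a ∈ ω
    · rw [signVar_of_mem ha, signVar_of_mem ((h a hax).1 ha), laurentAut_flipAut_varXinv_of_ne hax]
    · rw [signVar_of_notMem ha, signVar_of_notMem ((h a hax).not.1 ha),
        laurentAut_flipAut_varX_of_ne hax]

variable {I : Set ℂˣ}

/-- On positions of `ω` the signed variable has an eigenvalue in `I` if the variable has one in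
`I⁻¹`. -/
theorem exists_mem_signVar_iff (χ : AddMonoidAlgebra ℂ (Fin r → ℤ) →ₐ[ℂ] ℂ) {ω : Set (Fin r)}
    {a : Fin r} (h : a ∈ ω) : (∃ u ∈ I, (u : ℂ) = χ (signVar ω a)) ↔
      ∃ u ∈ I⁻¹, (u : ℂ) = χ (varX a) := by
  obtain ⟨b, hb, hb'⟩ := exists_unit_varX χ a
  rw [signVar_of_mem h, hb, hb', ← Units.val_inv_eq_inv_val]
  exact ⟨fun ⟨u, hu, e⟩ => ⟨u⁻¹, by simpa, by rw [Units.ext e, inv_inv]⟩,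
    fun ⟨u, hu, e⟩ => ⟨u⁻¹, hu, by rw [Units.ext e]⟩⟩

/-- Symmetric Laurent polynomials are central in the type A subalgebra, which contains no `T_0`. -/
theorem commute_laurentHom_of_mem_typeA {E : AddMonoidAlgebra ℂ (Fin r → ℤ)}
    (hE : ∀ a b, laurentAut (swapAut a b) E = E) {t : HeckeB p₀ p₁ r} (ht : t ∈ typeA p₀ p₁ r) :
    Commute (laurentHom p₀ p₁ r E) t := by
  have h : typeA p₀ p₁ r ≤ Subalgebra.centralizer ℂ {laurentHom p₀ p₁ r E} := by
    refine Algebra.adjoin_le ?_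
    rintro _ (⟨⟨i, hi⟩, h1, rfl⟩ | ⟨i, rfl | rfl⟩) <;>
      refine (Subalgebra.mem_centralizer_iff ℂ).2 fun _ h => ?_ <;>
      rw [Set.mem_singleton_iff.1 h]
    · obtain ⟨k, rfl⟩ := Nat.exists_eq_add_of_le' h1
      refine dlRep_injective p₀ p₁ ?_
      rw [map_mul, map_mul, dlRep_gen, dlRep_laurentHom, genOp_T_succ]
      exact (opT_mul_mulOp p₁ (by rw [← toRat_laurentAut]; exact congrArg _ (hE _ _))).symm
    · rw [← laurentHom_varX]
      exact (Commute.all E _).map (laurentHom p₀ p₁ r)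
    · rw [← laurentHom_varXinv]
      exact (Commute.all E _).map (laurentHom p₀ p₁ r)
  exact (Subalgebra.mem_centralizer_iff ℂ).1 (h ht) _ rfl

variable (p₀ p₁) (L : Type u) [AddCommGroup L] [Module ℂ L] [Module (HeckeB p₀ p₁ r) L]
  [IsScalarTower ℂ (HeckeB p₀ p₁ r) L]

/-- The vectors annihilated by the values of a polynomial at the signed variables. -/
def signSpace (p : Polynomial ℂ) (ω : Set (Fin r)) : Submodule ℂ L :=
  ⨅ a, LinearMap.ker (laurentSmul p₀ p₁ r L (Polynomial.aeval (signVar ω a) p))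

variable {p₀ p₁ L} {p q : Polynomial ℂ} {ω ω' : Set (Fin r)}

theorem mem_signSpace {v : L} : v ∈ signSpace p₀ p₁ L p ω ↔
    ∀ a, laurentSmul p₀ p₁ r L (Polynomial.aeval (signVar ω a) p) v = 0 := by
  simp [signSpace]

theorem laurentSmul_mem_signSpace (f : AddMonoidAlgebra ℂ (Fin r → ℤ)) {v : L}
    (hv : v ∈ signSpace p₀ p₁ L p ω) :
    laurentSmul p₀ p₁ r L f v ∈ signSpace p₀ p₁ L p ω := mem_signSpace.2 fun a => by
  rw [← Module.End.mul_apply, ← map_mul, mul_comm, map_mul, Module.End.mul_apply,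
    mem_signSpace.1 hv a, map_zero]

theorem isRoot_of_mem_signSpace {χ : AddMonoidAlgebra ℂ (Fin r → ℤ) →ₐ[ℂ] ℂ} {v : L}
    (hv : IsWeightVector (laurentSmul p₀ p₁ r L) χ v) (hm : v ∈ signSpace p₀ p₁ L p ω)
    (a : Fin r) : p.IsRoot (χ (signVar ω a)) := by
  have h1 := mem_signSpace.1 hm a
  rw [hv.2, ← Polynomial.aeval_algHom_apply] at h1
  exact (smul_eq_zero.1 h1).resolve_right hv.1

/-- An intertwiner that acts invertibly maps the subspaces of two sign patterns injectively to one
another. -/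
theorem finrank_signSpace_le [FiniteDimensional ℂ L] {t : HeckeB p₀ p₁ r} {g : LatAut r}
    {f : AddMonoidAlgebra ℂ (Fin r → ℤ)} (ht : IsIntertwiner t g f)
    (hg : ∀ a, ∃ b, laurentAut g (signVar ω a) = signVar ω' b)
    (hf : ∀ χ, ∀ v ∈ signSpace p₀ p₁ L p ω', IsWeightVector (laurentSmul p₀ p₁ r L) χ v →
      χ (laurentAut g f) ≠ 0 ∧ χ f ≠ 0) :
    Module.finrank ℂ (signSpace p₀ p₁ L p ω') ≤ Module.finrank ℂ (signSpace p₀ p₁ L p ω) := by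
  have hmap : ∀ v ∈ signSpace p₀ p₁ L p ω',
      Algebra.lsmul ℂ ℂ L t v ∈ signSpace p₀ p₁ L p ω := fun v hv => mem_signSpace.2 fun a => by
    obtain ⟨b, hb⟩ := hg a
    have h1 : laurentAut g (Polynomial.aeval (signVar ω a) p) =
        Polynomial.aeval (signVar ω' b) p := by
      rw [← hb]
      exact (Polynomial.aeval_algHom_apply (laurentAut g).toAlgHom _ p).symm
    rw [Algebra.lsmul_coe, ht.laurentSmul_smul, h1, mem_signSpace.1 hv b, smul_zero]
  refine LinearMap.finrank_le_finrank_of_injective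
    (f := (Algebra.lsmul ℂ ℂ L t).restrict hmap) ?_
  rw [← LinearMap.ker_eq_bot, LinearMap.ker_eq_bot']
  refine fun v hv => Subtype.ext (eq_zero_of_weight_ne_zero (laurentSmul p₀ p₁ r L)
    (f := laurentAut g f * f) (fun c z hz => laurentSmul_mem_signSpace c hz)
    (fun χ z hz h => ?_) v.2 ?_)
  · rw [map_mul]
    exact mul_ne_zero (hf χ z hz h).1 (hf χ z hz h).2
  · have h1 : t • (v : L) = 0 := congrArg Subtype.val hv
    rw [← ht.smul_smul_self, h1, smul_zero]

variable (hp : ∀ x, p.IsRoot x → ∃ u ∈ I, (u : ℂ) = x) (hd : Disjoint I I⁻¹)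

include hp in
theorem exists_mem_of_mem_signSpace {χ : AddMonoidAlgebra ℂ (Fin r → ℤ) →ₐ[ℂ] ℂ} {v : L}
    (hv : IsWeightVector (laurentSmul p₀ p₁ r L) χ v) (hm : v ∈ signSpace p₀ p₁ L p ω) (a : Fin r) :
    (a ∈ ω → ∃ u ∈ I⁻¹, (u : ℂ) = χ (varX a)) ∧ (a ∉ ω → ∃ u ∈ I, (u : ℂ) = χ (varX a)) := by
  have h1 := hp _ (isRoot_of_mem_signSpace hv hm a)
  exact ⟨fun h => (exists_mem_signVar_iff χ h).1 h1, fun h => by rwa [signVar_of_notMem h] at h1⟩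

include hp hd in
/-- The subspaces of all sign patterns have the same dimension, since the intertwiners between
adjacent patterns are invertible: for exchanges because `I` and `I⁻¹` are disjoint and stable under
`p₁²`, for sign changes because `±p₀` do not occur. -/
theorem finrank_signSpace [FiniteDimensional ℂ L] (hI : ∀ a ∈ I, a * p₁ ^ 2 ∈ I)
    (hI' : ∀ a ∈ I⁻¹, a * p₁ ^ 2 ∈ I⁻¹) (h0 : ∀ a ∈ I ∪ I⁻¹, a ^ 2 ≠ p₀ ^ 2)
    (ω : Set (Fin r)) :
    Module.finrank ℂ (signSpace p₀ p₁ L p ω) =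
      Module.finrank ℂ (signSpace p₀ p₁ L p (∅ : Set (Fin r))) := by
  have htau : ∀ (ω : Set (Fin r)) χ, ∀ v ∈ signSpace p₀ p₁ L p ω,
      IsWeightVector (laurentSmul p₀ p₁ r L) χ v → ∀ a b, a ∈ ω → b ∉ ω →
        χ (tauFactor p₁ a b) ≠ 0 ∧ χ (tauFactor p₁ b a) ≠ 0 := fun ω χ v hv hw a b ha hb => by
    have h1 := (exists_mem_of_mem_signSpace hp hw hv a).1 ha
    have h2 := (exists_mem_of_mem_signSpace hp hw hv b).2 hb
    exact ⟨character_tauFactor_ne_zero hI hd.symm χ h1 h2,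
      character_tauFactor_ne_zero hI' hd χ h2 h1⟩
  induction ω using signPattern_induction with
  | empty => rfl
  | flip ω h hm ih =>
    rw [← ih]
    have hf : ∀ (ω : Set (Fin r)) χ, ∀ v ∈ signSpace p₀ p₁ L p ω,
        IsWeightVector (laurentSmul p₀ p₁ r L) χ v →
          χ (laurentAut (flipAut ⟨0, h⟩)
            ((p₀ : ℂ) • varX ⟨0, h⟩ - (p₀ : ℂ)⁻¹ • varXinv ⟨0, h⟩)) ≠ 0 ∧
            χ ((p₀ : ℂ) • varX ⟨0, h⟩ - (p₀ : ℂ)⁻¹ • varXinv ⟨0, h⟩) ≠ 0 := by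
      intro ω χ v hv hw
      have hx : ∃ u ∈ I ∪ I⁻¹, (u : ℂ) = χ (varX ⟨0, h⟩) := by
        have h1 := exists_mem_of_mem_signSpace hp hw hv ⟨0, h⟩
        by_cases h2 : ⟨0, h⟩ ∈ ω
        · exact (h1.1 h2).imp fun u hu => ⟨Or.inr hu.1, hu.2⟩
        · exact (h1.2 h2).imp fun u hu => ⟨Or.inl hu.1, hu.2⟩
      obtain ⟨u, hu, e⟩ := hx
      obtain ⟨b, hb, hb'⟩ := exists_unit_varX χ ⟨0, h⟩
      obtain rfl : u = b := Units.ext (e.trans hb)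
      have hu' : u⁻¹ ∈ I ∪ I⁻¹ := hu.symm.imp id fun h => by simpa
      have key : ∀ u : ℂˣ, (p₀ : ℂ) * (u : ℂ)⁻¹ - (p₀ : ℂ)⁻¹ * u = 0 → u ^ 2 = p₀ ^ 2 := by
        intro u h
        have h1 := u.ne_zero
        have h2 := p₀.ne_zero
        field_simp at h
        exact Units.ext (by push_cast; linear_combination -h)
      simp only [map_sub, map_smul, laurentAut_flipAut_varX_self, laurentAut_flipAut_varXinv_self,
        hb, hb', smul_eq_mul]
      exact ⟨fun h1 => h0 _ hu (key u h1), fun h1 => h0 _ hu' (key u⁻¹ (by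
        rwa [Units.val_inv_eq_inv_val, inv_inv]))⟩
    exact le_antisymm
      (finrank_signSpace_le (isIntertwiner_tauZero h) (fun a => ⟨a, laurentAut_flip_signVar
        (by simp [hm]) (fun b hb => by simp [hb]) a⟩) (hf _))
      (finrank_signSpace_le (isIntertwiner_tauZero h) (fun a => ⟨a, laurentAut_flip_signVar
        (by simp [hm]) (fun b hb => by simp [hb]) a⟩) (hf _))
  | swap ω k h h1 h0 ih =>
    rw [← ih]
    refine le_antisymm
      (finrank_signSpace_le (isIntertwiner_tau k h) (fun a =>
        ⟨_, (laurentAut_swap_signVar _ _ _ _).trans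
          (by rw [← Set.preimage_comp, ← Equiv.coe_trans, Equiv.swap_swap]; rfl)⟩) fun χ v hv hw => ?_)
      (finrank_signSpace_le (isIntertwiner_tau k h) (fun a => ⟨_, laurentAut_swap_signVar _ _ _ _⟩)
        fun χ v hv hw => ?_) <;> rw [laurentAut_swap_tauFactor]
    · exact htau _ χ v hv hw _ _ h1 h0
    · exact (htau _ χ v hv hw _ _ (by simpa) (by simpa)).symm

end Sign

end HeckeB
end

noncomputable section

namespace HeckeB

/-! ### Dimension counts for induction from type A -/

section Count

open scoped Pointwise

variable {p₀ p₁ : ℂˣ} {r : ℕ} {I : Set ℂˣ} {L : Type u} [AddCommGroup L] [Module ℂ L]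
  [Module (HeckeB p₀ p₁ r) L] [IsScalarTower ℂ (HeckeB p₀ p₁ r) L] {p q : Polynomial ℂ}
  {ω ω' : Set (Fin r)}

/-- The product of the values of a polynomial at the signed variables. -/
def signProd (q : Polynomial ℂ) (ω : Set (Fin r)) : AddMonoidAlgebra ℂ (Fin r → ℤ) :=
  ∏ a, Polynomial.aeval (signVar ω a) q

theorem laurentSmul_signProd_mem
    (hpq : ∀ a, Polynomial.aeval (laurentSmul p₀ p₁ r L (signVar ω a)) (p * q) = 0) (v : L) :
    laurentSmul p₀ p₁ r L (signProd q ω) v ∈ signSpace p₀ p₁ L p ω := mem_signSpace.2 fun a => by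
  obtain ⟨g, hg⟩ := Finset.dvd_prod_of_mem (fun a => Polynomial.aeval (signVar ω a) q)
    (Finset.mem_univ a)
  rw [signProd, hg, ← Module.End.mul_apply, ← map_mul, ← mul_assoc, ← map_mul, map_mul,
    ← Polynomial.aeval_algHom_apply, hpq, zero_mul, LinearMap.zero_apply]

variable [FiniteDimensional ℂ L] (hp : ∀ x, p.IsRoot x → ∃ u ∈ I, (u : ℂ) = x)

include hp in
/-- The product of cofactors acts injectively on the subspace of the sign pattern, hence its image
is that subspace. -/
theorem eq_zero_of_signProd_smul_eq_zero (hq : ∀ x, q.IsRoot x → ¬ ∃ u ∈ I, (u : ℂ) = x) {v : L}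
    (hv : v ∈ signSpace p₀ p₁ L p ω) (h : laurentSmul p₀ p₁ r L (signProd q ω) v = 0) : v = 0 := by
  refine eq_zero_of_weight_ne_zero (laurentSmul p₀ p₁ r L) (S := signSpace p₀ p₁ L p ω)
    (fun c z hz => laurentSmul_mem_signSpace c hz) (fun χ z hz hw => ?_) hv h
  rw [signProd, map_prod]
  refine Finset.prod_ne_zero_iff.2 fun a _ h0 => ?_
  rw [← Polynomial.aeval_algHom_apply] at h0
  exact hq _ h0 (hp _ (isRoot_of_mem_signSpace hw hz a))

include hp in
theorem eq_zero_of_mem_signSpace_of_mem (hd : Disjoint I I⁻¹) (hω : ω ≠ ω') {v : L}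
    (hv : v ∈ signSpace p₀ p₁ L p ω) (hv' : v ∈ signSpace p₀ p₁ L p ω') : v = 0 := by
  refine eq_zero_of_weight_ne_zero (laurentSmul p₀ p₁ r L)
    (S := signSpace p₀ p₁ L p ω ⊓ signSpace p₀ p₁ L p ω') (f := 0)
    (fun c z hz => ⟨laurentSmul_mem_signSpace c hz.1, laurentSmul_mem_signSpace c hz.2⟩)
    (fun χ z hz hw => ?_) ⟨hv, hv'⟩ (by rw [map_zero, LinearMap.zero_apply])
  obtain ⟨a, ha⟩ : ∃ a, ¬ (a ∈ ω ↔ a ∈ ω') := by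
    by_contra! h
    exact hω (Set.ext h)
  have h1 := exists_mem_of_mem_signSpace hp hw hz.1 a
  have h2 := exists_mem_of_mem_signSpace hp hw hz.2 a
  have key : ∀ x : ℂ, (∃ u ∈ I⁻¹, (u : ℂ) = x) → (∃ u ∈ I, (u : ℂ) = x) → False := by
    rintro _ ⟨u, hu, rfl⟩ ⟨u', hu', e⟩
    exact Set.disjoint_left.1 hd hu' (by rwa [Units.ext e])
  by_cases h : a ∈ ω
  · exact (key _ (h1.1 h) (h2.2 fun h' => ha (iff_of_true h h'))).elim
  · exact (key _ (h2.1 (not_not.1 fun h' => ha (iff_of_false h h'))) (h1.2 h)).elim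

include hp in
/-- The subspaces of different sign patterns are independent: the product of cofactors of one pattern
annihilates the subspaces of all others. -/
theorem sum_finrank_signSpace_le (hq : ∀ x, q.IsRoot x → ¬ ∃ u ∈ I, (u : ℂ) = x)
    (hpq : ∀ (ω : Set (Fin r)) a,
      Polynomial.aeval (laurentSmul p₀ p₁ r L (signVar ω a)) (p * q) = 0)
    (hd : Disjoint I I⁻¹) :
    ∑ ω : Set (Fin r), Module.finrank ℂ (signSpace p₀ p₁ L p ω) ≤ Module.finrank ℂ L := by
  classical
  rw [← Module.finrank_pi_fintype]
  refine LinearMap.finrank_le_finrank_of_injective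
    (f := ∑ ω : Set (Fin r), (signSpace p₀ p₁ L p ω).subtype ∘ₗ LinearMap.proj ω) ?_
  rw [← LinearMap.ker_eq_bot, LinearMap.ker_eq_bot']
  refine fun v hv => funext fun ω => Subtype.ext ?_
  refine eq_zero_of_signProd_smul_eq_zero (q := q) hp hq (v ω).2 ?_
  have h1 := congrArg (laurentSmul p₀ p₁ r L (signProd q ω)) hv
  rw [LinearMap.sum_apply, map_sum, map_zero, Finset.sum_eq_single ω] at h1
  · exact h1
  · exact fun ω' _ hne => eq_zero_of_mem_signSpace_of_mem hp hd hne
      (laurentSmul_mem_signSpace _ (v ω').2) (laurentSmul_signProd_mem (hpq ω) _)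
  · exact fun h => absurd (Finset.mem_univ ω) h

include hp in
/-- The subspace of the empty sign pattern is stable under the type A subalgebra, being the image of
a symmetric element. -/
theorem smul_mem_signSpace_empty (hq : ∀ x, q.IsRoot x → ¬ ∃ u ∈ I, (u : ℂ) = x)
    (hpq : ∀ a, Polynomial.aeval (laurentSmul p₀ p₁ r L (signVar (∅ : Set (Fin r)) a)) (p * q) = 0)
    {t : HeckeB p₀ p₁ r} (ht : t ∈ typeA p₀ p₁ r) {v : L}
    (hv : v ∈ signSpace p₀ p₁ L p (∅ : Set (Fin r))) :
    t • v ∈ signSpace p₀ p₁ L p (∅ : Set (Fin r)) := by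
  set e := laurentSmul p₀ p₁ r L (signProd q ∅) with he
  obtain ⟨⟨w, hw⟩, h⟩ := LinearMap.surjective_of_injective
    (f := e.restrict (p := signSpace p₀ p₁ L p (∅ : Set (Fin r)))
      fun v _ => laurentSmul_signProd_mem hpq v)
    (LinearMap.ker_eq_bot.1 (LinearMap.ker_eq_bot'.2 fun v hv => Subtype.ext
      (eq_zero_of_signProd_smul_eq_zero hp hq v.2 (congrArg Subtype.val hv)))) ⟨v, hv⟩
  have h1 : e w = v := congrArg Subtype.val h
  have h2 : Commute (laurentHom p₀ p₁ r (signProd q ∅)) t :=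
    commute_laurentHom_of_mem_typeA (fun a b => by
      rw [signProd, map_prod, ← Equiv.prod_comp (Equiv.swap a b)]
      refine Finset.prod_congr rfl fun c _ => ?_
      rw [signVar_of_notMem (Set.notMem_empty _), signVar_of_notMem (Set.notMem_empty _)]
      refine (Polynomial.aeval_algHom_apply (laurentAut (swapAut a b)).toAlgHom _ q).symm.trans ?_
      refine congrArg (fun x => Polynomial.aeval x q) ((laurentAut_permAut_varX _ _).trans ?_)
      rw [Equiv.swap_apply_self]) ht
  rw [← h1, he, laurentSmul_apply, smul_smul, ← h2.eq, ← smul_smul]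
  exact laurentSmul_signProd_mem hpq _

end Count

section Induction

variable {p₀ p₁ : ℂˣ} {n : ℕ}

/-- The class of `b ⊗ u` in the induced module. -/
def indMk (M : Type*) [AddCommGroup M] [Module ℂ M] [Module (typeA p₀ p₁ n) M] :
    HeckeB p₀ p₁ n →ₗ[ℂ] M →ₗ[ℂ] Ind p₀ p₁ (n := n) M :=
  (TensorProduct.mk ℂ _ _).compr₂ ((Submodule.mkQ _).restrictScalars ℂ)

theorem indMk_mul (M : Type*) [AddCommGroup M] [Module ℂ M] [Module (typeA p₀ p₁ n) M]
    (b : HeckeB p₀ p₁ n) (a : typeA p₀ p₁ n) (u : M) :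
    indMk M (b * (a : HeckeB p₀ p₁ n)) u = indMk M b (a • u) :=
  (Submodule.Quotient.eq _).2 (Submodule.subset_span ⟨b, a, u, rfl⟩)

/-- Induction from type A multiplies the dimension by at most `2 ^ n`, since there are `2 ^ n` words
for the cosets. -/
theorem finrank_ind_le (M : Type*) [AddCommGroup M] [Module ℂ M] [FiniteDimensional ℂ M]
    [Module (typeA p₀ p₁ n) M] : FiniteDimensional ℂ (Ind p₀ p₁ (n := n) M) ∧
      Module.finrank ℂ (Ind p₀ p₁ (n := n) M) ≤ 2 ^ n * Module.finrank ℂ M := by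
  classical
  set l := cosetWords (tGen p₀ p₁ n) n n with hl
  let φ : (Fin l.length → M) →ₗ[ℂ] Ind p₀ p₁ (n := n) M :=
    ∑ i : Fin l.length, indMk M (l.get i) ∘ₗ LinearMap.proj i
  have hφ : ∀ i u, φ (Pi.single i u) = indMk M (l.get i) u := fun i u => by
    rw [LinearMap.sum_apply, Finset.sum_eq_single i]
    · simp
    · intro j _ hj
      simp [Pi.single_eq_of_ne hj]
    · exact fun h => absurd (Finset.mem_univ i) h
  have hmem : ∀ b u, indMk M b u ∈ LinearMap.range φ := fun b u => by
    have hb : b ∈ cosetSpan (tGen p₀ p₁ n) n (Subalgebra.toSubmodule (typeA p₀ p₁ n)) n := by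
      rw [cosetSpan_typeA_eq_top]; trivial
    induction hb using Submodule.span_induction with
    | mem y hy =>
      obtain ⟨x, hx, a, ha, rfl⟩ := hy
      obtain ⟨i, rfl⟩ := List.mem_iff_get.1 hx
      exact ⟨Pi.single i ((⟨a, ha⟩ : typeA p₀ p₁ n) • u),
        (hφ _ _).trans (indMk_mul M _ ⟨a, ha⟩ u).symm⟩
    | zero => rw [map_zero]; exact zero_mem _
    | add x y _ _ hx hy => rw [map_add]; exact add_mem hx hy
    | smul c x _ hx => rw [map_smul]; exact Submodule.smul_mem _ _ hx
  have hsurj : Function.Surjective φ := fun z => by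
    change z ∈ LinearMap.range φ
    obtain ⟨t, rfl⟩ := Submodule.mkQ_surjective _ z
    induction t using TensorProduct.induction_on with
    | zero => rw [map_zero]; exact zero_mem _
    | tmul b u => exact hmem b u
    | add x y hx hy => rw [map_add]; exact add_mem hx hy
  refine ⟨Module.Finite.of_surjective φ hsurj,
    (LinearMap.finrank_le_finrank_of_surjective hsurj).trans_eq ?_⟩
  rw [Module.finrank_pi_fintype, Finset.sum_const, Finset.card_univ, Fintype.card_fin, hl,
    length_cosetWords, smul_eq_mul]

/-- The map from an induced module given by a subspace that is stable under the type A
subalgebra. -/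
def indLift {L : Type*} [AddCommGroup L] [Module ℂ L] [Module (HeckeB p₀ p₁ n) L]
    [IsScalarTower ℂ (HeckeB p₀ p₁ n) L] (M : Submodule (typeA p₀ p₁ n) L) :
    Ind p₀ p₁ (n := n) M →ₗ[HeckeB p₀ p₁ n] L :=
  Submodule.liftQ _
    { toFun := TensorProduct.lift ((LinearMap.lcomp ℂ L (M.subtype.restrictScalars ℂ)) ∘ₗ
        (Algebra.lsmul ℂ ℂ L).toLinearMap)
      map_add' := map_add _
      map_smul' := fun a t => by
        induction t using TensorProduct.induction_on with
        | zero => rw [smul_zero, map_zero, smul_zero]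
        | tmul b u => exact mul_smul a b (u : L)
        | add t t' ht ht' => rw [smul_add, map_add, ht, ht', map_add, smul_add] }
    (Submodule.span_le.2 (by
      rintro _ ⟨b, a, u, rfl⟩
      exact (map_sub (TensorProduct.lift _) _ _).trans
        (sub_eq_zero.2 (mul_smul b (a : HeckeB p₀ p₁ n) (u : L)))))

theorem indLift_indMk {L : Type*} [AddCommGroup L] [Module ℂ L] [Module (HeckeB p₀ p₁ n) L]
    [IsScalarTower ℂ (HeckeB p₀ p₁ n) L] (M : Submodule (typeA p₀ p₁ n) L) (b : HeckeB p₀ p₁ n)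
    (u : M) : indLift M (indMk M b u) = b • (u : L) := rfl

open scoped Pointwise

/-- A simple module whose weights lie in `I ∪ I⁻¹` is induced from a simple submodule of the
subspace of the empty sign pattern: the dimensions leave no room for a kernel. -/
theorem exists_equiv_ind {I : Set ℂˣ} (hd : Disjoint I I⁻¹) (hI : ∀ a ∈ I, a * p₁ ^ 2 ∈ I)
    (hI' : ∀ a ∈ I⁻¹, a * p₁ ^ 2 ∈ I⁻¹) (h0 : ∀ a ∈ I ∪ I⁻¹, a ^ 2 ≠ p₀ ^ 2)
    {L : Type u} [AddCommGroup L] [Module ℂ L] [Module (HeckeB p₀ p₁ n) L]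
    [IsScalarTower ℂ (HeckeB p₀ p₁ n) L] [IsSimpleModule (HeckeB p₀ p₁ n) L]
    (hL : IsOfType p₀ p₁ (n := n) (I ∪ I⁻¹) L) :
    ∃ (M : Type u) (_ : AddCommGroup M) (_ : Module ℂ M) (_ : Module (typeA p₀ p₁ n) M)
      (_ : IsScalarTower ℂ (typeA p₀ p₁ n) M),
      FiniteDimensional ℂ M ∧ IsSimpleModule (typeA p₀ p₁ n) M ∧
      Nonempty (L ≃ₗ[HeckeB p₀ p₁ n] Ind p₀ p₁ (n := n) M) := by
  have := hL.1
  have := IsSimpleModule.nontrivial (HeckeB p₀ p₁ n) L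
  -- The roots of `p` lie in `I`, those of `q` do not, and `p q` annihilates all variables and their
  -- inverses.
  obtain ⟨p, q, hpq, hp, hq⟩ := exists_polynomial_split
    (fun b : Set (Fin n) × Fin n => laurentSmul p₀ p₁ n L (signVar b.1 b.2))
    fun x => ∃ u ∈ I, (u : ℂ) = x
  have hpq : ∀ (ω : Set (Fin n)) a,
      Polynomial.aeval (laurentSmul p₀ p₁ n L (signVar ω a)) (p * q) = 0 := fun ω a => hpq (ω, a)
  have hdim := finrank_signSpace (p₀ := p₀) (p₁ := p₁) (L := L) (r := n) hp hd hI hI' h0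
  have hne : signSpace p₀ p₁ L p (∅ : Set (Fin n)) ≠ ⊥ := by
    obtain ⟨χ, v, -, hv⟩ := exists_isWeightVector_mem (laurentSmul p₀ p₁ n L) ⊤ top_ne_bot
      fun _ _ _ => trivial
    -- The sign pattern of some weight has a nonzero subspace, and all subspaces have the same
    -- dimension.
    set ω : Set (Fin n) := {a | ∃ u ∈ I⁻¹, (u : ℂ) = χ (varX a)} with hω
    have hv' : laurentSmul p₀ p₁ n L (signProd q ω) v ∈ signSpace p₀ p₁ L p ω :=
      laurentSmul_signProd_mem (hpq ω) v
    intro hbot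
    have h1 := hdim ω
    rw [hbot, finrank_bot, Submodule.finrank_eq_zero] at h1
    rw [h1, Submodule.mem_bot, hv.2] at hv'
    refine smul_ne_zero ?_ hv.1 hv'
    rw [signProd, map_prod]
    refine Finset.prod_ne_zero_iff.2 fun a _ h2 => ?_
    rw [← Polynomial.aeval_algHom_apply] at h2
    refine hq _ h2 ?_
    by_cases ha : a ∈ ω
    · exact (exists_mem_signVar_iff χ ha).2 ha
    · rw [signVar_of_notMem ha]
      obtain ⟨u, hu | hu, e⟩ := exists_mem_of_isWeightVector hL hv a
      exacts [⟨u, hu, e⟩, absurd ⟨u, hu, e⟩ ha]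
  let S : Submodule (typeA p₀ p₁ n) L :=
    { (signSpace p₀ p₁ L p (∅ : Set (Fin n))).toAddSubmonoid with
      smul_mem' := fun t v hv => smul_mem_signSpace_empty hp hq (hpq ∅) t.2 hv }
  obtain ⟨M, hMS, hM⟩ := exists_isSimpleModule_submodule S (by
    obtain ⟨v, hv, hv0⟩ := (Submodule.ne_bot_iff _).1 hne
    exact (Submodule.ne_bot_iff _).2 ⟨v, hv, hv0⟩)
  have hMf : FiniteDimensional ℂ M := Module.Finite.of_injective
    (M.subtype.restrictScalars ℂ) M.injective_subtype
  refine ⟨M, inferInstance, inferInstance, inferInstance, inferInstance, hMf, hM, ?_⟩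
  have hle : Module.finrank ℂ M ≤ Module.finrank ℂ (signSpace p₀ p₁ L p (∅ : Set (Fin n))) :=
    LinearMap.finrank_le_finrank_of_injective
      (f := (M.subtype.restrictScalars ℂ).codRestrict _ fun u => hMS u.2)
      fun u u' h => Subtype.ext
        (congrArg (signSpace p₀ p₁ L p (∅ : Set (Fin n))).subtype h)
  have hsum := sum_finrank_signSpace_le hp hq hpq hd
  simp only [hdim, Finset.sum_const, Finset.card_univ, Fintype.card_set, Fintype.card_fin,
    smul_eq_mul] at hsum
  obtain ⟨hfin, hind⟩ := finrank_ind_le (p₀ := p₀) (p₁ := p₁) (n := n) M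
  have hΦ : indLift M ≠ 0 := fun h => by
    have := IsSimpleModule.nontrivial (typeA p₀ p₁ n) M
    obtain ⟨u, hu⟩ := exists_ne (0 : M)
    have h1 := LinearMap.congr_fun h (indMk M 1 u)
    rw [indLift_indMk, one_smul] at h1
    exact hu (Subtype.ext h1)
  have hsurj : Function.Surjective (indLift M) := LinearMap.surjective_of_ne_zero hΦ
  -- `dim Ind M ≤ 2 ^ n dim M ≤ 2 ^ n dim L_∅ = ∑ dim L_ω ≤ dim L ≤ dim Ind M`, with `L_ω` the
  -- subspace of the sign pattern `ω`.
  have heq : Module.finrank ℂ (Ind p₀ p₁ (n := n) M) = Module.finrank ℂ L :=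
    le_antisymm (hind.trans ((Nat.mul_le_mul_left _ hle).trans hsum))
      (LinearMap.finrank_le_finrank_of_surjective (f := (indLift M).restrictScalars ℂ) hsurj)
  have hinj : Function.Injective (indLift M) :=
    (LinearMap.injective_iff_surjective_of_finrank_eq_finrank
      (f := (indLift M).restrictScalars ℂ) heq).2 hsurj
  exact ⟨(LinearEquiv.ofBijective _ ⟨hinj, hsurj⟩).symm⟩

end Induction

end HeckeB
end

theorem mainTheorem3 (p₀ p₁ : ℂˣ) (hp₀ : p₀ ^ 2 ≠ 1) (hp₁ : p₁ ^ 2 ≠ 1) :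
    (∀ I J : Set ℂˣ, HeckeB.IsInvariant p₁ I → HeckeB.IsInvariant p₁ J → Disjoint I J →
      (∀ (n m r : ℕ) (hr : n + m = r)
        (N : Type u) [AddCommGroup N] [Module ℂ N] [Module (HeckeB p₀ p₁ n) N]
        [IsScalarTower ℂ (HeckeB p₀ p₁ n) N]
        (M : Type v) [AddCommGroup M] [Module ℂ M] [Module (HeckeB p₀ p₁ m) M]
        [IsScalarTower ℂ (HeckeB p₀ p₁ m) M],
        IsSimpleModule (HeckeB p₀ p₁ n) N → HeckeB.IsOfType p₀ p₁ (n := n) I N →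
        IsSimpleModule (HeckeB p₀ p₁ m) M → HeckeB.IsOfType p₀ p₁ (n := m) J M →
        IsSimpleModule (HeckeB p₀ p₁ r) (HeckeB.Diamond p₀ p₁ r hr N M) ∧
        HeckeB.IsOfType p₀ p₁ (n := r) (I ∪ J) (HeckeB.Diamond p₀ p₁ r hr N M)) ∧
      (∀ (n : ℕ) (L : Type u) [AddCommGroup L] [Module ℂ L] [Module (HeckeB p₀ p₁ n) L]
        [IsScalarTower ℂ (HeckeB p₀ p₁ n) L],
        IsSimpleModule (HeckeB p₀ p₁ n) L → HeckeB.IsOfType p₀ p₁ (n := n) (I ∪ J) L →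
        ∃ (m k : ℕ) (hmk : m + k = n)
          (N : Type u) (_ : AddCommGroup N) (_ : Module ℂ N) (_ : Module (HeckeB p₀ p₁ m) N)
          (_ : IsScalarTower ℂ (HeckeB p₀ p₁ m) N)
          (M : Type u) (_ : AddCommGroup M) (_ : Module ℂ M) (_ : Module (HeckeB p₀ p₁ k) M)
          (_ : IsScalarTower ℂ (HeckeB p₀ p₁ k) M),
          IsSimpleModule (HeckeB p₀ p₁ m) N ∧ HeckeB.IsOfType p₀ p₁ (n := m) I N ∧
          IsSimpleModule (HeckeB p₀ p₁ k) M ∧ HeckeB.IsOfType p₀ p₁ (n := k) J M ∧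
          Nonempty (L ≃ₗ[HeckeB p₀ p₁ n] HeckeB.Diamond p₀ p₁ n hmk N M))) ∧
    (∀ I Ipos Ineg : Set ℂˣ,
      (∃ a, I = HeckeB.orbitB p₁ a) → (∃ a, Ipos = HeckeB.orbitA p₁ a) →
      (∃ a, Ineg = HeckeB.orbitA p₁ a) → Ineg = (fun a : ℂˣ => a⁻¹) '' Ipos →
      Disjoint Ipos Ineg → I = Ipos ∪ Ineg →
      (1 : ℂˣ) ∉ I → (-1 : ℂˣ) ∉ I → p₀ ∉ I → -p₀ ∉ I →
      ∀ (n : ℕ) (L : Type u) [AddCommGroup L] [Module ℂ L] [Module (HeckeB p₀ p₁ n) L]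
        [IsScalarTower ℂ (HeckeB p₀ p₁ n) L],
        IsSimpleModule (HeckeB p₀ p₁ n) L → HeckeB.IsOfType p₀ p₁ (n := n) I L →
        ∃ (M : Type u) (_ : AddCommGroup M) (_ : Module ℂ M)
          (_ : Module (HeckeB.typeA p₀ p₁ n) M)
          (_ : IsScalarTower ℂ (HeckeB.typeA p₀ p₁ n) M),
          FiniteDimensional ℂ M ∧ IsSimpleModule (HeckeB.typeA p₀ p₁ n) M ∧
          Nonempty (L ≃ₗ[HeckeB p₀ p₁ n] HeckeB.Ind p₀ p₁ (n := n) M)) := by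
  refine ⟨fun I J hI hJ hd => ⟨?_, ?_⟩, ?_⟩
  · intro n m r hr N _ _ _ _ M _ _ _ _ hN hNt hM hMt
    subst hr
    exact ⟨HeckeB.isSimpleModule_diamond hI hJ hd hNt hMt,
      HeckeB.isOfType_diamond hI hJ hd hNt hMt⟩
  · intro n L _ _ _ _ hL hLt
    have := IsSimpleModule.nontrivial (HeckeB p₀ p₁ n) L
    obtain ⟨m, hm, χ, v, hv, hχ⟩ := HeckeB.exists_sorted_weight hI hJ hd hLt
    obtain ⟨k, rfl⟩ := Nat.exists_eq_add_of_le hm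
    exact ⟨m, k, rfl, HeckeB.exists_equiv_diamond hI hJ hd hLt hv hχ⟩
  · rintro I Ipos Ineg - ⟨a, ha⟩ ⟨b, hb⟩ hinv hd rfl - - hp hn n L _ _ _ _ hL hLt
    have horbit : ∀ c : ℂˣ, ∀ u ∈ HeckeB.orbitA p₁ c, u * p₁ ^ 2 ∈ HeckeB.orbitA p₁ c := by
      rintro c _ ⟨k, rfl⟩
      exact ⟨k + 1, by rw [mul_add, zpow_add, mul_assoc]; rfl⟩
    rw [Set.image_inv_eq_inv] at hinv
    subst hinv
    refine HeckeB.exists_equiv_ind hd (ha ▸ horbit a) (hb ▸ horbit b) (fun u hu h => ?_) hLt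
    rw [Units.ext_iff, Units.val_pow_eq_pow_val, Units.val_pow_eq_pow_val] at h
    rcases sq_eq_sq_iff_eq_or_eq_neg.1 h with h | h
    · exact hp (Units.ext h ▸ hu)
    · have h1 : u = -p₀ := Units.ext h
      exact hn (h1 ▸ hu)
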